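/- **Conventions.** For a ring $R$ put $R^{red}=R/\mathrm{nil}(R)$ and let $\overline R$ be the integral closure of $R^{red}$ in its total quotient ring. The *extended conductor ideal* is $\widetilde{\mathcal C}_R=\mathrm{Ann}_R(\overline R/R^{red})\cap \mathrm{Ann}_R(\mathrm{nil}(R))$; for a Noetherian Nagata scheme $X$ these ideals glue, and define the *extended conductor scheme* $\widetilde C_X\subset X$. A point is *normal* if its local ring is an integrally closed domain; a point $x$ is an *isolated non-normal singularity* if it is not normal but all other points of some neighbourhood are. A point $x$ of a scheme is called *isolated* if $\{x\}$ is an irreducible component. For a Noetherian scheme $Z$, $Z^{>1}$ denotes the reduced closed subscheme whose underlying set is the union of the irreducible components of dimension $>1$. For a local ring $(R,\mathfrak m)$ over a field $k$ put $$\varepsilon_k(R)=\dim_k H^0_{\mathfrak m}(R),\qquad \delta_k(R)=\dim_k \overline R/R^{red}-\varepsilon_k(R),$$ and for a $k$-scheme $Y$ let $\varepsilon_k(Y)$, $\delta_k(Y)$ be the sums of $\varepsilon_k(\mathcal O_{Y,y})$, $\delta_k(\mathcal O_{Y,y})$ over all points $y$ that are non-normal or isolated. They are called *finite* if there are only finitely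 many such points and all the vector spaces involved are finite-dimensional. **Statement.** Let $X$ be a Noetherian Nagata scheme all of whose irreducible components have dimension $\ge 2$, let $n:\overline X\to X$ be its normalization, let $S=\mathrm{Spec}\,A$ with $A$ a principal ideal domain, and let $f:X\to S$ be a flat morphism. Write $X_s$ for the fibre of $f$ over $s$, and $(W)_s$ for the fibre over $s$ of a scheme $W$ over $X$, regarded as a scheme over $S$ through $f$. Let $\eta$ be the generic point of $S$. Assume that * no fibre of $\overline f:=f\circ n:\overline X\to S$ has an isolated point; * for each $s\in f(X)$ the fibre $X_s$ has only finitely many non-normal points, each of them is an isolated non-normal singularity, and their residue fields are finite over $k(s)$; * the extended conductor scheme $\widetilde C_X$ is finite over $S$. Then $X^{>1}=X^{red}$ as closed subschemes of $X$ (so $(X^{>1})_t=(X^{red})_t$ for all $t$, and $(X^{>1})_t=X_t$ if $X$ is reduced), $\overline X^{>1}=\overline X$, and $\overline{X^{>1}}\cong\overline X$ over $X$ (so $(\overline{X^{>1}})_t=(\overline X)_t=(\overline X^{>1})_t$ for all $t$). The morphism $\overline f$ is flat. For each $s\in f(X)$ the invariants $\delta_{k(s)}$ and $\varepsilon_{k(s)}$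 of $X_s$, $(X^{red})_s$, $(X^{>1})_s$, $(\overline X)_s$ and $(\overline X^{>1})_s$ are finite. Moreover, for each $s\in f(X)$ there is an open neighbourhood $V\subset S$ of $s$ such that with $U=V\cap f(X)$: 1. for $t\in U$, $$\begin{aligned}\delta_{k(s)}(X_s)-\delta_{k(t)}(X_t)&=\delta_{k(s)}((X^{red})_s)-\delta_{k(t)}((X^{red})_t)=\delta_{k(s)}((X^{>1})_s)-\delta_{k(t)}((X^{>1})_t)\\&=\delta_{k(s)}((\overline X)_s)-\delta_{k(t)}((\overline X)_t)=\delta_{k(s)}((\overline X^{>1})_s)-\delta_{k(t)}((\overline X^{>1})_t);\end{aligned}$$ 2. for $t\in U\smallsetminus\{s\}$ with $(\overline X)_t$ normal, $\delta_{k(s)}(X_s)-\delta_{k(t)}(X_t)=\delta_{k(s)}((\overline X)_s)\ge 0$; 3. $\delta_{k(s)}(X_s)-\delta_{k(\eta)}(X_\eta)=\delta_{k(s)}((\overline X)_s)\ge 0$; 4. for $t\in U\smallsetminus\{s\}$, $\varepsilon_{k(s)}(X_s)-\varepsilon_{k(t)}(X_t)=\varepsilon_{k(s)}((X^{>1})_s)\ge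 0$; 5. $(\overline X)_t$ is reduced for every $t\in U$; and if $X$ is reduced, then $X_t$ is reduced for every $t\in U\smallsetminus\{s\}$. -/

import Mathlib

open CategoryTheory CategoryTheory.Limits AlgebraicGeometry TopologicalSpace

universe u

noncomputable section

namespace DeltaFamily

/-! ### Rings: normalization, conductors, Nagata rings, local invariants -/

section Rings

/-- The normalization of a (possibly non-reduced) ring `R`: the integral closure of the reduction
`R ⧸ nil(R)` in its total quotient ring. -/
abbrev NormRing (R : Type u) [CommRing R] : Type u :=
  integralClosure (R ⧸ nilradical R) (FractionRing (R ⧸ nilradical R))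

/-- The cokernel of the normalization map `R → NormRing R`, as an `R`-module. -/
abbrev NormCoker (R : Type u) [CommRing R] : Type u :=
  NormRing R ⧸ LinearMap.range (Algebra.linearMap R (NormRing R))

/-- The conductor ideal: the annihilator of the cokernel of the normalization map. -/
def conductor (R : Type u) [CommRing R] : Ideal R :=
  Module.annihilator R (NormCoker R)

/-- The extended conductor ideal: the conductor intersected with the annihilator of `nil(R)`. -/
def extConductor (R : Type u) [CommRing R] : Ideal R :=
  conductor R ⊓ Module.annihilator R (nilradical R)

/-- A domain `D` is N-2 if for every finite extension `L` of its fraction field the integral closure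
of `D` in `L` is a finite `D`-module. -/
def IsN2 (D : Type u) [CommRing D] [IsDomain D] : Prop :=
  ∀ (L : Type u) [Field L] [Algebra D L] [Algebra (FractionRing D) L]
    [IsScalarTower D (FractionRing D) L] [FiniteDimensional (FractionRing D) L],
    Module.Finite D (integralClosure D L)

/-- A Nagata ring: Noetherian, and every quotient by a prime ideal is N-2. -/
def IsNagataRing (R : Type u) [CommRing R] : Prop :=
  IsNoetherianRing R ∧ ∀ (p : Ideal R) [p.IsPrime], IsN2 (R ⧸ p)

/-- The zeroth local cohomology `H⁰_m(R)` of a local ring: the elements killed by a power of the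
maximal ideal. -/
def H0m (R : Type u) [CommRing R] [IsLocalRing R] : Ideal R where
  carrier := {x | ∃ k : ℕ, ∀ a ∈ IsLocalRing.maximalIdeal R ^ k, a * x = 0}
  zero_mem' := ⟨0, fun a _ => mul_zero a⟩
  add_mem' := by
    rintro x y ⟨k, hk⟩ ⟨l, hl⟩
    refine ⟨k + l, fun a ha => ?_⟩
    rw [mul_add, hk a (Ideal.pow_le_pow_right (Nat.le_add_right k l) ha),
      hl a (Ideal.pow_le_pow_right (Nat.le_add_left l k) ha), add_zero]
  smul_mem' := by
    rintro c x ⟨k, hk⟩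
    refine ⟨k, fun a ha => ?_⟩
    rw [smul_eq_mul, mul_left_comm, hk a ha, mul_zero]

variable (k R : Type u) [Field k] [CommRing R] [IsLocalRing R] [Algebra k R]

/-- Both vector spaces entering the definition of the local invariants are finite-dimensional. -/
def LocalFinite : Prop :=
  Module.Finite k (NormCoker R) ∧ Module.Finite k (H0m R)

/-- The epsilon invariant of a local `k`-algebra. -/
def localEpsilon : ℤ := Module.finrank k (H0m R)

/-- The delta invariant of a local `k`-algebra. -/
def localDelta : ℤ := (Module.finrank k (NormCoker R) : ℤ) - localEpsilon k R

end Rings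

/-! ### Schemes: normal points, Nagata schemes, normalization, dimension parts -/

section Schemes

/-- `Y` is normal at `y`: the local ring is an integrally closed domain. -/
def NormalAt (Y : Scheme.{u}) (y : Y) : Prop :=
  IsDomain (Y.presheaf.stalk y) ∧ IsIntegrallyClosed (Y.presheaf.stalk y)

/-- `Y` is a normal scheme. -/
def IsNormal (Y : Scheme.{u}) : Prop := ∀ y : Y, NormalAt Y y

/-- `y` has an open neighbourhood in which every point other than `y` is normal. -/
def IsINNS (Y : Scheme.{u}) (y : Y) : Prop :=
  ∃ U : Y.Opens, y ∈ U ∧ ∀ z ∈ U, z ≠ y → NormalAt Y z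

/-- A Nagata scheme: every point has an affine open neighbourhood `U` with `Γ(X, U)` Nagata. -/
def IsNagata (X : Scheme.{u}) : Prop :=
  ∀ x : X, ∃ U : X.Opens, x ∈ U ∧ IsAffineOpen U ∧ IsNagataRing Γ(X, U)

/-- `{y}` is an irreducible component of `Y`, i.e. `y` is a zero-dimensional component. -/
def IsIsolatedPoint (Y : Scheme.{u}) (y : Y) : Prop :=
  ({y} : Set Y) ∈ irreducibleComponents Y

/-- The extended conductor scheme of `X`, through its ideal sheaf. If the normalization of `X` is
finite, the extended conductor ideals of the rings `Γ(X, U)`, `U` affine open, are compatible with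
localization, and this ideal sheaf has these ideals as its sections; in general it is the largest
quasi-coherent ideal sheaf contained in them. -/
def extConductorIdealSheaf (X : Scheme.{u}) : X.IdealSheafData :=
  Scheme.IdealSheafData.ofIdeals fun U => extConductor Γ(X, U)

/-- The disjoint union of the spectra of the residue fields at the generic points of the irreducible
components of `X`, with its morphism to `X`. -/
def genericPointsMap (X : Scheme.{u}) :
    (∐ fun x : genericPoints X => Spec (X.residueField x.1)) ⟶ X :=
  Sigma.desc fun x => X.fromSpecResidueField x.1

instance (X : Scheme.{u}) [IsNoetherian X] : Finite (genericPoints X) := by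
  have hfin := finite_irreducibleComponents_of_isNoetherian (X := X)
  have : Finite (irreducibleComponents X) := hfin
  exact Finite.of_injective
    (fun x : genericPoints X => (⟨closure {x.1}, x.2⟩ : irreducibleComponents X)) (by
      intro x y hxy
      apply Subtype.ext
      exact (show IsGenericPoint x.1 (closure {x.1}) from rfl).eq
        (congrArg Subtype.val hxy).symm)

instance (X : Scheme.{u}) [IsNoetherian X] : QuasiCompact (genericPointsMap X) := by
  infer_instance

instance (X : Scheme.{u}) [IsNoetherian X] : QuasiSeparated (genericPointsMap X) := by
  infer_instance

/-- The normalization of a Noetherian scheme `X`: the relative normalization of `X` in the disjoint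
union of the spectra of the residue fields at its generic points. Over `U = Spec R` affine open this
is the spectrum of the integral closure of `R` in the total quotient ring of its reduction. -/
def normalization (X : Scheme.{u}) [IsNoetherian X] : Scheme.{u} :=
  (genericPointsMap X).normalization

/-- The normalization morphism. -/
def normalizationMap (X : Scheme.{u}) [IsNoetherian X] : normalization X ⟶ X :=
  (genericPointsMap X).fromNormalization

/-- The ideal sheaf of the reduced closed subscheme `X^{>i}` whose underlying set is the (closure
of the) union of the irreducible components of dimension `> i`. -/
def idealGT (X : Scheme.{u}) (i : ℕ) : X.IdealSheafData :=
  Scheme.IdealSheafData.vanishingIdeal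
    ⟨closure (⋃ Z ∈ {Z ∈ irreducibleComponents X | (i : WithBot ℕ∞) < topologicalKrullDim Z}, Z),
      isClosed_closure⟩

/-- The reduced closed subscheme `X^{>i}`. -/
abbrev partGT (X : Scheme.{u}) (i : ℕ) : Scheme.{u} := (idealGT X i).subscheme

/-- The inclusion of `X^{>i}` in `X`. -/
abbrev partGTMap (X : Scheme.{u}) (i : ℕ) : partGT X i ⟶ X := (idealGT X i).subschemeι

instance (X : Scheme.{u}) [IsNoetherian X] (I : X.IdealSheafData) : IsNoetherian I.subscheme where
  toIsLocallyNoetherian := LocallyOfFiniteType.isLocallyNoetherian I.subschemeι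
  toCompactSpace := QuasiCompact.compactSpace_of_compactSpace I.subschemeι

/-- The inclusion of the reduction of `X` in `X`. -/
abbrev redMap (X : Scheme.{u}) : X.nilradical.subscheme ⟶ X := X.nilradical.subschemeι

end Schemes

/-! ### Delta and epsilon of the fibres of a morphism -/

section Fibres

variable {X S : Scheme.{u}} (f : X ⟶ S) (s : S)

/-- The local rings of the fibre over `s` are algebras over the residue field of `s`. -/
instance fibreStalkAlgebra (x : f.fiber s) :
    Algebra (S.residueField s) ((f.fiber s).presheaf.stalk x) :=
  ((Scheme.ΓSpecIso (S.residueField s)).inv ≫ (f.fiberToSpecResidueField s).appTop ≫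
    (f.fiber s).presheaf.germ ⊤ x trivial).hom.toAlgebra

/-- The points of the fibre that contribute to delta and epsilon: the non-normal points and the
isolated points. (The local invariants of a normal point of positive dimension vanish; an isolated
point contributes, even if it is reduced.) -/
def specialPoints : Set (f.fiber s) :=
  {x | ¬ NormalAt (f.fiber s) x ∨ IsIsolatedPoint (f.fiber s) x}

/-- Delta and epsilon of the fibre over `s` are finite: there are finitely many special points, and
at each of them the local invariants are finite. -/
def FiniteInvariants : Prop :=
  (specialPoints f s).Finite ∧ ∀ x ∈ specialPoints f s,
    LocalFinite (S.residueField s) ((f.fiber s).presheaf.stalk x)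

/-- The delta invariant over `κ(s)` of the fibre over `s` (meaningful under
`FiniteInvariants f s`). -/
def delta : ℤ :=
  ∑ᶠ x ∈ specialPoints f s, localDelta (S.residueField s) ((f.fiber s).presheaf.stalk x)

/-- The epsilon invariant over `κ(s)` of the fibre over `s` (meaningful under
`FiniteInvariants f s`). -/
def epsilon : ℤ :=
  ∑ᶠ x ∈ specialPoints f s, localEpsilon (S.residueField s) ((f.fiber s).presheaf.stalk x)

/-- The fibre over `s` has only finitely many non-normal points; each of them is an isolated
non-normal point, with residue field finite over `κ(s)`. -/
def FibreHasFinitelyManyINNS : Prop :=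
  {x : f.fiber s | ¬ NormalAt (f.fiber s) x}.Finite ∧
  ∀ x : f.fiber s, ¬ NormalAt (f.fiber s) x →
    IsINNS (f.fiber s) x ∧
    Module.Finite (S.residueField s)
      (IsLocalRing.ResidueField ((f.fiber s).presheaf.stalk x))

end Fibres

end DeltaFamily

end

/-! ### Lengths of modules: additivity, base change to a field, localization. -/

noncomputable section
namespace DeltaFamily

section Length

variable {Λ : Type*} [CommRing Λ]
variable {M M' M'' : Type*} [AddCommGroup M] [AddCommGroup M'] [AddCommGroup M'']
variable [Module Λ M] [Module Λ M'] [Module Λ M'']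

/-! Call a finite morphism h : Z → X a modification if the ideal of the extended conductor scheme C
kills the kernel and the cokernel of O_X → h_*O_Z, Z has no torsion over A, and the fibres of Z over
S have no isolated points. The identity of X, the inclusion of X^red and the normalization are
modifications. The core of the proof is `delta_modification`: δ(Z_s) = b(s) − c(h), where b(s)
(`baseDelta`) does not depend on h and c(h) (`genericDefect`) does not depend on s. Hence δ(Z_s) −
δ(Z_t) = b(s) − b(t) for every modification, which is (1) without any shrinking of S. Since δ
vanishes on a normal fibre without isolated points, and the generic fibre of the normalization is
normal, (2) and (3) follow.

The formula comes from two Euler characteristics. Let R be a local ring of X_s at a bad point x, so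
that its punctured spectrum is normal, and let R → R' be finite with kernel and cokernel of finite
length. Both rings have the same normalization, so the six-term sequence of R → R' → (normalization)
shows that the colength of the normalization minus the length of the nilradical drops by ℓ(coker) −
ℓ(ker) of R → R' (`length_modification`). As x is not isolated, H⁰_m is the nilradical
(`H0m_eq_nilradical`), so this computes δ after multiplication by the residue degree
(`invariants_modification`).

Now R → R' is the reduction modulo π of O → H, where π generates the ideal of s, O is the local ring
of X and H the stalk of h_*O_Z. With K and M the kernel and cokernel of O → H, the snake lemma gives
the reduction the cokernel M/π and a kernel of length ℓ(K/π) + ℓ(M[π]). For π ≠ 0 the difference is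
χ(M) − χ(K) with χ(N) = ℓ(N/π) − ℓ(N[π]). Both modules live on C, which is finite over S, so their
support consists of x and points z of the generic fibre, and dévissage gives χ(N) = Σ_z ℓ(N_z)
ℓ(O/(P_z + π)) (`length_cotors_eq`). The closure of z in C is finite and torsion-free, hence free,
over the principal ideal domain A; so the lengths ℓ(O/(P_z + π)), weighted by residue degrees and
summed over x, give the degree of κ(z) over κ(η) (`sum_fibreLength_eq_finrank`), and s disappears.

For ε, the same computation shows that ε + δ of the fibre over s is the same for X and X^red, so
their ε differ by a constant. The fibres of the normalization are reduced, because a quotient of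
positive dimension of a normal local domain by one element has positive depth
(`H0m_eq_bot_of_isNormalDomain`). Reducedness descends to (X^red)_t when the generator of t is zero
or a nonzerodivisor on the cokernel of the normalization; finiteness of associated primes excludes
only finitely many closed points (`exists_finite_isReduced_fiber`). Removing those different from s
gives V, and there ε((X^red)_t) = 0 for t ≠ s. -/

lemma length_eq_ker_add_range (f : M →ₗ[Λ] M') :
    Module.length Λ M = Module.length Λ (LinearMap.ker f) + Module.length Λ (LinearMap.range f) :=
  Module.length_eq_add_of_exact (LinearMap.ker f).subtype f.rangeRestrict
    (Submodule.injective_subtype _) f.surjective_rangeRestrict (by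
      intro x
      rw [← LinearMap.mem_ker, LinearMap.ker_rangeRestrict]
      simp)

lemma length_eq_add_quotient (N : Submodule Λ M) :
    Module.length Λ M = Module.length Λ N + Module.length Λ (M ⧸ N) :=
  Module.length_eq_add_of_exact N.subtype N.mkQ
    (Submodule.injective_subtype _) (Submodule.mkQ_surjective _) (by
      intro x; simp)

/-- Kernels and cokernels of a composition: the Euler characteristic is additive. -/
lemma length_ker_coker_comp (f : M →ₗ[Λ] M') (g : M' →ₗ[Λ] M'') :
    Module.length Λ (LinearMap.ker (g ∘ₗ f)) + Module.length Λ (M' ⧸ LinearMap.range f) +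
      Module.length Λ (M'' ⧸ LinearMap.range g) =
    Module.length Λ (LinearMap.ker f) + Module.length Λ (LinearMap.ker g) +
      Module.length Λ (M'' ⧸ LinearMap.range (g ∘ₗ f)) := by
  -- The maps `α` and `γ` cut the exact sequence 0 → ker f → ker gf → ker g → coker f → coker gf →
  -- coker g → 0 into short exact pieces. The result stays additive because lengths in `ℕ∞` cannot
  -- be subtracted.
  let α : LinearMap.ker g →ₗ[Λ] M' ⧸ LinearMap.range f :=
    (LinearMap.range f).mkQ ∘ₗ (LinearMap.ker g).subtype
  have hle : LinearMap.range f ≤ LinearMap.ker ((LinearMap.range (g ∘ₗ f)).mkQ ∘ₗ g) := by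
    rintro _ ⟨x, rfl⟩
    simp only [LinearMap.mem_ker, LinearMap.comp_apply, Submodule.mkQ_apply,
      Submodule.Quotient.mk_eq_zero]
    exact ⟨x, rfl⟩
  let γ : (M' ⧸ LinearMap.range f) →ₗ[Λ] (M'' ⧸ LinearMap.range (g ∘ₗ f)) :=
    (LinearMap.range f).liftQ _ hle
  have h1 := length_eq_ker_add_range α
  have h2 := length_eq_ker_add_range γ
  have h3 := length_eq_add_quotient (LinearMap.range γ)
  have hker : LinearMap.ker γ = LinearMap.range α := by
    apply le_antisymm
    · intro y hy
      obtain ⟨y, rfl⟩ := Submodule.mkQ_surjective _ y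
      have : g y ∈ LinearMap.range (g ∘ₗ f) := by
        simpa [γ, LinearMap.mem_ker, Submodule.Quotient.mk_eq_zero] using hy
      obtain ⟨x, hx⟩ := this
      refine ⟨⟨y - f x, by simp [← hx]⟩, ?_⟩
      simp [α]
    · rintro _ ⟨⟨y, hy⟩, rfl⟩
      have hy' : g y = 0 := hy
      simp [α, γ, hy']
  have h4 : Module.length Λ (LinearMap.ker (g ∘ₗ f)) =
      Module.length Λ (LinearMap.ker f) + Module.length Λ (LinearMap.ker α) := by
    refine Module.length_eq_add_of_exact
      (Submodule.inclusion (p := LinearMap.ker f) (p' := LinearMap.ker (g ∘ₗ f)) ?_)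
      (LinearMap.codRestrict (LinearMap.ker α) (LinearMap.codRestrict (LinearMap.ker g)
        (f ∘ₗ (LinearMap.ker (g ∘ₗ f)).subtype) ?_) ?_) ?_ ?_ ?_
    · intro x hx; simp [LinearMap.mem_ker.mp hx]
    · rintro ⟨x, hx⟩; exact hx
    · rintro ⟨x, hx⟩
      simp only [LinearMap.mem_ker]
      simp only [α, LinearMap.comp_apply, Submodule.mkQ_apply, Submodule.Quotient.mk_eq_zero]
      exact ⟨x, rfl⟩
    · exact Submodule.inclusion_injective _
    · rintro ⟨⟨y, hy⟩, hy2⟩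
      have : y ∈ LinearMap.range f := by
        simpa [α, LinearMap.mem_ker, Submodule.Quotient.mk_eq_zero] using hy2
      obtain ⟨x, rfl⟩ := this
      exact ⟨⟨x, hy⟩, rfl⟩
    · rintro ⟨x, hx⟩
      constructor
      · intro h
        have h' : f x = 0 := congrArg (fun z => ((z.1.1 : M'))) h
        exact ⟨⟨x, h'⟩, rfl⟩
      · rintro ⟨⟨y, hy⟩, h⟩
        have h' : y = x := congrArg Subtype.val h
        subst h'
        apply Subtype.ext; apply Subtype.ext
        exact hy
  have h5 : Module.length Λ ((M'' ⧸ LinearMap.range (g ∘ₗ f)) ⧸ LinearMap.range γ) =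
      Module.length Λ (M'' ⧸ LinearMap.range g) := by
    have hr : LinearMap.range γ = (LinearMap.range g).map (LinearMap.range (g ∘ₗ f)).mkQ := by
      rw [← LinearMap.range_comp]
      simp only [γ, Submodule.range_liftQ]
    rw [hr]
    exact (Submodule.quotientQuotientEquivQuotient _ _ (LinearMap.range_comp_le_range f g)).length_eq
  rw [h4, h2, h1, h3, h5, hker]
  abel

end Length

section FiniteLength

lemma length_eq_of_equiv {k B V W : Type*} [CommRing k] [CommRing B] [Algebra k B]
    [AddCommGroup V] [AddCommGroup W] [Module B V] [Module B W] [Module k V] [Module k W]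
    [IsScalarTower k B V] [IsScalarTower k B W] (e : V ≃ₗ[B] W) :
    Module.length k V = Module.length k W :=
  (e.restrictScalars k).length_eq

lemma length_eq_add_of_exact_of_tower {k B V₁ V₂ V₃ : Type*} [CommRing k] [CommRing B]
    [Algebra k B] [AddCommGroup V₁] [AddCommGroup V₂] [AddCommGroup V₃] [Module B V₁]
    [Module B V₂] [Module B V₃] [Module k V₁] [Module k V₂] [Module k V₃]
    [IsScalarTower k B V₁] [IsScalarTower k B V₂] [IsScalarTower k B V₃]
    (f : V₁ →ₗ[B] V₂) (g : V₂ →ₗ[B] V₃) (hf : Function.Injective f)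
    (hg : Function.Surjective g) (h : Function.Exact f g) :
    Module.length k V₂ = Module.length k V₁ + Module.length k V₃ :=
  Module.length_eq_add_of_exact (f.restrictScalars k) (g.restrictScalars k) hf hg h

/-- Length over `k` of a finite length module over a local `k`-algebra. -/
lemma length_eq_length_mul_residue {k R : Type*} [CommRing k] [CommRing R] [IsLocalRing R]
    [Algebra k R] {κ : Type*} [AddCommGroup κ] [Module R κ] [Module k κ] [IsScalarTower k R κ]
    (eκ : κ ≃ₗ[R] R ⧸ IsLocalRing.maximalIdeal R)
    {V : Type*} [AddCommGroup V] [Module R V] (h : IsFiniteLength R V)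
    [Module k V] [IsScalarTower k R V] :
    Module.length k V = Module.length R V * Module.length k κ := by
  -- The `k`-module structure changes with the module along the induction, so it has to be
  -- generalized.
  revert k
  induction h with
  | of_subsingleton => intro k _ _ _ _ _ _; simp [Module.length_eq_zero]
  | @of_simple_quotient M _ _ N hs hN ih =>
    intro k _ _ _ _ _ _
    have e1 : Module.length k M = Module.length k N + Module.length k (M ⧸ N) :=
      length_eq_add_of_exact_of_tower N.subtype N.mkQ
        (Submodule.injective_subtype _) (Submodule.mkQ_surjective _) (by intro x; simp)
    have e2 := length_eq_add_quotient N
    obtain ⟨I, hI, ⟨e⟩⟩ := isSimpleModule_iff_quot_maximal.mp hs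
    have := IsLocalRing.eq_maximalIdeal hI
    subst this
    rw [e1, e2, ih, length_eq_of_equiv (k := k) (e.trans eκ.symm), Module.length_eq_one (R := R) (M := M ⧸ N),
      add_mul, one_mul]

/-- A `B`-module, regarded also as a module over `k` for a `k`-algebra `B`. -/
def ScalarsVia (_k _B V : Type*) : Type _ := V

instance (k B V : Type*) [inst : AddCommGroup V] : AddCommGroup (ScalarsVia k B V) := inst

instance (k B V : Type*) [CommRing B] [AddCommGroup V] [inst : Module B V] :
    Module B (ScalarsVia k B V) := inst

instance (k B V : Type*) [CommRing k] [CommRing B] [Algebra k B] [AddCommGroup V] [Module B V] :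
    Module k (ScalarsVia k B V) := Module.compHom V (algebraMap k B)

instance (k B V : Type*) [CommRing k] [CommRing B] [Algebra k B] [AddCommGroup V] [Module B V] :
    IsScalarTower k B (ScalarsVia k B V) where
  smul_assoc c b v := by
    rw [Algebra.smul_def]
    exact mul_smul (algebraMap k B c) b (v : V)

/-- An inverse modulo `n` of an element outside `n` already acts as its inverse on B/n, so a simple
module is its own localization. -/
lemma isLocalizedModule_id_of_equiv_quotient {B : Type*} [CommRing B] (n : Ideal B) [n.IsMaximal]
    {V : Type*} [AddCommGroup V] [Module B V] (e : V ≃ₗ[B] B ⧸ n) :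
    IsLocalizedModule n.primeCompl (LinearMap.id : V →ₗ[B] V) := by
  have hunit : ∀ x : n.primeCompl, IsUnit (algebraMap B (Module.End B V) x) := by
    intro x
    obtain ⟨y, hy⟩ : ∃ y, y * (x : B) - 1 ∈ n := by
      obtain ⟨y, z, hz, h⟩ := (Ideal.IsMaximal.exists_inv (I := n) inferInstance x.2)
      exact ⟨y, by rw [← h]; simpa using hz⟩
    have key : ∀ v : V, (y * (x : B)) • v = v := by
      intro v
      apply e.injective
      rw [map_smul]
      obtain ⟨b, hb⟩ := Ideal.Quotient.mk_surjective (e v)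
      rw [← hb, ← Ideal.Quotient.mk_eq_mk, ← Submodule.Quotient.mk_smul,
        Submodule.Quotient.eq, smul_eq_mul]
      have : y * (x : B) * b - b = (y * x - 1) * b := by ring
      rw [this]
      exact n.mul_mem_right _ hy
    refine (Module.End.isUnit_iff _).mpr ⟨fun v w h => ?_, fun v => ⟨y • v, ?_⟩⟩
    · have h' : (x : B) • v = (x : B) • w := h
      rw [← key v, ← key w, mul_smul, mul_smul, h']
    · change (x : B) • y • v = v
      rw [smul_smul, mul_comm]; exact key v
  exact
    { map_units := hunit
      surj := fun y => ⟨(y, 1), by simp⟩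
      exists_of_eq := fun h => ⟨1, by simpa using h⟩ }

lemma subsingleton_localizedModule_of_smul {B : Type*} [CommRing B] (S : Submonoid B)
    {V : Type*} [AddCommGroup V] [Module B V] (s : B) (hs : s ∈ S) (h : ∀ v : V, s • v = 0) :
    Subsingleton (LocalizedModule S V) := by
  rw [LocalizedModule.subsingleton_iff]
  exact fun m => ⟨s, hs, h m⟩

lemma length_localizedModule_add (k : Type*) {B : Type*} [CommRing k] [CommRing B] [Algebra k B]
    (S : Submonoid B) {V : Type*} [AddCommGroup V] [Module B V] (N : Submodule B V) :
    Module.length k (ScalarsVia k B (LocalizedModule S V)) =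
      Module.length k (ScalarsVia k B (LocalizedModule S N)) +
        Module.length k (ScalarsVia k B (LocalizedModule S (V ⧸ N))) := by
  let fN := LocalizedModule.mkLinearMap S N
  let fV := LocalizedModule.mkLinearMap S V
  let fQ := LocalizedModule.mkLinearMap S (V ⧸ N)
  exact length_eq_add_of_exact_of_tower (k := k)
    (V₁ := ScalarsVia k B (LocalizedModule S N))
    (V₂ := ScalarsVia k B (LocalizedModule S V))
    (V₃ := ScalarsVia k B (LocalizedModule S (V ⧸ N)))
    (IsLocalizedModule.map S fN fV N.subtype)
    (IsLocalizedModule.map S fV fQ N.mkQ)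
    (IsLocalizedModule.map_injective S fN fV _ (Submodule.injective_subtype _))
    (IsLocalizedModule.map_surjective S fV fQ _ (Submodule.mkQ_surjective _))
    (IsLocalizedModule.map_exact S fN fV fQ _ _ (LinearMap.exact_subtype_mkQ N))

/-- Both sides are additive in short exact sequences, which reduces to a simple module B/n_j: its
localization at n_j is itself and all the others vanish. Only maximal ideals containing the
annihilator need to be listed by `n`. -/
lemma length_eq_sum_localizedModule {k B : Type*} [CommRing k] [CommRing B] [Algebra k B]
    {ι : Type*} [Fintype ι] (n : ι → Ideal B) [∀ i, (n i).IsMaximal]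
    (hinj : Function.Injective n)
    {V : Type*} [AddCommGroup V] [Module B V] (h : IsFiniteLength B V)
    (hsupp : ∀ I : Ideal B, I.IsMaximal → Module.annihilator B V ≤ I → I ∈ Set.range n)
    [Module k V] [IsScalarTower k B V] :
    Module.length k V = ∑ i, Module.length k
      (ScalarsVia k B (LocalizedModule (n i).primeCompl V)) := by
  classical
  revert k
  induction h with
  | @of_subsingleton M _ _ _ =>
    intro k _ _ _ _
    rw [Module.length_eq_zero, Finset.sum_eq_zero]
    intro i _
    have : Subsingleton (ScalarsVia k B (LocalizedModule (n i).primeCompl M)) :=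
      inferInstanceAs (Subsingleton (LocalizedModule (n i).primeCompl M))
    exact Module.length_eq_zero
  | @of_simple_quotient M _ _ N hs hN ih =>
    intro k _ _ _ _
    have e1 : Module.length k M = Module.length k N + Module.length k (M ⧸ N) :=
      length_eq_add_of_exact_of_tower N.subtype N.mkQ
        (Submodule.injective_subtype _) (Submodule.mkQ_surjective _) (by intro x; simp)
    obtain ⟨I, hI, ⟨e⟩⟩ := isSimpleModule_iff_quot_maximal.mp hs
    have hann : Module.annihilator B M ≤ I := by
      intro b hb
      have : b • e.symm (Ideal.Quotient.mk I 1) = 0 := by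
        obtain ⟨m, hm⟩ := Submodule.mkQ_surjective N (e.symm (Ideal.Quotient.mk I 1))
        rw [← hm, ← map_smul, Module.mem_annihilator.mp hb, map_zero]
      rw [← map_smul, map_eq_zero_iff _ e.symm.injective, ← Ideal.Quotient.mk_eq_mk,
        ← Submodule.Quotient.mk_smul, Submodule.Quotient.mk_eq_zero] at this
      simpa using this
    obtain ⟨j, rfl⟩ := hsupp I hI hann
    have hN' : ∀ I : Ideal B, I.IsMaximal → Module.annihilator B N ≤ I → I ∈ Set.range n :=
      fun I hI h => hsupp I hI (le_trans (N.subtype.annihilator_le_of_injective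
        (Submodule.injective_subtype _)) h)
    rw [e1, ih hN']
    have hj : ∀ i, Module.length k
        (ScalarsVia k B (LocalizedModule (n i).primeCompl (M ⧸ N))) =
        if i = j then Module.length k (M ⧸ N) else 0 := by
      intro i
      split_ifs with hij
      · subst hij
        have := isLocalizedModule_id_of_equiv_quotient (n i) e
        exact length_eq_of_equiv
          (V := ScalarsVia k B (LocalizedModule (n i).primeCompl (M ⧸ N)))
          (IsLocalizedModule.iso (n i).primeCompl (LinearMap.id : (M ⧸ N) →ₗ[B] (M ⧸ N)))
      · have hne : ¬ (n j ≤ n i) := fun hle =>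
          hij (hinj (((inferInstance : (n j).IsMaximal).eq_of_le
            (Ideal.IsMaximal.ne_top inferInstance) hle).symm))
        obtain ⟨s, hs1, hs2⟩ := Set.not_subset.mp hne
        have : Subsingleton (LocalizedModule (n i).primeCompl (M ⧸ N)) := by
          refine subsingleton_localizedModule_of_smul _ s hs2 fun v => e.injective ?_
          rw [map_smul, map_zero]
          obtain ⟨b, hb⟩ := Ideal.Quotient.mk_surjective (e v)
          rw [← hb, ← Ideal.Quotient.mk_eq_mk, ← Submodule.Quotient.mk_smul,
            Submodule.Quotient.mk_eq_zero]
          exact (n j).mul_mem_right _ hs1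
        have : Subsingleton (ScalarsVia k B (LocalizedModule (n i).primeCompl (M ⧸ N))) :=
          this
        exact Module.length_eq_zero
    have hsum : Module.length k (M ⧸ N) = ∑ i, Module.length k
        (ScalarsVia k B (LocalizedModule (n i).primeCompl (M ⧸ N))) := by
      rw [Finset.sum_congr rfl (fun i _ => hj i)]
      simp
    rw [hsum, ← Finset.sum_add_distrib]
    exact Finset.sum_congr rfl fun i _ => (length_localizedModule_add k _ N).symm

/-- The length over `k` of a module of finite length over `B` is the sum of the lengths of its
localizations at maximal ideals. -/
lemma length_eq_sum_of_isLocalizedModule {k B : Type*} [CommRing k] [CommRing B] [Algebra k B]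
    {ι : Type*} [Fintype ι] (n : ι → Ideal B) [∀ i, (n i).IsMaximal]
    (hinj : Function.Injective n)
    {V : Type*} [AddCommGroup V] [Module B V] (h : IsFiniteLength B V)
    (hsupp : ∀ I : Ideal B, I.IsMaximal → Module.annihilator B V ≤ I → I ∈ Set.range n)
    [Module k V] [IsScalarTower k B V]
    (W : ι → Type*) [∀ i, AddCommGroup (W i)] [∀ i, Module B (W i)] [∀ i, Module k (W i)]
    [∀ i, IsScalarTower k B (W i)] (f : ∀ i, V →ₗ[B] W i)
    [∀ i, IsLocalizedModule (n i).primeCompl (f i)] :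
    Module.length k V = ∑ i, Module.length k (W i) := by
  have hW : ∀ i, Module.length k (W i) =
      Module.length k (ScalarsVia k B (LocalizedModule (n i).primeCompl V)) := fun i =>
    length_eq_of_equiv (W := ScalarsVia k B (LocalizedModule (n i).primeCompl V))
      (IsLocalizedModule.iso (n i).primeCompl (f i)).symm
  rw [Finset.sum_congr rfl fun i _ => hW i]
  exact length_eq_sum_localizedModule n hinj h hsupp

end FiniteLength

end DeltaFamily
end

/-! ### Normalization of rings: recognition, localization, normality of its local rings. -/

noncomputable section
namespace DeltaFamily

section NormalizationAlgebra

open nonZeroDivisors Polynomial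

/-- An integrally closed domain. -/
def IsNormalDomain (R : Type*) [CommRing R] : Prop := IsDomain R ∧ IsIntegrallyClosed R

lemma IsNormalDomain.of_ringEquiv {R R' : Type*} [CommRing R] [CommRing R'] (e : R ≃+* R')
    (h : IsNormalDomain R) : IsNormalDomain R' := by
  obtain ⟨h1, h2⟩ := h
  exact ⟨e.symm.toMulEquiv.isDomain, IsIntegrallyClosed.of_equiv e⟩

/-- In a ring whose local rings are integrally closed domains, integral fractions are elements of
the ring. -/
lemma dvd_of_isIntegral_of_isNormalDomain {T Q : Type*} [CommRing T] [CommRing Q] [Algebra T Q]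
    (hinj : Function.Injective (algebraMap T Q))
    (hT : ∀ (P : Ideal T) [P.IsMaximal], IsNormalDomain (Localization.AtPrime P))
    {z : Q} (hz : IsIntegral T z) {a b : T} (hb : b ∈ T⁰)
    (h : algebraMap T Q b * z = algebraMap T Q a) : b ∣ a := by
  obtain ⟨p, hp, hpz⟩ := hz
  -- Multiplying the integral equation of z = a/b by a power of `b` gives a polynomial relation in
  -- `T` itself, which can then be transported to any localization.
  have h1 : (p.scaleRoots b).eval a = 0 := by
    apply hinj
    have := p.scaleRoots_eval₂_mul (algebraMap T Q) z b
    rw [hpz, mul_zero, h, Polynomial.eval₂_at_apply] at this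
    rw [this, map_zero]
  by_contra hab
  -- If `b` did not divide `a`, the ideal of denominators (b : a) would lie in a maximal ideal `P`;
  -- integral closedness of the local ring at `P` produces a denominator outside `P`.
  have hne : (Ideal.span {b}).colon {a} ≠ ⊤ := by
    intro htop
    have h1 : (1 : T) ∈ (Ideal.span {b}).colon {a} := htop ▸ Submodule.mem_top
    rw [Submodule.mem_colon_singleton, one_smul, Ideal.mem_span_singleton] at h1
    exact hab h1
  obtain ⟨P, hP, hle⟩ := Ideal.exists_le_maximal _ hne
  obtain ⟨hd, hic⟩ := hT P
  let K := FractionRing (Localization.AtPrime P)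
  have hb0 : algebraMap T (Localization.AtPrime P) b ≠ 0 := by
    intro h0
    obtain ⟨s, hs⟩ := (IsLocalization.map_eq_zero_iff P.primeCompl _ b).mp h0
    have hs0 : (s : T) = 0 := (mul_right_mem_nonZeroDivisors_eq_zero_iff hb).mp hs
    exact s.2 (hs0 ▸ P.zero_mem)
  have hbK : algebraMap T K b ≠ 0 := by
    rw [IsScalarTower.algebraMap_apply T (Localization.AtPrime P) K]
    exact fun h0 => hb0 ((IsFractionRing.to_map_eq_zero_iff (K := K)).mp h0)
  have hint : IsIntegral T (algebraMap T K a / algebraMap T K b) := by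
    refine ⟨p, hp, ?_⟩
    have := p.scaleRoots_eval₂_mul (algebraMap T K) (algebraMap T K a / algebraMap T K b) b
    rw [mul_div_cancel₀ _ hbK, Polynomial.eval₂_at_apply, h1, map_zero] at this
    exact (mul_eq_zero.mp this.symm).resolve_left (pow_ne_zero _ hbK)
  obtain ⟨y, hy⟩ := IsIntegrallyClosed.isIntegral_iff.mp
    (hint.tower_top (A := Localization.AtPrime P))
  obtain ⟨c, s, rfl⟩ := IsLocalization.exists_mk'_eq P.primeCompl y
  have h2 : algebraMap T (Localization.AtPrime P) (b * c) =
      algebraMap T (Localization.AtPrime P) (s * a) := by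
    apply IsFractionRing.injective (Localization.AtPrime P) K
    rw [eq_div_iff hbK] at hy
    have h3 : algebraMap T K (s : T) * algebraMap (Localization.AtPrime P) K
        (IsLocalization.mk' (Localization.AtPrime P) c s) = algebraMap T K c := by
      rw [IsScalarTower.algebraMap_apply T (Localization.AtPrime P) K, ← map_mul,
        IsLocalization.mk'_spec', ← IsScalarTower.algebraMap_apply]
    rw [← IsScalarTower.algebraMap_apply, ← IsScalarTower.algebraMap_apply, map_mul, map_mul,
      ← hy, ← h3]
    ring
  obtain ⟨u, hu⟩ := (IsLocalization.eq_iff_exists P.primeCompl _).mp h2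
  have hmem : (u : T) * s ∈ (Ideal.span {b}).colon {a} := by
    rw [Submodule.mem_colon_singleton, Ideal.mem_span_singleton, smul_eq_mul]
    exact ⟨u * c, by rw [mul_assoc, ← hu]; ring⟩
  exact (u * s).2 (hle hmem)

/-- Recognizing the normalization of `G` as the integral closure of `G` in `L`, for a total quotient
ring `L` of the reduction of `G`. -/
lemma nonempty_integralClosure_equiv_normRing {G : Type u} {L : Type*} [CommRing G] [CommRing L]
    [Algebra G L]
    (hker : ∀ g : G, algebraMap G L g = 0 → IsNilpotent g)
    (hred : ∀ g : G, IsNilpotent g → algebraMap G L g = 0)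
    (hunit : ∀ b : G, Ideal.Quotient.mk (nilradical G) b ∈ (G ⧸ nilradical G)⁰ →
      IsUnit (algebraMap G L b))
    (hsurj : ∀ l : L, ∃ a b : G, Ideal.Quotient.mk (nilradical G) b ∈ (G ⧸ nilradical G)⁰ ∧
      algebraMap G L b * l = algebraMap G L a) :
    Nonempty (integralClosure G L ≃ₐ[G] NormRing G) := by
  let T := G ⧸ nilradical G
  let φ : T →+* L := Ideal.Quotient.lift (nilradical G) (algebraMap G L)
    (fun a ha => hred a ha)
  let _ : Algebra T L := φ.toAlgebra
  have htow : IsScalarTower G T L := IsScalarTower.of_algebraMap_eq fun g => rfl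
  have hfrac : IsFractionRing T L := by
    refine ⟨⟨?_, ?_, ?_⟩⟩
    · rintro ⟨y, hy⟩
      obtain ⟨b, rfl⟩ := Ideal.Quotient.mk_surjective y
      exact hunit b hy
    · intro l
      obtain ⟨a, b, hb, h⟩ := hsurj l
      refine ⟨(Ideal.Quotient.mk _ a, ⟨Ideal.Quotient.mk _ b, hb⟩), ?_⟩
      change l * algebraMap G L b = algebraMap G L a
      rw [mul_comm, h]
    · intro x y hxy
      obtain ⟨a, rfl⟩ := Ideal.Quotient.mk_surjective x
      obtain ⟨b, rfl⟩ := Ideal.Quotient.mk_surjective y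
      refine ⟨1, ?_⟩
      have h : algebraMap G L a = algebraMap G L b := hxy
      rw [← sub_eq_zero, ← map_sub] at h
      simp only [OneMemClass.coe_one, one_mul]
      exact (Ideal.Quotient.eq).mpr (hker _ h)
  let e : L ≃ₐ[T] FractionRing T := IsLocalization.algEquiv T⁰ L (FractionRing T)
  have hint : ∀ x : L, IsIntegral G x → IsIntegral T (e x) := fun x hx => by
    exact (hx.tower_top (A := T)).map e
  let ψ : integralClosure G L →ₐ[G] NormRing G :=
    { toFun := fun x => ⟨e x.1, hint x.1 x.2⟩
      map_one' := Subtype.ext (map_one e)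
      map_mul' := fun x y => Subtype.ext (map_mul e _ _)
      map_zero' := Subtype.ext (map_zero e)
      map_add' := fun x y => Subtype.ext (map_add e _ _)
      commutes' := fun g => Subtype.ext (e.commutes (Ideal.Quotient.mk _ g)) }
  refine ⟨AlgEquiv.ofBijective ψ ⟨fun x y h => ?_, fun y => ?_⟩⟩
  · exact Subtype.ext (e.injective (congrArg Subtype.val h))
  · refine ⟨⟨e.symm y.1, ?_⟩, Subtype.ext (e.apply_symm_apply _)⟩
    have h1 : IsIntegral T (e.symm y.1) := (show IsIntegral T y.1 from y.2).map e.symm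
    exact isIntegral_trans (R := G) (A := T) _ h1

lemma isNilpotent_iff_forall_minimalPrimes {G : Type*} [CommRing G] (g : G) :
    IsNilpotent g ↔ ∀ P ∈ minimalPrimes G, g ∈ P := by
  rw [← mem_nilradical, nilradical, ← Ideal.sInf_minimalPrimes]
  exact Submodule.mem_sInf

lemma mk_mem_nonZeroDivisors_of_forall_notMem {G : Type*} [CommRing G] {b : G}
    (hb : ∀ P ∈ minimalPrimes G, b ∉ P) :
    Ideal.Quotient.mk (nilradical G) b ∈ (G ⧸ nilradical G)⁰ := by
  rw [mem_nonZeroDivisors_iff_right]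
  intro x hx
  obtain ⟨a, rfl⟩ := Ideal.Quotient.mk_surjective x
  rw [← map_mul, Ideal.Quotient.eq_zero_iff_mem, mem_nilradical,
    isNilpotent_iff_forall_minimalPrimes] at hx
  rw [Ideal.Quotient.eq_zero_iff_mem, mem_nilradical, isNilpotent_iff_forall_minimalPrimes]
  intro P hP
  have : P.IsPrime := hP.1.1
  exact (this.mem_or_mem (hx P hP)).resolve_right (hb P hP)

/-- Elements of a minimal prime are zero divisors, and since the nilradical lies in every prime, `P`
stays a minimal prime in the reduction. -/
lemma forall_notMem_of_mk_mem_nonZeroDivisors {G : Type*} [CommRing G] {b : G}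
    (hb : Ideal.Quotient.mk (nilradical G) b ∈ (G ⧸ nilradical G)⁰) :
    ∀ P ∈ minimalPrimes G, b ∉ P := by
  intro P hP hbP
  have hp : P.IsPrime := hP.1.1
  have hle : nilradical G ≤ P := nilradical_le_prime P
  have hmin : P.map (Ideal.Quotient.mk (nilradical G)) ∈ minimalPrimes (G ⧸ nilradical G) := by
    have hcm : (P.map (Ideal.Quotient.mk (nilradical G))).comap
        (Ideal.Quotient.mk (nilradical G)) = P := by
      rw [Ideal.comap_map_of_surjective _ Ideal.Quotient.mk_surjective, ← RingHom.ker_eq_comap_bot,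
        Ideal.mk_ker, sup_eq_left.mpr hle]
    refine ⟨⟨Ideal.map_isPrime_of_surjective Ideal.Quotient.mk_surjective
      (by rwa [Ideal.mk_ker]), bot_le⟩, fun I hI hIP => ?_⟩
    have hIp := hI.1
    have h1 : P ≤ I.comap (Ideal.Quotient.mk (nilradical G)) :=
      hP.2 ⟨inferInstance, bot_le⟩ (by rw [← hcm]; exact Ideal.comap_mono hIP)
    rw [Ideal.map_le_iff_le_comap]
    exact h1
  exact notMem_nonZeroDivisors_of_mem_mem_minimalPrimes (Ideal.mem_map_of_mem _ hbP) hmin hb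

/-- If the localization of `R` away from `t` is normal and `t` avoids the minimal primes, then the
normalization of `R` is the integral closure of `R` in that localization. -/
lemma nonempty_normRing_equiv_integralClosure_away {R : Type u} {T : Type*} [CommRing R]
    [CommRing T] [Algebra R T] (t : R) [IsLocalization.Away t T]
    (ht : ∀ P ∈ minimalPrimes R, t ∉ P)
    (hT : ∀ (P : Ideal T) [P.IsMaximal], IsNormalDomain (Localization.AtPrime P))
    [IsReduced T] :
    Nonempty (integralClosure R T ≃ₐ[R] NormRing R) := by
  let R₀ := R ⧸ nilradical R
  let Q := FractionRing R₀
  have htu : IsUnit (algebraMap R Q t) :=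
    IsLocalization.map_units Q (⟨_, mk_mem_nonZeroDivisors_of_forall_notMem ht⟩ : R₀⁰)
  -- Avoiding the minimal primes makes `t` a nonzerodivisor of the reduction, so the localization
  -- maps to the total quotient ring; it embeds there because it is reduced.
  let φ₀ : T →+* Q := IsLocalization.Away.lift t htu
  have hφ₀ : ∀ r, φ₀ (algebraMap R T r) = algebraMap R Q r := IsLocalization.Away.lift_eq t htu
  let φ : T →ₐ[R] Q := { φ₀ with commutes' := hφ₀ }
  have hφ : ∀ r, φ (algebraMap R T r) = algebraMap R Q r := hφ₀
  have hQ0 : ∀ r : R, algebraMap R Q r = 0 → IsNilpotent r := by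
    intro r hr
    have : algebraMap R₀ Q (Ideal.Quotient.mk _ r) = 0 := hr
    rw [IsFractionRing.to_map_eq_zero_iff, Ideal.Quotient.eq_zero_iff_mem] at this
    exact this
  have hT0 : ∀ y : T, ∃ (r : R) (n : ℕ), algebraMap R T (t ^ n) * y = algebraMap R T r := by
    intro y
    obtain ⟨n, r, h⟩ := IsLocalization.Away.surj t y
    exact ⟨r, n, by rw [map_pow, mul_comm, h]⟩
  have htT : ∀ n : ℕ, IsUnit (algebraMap R T (t ^ n)) := fun n => by
    rw [map_pow]; exact (IsLocalization.Away.algebraMap_isUnit t).pow n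
  have hinj : Function.Injective φ := by
    rw [injective_iff_map_eq_zero]
    intro y hy
    obtain ⟨r, n, h⟩ := hT0 y
    have h1 : algebraMap R Q r = 0 := by rw [← hφ, ← h, map_mul, hy, mul_zero]
    have h2 := ((hQ0 r h1).map (algebraMap R T)).eq_zero
    rw [h2] at h
    exact (htT n).mul_right_eq_zero.mp h
  have hint : ∀ x : T, IsIntegral R x → IsIntegral R₀ (φ x) := fun x hx =>
    (hx.map φ).tower_top (A := R₀)
  let ψ : integralClosure R T →ₐ[R] NormRing R :=
    { toFun := fun x => ⟨φ x.1, hint x.1 x.2⟩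
      map_one' := Subtype.ext (map_one φ)
      map_mul' := fun x y => Subtype.ext (map_mul φ _ _)
      map_zero' := Subtype.ext (map_zero φ)
      map_add' := fun x y => Subtype.ext (map_add φ _ _)
      commutes' := fun g => Subtype.ext (hφ g) }
  refine ⟨AlgEquiv.ofBijective ψ ⟨fun x y h => ?_, fun y => ?_⟩⟩
  · exact Subtype.ext (hinj (congrArg Subtype.val h))
  · obtain ⟨z, hz⟩ := y
    have hzR : IsIntegral R z := isIntegral_trans (R := R) (A := R₀) _ hz
    obtain ⟨a, b, hab⟩ : ∃ a : R, ∃ b : R, Ideal.Quotient.mk (nilradical R) b ∈ R₀⁰ ∧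
        algebraMap R Q b * z = algebraMap R Q a := by
      obtain ⟨⟨a, b, hb⟩, h⟩ := IsLocalization.surj R₀⁰ z
      obtain ⟨a, rfl⟩ := Ideal.Quotient.mk_surjective a
      obtain ⟨b, rfl⟩ := Ideal.Quotient.mk_surjective b
      exact ⟨a, b, hb, by rw [mul_comm]; exact h⟩
    obtain ⟨hb, hab⟩ := hab
    let _ : Algebra T Q := φ₀.toAlgebra
    have : IsScalarTower R T Q := IsScalarTower.of_algebraMap_eq fun r => (hφ r).symm
    have hbT : algebraMap R T b ∈ T⁰ := by
      rw [mem_nonZeroDivisors_iff_right]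
      intro x hx
      apply hinj
      have hbu : IsUnit (algebraMap R Q b) := IsLocalization.map_units Q (⟨_, hb⟩ : R₀⁰)
      have h1 := congrArg φ hx
      rw [map_mul, hφ, map_zero] at h1
      rw [map_zero]
      exact hbu.mul_left_eq_zero.mp h1
    have hbu : IsUnit (algebraMap R Q b) := IsLocalization.map_units Q (⟨_, hb⟩ : R₀⁰)
    -- An integral element z = a/b of the total quotient ring already lies in `T`, since `T` is
    -- locally an integrally closed domain.
    obtain ⟨c, hc⟩ := dvd_of_isIntegral_of_isNormalDomain (T := T) (Q := Q) hinj hT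
      (hzR.tower_top (A := T)) hbT (a := algebraMap R T a) (by
        rw [← IsScalarTower.algebraMap_apply, ← IsScalarTower.algebraMap_apply, hab])
    have hcz : φ c = z := by
      apply hbu.mul_left_cancel
      rw [hab, ← hφ, ← hφ, ← map_mul, ← hc]
    refine ⟨⟨c, ?_⟩, Subtype.ext hcz⟩
    have h2 : IsIntegral R (φ c) := hcz ▸ hzR
    exact (isIntegral_algHom_iff φ hinj).mp h2

section Localization

variable {G : Type u} [CommRing G] [IsNoetherianRing G]

/-- A prime of the total quotient ring contracts to a prime made of zero divisors. Zero divisors of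
a reduced ring lie in the union of the finitely many minimal primes, so by prime avoidance the
contraction is minimal and the dimension is zero. -/
lemma isArtinianRing_fractionRing_of_isReduced (T : Type*) [CommRing T] [IsNoetherianRing T]
    [IsReduced T] : IsArtinianRing (FractionRing T) := by
  have hN : IsNoetherianRing (FractionRing T) :=
    IsLocalization.isNoetherianRing T⁰ _ inferInstance
  rw [isArtinianRing_iff_isNoetherianRing_krullDimLE_zero]
  refine ⟨hN, ?_⟩
  have hmin : ∀ P : Ideal (FractionRing T), P.IsPrime →
      P.comap (algebraMap T (FractionRing T)) ∈ minimalPrimes T := by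
    intro P hP
    have hfin := minimalPrimes.finite_of_isNoetherianRing T
    have hsub : ((P.comap (algebraMap T (FractionRing T)) : Ideal T) : Set T) ⊆
        ⋃ I ∈ (hfin.toFinset : Set (Ideal T)), (I : Set T) := by
      intro x hx
      by_contra hcon
      simp only [Set.Finite.coe_toFinset, Set.mem_iUnion, not_exists] at hcon
      have hx0 : x ∈ T⁰ := by
        rw [mem_nonZeroDivisors_iff_right]
        intro y hy
        apply IsNilpotent.eq_zero
        rw [isNilpotent_iff_forall_minimalPrimes]
        intro I hI
        have : I.IsPrime := hI.1.1
        exact (this.mem_or_mem (x := y) (y := x) (by rw [hy]; exact I.zero_mem)).resolve_right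
          (hcon I hI)
      have : IsUnit (algebraMap T (FractionRing T) x) :=
        IsLocalization.map_units (FractionRing T) ⟨x, hx0⟩
      exact hP.ne_top (Ideal.eq_top_of_isUnit_mem _ hx this)
    obtain ⟨I, hI, hle⟩ := (Ideal.subset_union_prime (s := hfin.toFinset) (f := id) ⊥ ⊥
      (fun I hI _ _ => ((hfin.mem_toFinset.mp hI).1.1))).mp hsub
    have hI' := hfin.mem_toFinset.mp hI
    have hPp : (P.comap (algebraMap T (FractionRing T))).IsPrime := inferInstance
    have := hI'.2 ⟨hPp, bot_le⟩ hle
    rw [le_antisymm hle this]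
    exact hI'
  rw [Ring.krullDimLE_zero_iff]
  intro P hP
  obtain ⟨M, hM, hle⟩ := Ideal.exists_le_maximal P hP.ne_top
  have h1 := hmin P hP
  have h2 := hmin M hM.isPrime
  have h3 : P.comap (algebraMap T (FractionRing T)) = M.comap (algebraMap T (FractionRing T)) :=
    le_antisymm (Ideal.comap_mono hle) (h2.2 h1.1 (Ideal.comap_mono hle))
  have : P = M := by
    rw [← IsLocalization.map_under T⁰ (FractionRing T) P,
      ← IsLocalization.map_under T⁰ (FractionRing T) M]
    exact congrArg _ h3
  rw [this]; exact hM

lemma isReduced_fractionRing (T : Type*) [CommRing T] [IsReduced T] :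
    IsReduced (FractionRing T) :=
  isReduced_localizationPreserves T⁰ _ inferInstance

instance (G : Type*) [CommRing G] : IsReduced (G ⧸ nilradical G) :=
  (Ideal.isRadical_iff_quotient_reduced _).mp (Ideal.radical_isRadical _)

/-- Normalization commutes with localization. -/
lemma nonempty_normRing_equiv_of_isLocalization (S : Submonoid G) {G' : Type u} [CommRing G']
    [Algebra G G'] [IsLocalization S G'] {H H' : Type*} [CommRing H] [Algebra G H]
    (e : Nonempty (H ≃ₐ[G] NormRing G)) [CommRing H'] [Algebra H H']
    [IsLocalization (Algebra.algebraMapSubmonoid H S) H'] [Algebra G' H'] [Algebra G H']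
    [IsScalarTower G H H'] [IsScalarTower G G' H'] :
    Nonempty (H' ≃ₐ[G'] NormRing G') := by
  let T := G ⧸ nilradical G
  let L := FractionRing T
  let SL := Algebra.algebraMapSubmonoid L S
  -- `L'` will turn out to be a total quotient ring of the reduction of `G'`; the normalization of
  -- `G'` can then be computed inside it.
  let L' := Localization SL
  have hArt : IsArtinianRing L := isArtinianRing_fractionRing_of_isReduced T
  have hredL : IsReduced L := isReduced_fractionRing T
  have hArt' : IsArtinianRing L' := IsArtinianRing.localization_artinian SL L'
  have hredL' : IsReduced L' := isReduced_localizationPreserves SL L' hredL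
  let _ : Algebra G' L' := localizationAlgebra S L
  have htow : IsScalarTower G G' L' := isScalarTower_localizationAlgebra S L
  have hL0 : ∀ g : G, algebraMap G L g = 0 → IsNilpotent g := by
    intro r hr
    have : algebraMap T L (Ideal.Quotient.mk _ r) = 0 := hr
    rw [IsFractionRing.to_map_eq_zero_iff, Ideal.Quotient.eq_zero_iff_mem] at this
    exact this
  have hLunit : ∀ b : G, Ideal.Quotient.mk (nilradical G) b ∈ T⁰ → IsUnit (algebraMap G L b) :=
    fun b hb => IsLocalization.map_units L (⟨_, hb⟩ : T⁰)
  have hLsurj : ∀ l : L, ∃ a b : G, Ideal.Quotient.mk (nilradical G) b ∈ T⁰ ∧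
      algebraMap G L b * l = algebraMap G L a := by
    intro z
    obtain ⟨⟨a, b, hb⟩, h⟩ := IsLocalization.surj T⁰ z
    obtain ⟨a, rfl⟩ := Ideal.Quotient.mk_surjective a
    obtain ⟨b, rfl⟩ := Ideal.Quotient.mk_surjective b
    exact ⟨a, b, hb, by rw [mul_comm]; exact h⟩
  obtain ⟨e₁⟩ := nonempty_integralClosure_equiv_normRing (G := G) (L := L) hL0
    (fun g hg => (hg.map _).eq_zero) hLunit hLsurj
  have hGG' : ∀ x : G', ∃ (g : G) (s : S), algebraMap G G' s * x = algebraMap G G' g := by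
    intro x
    obtain ⟨⟨g, s⟩, h⟩ := IsLocalization.surj S x
    exact ⟨g, s, by rw [mul_comm, h]⟩
  have hSu : ∀ s : S, IsUnit (algebraMap G G' s) := fun s => IsLocalization.map_units G' s
  have hGL' : ∀ g : G, algebraMap G L' g = 0 → IsNilpotent (algebraMap G G' g) := by
    intro g hg
    rw [IsScalarTower.algebraMap_apply G L L'] at hg
    obtain ⟨⟨_, s, hs, rfl⟩, h⟩ := (IsLocalization.map_eq_zero_iff SL L' _).mp hg
    have h1 : algebraMap G L (s * g) = 0 := by rw [map_mul]; exact h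
    have h2 := (hL0 _ h1).map (algebraMap G G')
    rw [map_mul] at h2
    exact ((hSu ⟨s, hs⟩).isNilpotent_mul_unit_of_commute_iff (Commute.all _ _)).mp
      (by rw [mul_comm]; exact h2)
  have hker' : ∀ x : G', algebraMap G' L' x = 0 → IsNilpotent x := by
    intro x hx
    obtain ⟨g, s, h⟩ := hGG' x
    have h1 : algebraMap G L' g = 0 := by
      rw [IsScalarTower.algebraMap_apply G G' L', ← h, map_mul, hx, mul_zero]
    have h2 := hGL' g h1
    rw [← h] at h2
    exact ((hSu s).isNilpotent_mul_unit_of_commute_iff (Commute.all _ _)).mp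
      (by rw [mul_comm]; exact h2)
  have hnzd : ∀ b : G, Ideal.Quotient.mk (nilradical G) b ∈ T⁰ →
      Ideal.Quotient.mk (nilradical G') (algebraMap G G' b) ∈ (G' ⧸ nilradical G')⁰ := by
    intro b hb
    rw [mem_nonZeroDivisors_iff_right]
    intro x hx
    obtain ⟨x, rfl⟩ := Ideal.Quotient.mk_surjective x
    rw [← map_mul, Ideal.Quotient.eq_zero_iff_mem, mem_nilradical] at hx
    rw [Ideal.Quotient.eq_zero_iff_mem, mem_nilradical]
    apply hker'
    have h1 : algebraMap G' L' (x * algebraMap G G' b) = 0 := (hx.map _).eq_zero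
    rw [map_mul, ← IsScalarTower.algebraMap_apply, IsScalarTower.algebraMap_apply G L L'] at h1
    exact ((hLunit b hb).map (algebraMap L L')).mul_left_eq_zero.mp h1
  have hsurj' : ∀ l : L', ∃ a b : G', Ideal.Quotient.mk (nilradical G') b ∈ (G' ⧸ nilradical G')⁰ ∧
      IsUnit (algebraMap G' L' b) ∧ algebraMap G' L' b * l = algebraMap G' L' a := by
    intro l
    obtain ⟨⟨x, _, s, hs, rfl⟩, h⟩ := IsLocalization.surj SL l
    obtain ⟨a, b, hb, hab⟩ := hLsurj x
    obtain ⟨s', hs'⟩ := hSu ⟨s, hs⟩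
    refine ⟨algebraMap G G' a * ↑(s'⁻¹), algebraMap G G' b, hnzd b hb, ?_, ?_⟩
    · rw [← IsScalarTower.algebraMap_apply, IsScalarTower.algebraMap_apply G L L']
      exact (hLunit b hb).map _
    · have hsL : algebraMap G' L' s' = algebraMap L L' (algebraMap G L s) := by
        rw [hs', ← IsScalarTower.algebraMap_apply, ← IsScalarTower.algebraMap_apply]
      apply (s'.isUnit.map (algebraMap G' L')).mul_left_cancel
      have h1 : algebraMap G' L' s' * algebraMap G' L' (algebraMap G G' a * ↑s'⁻¹) =
          algebraMap L L' (algebraMap G L a) := by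
        rw [← map_mul, mul_left_comm, Units.mul_inv, mul_one, ← IsScalarTower.algebraMap_apply,
          IsScalarTower.algebraMap_apply G L L' a]
      rw [h1, ← hab, map_mul, ← h, hsL, ← IsScalarTower.algebraMap_apply G G' L',
        IsScalarTower.algebraMap_apply G L L' b]
      ring
  obtain ⟨e₂⟩ := nonempty_integralClosure_equiv_normRing (G := G') (L := L') hker'
    (fun g hg => (hg.map _).eq_zero)
    (fun b hb => by
      -- `S` may contain zero divisors, so a nonzerodivisor of the reduction of `G'` need not come
      -- from one of `G`. It suffices that it stays a nonzerodivisor in the Artinian ring `L'`.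
      apply IsArtinianRing.isUnit_of_mem_nonZeroDivisors
      rw [mem_nonZeroDivisors_iff_right]
      intro l hl
      obtain ⟨a, c, -, hcu, hca⟩ := hsurj' l
      have h1 : algebraMap G' L' (a * b) = 0 := by rw [map_mul, ← hca, mul_assoc, hl, mul_zero]
      have h2 := hker' _ h1
      rw [← mem_nilradical, ← Ideal.Quotient.eq_zero_iff_mem, map_mul] at h2
      have h3 := (mul_right_mem_nonZeroDivisors_eq_zero_iff hb).mp h2
      rw [Ideal.Quotient.eq_zero_iff_mem, mem_nilradical] at h3
      rw [(h3.map _).eq_zero] at hca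
      exact hcu.mul_right_eq_zero.mp hca)
    (fun l => by
      obtain ⟨a, b, hb, -, h⟩ := hsurj' l
      exact ⟨a, b, hb, h⟩)
  let C := integralClosure G L
  let C' := integralClosure G' L'
  let j : C →+* C' := ((algebraMap L L').comp C.val.toRingHom).codRestrict C'.toSubring
    (fun x => ((show IsIntegral G x.1 from x.2).map (IsScalarTower.toAlgHom G L L')).tower_top)
  let _ : Algebra C C' := j.toAlgebra
  have t1 : IsScalarTower C C' L' := IsScalarTower.of_algebraMap_eq fun x => rfl
  have t2 : IsScalarTower G C C' := IsScalarTower.of_algebraMap_eq fun x => by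
    apply Subtype.ext
    change algebraMap G L' x = algebraMap L L' (algebraMap G L x)
    rw [← IsScalarTower.algebraMap_apply]
  -- Integral closure inside a given algebra commutes with localization; with both total quotient
  -- rings identified this is all that remains.
  have hloc : IsLocalization (Algebra.algebraMapSubmonoid C S) C' :=
    IsLocalization.integralClosure S
  obtain ⟨e⟩ := e
  let e₀ : H ≃ₐ[G] C := e.trans e₁.symm
  have hmap : (Algebra.algebraMapSubmonoid H S).map e₀.toRingEquiv.toMonoidHom =
      Algebra.algebraMapSubmonoid C S := by
    ext x
    simp only [Algebra.algebraMapSubmonoid, Submonoid.mem_map]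
    constructor
    · rintro ⟨_, ⟨g, hg, rfl⟩, rfl⟩; exact ⟨g, hg, (e₀.commutes g).symm⟩
    · rintro ⟨g, hg, rfl⟩; exact ⟨_, ⟨g, hg, rfl⟩, e₀.commutes g⟩
  let e₃ : H' ≃+* C' := IsLocalization.ringEquivOfRingEquiv H' C' e₀.toRingEquiv hmap
  have e₃c : ∀ x : G', e₃ (algebraMap G' H' x) = algebraMap G' C' x := by
    intro x
    obtain ⟨g, s, h⟩ := hGG' x
    have key : ∀ g : G, e₃ (algebraMap G' H' (algebraMap G G' g)) =
        algebraMap G' C' (algebraMap G G' g) := by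
      intro g
      rw [← IsScalarTower.algebraMap_apply, IsScalarTower.algebraMap_apply G H H']
      simp only [e₃, IsLocalization.ringEquivOfRingEquiv_eq]
      have : e₀.toRingEquiv (algebraMap G H g) = algebraMap G C g := e₀.commutes g
      rw [this, ← IsScalarTower.algebraMap_apply]
      exact IsScalarTower.algebraMap_apply G G' C' g
    apply ((hSu s).map (algebraMap G' C')).mul_left_cancel
    rw [← key s, ← map_mul, ← map_mul, h, key, key s, ← map_mul, h]
  exact ⟨(AlgEquiv.ofRingEquiv (f := e₃) e₃c).trans e₂⟩

/-- The powers of a nonzero `a` stabilize, so aⁿ = aⁿ⁺¹y; by reducedness a = a²y. Then ay is a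
nonzero idempotent, hence 1. -/
lemma isField_of_forall_idempotent {Q : Type*} [CommRing Q] [Nontrivial Q] [IsArtinianRing Q]
    [IsReduced Q] (h : ∀ e : Q, e * e = e → e = 0 ∨ e = 1) : IsField Q := by
  refine ⟨⟨0, 1, zero_ne_one⟩, mul_comm, fun {a} ha => ?_⟩
  obtain ⟨n, y, hy⟩ := IsArtinian.exists_pow_succ_smul_dvd a (1 : Q)
  simp only [smul_eq_mul, mul_one] at hy
  have h1 : (a * (1 - a * y)) ^ (n + 1) = 0 := by
    have : a ^ n * (1 - a * y) = 0 := by rw [mul_sub, mul_one, ← mul_assoc, ← pow_succ, hy, sub_self]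
    rw [mul_pow, pow_succ a, pow_succ (1 - a * y)]
    linear_combination (a * (1 - a * y) ^ n) * this
  have h2 := eq_zero_of_pow_eq_zero h1
  rcases h (a * y) (by linear_combination (-y) * h2) with h3 | h3
  · exfalso; apply ha
    rw [h3] at h2; simpa using h2
  · exact ⟨y, h3⟩

/-- The local rings of a normalization are integrally closed domains. -/
lemma isNormalDomain_of_isLocalization_normRing {H H' : Type*} [CommRing H] [Algebra G H]
    (e : Nonempty (H ≃ₐ[G] NormRing G)) (P : Ideal H) [P.IsPrime] [CommRing H'] [Algebra H H']
    [IsLocalization.AtPrime H' P] : IsNormalDomain H' := by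
  let T := G ⧸ nilradical G
  let L := FractionRing T
  obtain ⟨e⟩ := e
  let _ : Algebra H L := ((algebraMap (NormRing G) L).comp e.toRingHom).toAlgebra
  have hHL : ∀ x, algebraMap H L x = (e x).1 := fun x => rfl
  have hHLinj : Function.Injective (algebraMap H L) := fun x y hxy =>
    e.injective (Subtype.ext hxy)
  have hclosed : ∀ z : L, IsIntegral H z → ∃ h, algebraMap H L h = z := by
    intro z hz
    let _ : Algebra H (NormRing G) := e.toRingHom.toAlgebra
    have : IsScalarTower H (NormRing G) L := IsScalarTower.of_algebraMap_eq fun x => rfl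
    have h1 : IsIntegral (NormRing G) z := hz.tower_top
    have h2 : IsIntegral T z := isIntegral_trans (R := T) (A := NormRing G) _ h1
    exact ⟨e.symm ⟨z, h2⟩, by rw [hHL, e.apply_symm_apply]⟩
  let SL := Algebra.algebraMapSubmonoid L P.primeCompl
  let L' := Localization SL
  have hArt : IsArtinianRing L := isArtinianRing_fractionRing_of_isReduced T
  have hredL : IsReduced L := isReduced_fractionRing T
  have hArt' : IsArtinianRing L' := IsArtinianRing.localization_artinian SL L'
  have hredL' : IsReduced L' := isReduced_localizationPreserves SL L' hredL
  have : IsLocalization P.primeCompl H' := inferInstance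
  let _ : Algebra H' L' := localizationAlgebra P.primeCompl L
  have htow : IsScalarTower H H' L' := isScalarTower_localizationAlgebra P.primeCompl L
  have hinj' : Function.Injective (algebraMap H' L') :=
    localizationAlgebra_injective (M := P.primeCompl) (Rₘ := H') (Sₘ := L') hHLinj
  have hloc : IsLocalRing H' := IsLocalization.AtPrime.isLocalRing H' P
  -- Clearing denominators turns an element of `L'` integral over `H'` into an element of `L`
  -- integral over `H`, where closedness is known.
  have hclosed' : ∀ y : L', IsIntegral H' y → ∃ h, algebraMap H' L' h = y := by
    intro y hy
    obtain ⟨m, hm⟩ := IsIntegral.exists_multiple_integral_of_isLocalization P.primeCompl y hy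
    obtain ⟨⟨x, _, m₁, hm₁, rfl⟩, h⟩ := IsLocalization.surj SL y
    obtain ⟨m₃, hm₃, hm₃s⟩ := IsLocalization.exists_isIntegral_smul_of_isIntegral_map (Sₘ := L')
      P.primeCompl (x := (m : H) • x) <| by
        simp only [Submonoid.smul_def, Algebra.smul_def] at hm
        simp only [Algebra.smul_def, map_mul, ← IsScalarTower.algebraMap_apply, ← h, ← mul_assoc]
        exact hm.mul (.algebraMap (Algebra.IsIntegral.isIntegral _))
    obtain ⟨c, hc⟩ := hclosed _ hm₃s
    have hu : IsUnit (algebraMap H H' (m₃ * m * m₁)) :=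
      IsLocalization.map_units H' (⟨_, mul_mem (mul_mem hm₃ m.2) hm₁⟩ : P.primeCompl)
    obtain ⟨u, hu⟩ := hu
    refine ⟨algebraMap H H' c * ↑u⁻¹, ?_⟩
    apply (u.isUnit.map (algebraMap H' L')).mul_left_cancel
    rw [← map_mul, mul_left_comm, Units.mul_inv, mul_one, hu, ← IsScalarTower.algebraMap_apply,
      ← IsScalarTower.algebraMap_apply, IsScalarTower.algebraMap_apply H L L', hc]
    simp only [Algebra.smul_def, map_mul, ← IsScalarTower.algebraMap_apply] at h ⊢
    rw [← h]; ring
  have hnt : Nontrivial L' := hinj'.nontrivial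
  -- Idempotents of `L'` are integral, being roots of X² − X, so they lie in the local ring `H'` and
  -- are trivial. An Artinian reduced ring with only trivial idempotents is a field.
  have hfield : IsField L' := by
    refine isField_of_forall_idempotent fun i hi => ?_
    have hint : IsIntegral H' i := by
      refine ⟨X ^ 2 - X, by monicity!, ?_⟩
      simp [pow_two, hi]
    obtain ⟨c, rfl⟩ := hclosed' i hint
    have hc : c * c = c := hinj' (by rw [map_mul, hi])
    rcases IsLocalRing.isUnit_or_isUnit_one_sub_self c with hu | hu
    · right
      rw [hu.mul_left_cancel (hc.trans (mul_one c).symm), map_one]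
    · left
      have : (1 - c) * c = 0 := by rw [sub_mul, one_mul, hc, sub_self]
      rw [hu.mul_right_eq_zero.mp this, map_zero]
  let _ : Field L' := hfield.toField
  have hdom : IsDomain H' := hinj'.isDomain (algebraMap H' L')
  refine ⟨hdom, ?_⟩
  rw [isIntegrallyClosed_iff (FractionRing H')]
  intro x hx
  let j : FractionRing H' →ₐ[H'] L' := IsFractionRing.liftAlgHom
    (g := Algebra.ofId H' L') hinj'
  obtain ⟨c, hc⟩ := hclosed' (j x) (hx.map j)
  exact ⟨c, j.toRingHom.injective (by simpa using hc)⟩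

end Localization

end NormalizationAlgebra

end DeltaFamily
end

/-! ### Local rings with normal punctured spectrum. -/

noncomputable section
namespace DeltaFamily

section LocalAlgebra

open nonZeroDivisors IsLocalRing

/-- A local ring whose localizations at non-maximal primes are integrally closed domains. -/
def PuncturedNormal (R : Type*) [CommRing R] [IsLocalRing R] : Prop :=
  ∀ (q : Ideal R) [q.IsPrime], q ≠ maximalIdeal R → IsNormalDomain (Localization.AtPrime q)

/-- Prime avoidance. Inverting the resulting `t` removes the closed point while leaving the listed
primes, in practice minimal ones, untouched. -/
lemma exists_mem_maximalIdeal_avoiding {R : Type*} [CommRing R] [IsLocalRing R]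
    (F : Set (Ideal R)) (hF : F.Finite) (hp : ∀ P ∈ F, P.IsPrime ∧ P ≠ maximalIdeal R) :
    ∃ t ∈ maximalIdeal R, ∀ P ∈ F, t ∉ P := by
  by_contra! hcon
  have hsub : ((maximalIdeal R : Ideal R) : Set R) ⊆
      ⋃ I ∈ (hF.toFinset : Set (Ideal R)), (I : Set R) := by
    intro x hx
    obtain ⟨P, hP, hxP⟩ := hcon x hx
    simp only [Set.Finite.coe_toFinset, Set.mem_iUnion]
    exact ⟨P, hP, hxP⟩
  obtain ⟨I, hI, hle⟩ := (Ideal.subset_union_prime (s := hF.toFinset) (f := id) ⊥ ⊥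
    (fun I hI _ _ => (hp I (hF.mem_toFinset.mp hI)).1)).mp hsub
  have h := hp I (hF.mem_toFinset.mp hI)
  exact h.2 (le_antisymm (le_maximalIdeal h.1.ne_top) hle)

/-- Over a Noetherian local ring, a finite module supported at the closed point has finite
length. -/
lemma isFiniteLength_of_support {R : Type*} [CommRing R] [IsLocalRing R] [IsNoetherianRing R]
    {V : Type*} [AddCommGroup V] [Module R V] [Module.Finite R V]
    (h : ∀ q ∈ Module.support R V, q.asIdeal = maximalIdeal R) : IsFiniteLength R V := by
  revert h
  induction ‹Module.Finite R V› using
    IsNoetherianRing.induction_on_isQuotientEquivQuotientPrime R with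
  | subsingleton N => exact fun _ => .of_subsingleton
  | quotient N p f =>
    intro h
    have hp : p ∈ Module.support R N := by
      rw [Module.mem_support_iff']
      refine ⟨f.symm (Ideal.Quotient.mk p.1 1), fun r hr h0 => hr ?_⟩
      rw [← map_smul, map_eq_zero_iff _ f.symm.injective, ← Ideal.Quotient.mk_eq_mk,
        ← Submodule.Quotient.mk_smul, Submodule.Quotient.mk_eq_zero] at h0
      simpa using h0
    have hm := h p hp
    have hmax : (p.1).IsMaximal := by
      rw [show p.1 = maximalIdeal R from hm]; infer_instance
    have : IsSimpleModule R (R ⧸ p.1) := isSimpleModule_iff_quot_maximal.mpr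
      ⟨p.1, hmax, ⟨LinearEquiv.refl _ _⟩⟩
    have : IsSimpleModule R N := IsSimpleModule.congr f
    exact isFiniteLength_iff_isNoetherian_isArtinian.mpr ⟨inferInstance, inferInstance⟩
  | exact N₁ N₂ N₃ f g hf hg hfg h₁ h₃ =>
    intro h
    have hs := Module.support_of_exact hfg hf hg
    have l1 := h₁ fun q hq => h q (by rw [hs]; exact Or.inl hq)
    have l3 := h₃ fun q hq => h q (by rw [hs]; exact Or.inr hq)
    rw [← Module.length_ne_top_iff] at l1 l3 ⊢
    rw [Module.length_eq_add_of_exact f g hf hg hfg]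
    exact WithTop.add_ne_top.mpr ⟨l1, l3⟩

lemma isNormalDomain_of_isLocalization_atPrime {R : Type*} [CommRing R] {q : Ideal R} [q.IsPrime]
    {S : Type*} [CommRing S] [Algebra R S] [IsLocalization.AtPrime S q]
    {S' : Type*} [CommRing S'] [Algebra R S'] [IsLocalization.AtPrime S' q]
    (h : IsNormalDomain S) : IsNormalDomain S' :=
  h.of_ringEquiv (IsLocalization.algEquiv q.primeCompl S S').toRingEquiv

lemma isNormalDomain_atPrime_congr {R : Type*} [CommRing R] {q q' : Ideal R} [q.IsPrime]
    [q'.IsPrime] (hqq : q = q') (h : IsNormalDomain (Localization.AtPrime q)) :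
    IsNormalDomain (Localization.AtPrime q') := by
  subst hqq; exact h

lemma isNormalDomain_atPrime_of_isLocalization {R T : Type*} [CommRing R] [CommRing T]
    [Algebra R T] (M : Submonoid R) [IsLocalization M T] (P : Ideal T) [P.IsPrime]
    {S : Type*} [CommRing S] [Algebra R S] [IsLocalization.AtPrime S (P.comap (algebraMap R T))]
    (h : IsNormalDomain S) : IsNormalDomain (Localization.AtPrime P) := by
  have := IsLocalization.isLocalization_isLocalization_atPrime_isLocalization M
    (Localization.AtPrime P) P
  exact isNormalDomain_of_isLocalization_atPrime (q := P.comap (algebraMap R T)) h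

section Away

variable {R : Type*} [CommRing R] [IsLocalRing R] (hPN : PuncturedNormal R)
  {t : R} (ht : t ∈ maximalIdeal R) (T : Type*) [CommRing T] [Algebra R T]
  [IsLocalization.Away t T]

include hPN ht

/-- Inverting an element of the maximal ideal discards the closed point, the only one that may fail
to be normal. -/
lemma isNormalDomain_atPrime_away (P : Ideal T) [P.IsPrime] :
    IsNormalDomain (Localization.AtPrime P) := by
  have hne : P.comap (algebraMap R T) ≠ maximalIdeal R := by
    intro h
    have : algebraMap R T t ∈ P := by
      rw [← Ideal.mem_comap, h]; exact ht
    exact (inferInstance : P.IsPrime).ne_top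
      (Ideal.eq_top_of_isUnit_mem _ this (IsLocalization.Away.algebraMap_isUnit t))
  exact isNormalDomain_atPrime_of_isLocalization (Submonoid.powers t) P (hPN _ hne)

lemma isReduced_away : IsReduced T := by
  refine isReduced_ofLocalizationMaximal T fun P hP => ?_
  have := (isNormalDomain_atPrime_away hPN ht T P).1
  infer_instance

end Away

section Support

variable {R : Type u} [CommRing R] [IsLocalRing R]

/-- At any other prime the local ring is a domain, where nilpotents die. -/
lemma support_nilradical_of_puncturedNormal (hPN : PuncturedNormal R) :
    ∀ q ∈ Module.support R (nilradical R), q.asIdeal = maximalIdeal R := by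
  intro q hq
  by_contra hne
  obtain ⟨x, hx⟩ := Module.mem_support_iff'.mp hq
  have hd := (hPN q.asIdeal hne).1
  have h0 : algebraMap R (Localization.AtPrime q.asIdeal) x.1 = 0 :=
    ((mem_nilradical.mp x.2).map _).eq_zero
  obtain ⟨s, hs⟩ := (IsLocalization.map_eq_zero_iff q.asIdeal.primeCompl _ _).mp h0
  exact hx s s.2 (Subtype.ext hs)

variable [IsNoetherianRing R]

/-- For q not maximal choose `t` in the maximal ideal outside q and outside all minimal primes. Then
the normalization sits inside R_t, so a power of `t` brings each of its elements back into `R`, and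
that power is not in q. -/
lemma support_normCoker_of_puncturedNormal (hPN : PuncturedNormal R)
    (hmin : maximalIdeal R ∉ minimalPrimes R) :
    ∀ q ∈ Module.support R (NormCoker R), q.asIdeal = maximalIdeal R := by
  intro q hq
  by_contra hne
  obtain ⟨t, htm, ht⟩ := exists_mem_maximalIdeal_avoiding (insert q.asIdeal (minimalPrimes R))
    ((minimalPrimes.finite_of_isNoetherianRing R).insert _) (by
      rintro P (rfl | hP)
      · exact ⟨q.2, hne⟩
      · exact ⟨hP.1.1, fun h => hmin (h ▸ hP)⟩)
  let T := Localization.Away t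
  have := isReduced_away hPN htm T
  obtain ⟨e⟩ := nonempty_normRing_equiv_integralClosure_away (T := T) t
    (fun P hP => ht P (Or.inr hP)) (fun P _ => isNormalDomain_atPrime_away hPN htm T P)
  obtain ⟨x, hx⟩ := Module.mem_support_iff'.mp hq
  obtain ⟨y, rfl⟩ := Submodule.mkQ_surjective _ x
  obtain ⟨y, rfl⟩ := e.surjective y
  obtain ⟨n, r, hr⟩ := IsLocalization.Away.surj t y.1
  have hq' := q.2
  refine hx (t ^ n) (fun hmem => ht q.asIdeal (Or.inl rfl) (hq'.mem_of_pow_mem _ hmem)) ?_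
  rw [← map_smul, Submodule.mkQ_apply, Submodule.Quotient.mk_eq_zero]
  refine ⟨r, ?_⟩
  rw [Algebra.linearMap_apply, ← map_smul]
  have : t ^ n • y = algebraMap R _ r := by
    apply Subtype.ext
    change t ^ n • y.1 = algebraMap R T r
    rw [← hr, Algebra.smul_def, map_pow, mul_comm]
  rw [this, e.commutes]

/-- No minimal prime contains a power of the maximal ideal, so an element killed by such a power
lies in all minimal primes. Conversely the nilradical is supported at the closed point, so a power
of the maximal ideal annihilates it. This turns ε into a length of nilpotents. -/
lemma H0m_eq_nilradical (hPN : PuncturedNormal R) (hmin : maximalIdeal R ∉ minimalPrimes R) :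
    H0m R = nilradical R := by
  apply le_antisymm
  · rintro x ⟨k, hk⟩
    rw [mem_nilradical, isNilpotent_iff_forall_minimalPrimes]
    intro P hP
    have hPp : P.IsPrime := hP.1.1
    have hnle : ¬ maximalIdeal R ^ k ≤ P := fun hle => by
      have := hPp.le_of_pow_le hle
      exact hmin (le_antisymm this (le_maximalIdeal hPp.ne_top) ▸ hP)
    obtain ⟨a, ha, haP⟩ := Set.not_subset.mp hnle
    exact (hPp.mem_or_mem (x := a) (y := x) (by rw [hk a ha]; exact P.zero_mem)).resolve_left haP
  · intro x hx
    have hrad : maximalIdeal R ≤ (Module.annihilator R (nilradical R)).radical := by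
      rw [Ideal.radical_eq_sInf]
      refine le_sInf ?_
      rintro q ⟨hq, hqp⟩
      have : (⟨q, hqp⟩ : PrimeSpectrum R) ∈ Module.support R (nilradical R) := by
        rw [Module.support_eq_zeroLocus]; exact hq
      rw [← support_nilradical_of_puncturedNormal hPN _ this]
    obtain ⟨k, hk⟩ := Ideal.exists_pow_le_of_le_radical_of_fg hrad
      (IsNoetherian.noetherian (maximalIdeal R))
    refine ⟨k, fun a ha => ?_⟩
    exact congrArg Subtype.val (Module.mem_annihilator.mp (hk ha) ⟨x, hx⟩)

lemma isFiniteLength_nilradical (hPN : PuncturedNormal R) : IsFiniteLength R (nilradical R) :=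
  isFiniteLength_of_support (support_nilradical_of_puncturedNormal hPN)

lemma isFiniteLength_normCoker (hPN : PuncturedNormal R)
    (hmin : maximalIdeal R ∉ minimalPrimes R) [Module.Finite R (NormRing R)] :
    IsFiniteLength R (NormCoker R) :=
  isFiniteLength_of_support (support_normCoker_of_puncturedNormal hPN hmin)

end Support

/-! ### Localization of cokernels of algebra structure maps and of nilradicals. -/

section LocalizedCokernel

variable {G G' : Type u} [CommRing G] [CommRing G'] [Algebra G G'] (S : Submonoid G)
  [IsLocalization S G']

lemma isUnit_end_of_isLocalization {W : Type*} [AddCommGroup W] [Module G W] [Module G' W]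
    [IsScalarTower G G' W] (s : S) : IsUnit (algebraMap G (Module.End G W) s) := by
  obtain ⟨u, hu⟩ := IsLocalization.map_units G' s
  refine (Module.End.isUnit_iff _).mpr ⟨fun v w h => ?_, fun w => ⟨(↑u⁻¹ : G') • w, ?_⟩⟩
  · have h' : (s : G) • v = (s : G) • w := h
    rw [← algebraMap_smul G' (s : G) v, ← algebraMap_smul G' (s : G) w, ← hu] at h'
    have := congrArg (fun z => (↑u⁻¹ : G') • z) h'
    simpa [smul_smul] using this
  · change (s : G) • ((↑u⁻¹ : G') • w) = w
    rw [← algebraMap_smul G' (s : G), ← hu, smul_smul, Units.mul_inv, one_smul]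

/-- The cokernel of the structure map of an algebra commutes with localization. -/
lemma exists_isLocalizedModule_coker {H H' : Type*} [CommRing H] [CommRing H'] [Algebra G H]
    [Algebra G' H'] [Algebra G H'] [Algebra H H'] [IsScalarTower G H H'] [IsScalarTower G G' H']
    [IsLocalization (Algebra.algebraMapSubmonoid H S) H'] :
    ∃ f : (H ⧸ LinearMap.range (Algebra.linearMap G H)) →ₗ[G]
      (H' ⧸ LinearMap.range (Algebra.linearMap G' H')), IsLocalizedModule S f ∧
      ∀ h : H, f (Submodule.Quotient.mk h) = Submodule.Quotient.mk (algebraMap H H' h) := by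
  let j : H →ₗ[G] H' := (IsScalarTower.toAlgHom G H H').toLinearMap
  let qm : H' →ₗ[G] (H' ⧸ LinearMap.range (Algebra.linearMap G' H')) :=
    (LinearMap.range (Algebra.linearMap G' H')).mkQ.restrictScalars G
  let f : (H ⧸ LinearMap.range (Algebra.linearMap G H)) →ₗ[G]
      (H' ⧸ LinearMap.range (Algebra.linearMap G' H')) :=
    (LinearMap.range (Algebra.linearMap G H)).liftQ (qm ∘ₗ j) (by
      rintro _ ⟨g, rfl⟩
      simp only [LinearMap.mem_ker, LinearMap.comp_apply]
      change Submodule.Quotient.mk (algebraMap H H' (algebraMap G H g)) = _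
      rw [Submodule.Quotient.mk_eq_zero]
      exact ⟨algebraMap G G' g, by
        rw [Algebra.linearMap_apply, ← IsScalarTower.algebraMap_apply,
          ← IsScalarTower.algebraMap_apply]⟩)
  have hf : ∀ h : H, f (Submodule.Quotient.mk h) = Submodule.Quotient.mk (algebraMap H H' h) :=
    fun h => rfl
  refine ⟨f, ⟨fun s => isUnit_end_of_isLocalization (G' := G') S s, fun y => ?_, ?_⟩, hf⟩
  · obtain ⟨y, rfl⟩ := Submodule.Quotient.mk_surjective _ y
    obtain ⟨⟨x, _, s, hs, rfl⟩, h⟩ := IsLocalization.surj (Algebra.algebraMapSubmonoid H S) y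
    refine ⟨(Submodule.Quotient.mk x, ⟨s, hs⟩), ?_⟩
    rw [hf]
    change (s : G) • (qm y) = qm (algebraMap H H' x)
    rw [← map_smul]
    congr 1
    rw [← h, Algebra.smul_def, IsScalarTower.algebraMap_apply G H H', mul_comm]
  · intro x y hxy
    obtain ⟨x, rfl⟩ := Submodule.Quotient.mk_surjective _ x
    obtain ⟨y, rfl⟩ := Submodule.Quotient.mk_surjective _ y
    rw [hf, hf, Submodule.Quotient.eq, ← map_sub] at hxy
    obtain ⟨g', hg'⟩ := hxy
    obtain ⟨⟨g, s⟩, hgs⟩ := IsLocalization.surj S g'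
    have h1 : algebraMap H H' (algebraMap G H s * (x - y)) =
        algebraMap H H' (algebraMap G H g) := by
      rw [map_mul, ← hg', ← IsScalarTower.algebraMap_apply, ← IsScalarTower.algebraMap_apply,
        IsScalarTower.algebraMap_apply G G' H', IsScalarTower.algebraMap_apply G G' H', ← hgs,
        map_mul, Algebra.linearMap_apply, mul_comm]
    obtain ⟨⟨_, c, hc, rfl⟩, hc'⟩ :=
      (IsLocalization.eq_iff_exists (Algebra.algebraMapSubmonoid H S) _).mp h1
    refine ⟨⟨c, hc⟩ * s, ?_⟩
    change (c * (s : G)) • (Submodule.Quotient.mk x : H ⧸ LinearMap.range (Algebra.linearMap G H)) =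
      (c * (s : G)) • (Submodule.Quotient.mk y : H ⧸ LinearMap.range (Algebra.linearMap G H))
    rw [← Submodule.Quotient.mk_smul, ← Submodule.Quotient.mk_smul, Submodule.Quotient.eq,
      ← smul_sub]
    refine ⟨c * g, ?_⟩
    rw [Algebra.linearMap_apply, map_mul, Algebra.smul_def, map_mul, mul_assoc]
    exact hc'.symm

/-- An isomorphism of algebras induces an isomorphism of the cokernels of the structure maps. -/
lemma nonempty_coker_equiv {G H K : Type*} [CommRing G] [CommRing H] [CommRing K] [Algebra G H]
    [Algebra G K] (e : H ≃ₐ[G] K) :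
    Nonempty ((H ⧸ LinearMap.range (Algebra.linearMap G H)) ≃ₗ[G]
      (K ⧸ LinearMap.range (Algebra.linearMap G K))) := by
  refine ⟨Submodule.Quotient.equiv _ _ e.toLinearEquiv ?_⟩
  ext x
  simp only [Submodule.mem_map, LinearMap.mem_range, Algebra.linearMap_apply]
  constructor
  · rintro ⟨_, ⟨g, rfl⟩, rfl⟩
    exact ⟨g, (e.commutes g).symm⟩
  · rintro ⟨g, rfl⟩
    exact ⟨_, ⟨g, rfl⟩, e.commutes g⟩

/-- The cokernel of the normalization map commutes with localization. -/
lemma exists_isLocalizedModule_normCoker [IsNoetherianRing G] :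
    ∃ f : NormCoker G →ₗ[G] NormCoker G', IsLocalizedModule S f := by
  let H := NormRing G
  let H' := Localization (Algebra.algebraMapSubmonoid H S)
  let _ : Algebra G' H' := localizationAlgebra S H
  have : IsScalarTower G G' H' := isScalarTower_localizationAlgebra S H
  obtain ⟨e⟩ := nonempty_normRing_equiv_of_isLocalization (G := G) S (G' := G') (H := H) (H' := H')
    ⟨AlgEquiv.refl⟩
  obtain ⟨f, hf, -⟩ := exists_isLocalizedModule_coker (G := G) (G' := G') S (H := H) (H' := H')
  obtain ⟨e'⟩ := nonempty_coker_equiv (G := G') (H := H') (K := NormRing G') e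
  exact ⟨(e'.restrictScalars G).toLinearMap ∘ₗ f, inferInstance⟩

lemma exists_isLocalizedModule_nilradical :
    ∃ f : nilradical G →ₗ[G] nilradical G', IsLocalizedModule S f := by
  let f : nilradical G →ₗ[G] nilradical G' :=
    LinearMap.codRestrict ((nilradical G').restrictScalars G)
      ((Algebra.linearMap G G') ∘ₗ (nilradical G).subtype)
      (fun x => (mem_nilradical.mp x.2).map (algebraMap G G'))
  have hf : ∀ x, (f x).1 = algebraMap G G' x.1 := fun x => rfl
  refine ⟨f, ⟨fun s => isUnit_end_of_isLocalization (G' := G') S s, fun y => ?_, ?_⟩⟩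
  · obtain ⟨⟨x, s⟩, h⟩ := IsLocalization.surj S y.1
    have hx : IsNilpotent (algebraMap G G' x) := by
      rw [← h]
      exact (Commute.all _ _).isNilpotent_mul_right (mem_nilradical.mp y.2)
    obtain ⟨n, hn⟩ := hx
    rw [← map_pow] at hn
    obtain ⟨c, hc⟩ := (IsLocalization.map_eq_zero_iff S G' _).mp hn
    -- The exponent `n + 1` guarantees a factor `c` next to xⁿ even for `n = 0`.
    have hcx : IsNilpotent ((c : G) * x) :=
      ⟨n + 1, by rw [mul_pow, pow_succ x, ← mul_assoc, pow_succ (c : G), mul_assoc _ (c : G) (x ^ n),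
        hc, mul_zero, zero_mul]⟩
    refine ⟨(⟨c * x, mem_nilradical.mpr hcx⟩, c * s), ?_⟩
    apply Subtype.ext
    rw [hf]
    change ((c : G) * (s : G)) • y.1 = algebraMap G G' (c * x)
    rw [Algebra.smul_def, map_mul, map_mul, ← h]; ring
  · intro x y hxy
    have h1 : algebraMap G G' x.1 = algebraMap G G' y.1 := congrArg Subtype.val hxy
    obtain ⟨c, hc⟩ := (IsLocalization.eq_iff_exists S G').mp h1
    exact ⟨c, Subtype.ext hc⟩

end LocalizedCokernel

end LocalAlgebra

end DeltaFamily
end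

/-! ### Finite modifications of local rings and their Euler characteristic. -/

noncomputable section
namespace DeltaFamily

section Modification

open nonZeroDivisors IsLocalRing

/-- Each simple subquotient is a residue field, which `t` kills, so every step of a composition
series costs one power of `t`. -/
lemma exists_pow_smul_eq_zero {R V : Type*} [CommRing R] [IsLocalRing R] [AddCommGroup V]
    [Module R V] (h : IsFiniteLength R V) {t : R} (ht : t ∈ maximalIdeal R) (x : V) :
    ∃ n : ℕ, t ^ n • x = 0 := by
  induction h with
  | of_subsingleton => exact ⟨0, Subsingleton.elim _ _⟩
  | @of_simple_quotient V _ _ N hs _ ih =>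
    have hx : t • x ∈ N := by
      obtain ⟨I, hI, ⟨e⟩⟩ := isSimpleModule_iff_quot_maximal.mp hs
      rw [← Submodule.Quotient.mk_eq_zero, ← map_eq_zero_iff e e.injective,
        Submodule.Quotient.mk_smul, map_smul]
      obtain ⟨y, hy⟩ := Submodule.Quotient.mk_surjective _ (e (Submodule.Quotient.mk x))
      rw [← hy, ← Submodule.Quotient.mk_smul, Submodule.Quotient.mk_eq_zero, smul_eq_mul]
      rw [eq_maximalIdeal hI]
      exact Ideal.mul_mem_right _ _ ht
    obtain ⟨n, hn⟩ := ih ⟨t • x, hx⟩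
    refine ⟨n + 1, ?_⟩
    have := congrArg Subtype.val hn
    rw [pow_succ, mul_smul]
    exact this

lemma finrank_eq_toNat_length (k V : Type*) [Field k] [AddCommGroup V] [Module k V] :
    Module.finrank k V = (Module.length k V).toNat := by
  rw [Module.length_eq_rank]
  rfl

lemma isFiniteLength_of_tower {R B V : Type*} [CommRing R] [CommRing B] [AddCommGroup V]
    [Algebra R B] [Module R V] [Module B V] [IsScalarTower R B V] (h : IsFiniteLength R V) :
    IsFiniteLength B V := by
  obtain ⟨h1, h2⟩ := isFiniteLength_iff_isNoetherian_isArtinian.mp h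
  exact isFiniteLength_iff_isNoetherian_isArtinian.mpr
    ⟨isNoetherian_of_tower R h1, isArtinian_of_tower R h2⟩

lemma finite_of_length_ne_top {k V : Type*} [CommRing k] [AddCommGroup V] [Module k V]
    (h : Module.length k V ≠ ⊤) : Module.Finite k V := by
  have := (isFiniteLength_iff_isNoetherian_isArtinian.mp (Module.length_ne_top_iff.mp h)).1
  infer_instance

/-- Primes of `W` are the primes of `B` inside `n`, so minimality of `n` is visible in the local
ring. With the converse below, the absence of isolated points can be moved between a semilocal ring
and its local rings. -/
lemma maximalIdeal_notMem_minimalPrimes_of_isLocalization {B W : Type*} [CommRing B]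
    [CommRing W] [IsLocalRing W] [Algebra B W] (n : Ideal B) [n.IsPrime]
    [IsLocalization.AtPrime W n] (h : n ∉ minimalPrimes B) :
    maximalIdeal W ∉ minimalPrimes W := by
  intro hmin
  refine h ⟨⟨inferInstance, bot_le⟩, fun p hp hpn => ?_⟩
  have hpp : p.IsPrime := hp.1
  have hdis : Disjoint (n.primeCompl : Set B) p :=
    Set.disjoint_left.mpr fun x hx hxp => hx (hpn hxp)
  have h1 := IsLocalization.isPrime_of_isPrime_disjoint n.primeCompl W p hpp hdis
  have h2 : maximalIdeal W ≤ p.map (algebraMap B W) :=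
    hmin.2 ⟨h1, bot_le⟩ (le_maximalIdeal h1.ne_top)
  have h3 : Ideal.under B (maximalIdeal W) ≤ Ideal.under B (p.map (algebraMap B W)) :=
    Ideal.comap_mono (f := algebraMap B W) h2
  rwa [IsLocalization.under_map_of_isPrime_disjoint n.primeCompl W hpp hdis,
    IsLocalization.AtPrime.under_maximalIdeal W n] at h3

lemma notMem_minimalPrimes_of_isLocalization {B W : Type*} [CommRing B]
    [CommRing W] [IsLocalRing W] [Algebra B W] (n : Ideal B) [n.IsPrime]
    [IsLocalization.AtPrime W n] (h : maximalIdeal W ∉ minimalPrimes W) :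
    n ∉ minimalPrimes B := by
  intro hmin
  refine h ⟨⟨inferInstance, bot_le⟩, fun p hp hpn => ?_⟩
  have hpp : p.IsPrime := hp.1
  have h1 : n ≤ p.comap (algebraMap B W) := hmin.2 ⟨hpp.comap _, bot_le⟩ (by
    rw [← IsLocalization.AtPrime.under_maximalIdeal W n]
    exact Ideal.comap_mono hpn)
  rw [← IsLocalization.AtPrime.map_eq_maximalIdeal n W]
  exact Ideal.map_le_iff_le_comap.mpr h1

variable {R R' : Type u} [CommRing R] [IsLocalRing R] [CommRing R'] [Algebra R R']

/-- Powers of `t` kill the elements of the kernel and of the cokernel, so R → R' becomes an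
isomorphism after `t` is inverted. -/
lemma isLocalization_away_of_isFiniteLength
    (hker : IsFiniteLength R (LinearMap.ker (Algebra.linearMap R R')))
    (hcoker : IsFiniteLength R (R' ⧸ LinearMap.range (Algebra.linearMap R R')))
    {t : R} (ht : t ∈ maximalIdeal R) (T : Type*) [CommRing T] [Algebra R' T] [Algebra R T]
    [IsScalarTower R R' T] [IsLocalization.Away (algebraMap R R' t) T] :
    IsLocalization.Away t T := by
  refine ⟨?_, ?_, ?_⟩
  · rintro ⟨_, n, rfl⟩
    rw [IsScalarTower.algebraMap_apply R R' T]
    simp only [map_pow]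
    exact (IsLocalization.Away.algebraMap_isUnit (algebraMap R R' t)).pow n
  · intro y
    obtain ⟨n, r', hr⟩ := IsLocalization.Away.surj (algebraMap R R' t) y
    obtain ⟨m, hm⟩ := exists_pow_smul_eq_zero hcoker ht (Submodule.Quotient.mk r')
    rw [← Submodule.Quotient.mk_smul, Submodule.Quotient.mk_eq_zero] at hm
    obtain ⟨r, hr'⟩ := hm
    refine ⟨(r, ⟨t ^ (n + m), n + m, rfl⟩), ?_⟩
    have h1 := congrArg (algebraMap R' T) hr'
    rw [Algebra.linearMap_apply, Algebra.smul_def, map_mul, ← hr] at h1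
    simp only
    rw [IsScalarTower.algebraMap_apply R R' T, IsScalarTower.algebraMap_apply R R' T, h1]
    simp only [map_pow]
    ring
  · intro a b hab
    rw [IsScalarTower.algebraMap_apply R R' T, IsScalarTower.algebraMap_apply R R' T] at hab
    obtain ⟨⟨_, n, rfl⟩, hn⟩ := (IsLocalization.eq_iff_exists (Submonoid.powers
      (algebraMap R R' t)) T).mp hab
    have hk : t ^ n * (a - b) ∈ LinearMap.ker (Algebra.linearMap R R') := by
      rw [LinearMap.mem_ker, Algebra.linearMap_apply, map_mul, map_sub, map_pow, mul_sub, sub_eq_zero]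
      exact hn
    obtain ⟨m, hm⟩ := exists_pow_smul_eq_zero hker ht ⟨_, hk⟩
    refine ⟨⟨t ^ (m + n), m + n, rfl⟩, ?_⟩
    have := congrArg Subtype.val hm
    simp only [SetLike.mk_smul_mk, smul_eq_mul, ZeroMemClass.coe_zero] at this
    change t ^ (m + n) * a = t ^ (m + n) * b
    rw [← sub_eq_zero, ← mul_sub, pow_add, mul_assoc]
    exact this

variable [Module.Finite R R'] (hPN : PuncturedNormal R)
  (hker : IsFiniteLength R (LinearMap.ker (Algebra.linearMap R R')))
  (hcoker : IsFiniteLength R (R' ⧸ LinearMap.range (Algebra.linearMap R R')))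

omit [IsLocalRing R] in
lemma comap_isMaximal_iff [IsLocalRing R] (q : Ideal R') [q.IsPrime] :
    q.comap (algebraMap R R') = maximalIdeal R ↔ q.IsMaximal := by
  have : Algebra.IsIntegral R R' := Algebra.IsIntegral.of_finite R R'
  constructor
  · intro h
    exact Ideal.isMaximal_of_isIntegral_of_isMaximal_comap (R := R) q
      (h ▸ maximalIdeal.isMaximal R)
  · intro h
    exact eq_maximalIdeal (Ideal.isMaximal_comap_of_isIntegral_of_isMaximal (R := R) q)

include hPN hker hcoker in
-- By integrality a nonmaximal prime contracts to a nonmaximal prime, hence misses some `t` in the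
-- maximal ideal; away from `t` the two rings agree.
lemma isNormalDomain_atPrime_of_modification (q : Ideal R') [q.IsPrime] (hq : ¬ q.IsMaximal) :
    IsNormalDomain (Localization.AtPrime q) := by
  have hne : q.comap (algebraMap R R') ≠ maximalIdeal R := fun h =>
    hq ((comap_isMaximal_iff q).mp h)
  obtain ⟨t, ht, htq⟩ := Set.not_subset.mp fun h : ((maximalIdeal R : Ideal R) : Set R) ⊆
    q.comap (algebraMap R R') => hne (le_antisymm (le_maximalIdeal (Ideal.IsPrime.ne_top
      (Ideal.IsPrime.comap _))) h)
  let T := Localization.Away (algebraMap R R' t)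
  have := isLocalization_away_of_isFiniteLength hker hcoker ht T
  have hdis : Disjoint (Submonoid.powers (algebraMap R R' t) : Set R') q := by
    refine Set.disjoint_left.mpr ?_
    rintro _ ⟨n, rfl⟩ hx
    exact htq ((inferInstance : q.IsPrime).mem_of_pow_mem n hx)
  let P := q.map (algebraMap R' T)
  have hP : P.IsPrime := IsLocalization.isPrime_of_isPrime_disjoint
    (Submonoid.powers (algebraMap R R' t)) T q inferInstance hdis
  have hPq : P.comap (algebraMap R' T) = q := IsLocalization.under_map_of_isPrime_disjoint
    (Submonoid.powers (algebraMap R R' t)) T inferInstance hdis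
  have h1 := isNormalDomain_atPrime_away hPN ht T P
  have := IsLocalization.isLocalization_isLocalization_atPrime_isLocalization
    (Submonoid.powers (algebraMap R R' t)) (Localization.AtPrime P) P
  exact isNormalDomain_atPrime_congr hPq (isNormalDomain_of_isLocalization_atPrime
    (q := P.comap (algebraMap R' T)) h1)

include hPN hker hcoker in
lemma puncturedNormal_of_modification (n : Ideal R') [n.IsMaximal] {W : Type*} [CommRing W]
    [IsLocalRing W] [Algebra R' W] [IsLocalization.AtPrime W n] : PuncturedNormal W := by
  intro Q _ hQ
  have hq : ¬ (Q.comap (algebraMap R' W)).IsMaximal := by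
    intro hmax
    have hle : Q.comap (algebraMap R' W) ≤ n := by
      rw [← IsLocalization.AtPrime.under_maximalIdeal W n]
      exact Ideal.comap_mono (le_maximalIdeal (Ideal.IsPrime.ne_top inferInstance))
    have heq := hmax.eq_of_le (Ideal.IsPrime.ne_top inferInstance) hle
    apply hQ
    rw [← IsLocalization.AtPrime.map_eq_maximalIdeal n W, ← heq,
      IsLocalization.map_under n.primeCompl]
  exact isNormalDomain_atPrime_of_isLocalization n.primeCompl Q
    (isNormalDomain_atPrime_of_modification hPN hker hcoker _ hq)

lemma ker_linearMap_normRing (G : Type u) [CommRing G] :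
    LinearMap.ker (Algebra.linearMap G (NormRing G)) = nilradical G := by
  ext x
  have hinj : Function.Injective (algebraMap (G ⧸ nilradical G) (FractionRing (G ⧸ nilradical G))) :=
    IsLocalization.injective _ le_rfl
  rw [LinearMap.mem_ker, Algebra.linearMap_apply, ← Ideal.Quotient.eq_zero_iff_mem,
    ← map_eq_zero_iff _ hinj, ← Subalgebra.coe_eq_zero]
  rfl

/-- A finite modification of a local ring with normal punctured spectrum changes the difference of
the lengths of the cokernel of the normalization map and of the nilradical by the Euler
characteristic of the modification. -/
lemma length_modification [IsNoetherianRing R] (hPN : PuncturedNormal R)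
    (hker : IsFiniteLength R (LinearMap.ker (Algebra.linearMap R R')))
    (hcoker : IsFiniteLength R (R' ⧸ LinearMap.range (Algebra.linearMap R R')))
    (hmin : maximalIdeal R ∉ minimalPrimes R)
    (hmax : ∀ n : Ideal R', n.IsMaximal → n ∉ minimalPrimes R') :
    Module.length R (nilradical R) +
      Module.length R (R' ⧸ LinearMap.range (Algebra.linearMap R R')) +
      Module.length R (NormCoker R') =
    Module.length R (LinearMap.ker (Algebra.linearMap R R')) +
      Module.length R (nilradical R') + Module.length R (NormCoker R) := by
  have hNoeth : IsNoetherianRing R' := IsNoetherianRing.of_finite R R'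
  -- One `t` has to serve both rings: it avoids the minimal primes of `R` and the contractions of
  -- those of `R'`, so that both normalizations are integral closures in the same ring `T`.
  obtain ⟨t, ht, hav⟩ := exists_mem_maximalIdeal_avoiding
    (minimalPrimes R ∪ (Ideal.comap (algebraMap R R')) '' minimalPrimes R')
    ((minimalPrimes.finite_of_isNoetherianRing R).union
      ((minimalPrimes.finite_of_isNoetherianRing R').image _)) (by
      rintro P (hP | ⟨Q, hQ, rfl⟩)
      · exact ⟨hP.1.1, fun h => hmin (h ▸ hP)⟩
      · have := hQ.1.1
        exact ⟨inferInstance, fun h => hmax Q ((comap_isMaximal_iff Q).mp h) hQ⟩)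
  let T := Localization.Away (algebraMap R R' t)
  have hT := isLocalization_away_of_isFiniteLength hker hcoker ht T
  have := isReduced_away hPN ht T
  have hTn : ∀ (P : Ideal T) [P.IsMaximal], IsNormalDomain (Localization.AtPrime P) :=
    fun P _ => isNormalDomain_atPrime_away hPN ht T P
  obtain ⟨e⟩ := nonempty_normRing_equiv_integralClosure_away (T := T) t
    (fun P hP => hav P (Or.inl hP)) hTn
  obtain ⟨e'⟩ := nonempty_normRing_equiv_integralClosure_away (R := R') (T := T)
    (algebraMap R R' t) (fun P hP h => hav _ (Or.inr ⟨P, hP, rfl⟩) h) hTn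
  have hint : Algebra.IsIntegral R R' := Algebra.IsIntegral.of_finite R R'
  -- As `R'` is integral over `R`, both have the same integral closure in `T`, so `R` and `R'` share
  -- their normalization.
  let j₀ : integralClosure R T ≃ₐ[R] integralClosure R' T :=
    { toFun := fun x => ⟨x.1, IsIntegral.tower_top x.2⟩
      invFun := fun x => ⟨x.1, isIntegral_trans (R := R) (A := R') _ x.2⟩
      left_inv := fun _ => rfl
      right_inv := fun _ => rfl
      map_mul' := fun _ _ => rfl
      map_add' := fun _ _ => rfl
      commutes' := fun r => Subtype.ext (IsScalarTower.algebraMap_apply R R' T r) }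
  let j : integralClosure R T ≃ₐ[R] NormRing R' := j₀.trans (e'.restrictScalars R)
  let E : NormRing R ≃ₐ[R] NormRing R' := e.symm.trans j
  -- The composite R → R' → (normalization of R') is the normalization map of `R`; the six-term
  -- sequence of this composition is the claimed identity.
  let f : R →ₗ[R] R' := Algebra.linearMap R R'
  let g : R' →ₗ[R] NormRing R' := (Algebra.linearMap R' (NormRing R')).restrictScalars R
  have key := length_ker_coker_comp f g
  have hgf : g ∘ₗ f = E.toLinearMap ∘ₗ Algebra.linearMap R (NormRing R) := by
    ext
    simp only [LinearMap.comp_apply, f, g, Algebra.linearMap_apply, map_one,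
      LinearMap.restrictScalars_apply, AlgEquiv.toLinearMap_apply]
  have h1 : LinearMap.ker (g ∘ₗ f) = nilradical R := by
    rw [hgf, LinearMap.ker_comp_of_ker_eq_bot _ (LinearMap.ker_eq_bot.mpr E.injective),
      ker_linearMap_normRing]
  have h2 : LinearMap.ker g = (nilradical R').restrictScalars R :=
    congrArg (Submodule.restrictScalars R) (ker_linearMap_normRing R')
  obtain ⟨E'⟩ := nonempty_coker_equiv (G := R) (H := NormRing R) (K := NormRing R') E
  have h3 : LinearMap.range (g ∘ₗ f) = LinearMap.range (Algebra.linearMap R (NormRing R')) := by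
    congr 1
  rw [h1, h2, h3, ← E'.length_eq] at key
  exact key

lemma toNat_add_add_eq {a b c d e f : ℕ∞} (h : a + b + c = d + e + f) (ha : a ≠ ⊤) (hb : b ≠ ⊤)
    (hc : c ≠ ⊤) (hd : d ≠ ⊤) (he : e ≠ ⊤) (hf : f ≠ ⊤) :
    (a.toNat : ℤ) + b.toNat + c.toNat = d.toNat + e.toNat + f.toNat := by
  lift a to ℕ using ha
  lift b to ℕ using hb
  lift c to ℕ using hc
  lift d to ℕ using hd
  lift e to ℕ using he
  lift f to ℕ using hf
  simp only [ENat.toNat_natCast]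
  exact_mod_cast h

/-- Away from any `t` in the maximal ideal, `R'` agrees with the reduced ring R_t, so nilpotents of
`R'` are killed by powers of `t`. -/
lemma isFiniteLength_nilradical_of_modification [IsNoetherianRing R] (hPN : PuncturedNormal R)
    (hker : IsFiniteLength R (LinearMap.ker (Algebra.linearMap R R')))
    (hcoker : IsFiniteLength R (R' ⧸ LinearMap.range (Algebra.linearMap R R'))) :
    IsFiniteLength R (nilradical R') := by
  have : Module.Finite R ((nilradical R').restrictScalars R) := inferInstance
  have h : IsFiniteLength R ((nilradical R').restrictScalars R) := by
    refine isFiniteLength_of_support fun q hq => ?_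
    by_contra hne
    obtain ⟨t, ht, htq⟩ := Set.not_subset.mp fun h : ((maximalIdeal R : Ideal R) : Set R) ⊆
      q.asIdeal => hne (le_antisymm (le_maximalIdeal q.2.ne_top) h)
    let T := Localization.Away (algebraMap R R' t)
    have := isLocalization_away_of_isFiniteLength hker hcoker ht T
    have hred := isReduced_away hPN ht T
    obtain ⟨y, hy⟩ := Module.mem_support_iff'.mp hq
    have h0 : algebraMap R' T y.1 = 0 := ((mem_nilradical.mp y.2).map _).eq_zero
    obtain ⟨⟨_, n, rfl⟩, hn⟩ := (IsLocalization.map_eq_zero_iff (Submonoid.powers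
      (algebraMap R R' t)) T _).mp h0
    refine hy (t ^ n) (fun h => htq (q.2.mem_of_pow_mem n h)) (Subtype.ext ?_)
    change t ^ n • y.1 = 0
    rw [Algebra.smul_def, map_pow]
    exact hn
  exact h

section Invariants

variable [IsNoetherianRing R] {k : Type u} [Field k] [Algebra k R] [Algebra k R']
  [IsScalarTower k R R'] [Module.Finite R (NormRing R)]
  {κ : Type*} [AddCommGroup κ] [Module R κ] [Module k κ] [IsScalarTower k R κ]
  [Module.Finite k κ]

/-- The local invariants of a finite modification of a local ring with normal punctured
spectrum. -/
lemma invariants_modification (hPN : PuncturedNormal R)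
    (hker : IsFiniteLength R (LinearMap.ker (Algebra.linearMap R R')))
    (hcoker : IsFiniteLength R (R' ⧸ LinearMap.range (Algebra.linearMap R R')))
    (hmin : maximalIdeal R ∉ minimalPrimes R)
    (hmax : ∀ n : Ideal R', n.IsMaximal → n ∉ minimalPrimes R')
    (eκ : κ ≃ₗ[R] R ⧸ maximalIdeal R)
    {ι : Type*} [Fintype ι] (n : ι → Ideal R') [∀ i, (n i).IsMaximal]
    (hinj : Function.Injective n) (hsurj : ∀ I : Ideal R', I.IsMaximal → I ∈ Set.range n)
    (W : ι → Type u) [∀ i, CommRing (W i)] [∀ i, IsLocalRing (W i)] [∀ i, Algebra R' (W i)]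
    [∀ i, Algebra k (W i)] [∀ i, IsScalarTower k R' (W i)]
    [∀ i, IsLocalization.AtPrime (W i) (n i)] :
    (∀ i, LocalFinite k (W i)) ∧
    (∑ i, localEpsilon k (W i) =
      ((Module.length R (nilradical R')).toNat * Module.finrank k κ : ℕ)) ∧
    (∑ i, localDelta k (W i) =
      (Module.finrank k κ : ℤ) * ((Module.length R (NormCoker R)).toNat -
        (Module.length R (nilradical R)).toNat -
        ((Module.length R (R' ⧸ LinearMap.range (Algebra.linearMap R R'))).toNat -
          (Module.length R (LinearMap.ker (Algebra.linearMap R R'))).toNat))) := by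
  have hNoeth : IsNoetherianRing R' := IsNoetherianRing.of_finite R R'
  have hW : ∀ i, IsNoetherianRing (W i) := fun i =>
    IsLocalization.isNoetherianRing (n i).primeCompl (W i) hNoeth
  have key := length_modification hPN hker hcoker hmin hmax
  have l1 := Module.length_ne_top_iff.mpr hker
  have l2 := Module.length_ne_top_iff.mpr hcoker
  have l3 := Module.length_ne_top_iff.mpr (isFiniteLength_nilradical hPN)
  have l4 := Module.length_ne_top_iff.mpr (isFiniteLength_normCoker hPN hmin)
  have hN' := isFiniteLength_nilradical_of_modification hPN hker hcoker
  have l5 := Module.length_ne_top_iff.mpr hN'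
  -- Only the normalization of `R` is assumed finite. The finiteness for `R'` is read off from
  -- `key`, whose other side is finite.
  have l6 : Module.length R (NormCoker R') ≠ ⊤ := by
    intro h
    rw [h, add_top] at key
    exact WithTop.add_ne_top.mpr ⟨WithTop.add_ne_top.mpr ⟨l1, l5⟩, l4⟩ key.symm
  have hC' := Module.length_ne_top_iff.mp l6
  have hPN' : ∀ i, PuncturedNormal (W i) := fun i =>
    puncturedNormal_of_modification hPN hker hcoker (n i)
  have hmin' : ∀ i, maximalIdeal (W i) ∉ minimalPrimes (W i) := fun i =>
    maximalIdeal_notMem_minimalPrimes_of_isLocalization (n i) (hmax _ inferInstance)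
  choose fN hfN using fun i => exists_isLocalizedModule_nilradical (G := R') (G' := W i)
    (n i).primeCompl
  choose fC hfC using fun i => exists_isLocalizedModule_normCoker (G := R') (G' := W i)
    (n i).primeCompl
  have sN := length_eq_sum_of_isLocalizedModule (k := k) n hinj (isFiniteLength_of_tower hN')
    (fun I hI _ => hsurj I hI) (fun i => nilradical (W i)) fN
  have sC := length_eq_sum_of_isLocalizedModule (k := k) n hinj (isFiniteLength_of_tower hC')
    (fun I hI _ => hsurj I hI) (fun i => NormCoker (W i)) fC
  have hd : Module.length k κ ≠ ⊤ := by
    rw [Module.length_ne_top_iff]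
    exact isFiniteLength_iff_isNoetherian_isArtinian.mpr ⟨inferInstance, inferInstance⟩
  -- `sN` and `sC` split a dimension over `k` into the contributions of the local rings `W i`; on
  -- the left it becomes a length over `R` times the degree of the residue field.
  rw [length_eq_length_mul_residue eκ hN'] at sN
  rw [length_eq_length_mul_residue eκ hC'] at sC
  have tN : ∀ i, Module.length k (nilradical (W i)) ≠ ⊤ := fun i h => by
    have := Finset.single_le_sum (f := fun i => Module.length k (nilradical (W i)))
      (fun _ _ => zero_le) (Finset.mem_univ i)
    rw [← sN, h, top_le_iff] at this
    exact WithTop.mul_ne_top l5 hd this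
  have tC : ∀ i, Module.length k (NormCoker (W i)) ≠ ⊤ := fun i h => by
    have := Finset.single_le_sum (f := fun i => Module.length k (NormCoker (W i)))
      (fun _ _ => zero_le) (Finset.mem_univ i)
    rw [← sC, h, top_le_iff] at this
    exact WithTop.mul_ne_top l6 hd this
  have hH : ∀ i, H0m (W i) = nilradical (W i) := fun i => H0m_eq_nilradical (hPN' i) (hmin' i)
  have eN : ∀ i, localEpsilon k (W i) = ((Module.length k (nilradical (W i))).toNat : ℤ) :=
    fun i => by rw [localEpsilon, hH, finrank_eq_toNat_length]
  have eC : ∀ i, (Module.finrank k (NormCoker (W i)) : ℤ) =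
      ((Module.length k (NormCoker (W i))).toNat : ℤ) :=
    fun i => by rw [finrank_eq_toNat_length]
  have sN' : ∑ i, (Module.length k (nilradical (W i))).toNat =
      (Module.length R (nilradical R')).toNat * Module.finrank k κ := by
    rw [finrank_eq_toNat_length, ← ENat.toNat_mul, sN, ENat.toNat_sum fun i _ => tN i]
  have sC' : ∑ i, (Module.length k (NormCoker (W i))).toNat =
      (Module.length R (NormCoker R')).toNat * Module.finrank k κ := by
    rw [finrank_eq_toNat_length, ← ENat.toNat_mul, sC, ENat.toNat_sum fun i _ => tC i]
  refine ⟨fun i => ⟨finite_of_length_ne_top (tC i), ?_⟩, ?_, ?_⟩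
  · rw [hH]; exact finite_of_length_ne_top (tN i)
  · rw [Finset.sum_congr rfl fun i _ => eN i, ← sN']
    push_cast; rfl
  · simp only [localDelta, eN, eC]
    rw [Finset.sum_sub_distrib, ← Nat.cast_sum, ← Nat.cast_sum, sN', sC']
    have key' := toNat_add_add_eq key l3 l2 l6 l1 l5 l4
    push_cast
    linear_combination (Module.finrank k κ : ℤ) * key'

end Invariants

end Modification

end DeltaFamily
end

/-! ### Nagata rings: localizations, quotients, finiteness of the normalization. -/

noncomputable section
namespace DeltaFamily

section Nagata

open nonZeroDivisors

lemma IsN2.finite_integralClosure {D : Type u} [CommRing D] [IsDomain D] (h : IsN2 D)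
    (L : Type u) [Field L] [Algebra D L] [IsFractionRing D L] :
    Module.Finite D (integralClosure D L) := by
  let e : FractionRing D ≃ₐ[D] L := FractionRing.algEquiv D L
  let _ : Algebra (FractionRing D) L := e.toRingEquiv.toRingHom.toAlgebra
  have : IsScalarTower D (FractionRing D) L :=
    IsScalarTower.of_algebraMap_eq fun x => (e.commutes x).symm
  have : FiniteDimensional (FractionRing D) L :=
    Module.Finite.of_surjective (Algebra.linearMap (FractionRing D) L) e.surjective
  exact h L

/-- `D` and `D'` have the same fraction field, hence the same finite extensions to test. Generators
of the integral closure of `D` also generate that of `D'`, after clearing denominators. -/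
lemma IsN2.of_isLocalization {D D' : Type u} [CommRing D] [IsDomain D] [CommRing D'] [IsDomain D']
    [Algebra D D'] (M : Submonoid D) [IsLocalization M D'] (h : IsN2 D) : IsN2 D' := by
  intro L _ _ _ _ _
  have hM : M ≤ D⁰ := le_nonZeroDivisors_of_noZeroDivisors fun h0 => by
    have := IsLocalization.map_units D' (⟨0, h0⟩ : M)
    simp at this
  let F' := FractionRing D'
  let F := FractionRing D
  let _ : Algebra D' F := (IsLocalization.lift (M := M) (S := D') (g := algebraMap D F)
    fun y => IsLocalization.map_units F (⟨y, hM y.2⟩ : D⁰)).toAlgebra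
  have : IsScalarTower D D' F := IsScalarTower.of_algebraMap_eq fun x =>
    (IsLocalization.lift_eq (M := M) (S := D') (g := algebraMap D F) _ x).symm
  have : IsFractionRing D' F := IsFractionRing.isFractionRing_of_isLocalization M D' F hM
  let _ : Algebra D L := ((algebraMap D' L).comp (algebraMap D D')).toAlgebra
  have : IsScalarTower D D' L := IsScalarTower.of_algebraMap_eq fun _ => rfl
  let e : F ≃ₐ[D'] F' := (FractionRing.algEquiv D' F).symm
  let _ : Algebra (FractionRing D) F' := e.toRingEquiv.toRingHom.toAlgebra
  have : FiniteDimensional (FractionRing D) F' :=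
    Module.Finite.of_surjective (Algebra.linearMap (FractionRing D) F') e.surjective
  let _ : Algebra (FractionRing D) L :=
    ((algebraMap F' L).comp (algebraMap (FractionRing D) F')).toAlgebra
  have : IsScalarTower (FractionRing D) F' L := IsScalarTower.of_algebraMap_eq fun _ => rfl
  have : FiniteDimensional (FractionRing D) L := Module.Finite.trans F' L
  have : IsScalarTower D (FractionRing D) L := IsScalarTower.of_algebraMap_eq fun x => by
    change algebraMap D' L (algebraMap D D' x) = algebraMap F' L (e (algebraMap D _ x))
    rw [IsScalarTower.algebraMap_apply D D' (FractionRing D), e.commutes]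
    exact IsScalarTower.algebraMap_apply D' F' L _
  obtain ⟨s, hs⟩ := (Submodule.fg_top (Subalgebra.toSubmodule (integralClosure D L))).mp (h L).1
  refine ⟨(Submodule.fg_top (Subalgebra.toSubmodule (integralClosure D' L))).mpr ⟨s, ?_⟩⟩
  apply le_antisymm
  · rw [Submodule.span_le]
    intro x hx
    have : x ∈ Subalgebra.toSubmodule (integralClosure D L) := hs ▸ Submodule.subset_span hx
    exact IsIntegral.tower_top (A := D') (show IsIntegral D x from this)
  · intro x hx
    obtain ⟨m, hm⟩ := IsIntegral.exists_multiple_integral_of_isLocalization M x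
      (show IsIntegral D' x from hx)
    have h1 : (m : D) • x ∈ Submodule.span D (s : Set L) := by rw [hs]; exact hm
    have h2 : (m : D) • x ∈ Submodule.span D' (s : Set L) :=
      Submodule.span_le_restrictScalars D D' _ h1
    obtain ⟨u, hu⟩ := IsLocalization.map_units D' m
    have h3 : x = (↑u⁻¹ : D') • ((m : D) • x) := by
      rw [← algebraMap_smul D' (m : D) x, ← hu, smul_smul, Units.inv_mul, one_smul]
    rw [h3]
    exact Submodule.smul_mem _ _ h2

lemma IsNagataRing.of_isLocalization {G G' : Type u} [CommRing G] [CommRing G'] [Algebra G G']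
    (S : Submonoid G) [IsLocalization S G'] (h : IsNagataRing G) : IsNagataRing G' := by
  refine ⟨IsLocalization.isNoetherianRing S G' h.1, fun p' _ => ?_⟩
  let p := p'.comap (algebraMap G G')
  let _ : Algebra (G ⧸ p) (G' ⧸ p') :=
    (Ideal.quotientMap p' (algebraMap G G') le_rfl).toAlgebra
  have : IsLocalization (S.map (Ideal.Quotient.mk p)) (G' ⧸ p') :=
    IsLocalization.of_surjective S G' (Ideal.Quotient.mk p) Ideal.Quotient.mk_surjective
      (Ideal.Quotient.mk p') Ideal.Quotient.mk_surjective rfl (by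
        rw [Ideal.mk_ker, Ideal.mk_ker, IsLocalization.map_under S])
  exact (h.2 p).of_isLocalization (S.map (Ideal.Quotient.mk p))

lemma IsNagataRing.of_surjective {G G' : Type u} [CommRing G] [CommRing G'] (φ : G →+* G')
    (hφ : Function.Surjective φ) (h : IsNagataRing G) : IsNagataRing G' := by
  have := h.1
  refine ⟨isNoetherianRing_of_surjective G G' φ hφ, fun p' _ => ?_⟩
  let p := p'.comap φ
  have hbij : Function.Bijective (Ideal.quotientMap p' φ (le_refl p)) :=
    ⟨Ideal.quotientMap_injective, Ideal.quotientMap_surjective hφ⟩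
  let _ : Algebra (G ⧸ p) (G' ⧸ p') := (Ideal.quotientMap p' φ le_rfl).toAlgebra
  -- A prime quotient of `G'` is isomorphic to one of `G`; an isomorphism is a localization at the
  -- trivial submonoid, so the previous case applies.
  have : IsLocalization (⊥ : Submonoid (G ⧸ p)) (G' ⧸ p') :=
    have : IsLocalization (⊥ : Submonoid (G ⧸ p)) (G ⧸ p) :=
      IsLocalization.self fun x hx => by rw [Submonoid.mem_bot.mp hx]; exact isUnit_one
    IsLocalization.isLocalization_of_algEquiv ⊥
      (AlgEquiv.ofBijective (Algebra.ofId (G ⧸ p) (G' ⧸ p')) hbij)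
  exact (h.2 p).of_isLocalization ⊥

/-- The normalization of a Nagata ring is finite. -/
lemma IsNagataRing.finite_normRing {G : Type u} [CommRing G] (h : IsNagataRing G) :
    Module.Finite G (NormRing G) := by
  have hN := h.1
  let G₀ := G ⧸ nilradical G
  let Q := FractionRing G₀
  have : IsArtinianRing Q := isArtinianRing_fractionRing_of_isReduced G₀
  have hQred : IsReduced Q := isReduced_fractionRing G₀
  let p : MaximalSpectrum Q → Ideal G := fun m => m.asIdeal.comap (algebraMap G Q)
  have hp : ∀ m, (p m).IsPrime := fun m => inferInstance
  let _ : ∀ m : MaximalSpectrum Q, Field (Q ⧸ m.asIdeal) := fun m => Ideal.Quotient.field _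
  let _ : ∀ m : MaximalSpectrum Q, Algebra (G ⧸ p m) (Q ⧸ m.asIdeal) := fun m =>
    (Ideal.quotientMap m.asIdeal (algebraMap G Q) le_rfl).toAlgebra
  have htow : ∀ m : MaximalSpectrum Q, IsScalarTower G (G ⧸ p m) (Q ⧸ m.asIdeal) := fun m =>
    IsScalarTower.of_algebraMap_eq fun x => rfl
  have hfr : ∀ m : MaximalSpectrum Q, IsFractionRing (G ⧸ p m) (Q ⧸ m.asIdeal) := by
    intro m
    have hinj : Function.Injective (algebraMap (G ⧸ p m) (Q ⧸ m.asIdeal)) :=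
      Ideal.quotientMap_injective
    have : FaithfulSMul (G ⧸ p m) (Q ⧸ m.asIdeal) := (faithfulSMul_iff_algebraMap_injective _ _).mpr hinj
    refine IsFractionRing.of_field _ _ fun z => ?_
    obtain ⟨z, rfl⟩ := Ideal.Quotient.mk_surjective z
    obtain ⟨⟨a, s⟩, has⟩ := IsLocalization.surj G₀⁰ z
    obtain ⟨a, rfl⟩ := Ideal.Quotient.mk_surjective a
    obtain ⟨s', hs'⟩ := Ideal.Quotient.mk_surjective s.1
    refine ⟨Ideal.Quotient.mk _ a, Ideal.Quotient.mk _ s', ?_⟩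
    have hu : IsUnit (Ideal.Quotient.mk m.asIdeal (algebraMap G₀ Q s.1)) :=
      (IsLocalization.map_units Q s).map _
    rw [eq_div_iff]
    · change Ideal.Quotient.mk m.asIdeal z * Ideal.Quotient.mk m.asIdeal (algebraMap G Q s') =
        Ideal.Quotient.mk m.asIdeal (algebraMap G Q a)
      rw [← map_mul]
      congr 1
      rw [← hs'] at has
      exact has
    · rw [← hs'] at hu
      exact hu.ne_zero
  have hfin : ∀ m : MaximalSpectrum Q,
      Module.Finite G (integralClosure (G ⧸ p m) (Q ⧸ m.asIdeal)) := fun m => by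
    have := (h.2 (p m)).finite_integralClosure (Q ⧸ m.asIdeal)
    exact Module.Finite.trans (G ⧸ p m) _
  -- The reduced Artinian ring `Q` embeds in the product of its residue fields, the fraction fields
  -- of the domains G/p. The normalization therefore embeds in a finite product of integral
  -- closures, each finite by N-2, and `G` is Noetherian.
  let ψ : NormRing G →ₗ[G] (∀ m : MaximalSpectrum Q,
      integralClosure (G ⧸ p m) (Q ⧸ m.asIdeal)) :=
    LinearMap.pi fun m =>
      { toFun := fun x => ⟨Ideal.Quotient.mk m.asIdeal x.1, by
          have h1 : IsIntegral G₀ x.1 := x.2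
          have h2 : IsIntegral G x.1 := isIntegral_trans (R := G) (A := G₀) _ h1
          have h3 : IsIntegral G (Ideal.Quotient.mkₐ G m.asIdeal x.1) := h2.map _
          exact h3.tower_top⟩
        map_add' := fun x y => Subtype.ext (map_add (Ideal.Quotient.mk m.asIdeal) x.1 y.1)
        map_smul' := fun c x => Subtype.ext (by
          exact map_smul (Ideal.Quotient.mkₐ G m.asIdeal) c x.1) }
  have hψ : Function.Injective ψ := by
    rw [injective_iff_map_eq_zero]
    intro x hx
    apply Subtype.ext
    have hnil : IsNilpotent x.1 := by
      rw [nilpotent_iff_mem_prime]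
      intro J hJ
      have h1 := congrArg Subtype.val (congrFun hx ⟨J, IsArtinianRing.isMaximal_of_isPrime J⟩)
      exact Ideal.Quotient.eq_zero_iff_mem.mp h1
    exact hnil.eq_zero
  exact Module.Finite.of_injective ψ hψ

end Nagata

end DeltaFamily
end

/-! ### Depth: hypersurface sections of normal local domains. -/

noncomputable section
namespace DeltaFamily

section DepthTwo

open nonZeroDivisors IsLocalRing

/-- Since `a` is not in `p`, every element of `p` is `a` times an element of `p`; Nakayama's lemma
finishes. -/
lemma eq_bot_of_lt_span_singleton {W : Type*} [CommRing W] [IsLocalRing W] [IsNoetherianRing W]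
    {a : W} (ha : maximalIdeal W = Ideal.span {a}) (p : Ideal W) [p.IsPrime]
    (hp : p ≠ maximalIdeal W) : p = ⊥ := by
  have hap : a ∉ p := fun h => hp (le_antisymm (le_maximalIdeal (Ideal.IsPrime.ne_top inferInstance))
    (ha ▸ (Ideal.span_singleton_le_iff_mem _).mpr h))
  refine Submodule.eq_bot_of_le_smul_of_le_jacobson_bot (maximalIdeal W) p
    (IsNoetherian.noetherian p) (fun x hx => ?_) (maximalIdeal_le_jacobson ⊥)
  have hxm : x ∈ Ideal.span {a} := ha ▸ le_maximalIdeal (Ideal.IsPrime.ne_top inferInstance) hx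
  obtain ⟨y, rfl⟩ := Ideal.mem_span_singleton'.mp hxm
  have hy := ((inferInstance : p.IsPrime).mem_or_mem hx).resolve_right hap
  rw [mul_comm]
  exact Submodule.smul_mem_smul (ha ▸ Ideal.mem_span_singleton_self a) hy

/-- A quotient of positive dimension of a normal local domain by one element has positive
depth. -/
lemma H0m_eq_bot_of_isNormalDomain {W₀ W : Type u} [CommRing W₀] [IsLocalRing W₀]
    [IsNoetherianRing W₀] [CommRing W] [IsLocalRing W] (hn : IsNormalDomain W₀) (φ : W₀ →+* W)
    (hφ : Function.Surjective φ) (π : W₀) (hker : RingHom.ker φ = Ideal.span {π})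
    (hmin : maximalIdeal W ∉ minimalPrimes W) : H0m W = ⊥ := by
  have := hn.1
  have := hn.2
  have hloc : IsLocalHom φ := Function.Surjective.isLocalHom φ hφ
  have hmem : ∀ x, φ x ∈ maximalIdeal W ↔ x ∈ maximalIdeal W₀ := fun x => by
    simp only [mem_maximalIdeal, mem_nonunits_iff, isUnit_map_iff]
  have hφ0 : ∀ x, φ x = 0 ↔ π ∣ x := fun x => by
    rw [← RingHom.mem_ker, hker, Ideal.mem_span_singleton]
  obtain ⟨p, hp, hpm⟩ : ∃ p : Ideal W, p.IsPrime ∧ p ≠ maximalIdeal W := by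
    by_contra! h
    exact hmin ⟨⟨inferInstance, bot_le⟩, fun q hq _ => (h q hq.1).ge⟩
  rw [eq_bot_iff]
  rintro x ⟨k, hk⟩
  rw [Submodule.mem_bot]
  by_contra hx
  -- Multiplying a nonzero element of H⁰_m by ring elements as long as possible reaches the socle;
  -- `y` lifts a nonzero socle element.
  obtain ⟨y, hy, hym⟩ : ∃ y : W₀, ¬ π ∣ y ∧ ∀ b ∈ maximalIdeal W₀, π ∣ b * y := by
    clear hpm
    induction k generalizing x with
    | zero => exact absurd (by simpa using hk 1 (by simp)) hx
    | succ k ih =>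
      by_cases h : ∃ b ∈ maximalIdeal W, b * x ≠ 0
      · obtain ⟨b, hb, hbx⟩ := h
        refine ih (x := b * x) (fun a ha => ?_) hbx
        rw [← mul_assoc]
        exact hk _ (by rw [pow_succ]; exact Ideal.mul_mem_mul ha hb)
      · push Not at h
        obtain ⟨y, rfl⟩ := hφ x
        refine ⟨y, fun hd => hx ((hφ0 y).mpr hd), fun b hb => ?_⟩
        rw [← hφ0, map_mul]
        exact h _ ((hmem b).mpr hb)
  have hm0 : maximalIdeal W₀ ≠ ⊥ := by
    intro h0
    apply hpm
    apply le_antisymm (le_maximalIdeal hp.ne_top)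
    intro w hw
    obtain ⟨w, rfl⟩ := hφ w
    rw [hmem, h0, Submodule.mem_bot] at hw
    rw [hw, map_zero]; exact p.zero_mem
  have hπ : π ≠ 0 := by
    rintro rfl
    obtain ⟨b, hb, hb0⟩ := Submodule.exists_mem_ne_zero_of_ne_bot hm0
    have := zero_dvd_iff.mp (hym b hb)
    rcases mul_eq_zero.mp this with h | h
    · exact hb0 h
    · exact hy (zero_dvd_iff.mpr h)
  let K := FractionRing W₀
  have hinj : Function.Injective (algebraMap W₀ K) := IsFractionRing.injective W₀ K
  have hπK : algebraMap W₀ K π ≠ 0 := (map_ne_zero_iff _ hinj).mpr hπ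
  -- The fraction z = y/π maps the maximal ideal into the ring. If it maps it into itself, z is
  -- integral by the determinant trick, hence in `W₀`, and π divides y.
  by_cases hall : ∀ b ∈ maximalIdeal W₀, ∀ c, b * y = π * c → c ∈ maximalIdeal W₀
  · let z : K := algebraMap W₀ K y / algebraMap W₀ K π
    have hz : IsIntegral W₀ z := by
      refine isIntegral_of_smul_mem_submodule (M := K)
        (Submodule.map (Algebra.linearMap W₀ K) (maximalIdeal W₀)) ?_
        (Submodule.FG.map _ (IsNoetherian.noetherian _)) z ?_
      · intro h
        refine hm0 (le_bot_iff.mp fun b hb => hinj ?_)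
        rw [map_zero]
        exact (Submodule.mem_bot (R := W₀) (x := algebraMap W₀ K b)).mp
          (h ▸ Submodule.mem_map_of_mem (f := Algebra.linearMap W₀ K) hb)
      · rintro _ ⟨b, hb, rfl⟩
        obtain ⟨c, hc⟩ := hym b hb
        refine ⟨c, hall b hb c hc, ?_⟩
        change algebraMap W₀ K c = z * algebraMap W₀ K b
        rw [div_mul_eq_mul_div, eq_div_iff hπK, ← map_mul, ← map_mul, mul_comm c, ← hc, mul_comm]
    obtain ⟨w, hw⟩ := IsIntegrallyClosed.isIntegral_iff.mp hz
    refine hy ⟨w, hinj ?_⟩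
    rw [map_mul, hw, mul_div_cancel₀ _ hπK]
  · push Not at hall
    obtain ⟨a, ha, c, hc, hcm⟩ := hall
    have hcu : IsUnit c := by simpa using hcm
    obtain ⟨u, rfl⟩ := hcu
    have hy0 : y ≠ 0 := fun h => hy (h ▸ dvd_zero π)
    -- Otherwise az is a unit for some `a`, which makes the maximal ideal principal. Then the
    -- nonmaximal prime `p` pulls back to zero although it contains π ≠ 0.
    have hspan : maximalIdeal W₀ = Ideal.span {a} := by
      apply le_antisymm
      · intro b hb
        obtain ⟨d, hd⟩ := hym b hb
        rw [Ideal.mem_span_singleton]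
        refine ⟨d * ↑u⁻¹, mul_right_cancel₀ hy0 ?_⟩
        calc b * y = π * d := hd
          _ = (π * ↑u) * (d * ↑u⁻¹) := by
            rw [mul_mul_mul_comm, Units.mul_inv, mul_one]
          _ = a * (d * ↑u⁻¹) * y := by rw [← hc]; ring
      · exact (Ideal.span_singleton_le_iff_mem _).mpr ha
    have hpb := eq_bot_of_lt_span_singleton hspan (p.comap φ) (fun h => hpm (by
      apply le_antisymm (le_maximalIdeal hp.ne_top)
      intro w hw
      obtain ⟨w, rfl⟩ := hφ w
      rw [hmem, ← h] at hw
      exact hw))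
    have : π ∈ p.comap φ := by
      rw [Ideal.mem_comap, (hφ0 π).mpr dvd_rfl]; exact p.zero_mem
    rw [hpb] at this
    exact hπ this

end DepthTwo

/-! ### The Euler characteristic of multiplication by π. -/

section Euler

/-- The submodule killed by `π`. -/
abbrev tors {O : Type*} [CommRing O] (π : O) (M : Type*) [AddCommGroup M] [Module O M] :
    Submodule O M := LinearMap.ker (LinearMap.lsmul O M π)

/-- The cokernel of multiplication by `π`. -/
abbrev cotors {O : Type*} [CommRing O] (π : O) (M : Type*) [AddCommGroup M] [Module O M] :=
  M ⧸ LinearMap.range (LinearMap.lsmul O M π)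

variable {O : Type*} [CommRing O] (π : O)

/-- The alternating sum of lengths in an exact sequence vanishes, written additively since lengths
may be infinite. The last two clauses isolate the part of the sequence at C₁, needed for the kernel
of a reduction. -/
lemma length_six_term {K₁ K₂ K₃ C₁ C₂ C₃ : Type*} [AddCommGroup K₁] [AddCommGroup K₂]
    [AddCommGroup K₃] [AddCommGroup C₁] [AddCommGroup C₂] [AddCommGroup C₃] [Module O K₁]
    [Module O K₂] [Module O K₃] [Module O C₁] [Module O C₂] [Module O C₃]
    (a : K₁ →ₗ[O] K₂) (b : K₂ →ₗ[O] K₃) (δ : K₃ →ₗ[O] C₁) (c : C₁ →ₗ[O] C₂) (d : C₂ →ₗ[O] C₃)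
    (ha : Function.Injective a) (hab : Function.Exact a b) (hbδ : Function.Exact b δ)
    (hδc : Function.Exact δ c) (hcd : Function.Exact c d) (hd : Function.Surjective d) :
    Module.length O K₂ ≤ Module.length O K₁ + Module.length O K₃ ∧
    Module.length O C₂ + Module.length O K₁ + Module.length O K₃ =
      Module.length O C₁ + Module.length O C₃ + Module.length O K₂ ∧
    Module.length O C₁ = Module.length O (LinearMap.ker c) + Module.length O (LinearMap.ker d) ∧
    (Subsingleton K₂ → Module.length O (LinearMap.ker c) = Module.length O K₃) := by
  have h1 := length_eq_ker_add_range b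
  have h2 := length_eq_ker_add_range δ
  have h3 := length_eq_ker_add_range c
  have h4 := length_eq_ker_add_range d
  rw [hab.linearMap_ker_eq, ← (LinearEquiv.ofInjective a ha).length_eq] at h1
  rw [hbδ.linearMap_ker_eq] at h2
  rw [hδc.linearMap_ker_eq] at h3
  rw [hcd.linearMap_ker_eq, LinearMap.range_eq_top.mpr hd, Submodule.topEquiv.length_eq] at h4
  refine ⟨?_, by rw [h1, h2, h3, h4]; abel, ?_, fun hK => ?_⟩
  · rw [h1, h2]
    exact add_le_add_right le_self_add _
  · rw [h3, hδc.linearMap_ker_eq, hcd.linearMap_ker_eq]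
  · have : Subsingleton (LinearMap.range b) :=
      ⟨fun x y => by
        obtain ⟨_, x, rfl⟩ := x
        obtain ⟨_, y, rfl⟩ := y
        exact Subtype.ext (congrArg b (Subsingleton.elim x y))⟩
    rw [h2, Module.length_eq_zero (M := LinearMap.range b), zero_add, hδc.linearMap_ker_eq]

/-- The map induced on the cokernels of multiplication by `π`. -/
abbrev cotorsMap {M M' : Type*} [AddCommGroup M] [Module O M] [AddCommGroup M'] [Module O M']
    (f : M →ₗ[O] M') : cotors π M →ₗ[O] cotors π M' :=
  Submodule.mapQ _ _ f (by rintro _ ⟨x, rfl⟩; exact ⟨f x, by simp⟩)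

/-- The snake lemma for multiplication by π on the three terms: 0 → M₁[π] → M₂[π] → M₃[π] → M₁/π →
M₂/π → M₃/π → 0. -/
lemma length_snake {M₁ M₂ M₃ : Type*} [AddCommGroup M₁] [Module O M₁] [AddCommGroup M₂]
    [Module O M₂] [AddCommGroup M₃] [Module O M₃] (f : M₁ →ₗ[O] M₂) (g : M₂ →ₗ[O] M₃)
    (hf : Function.Injective f) (hg : Function.Surjective g) (hfg : Function.Exact f g) :
    Module.length O (tors π M₂) ≤ Module.length O (tors π M₁) + Module.length O (tors π M₃) ∧
    Module.length O (cotors π M₂) + Module.length O (tors π M₁) + Module.length O (tors π M₃) =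
      Module.length O (cotors π M₁) + Module.length O (cotors π M₃) +
        Module.length O (tors π M₂) ∧
    Module.length O (cotors π M₁) = Module.length O (LinearMap.ker (cotorsMap π f)) +
      Module.length O (LinearMap.ker (cotorsMap π g)) ∧
    (Subsingleton (tors π M₂) →
      Module.length O (LinearMap.ker (cotorsMap π f)) = Module.length O (tors π M₃)) := by
  let i₁ := LinearMap.lsmul O M₁ π
  let i₂ := LinearMap.lsmul O M₂ π
  let i₃ := LinearMap.lsmul O M₃ π
  have h1 : f ∘ₗ i₁ = i₂ ∘ₗ f := by ext; simp [i₁, i₂]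
  have h2 : g ∘ₗ i₂ = i₃ ∘ₗ g := by ext; simp [i₂, i₃]
  let a : tors π M₁ →ₗ[O] tors π M₂ := f.restrict fun x hx => by
    simp only [LinearMap.mem_ker, LinearMap.lsmul_apply] at hx ⊢
    rw [← map_smul, hx, map_zero]
  let b : tors π M₂ →ₗ[O] tors π M₃ := g.restrict fun x hx => by
    simp only [LinearMap.mem_ker, LinearMap.lsmul_apply] at hx ⊢
    rw [← map_smul, hx, map_zero]
  let c : cotors π M₁ →ₗ[O] cotors π M₂ := cotorsMap π f
  let d : cotors π M₂ →ₗ[O] cotors π M₃ := cotorsMap π g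
  let δ : tors π M₃ →ₗ[O] cotors π M₁ := SnakeLemma.δ' i₁ i₂ i₃ f g hfg f g hfg h1 h2
    (tors π M₃).subtype (LinearMap.exact_subtype_ker_map _) (LinearMap.range i₁).mkQ
    (LinearMap.exact_map_mkQ_range _) hg hf
  refine length_six_term a b δ c d (fun x y h => Subtype.ext (hf (congrArg Subtype.val h))) ?_ ?_ ?_
    ?_ ?_
  · intro x
    constructor
    · intro hx
      obtain ⟨y, hy⟩ := (hfg x.1).mp (congrArg Subtype.val hx)
      refine ⟨⟨y, ?_⟩, Subtype.ext hy⟩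
      rw [LinearMap.mem_ker, LinearMap.lsmul_apply]
      apply hf
      rw [map_smul, hy, map_zero]
      exact x.2
    · rintro ⟨y, rfl⟩
      exact Subtype.ext ((hfg _).mpr ⟨y.1, rfl⟩)
  · exact SnakeLemma.exact_δ'_right i₁ i₂ i₃ f g hfg f g hfg h1 h2 (tors π M₂).subtype
      (LinearMap.exact_subtype_ker_map _)
      (tors π M₃).subtype (LinearMap.exact_subtype_ker_map _) (LinearMap.range i₁).mkQ
      (LinearMap.exact_map_mkQ_range _) hg hf b rfl (Submodule.injective_subtype _)
  · exact SnakeLemma.exact_δ'_left i₁ i₂ i₃ f g hfg f g hfg h1 h2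
      (tors π M₃).subtype (LinearMap.exact_subtype_ker_map _) (LinearMap.range i₁).mkQ
      (LinearMap.exact_map_mkQ_range _) (LinearMap.range i₂).mkQ
      (LinearMap.exact_map_mkQ_range _) hg hf c rfl (Submodule.mkQ_surjective _)
  · intro x
    obtain ⟨x, rfl⟩ := Submodule.mkQ_surjective _ x
    constructor
    · intro hx
      have hx' : (Submodule.Quotient.mk (g x) : cotors π M₃) = 0 := hx
      rw [Submodule.Quotient.mk_eq_zero] at hx'
      obtain ⟨z, hz⟩ := hx'
      obtain ⟨z, rfl⟩ := hg z
      obtain ⟨y, hy⟩ := (hfg (x - π • z)).mp (by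
        rw [map_sub, map_smul, ← hz, LinearMap.lsmul_apply, sub_self])
      refine ⟨Submodule.Quotient.mk y, ?_⟩
      change (Submodule.Quotient.mk (f y) : cotors π M₂) = Submodule.Quotient.mk x
      rw [Submodule.Quotient.eq, hy]
      exact ⟨-z, by simp⟩
    · rintro ⟨y, hy⟩
      obtain ⟨y, rfl⟩ := Submodule.mkQ_surjective _ y
      rw [← hy]
      change (Submodule.Quotient.mk (g (f y)) : cotors π M₃) = 0
      rw [hfg.apply_apply_eq_zero, Submodule.Quotient.mk_zero]
  · intro x
    obtain ⟨x, rfl⟩ := Submodule.mkQ_surjective _ x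
    obtain ⟨y, rfl⟩ := hg x
    exact ⟨Submodule.Quotient.mk y, rfl⟩

lemma length_cotors_congr {M M' : Type*} [AddCommGroup M] [Module O M] [AddCommGroup M']
    [Module O M'] (e : M ≃ₗ[O] M') :
    Module.length O (cotors π M) = Module.length O (cotors π M') := by
  refine (Submodule.Quotient.equiv _ _ e ?_).length_eq
  ext x
  constructor
  · rintro ⟨_, ⟨y, rfl⟩, rfl⟩
    exact ⟨e y, by simp⟩
  · rintro ⟨y, rfl⟩
    exact ⟨_, ⟨e.symm y, rfl⟩, by simp⟩

/-- The localization of O/p at p is the residue field at p. -/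
lemma length_localizedModule_of_equiv_quotient {p : Ideal O} [p.IsPrime] {N : Type*}
    [AddCommGroup N] [Module O N] (e : N ≃ₗ[O] O ⧸ p) :
    Module.length (Localization.AtPrime p) (LocalizedModule p.primeCompl N) = 1 := by
  rw [Module.length_eq_one_iff, isSimpleModule_iff_quot_maximal]
  let x₀ : N := e.symm (Ideal.Quotient.mk p 1)
  have hx₀ : ∀ a : O, a • x₀ = 0 ↔ a ∈ p := fun a => by
    rw [← map_smul, map_eq_zero_iff _ e.symm.injective, ← Ideal.Quotient.eq_zero_iff_mem]
    rw [Algebra.smul_def, map_one, mul_one]; rfl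
  have hgen : ∀ y : N, ∃ a : O, y = a • x₀ := fun y => by
    obtain ⟨a, ha⟩ := Ideal.Quotient.mk_surjective (e y)
    refine ⟨a, e.injective ?_⟩
    rw [map_smul, LinearEquiv.apply_symm_apply, ← ha, Algebra.smul_def, map_one, mul_one]; rfl
  let x : LocalizedModule p.primeCompl N := LocalizedModule.mk x₀ 1
  let φ := LinearMap.toSpanSingleton (Localization.AtPrime p) _ x
  have hφ : Function.Surjective φ := by
    intro y
    induction y using LocalizedModule.induction_on with
    | h n s =>
      obtain ⟨a, rfl⟩ := hgen n
      refine ⟨Localization.mk a s, ?_⟩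
      rw [LinearMap.toSpanSingleton_apply, LocalizedModule.mk_smul_mk, mul_one]
  have hker : LinearMap.ker φ = IsLocalRing.maximalIdeal (Localization.AtPrime p) := by
    have hle : IsLocalRing.maximalIdeal (Localization.AtPrime p) ≤ LinearMap.ker φ := by
      rw [← Localization.AtPrime.map_eq_maximalIdeal, Ideal.map_le_iff_le_comap]
      intro a ha
      rw [Ideal.mem_comap]
      change algebraMap O (Localization.AtPrime p) a • x = 0
      rw [← Localization.mk_one_eq_algebraMap, LocalizedModule.mk_smul_mk, mul_one]
      change LocalizedModule.mk (a • x₀) 1 = 0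
      rw [(hx₀ a).mpr ha, LocalizedModule.zero_mk]
    refine ((IsLocalRing.maximalIdeal.isMaximal _).eq_of_le ?_ hle).symm
    intro h
    have h1 : (1 : Localization.AtPrime p) ∈ LinearMap.ker φ := h ▸ Submodule.mem_top
    rw [LinearMap.mem_ker, LinearMap.toSpanSingleton_apply, one_smul] at h1
    rw [← LocalizedModule.zero_mk 1, LocalizedModule.mk_eq] at h1
    obtain ⟨u, hu⟩ := h1
    refine u.2 ((hx₀ u).mp ?_)
    rw [smul_zero, smul_zero, one_smul] at hu
    exact hu
  exact ⟨_, IsLocalRing.maximalIdeal.isMaximal _, ⟨((LinearMap.quotKerEquivOfSurjective φ hφ).symm.trans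
    (Submodule.quotEquivOfEq _ _ hker))⟩⟩

lemma eq_of_add_add_eq {a b c d e f : ℕ∞} (h : a + b + c = b + d + (c + e) + f) (hb : b ≠ ⊤)
    (hc : c ≠ ⊤) : a = f + (d + e) := by
  refine ENat.add_left_injective_of_ne_top (n := b + c) (WithTop.add_ne_top.mpr ⟨hb, hc⟩) ?_
  simp only
  rw [← add_assoc, h]
  abel

/-- The Euler characteristic of multiplication by `π` on a finite module over a Noetherian local
ring whose support consists of the closed point and finitely many one-dimensional points outside
the locus `π = 0`. -/
theorem length_cotors_eq [IsLocalRing O] [IsNoetherianRing O] {ι : Type*} [Fintype ι]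
    (P : ι → Ideal O) [∀ i, (P i).IsPrime] (hinj : ∀ i j, P i ≤ P j → i = j)
    (hπP : ∀ i, π ∉ P i) (hπ : π ∈ IsLocalRing.maximalIdeal O)
    (M : Type*) [AddCommGroup M] [Module O M] [Module.Finite O M]
    (hM : ∀ q ∈ Module.support O M,
      q.asIdeal = IsLocalRing.maximalIdeal O ∨ ∃ i, q.asIdeal = P i) :
    Module.length O (tors π M) ≠ ⊤ ∧
    (∀ i, Module.length (Localization.AtPrime (P i)) (LocalizedModule (P i).primeCompl M) *
      Module.length O (cotors π (O ⧸ P i)) ≠ ⊤) ∧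
    Module.length O (cotors π M) = Module.length O (tors π M) +
      ∑ i, Module.length (Localization.AtPrime (P i)) (LocalizedModule (P i).primeCompl M) *
        Module.length O (cotors π (O ⧸ P i)) := by
  revert hM
  induction ‹Module.Finite O M› using
    IsNoetherianRing.induction_on_isQuotientEquivQuotientPrime O with
  | subsingleton N => 
    intro _
    simp [Module.length_eq_zero]
  | quotient N p e =>
    intro h
    obtain ⟨p, hp⟩ := p
    change N ≃ₗ[O] O ⧸ p at e
    have hpS : (⟨p, hp⟩ : PrimeSpectrum O) ∈ Module.support O N := by
      rw [Module.mem_support_iff']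
      refine ⟨e.symm (Ideal.Quotient.mk p 1), fun r hr h0 => hr ?_⟩
      rw [← map_smul, map_eq_zero_iff _ e.symm.injective, Algebra.smul_def, map_one, mul_one] at h0
      exact Ideal.Quotient.eq_zero_iff_mem.mp h0
    have hloc0 : ∀ i, ¬ p ≤ P i → Module.length (Localization.AtPrime (P i))
        (LocalizedModule (P i).primeCompl N) = 0 := fun i hi => by
      obtain ⟨a, ha, hai⟩ := Set.not_subset.mp hi
      have : Subsingleton (LocalizedModule (P i).primeCompl N) := by
        refine subsingleton_localizedModule_of_smul _ a hai fun v => e.injective ?_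
        obtain ⟨y, hy⟩ := Ideal.Quotient.mk_surjective (e v)
        rw [map_smul, map_zero, ← hy, Algebra.smul_def]
        change Ideal.Quotient.mk p a * _ = 0
        rw [Ideal.Quotient.eq_zero_iff_mem.mpr ha, zero_mul]
      exact Module.length_eq_zero
    -- In the prime filtration, a factor O/m is killed by π and adds 1 both to the torsion and to
    -- the cotorsion, while a factor O/P_i has no π-torsion and has length 1 at P_i and 0 at the
    -- other P_j.
    rcases h _ hpS with hm | ⟨i, hi⟩
    · change p = _ at hm
      subst hm
      have h0 : ∀ i, Module.length (Localization.AtPrime (P i))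
        (LocalizedModule (P i).primeCompl N) = 0 := fun i => hloc0 i fun hle => hπP i (hle hπ)
      have hπ0 : LinearMap.lsmul O N π = 0 := by
        ext v
        apply e.injective
        obtain ⟨y, hy⟩ := Ideal.Quotient.mk_surjective (e v)
        rw [LinearMap.lsmul_apply, map_smul, LinearMap.zero_apply, map_zero, ← hy, Algebra.smul_def]
        change Ideal.Quotient.mk _ π * _ = 0
        rw [Ideal.Quotient.eq_zero_iff_mem.mpr hπ, zero_mul]
      have hN : Module.length O N = 1 := by
        rw [Module.length_eq_one_iff, isSimpleModule_iff_quot_maximal]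
        exact ⟨_, inferInstance, ⟨e⟩⟩
      have ht : Module.length O (tors π N) = 1 := by
        rw [tors, hπ0, LinearMap.ker_zero, Submodule.topEquiv.length_eq, hN]
      have hc : Module.length O (cotors π N) = 1 := by
        rw [(Submodule.quotEquivOfEqBot _ (by rw [hπ0, LinearMap.range_zero])).length_eq, hN]
      simp [h0, ht, hc]
    · change p = _ at hi
      subst hi
      have h0 : ∀ j, j ≠ i → Module.length (Localization.AtPrime (P j))
        (LocalizedModule (P j).primeCompl N) = 0 := fun j hj => hloc0 j fun hle => hj (hinj _ _ hle).symm
      have h1 := length_localizedModule_of_equiv_quotient e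
      have ht : tors π N = ⊥ := by
        rw [LinearMap.ker_eq_bot']
        intro v hv
        apply e.injective
        have h2 := congrArg e hv
        obtain ⟨y, hy⟩ := Ideal.Quotient.mk_surjective (e v)
        rw [LinearMap.lsmul_apply, map_smul, ← hy, map_zero, Algebra.smul_def] at h2
        rw [← hy, map_zero]
        exact ((mul_eq_zero.mp h2).resolve_left fun h3 =>
          hπP i (Ideal.Quotient.eq_zero_iff_mem.mp h3))
      -- A prime in the support contains P_i and π. Since no P_j contains π, only the closed point
      -- is left.
      have hfin : Module.length O (cotors π (O ⧸ P i)) ≠ ⊤ := by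
        rw [Module.length_ne_top_iff]
        refine isFiniteLength_of_support fun q hq => ?_
        obtain ⟨y, hy⟩ := Module.mem_support_iff'.mp hq
        obtain ⟨y, rfl⟩ := Submodule.mkQ_surjective _ y
        have hπq : π ∈ q.asIdeal := by
          by_contra hne
          refine hy π hne ?_
          rw [← map_smul, Submodule.mkQ_apply, Submodule.Quotient.mk_eq_zero]
          exact ⟨y, rfl⟩
        have hPq : P i ≤ q.asIdeal := fun a ha => by
          by_contra hne
          refine hy a hne ?_
          obtain ⟨y, rfl⟩ := Ideal.Quotient.mk_surjective y
          rw [← map_smul, Algebra.smul_def]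
          change (LinearMap.range (LinearMap.lsmul O (O ⧸ P i) π)).mkQ
            (Ideal.Quotient.mk _ a * _) = 0
          rw [Ideal.Quotient.eq_zero_iff_mem.mpr ha, zero_mul, map_zero]
        rcases h q (by
          rw [Module.mem_support_iff'] at hpS ⊢
          obtain ⟨x, hx⟩ := hpS
          exact ⟨x, fun r hr => hx r fun h' => hr (hPq h')⟩) with h' | ⟨j, hj⟩
        · exact h'
        · exact absurd (hj ▸ hπq) (hπP j)
      refine ⟨?_, fun j => ?_, ?_⟩
      · rw [ht, Module.length_eq_zero]; exact ENat.zero_ne_top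
      · by_cases hj : j = i
        · subst hj; rw [h1, one_mul]; exact hfin
        · rw [h0 j hj, zero_mul]; exact ENat.zero_ne_top
      · rw [Finset.sum_eq_single i (fun j _ hj => by rw [h0 j hj, zero_mul]) (by simp), h1, one_mul,
          ht, Module.length_eq_zero (M := (⊥ : Submodule O N)), zero_add, length_cotors_congr π e]
  | exact N₁ N₂ N₃ f g hf hg hfg h₁ h₃ =>
    intro h
    have hs := Module.support_of_exact hfg hf hg
    obtain ⟨t1, m1, e1⟩ := h₁ fun q hq => h q (by rw [hs]; exact Or.inl hq)
    obtain ⟨t3, m3, e3⟩ := h₃ fun q hq => h q (by rw [hs]; exact Or.inr hq)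
    have hl : ∀ i, Module.length (Localization.AtPrime (P i)) (LocalizedModule (P i).primeCompl N₂) =
        Module.length (Localization.AtPrime (P i)) (LocalizedModule (P i).primeCompl N₁) +
        Module.length (Localization.AtPrime (P i)) (LocalizedModule (P i).primeCompl N₃) := fun i =>
      Module.length_eq_add_of_exact (LocalizedModule.map (P i).primeCompl f)
        (LocalizedModule.map (P i).primeCompl g) (LocalizedModule.map_injective _ _ hf)
        (LocalizedModule.map_surjective _ _ hg) (LocalizedModule.map_exact _ _ _ hfg)
    simp only [hl, add_mul, Finset.sum_add_distrib]
    obtain ⟨hle, hsn, -⟩ := length_snake π f g hf hg hfg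
    have t13 := WithTop.add_ne_top.mpr ⟨t1, t3⟩
    refine ⟨ne_top_of_le_ne_top t13 hle, fun i => WithTop.add_ne_top.mpr ⟨m1 i, m3 i⟩, ?_⟩
    rw [e1, e3] at hsn
    exact eq_of_add_add_eq hsn t1 t3

end Euler

end DeltaFamily
end

/-! ### Reduction modulo π of an algebra O → H. -/

noncomputable section
namespace DeltaFamily

section Specialization

open nonZeroDivisors

variable {O : Type*} [CommRing O] (π : O)

/-- The reduction modulo `π` of an algebra. -/
lemma exists_cotors_equiv (H R' : Type*) [CommRing H] [CommRing R'] [Algebra O H] [Algebra H R']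
    [Algebra O R'] [IsScalarTower O H R'] (hs : Function.Surjective (algebraMap H R'))
    (hk : RingHom.ker (algebraMap H R') = Ideal.span {algebraMap O H π}) :
    ∃ e : cotors π H ≃ₗ[O] R', ∀ h : H, e (Submodule.Quotient.mk h) = algebraMap H R' h := by
  let φ : H →ₗ[O] R' := (IsScalarTower.toAlgHom O H R').toLinearMap
  have hker : LinearMap.range (LinearMap.lsmul O H π) = LinearMap.ker φ := by
    ext x
    have h1 : x ∈ LinearMap.ker φ ↔ x ∈ RingHom.ker (algebraMap H R') := Iff.rfl
    rw [h1, hk, Ideal.mem_span_singleton']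
    simp only [LinearMap.mem_range, LinearMap.lsmul_apply, Algebra.smul_def, mul_comm]
  exact ⟨(Submodule.quotEquivOfEq _ _ hker).trans (LinearMap.quotKerEquivOfSurjective φ hs),
    fun h => rfl⟩

lemma length_ker_comp_of_surjective {M M' M'' : Type*} [AddCommGroup M] [AddCommGroup M']
    [AddCommGroup M''] [Module O M] [Module O M'] [Module O M''] (f : M →ₗ[O] M')
    (g : M' →ₗ[O] M'') (hf : Function.Surjective f) :
    Module.length O (LinearMap.ker (g ∘ₗ f)) =
      Module.length O (LinearMap.ker f) + Module.length O (LinearMap.ker g) := by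
  let b : LinearMap.ker (g ∘ₗ f) →ₗ[O] LinearMap.ker g := f.restrict fun x hx => hx
  let a : LinearMap.ker f →ₗ[O] LinearMap.ker (g ∘ₗ f) := Submodule.inclusion fun x hx => by
    rw [LinearMap.mem_ker] at hx ⊢
    rw [LinearMap.comp_apply, hx, map_zero]
  refine Module.length_eq_add_of_exact a b (Submodule.inclusion_injective _) ?_ ?_
  · rintro ⟨y, hy⟩
    obtain ⟨x, rfl⟩ := hf y
    exact ⟨⟨x, hy⟩, rfl⟩
  · intro x
    constructor
    · intro hx
      exact ⟨⟨x.1, congrArg Subtype.val hx⟩, rfl⟩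
    · rintro ⟨y, rfl⟩
      exact Subtype.ext y.2

section

variable (H : Type*) [CommRing H] [Algebra O H]

/-- Factor O → H through its image I. As I ⊆ H has no π-torsion, the kernel of O/π → I/π has the
length of K/π; as H has none, the kernel of I/π → H/π has the length of the π-torsion of H/I. -/
lemma length_ker_cotorsMap (h1 : ∀ x : O, π * x = 0 → x = 0) (h2 : ∀ x : H, π • x = 0 → x = 0) :
    Module.length O (LinearMap.ker (cotorsMap π (Algebra.linearMap O H))) =
      Module.length O (cotors π (LinearMap.ker (Algebra.linearMap O H))) +
        Module.length O (tors π (H ⧸ LinearMap.range (Algebra.linearMap O H))) := by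
  let φ := Algebra.linearMap O H
  have hO : Subsingleton (tors π O) := by
    refine ⟨fun x y => Subtype.ext ?_⟩
    rw [h1 _ x.2, h1 _ y.2]
  have hH : Subsingleton (tors π H) := by
    refine ⟨fun x y => Subtype.ext ?_⟩
    rw [h2 _ x.2, h2 _ y.2]
  have hI : Subsingleton (tors π (LinearMap.range φ)) := by
    refine ⟨fun x y => Subtype.ext (Subtype.ext ?_)⟩
    rw [h2 _ (congrArg Subtype.val x.2), h2 _ (congrArg Subtype.val y.2)]
  obtain ⟨-, -, s1, s2⟩ := length_snake π (LinearMap.ker φ).subtype φ.rangeRestrict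
    (Submodule.injective_subtype _) φ.surjective_rangeRestrict
    (by intro x; rw [← LinearMap.mem_ker, LinearMap.ker_rangeRestrict]; simp)
  obtain ⟨-, -, -, s4⟩ := length_snake π (LinearMap.range φ).subtype (LinearMap.range φ).mkQ
    (Submodule.injective_subtype _) (Submodule.mkQ_surjective _)
    (by intro x; simp)
  have hcomp : cotorsMap π φ = cotorsMap π (LinearMap.range φ).subtype ∘ₗ
      cotorsMap π φ.rangeRestrict := by
    apply Submodule.linearMap_qext
    rfl
  rw [hcomp, length_ker_comp_of_surjective _ _ (by
    intro x
    obtain ⟨x, rfl⟩ := Submodule.mkQ_surjective _ x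
    obtain ⟨y, rfl⟩ := φ.surjective_rangeRestrict x
    exact ⟨Submodule.Quotient.mk y, rfl⟩), s4 hH, s1, s2 hO, Module.length_eq_zero (M := tors π (LinearMap.range φ)),
    zero_add]

/-- Taking cokernels commutes with reduction modulo π, by right exactness. -/
lemma length_coker_cotorsMap :
    Module.length O (cotors π H ⧸ LinearMap.range (cotorsMap π (Algebra.linearMap O H))) =
      Module.length O (cotors π (H ⧸ LinearMap.range (Algebra.linearMap O H))) := by
  let φ := Algebra.linearMap O H
  let ψ := cotorsMap π (LinearMap.range φ).mkQ
  have hψ : Function.Surjective ψ := by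
    intro x
    obtain ⟨x, rfl⟩ := Submodule.mkQ_surjective _ x
    obtain ⟨x, rfl⟩ := Submodule.mkQ_surjective _ x
    exact ⟨Submodule.Quotient.mk x, rfl⟩
  have hk : LinearMap.range (cotorsMap π φ) = LinearMap.ker ψ := by
    ext x
    obtain ⟨x, rfl⟩ := Submodule.mkQ_surjective _ x
    constructor
    · rintro ⟨y, hy⟩
      obtain ⟨y, rfl⟩ := Submodule.mkQ_surjective _ y
      rw [LinearMap.mem_ker, ← hy]
      change Submodule.Quotient.mk (Submodule.Quotient.mk (φ y)) = _
      rw [(Submodule.Quotient.mk_eq_zero (LinearMap.range φ)).mpr ⟨y, rfl⟩, Submodule.Quotient.mk_zero]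
    · intro hx
      have hx' : (Submodule.Quotient.mk (Submodule.Quotient.mk x) :
        cotors π (H ⧸ LinearMap.range φ)) = 0 := hx
      rw [Submodule.Quotient.mk_eq_zero] at hx'
      obtain ⟨z, hz⟩ := hx'
      obtain ⟨z, rfl⟩ := Submodule.mkQ_surjective _ z
      rw [LinearMap.lsmul_apply, ← map_smul] at hz
      obtain ⟨y, hy⟩ := (Submodule.Quotient.eq _).mp hz.symm
      refine ⟨Submodule.Quotient.mk y, ?_⟩
      change (Submodule.Quotient.mk (φ y) : cotors π H) = Submodule.Quotient.mk x
      rw [Submodule.Quotient.eq, hy]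
      exact ⟨-z, by simp⟩
  rw [hk]
  exact (LinearMap.quotKerEquivOfSurjective ψ hψ).length_eq

variable {H} {R R' : Type*} [CommRing R] [CommRing R'] [Algebra O R] [Algebra H R'] [Algebra O R']
  [Algebra R R'] [IsScalarTower O H R'] [IsScalarTower O R R']
  (hsR : Function.Surjective (algebraMap O R)) (hkR : RingHom.ker (algebraMap O R) = Ideal.span {π})
  (hsH : Function.Surjective (algebraMap H R'))
  (hkH : RingHom.ker (algebraMap H R') = Ideal.span {algebraMap O H π})

include hsR hkR hsH hkH

lemma exists_cotors_square :
    ∃ (e : cotors π O ≃ₗ[O] R) (e' : cotors π H ≃ₗ[O] R'),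
      ∀ x, e' (cotorsMap π (Algebra.linearMap O H) x) = algebraMap R R' (e x) := by
  obtain ⟨e, he⟩ := exists_cotors_equiv π O R hsR hkR
  obtain ⟨e', he'⟩ := exists_cotors_equiv π H R' hsH hkH
  refine ⟨e, e', fun x => ?_⟩
  obtain ⟨x, rfl⟩ := Submodule.mkQ_surjective _ x
  change e' (Submodule.Quotient.mk (algebraMap O H x)) = algebraMap R R' (e (Submodule.Quotient.mk x))
  rw [he, he', ← IsScalarTower.algebraMap_apply, ← IsScalarTower.algebraMap_apply]

/-- The square of `exists_cotors_square` identifies the two kernels, and lengths over `O` and `R`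
agree because O → R is surjective. -/
lemma length_ker_reduction : Module.length R (LinearMap.ker (Algebra.linearMap R R')) =
    Module.length O (LinearMap.ker (cotorsMap π (Algebra.linearMap O H))) := by
  obtain ⟨e, e', he⟩ := exists_cotors_square π hsR hkR hsH hkH
  rw [← Module.length_eq_of_surjective (S := O) hsR]
  refine LinearEquiv.length_eq
    { toFun := fun x => ⟨e.symm x.1, ?_⟩
      invFun := fun x => ⟨e x.1, ?_⟩
      left_inv := fun x => Subtype.ext (by simp)
      right_inv := fun x => Subtype.ext (by simp)
      map_add' := fun x y => Subtype.ext (by simp)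
      map_smul' := fun x y => Subtype.ext (by simp) }
  · rw [LinearMap.mem_ker]
    apply e'.injective
    rw [he, map_zero, LinearEquiv.apply_symm_apply]
    exact x.2
  · rw [LinearMap.mem_ker, Algebra.linearMap_apply, ← he, LinearMap.mem_ker.mp x.2, map_zero]

lemma length_coker_reduction :
    Module.length R (R' ⧸ LinearMap.range (Algebra.linearMap R R')) =
    Module.length O (cotors π H ⧸ LinearMap.range (cotorsMap π (Algebra.linearMap O H))) := by
  obtain ⟨e, e', he⟩ := exists_cotors_square π hsR hkR hsH hkH
  rw [← Module.length_eq_of_surjective (S := O) hsR]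
  have : (LinearMap.range (cotorsMap π (Algebra.linearMap O H))).map e'.toLinearMap =
      (LinearMap.range (Algebra.linearMap R R')).restrictScalars O := by
    ext y
    constructor
    · rintro ⟨_, ⟨x, rfl⟩, rfl⟩
      exact ⟨e x, (he x).symm⟩
    · rintro ⟨x, rfl⟩
      exact ⟨_, ⟨e.symm x, rfl⟩, by
        change e' _ = _
        rw [he, LinearEquiv.apply_symm_apply]; rfl⟩
  exact (Submodule.Quotient.equiv _ _ e' this).symm.length_eq

end

end Specialization

/-! ### Degrees of finite torsion-free domains over a principal ideal domain. -/

section PID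

open nonZeroDivisors

/-- The length of a finite torsion-free domain over a principal ideal domain modulo a prime
element is the degree of the field extension. -/
lemma length_cotors_eq_finrank {A D : Type*} [CommRing A] [IsDomain A] [IsPrincipalIdealRing A]
    [CommRing D] [IsDomain D] [Algebra A D] [Module.Finite A D] [FaithfulSMul A D]
    {π : A} (hπ : Prime π) (K L : Type*) [Field K] [Field L] [Algebra A K] [IsFractionRing A K]
    [Algebra D L] [IsFractionRing D L] [Algebra K L] [Algebra A L] [IsScalarTower A K L]
    [IsScalarTower A D L] :
    Module.length A (cotors π D) = Module.finrank K L := by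
  have : Module.IsTorsionFree A D := inferInstance
  -- A finite torsion-free module over a principal ideal domain is free. Its rank is the field
  -- degree, and each basis element contributes one copy of the simple module A/π.
  have : Module.Free A D := inferInstance
  have hr : Module.finrank K L = Module.finrank A D := IsFractionRing.finrank_eq A K D L
  let e : D ≃ₗ[A] (Fin (Module.finrank A D) → A) :=
    (Module.finBasis A D).equivFun
  rw [length_cotors_congr π e, hr]
  generalize Module.finrank A D = r
  let φ : (Fin r → A) →ₗ[A] (Fin r → A ⧸ Ideal.span {π}) :=
    (Submodule.mkQ (Ideal.span {π})).compLeft (Fin r)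
  have hφ : Function.Surjective φ := fun x => by
    choose y hy using fun i => Submodule.mkQ_surjective _ (x i)
    exact ⟨y, funext hy⟩
  have hk : LinearMap.range (LinearMap.lsmul A (Fin r → A) π) = LinearMap.ker φ := by
    ext x
    rw [LinearMap.mem_ker, funext_iff]
    have : ∀ i, φ x i = 0 ↔ ∃ a, x i = π * a := fun i => by
      change Submodule.Quotient.mk (x i) = 0 ↔ _
      rw [Submodule.Quotient.mk_eq_zero, Ideal.mem_span_singleton]; rfl
    constructor
    · rintro ⟨y, rfl⟩ i
      exact (this i).mpr ⟨y i, rfl⟩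
    · intro h
      choose y hy using fun i => (this i).mp (h i)
      exact ⟨y, funext fun i => (hy i).symm⟩
  have hs : Module.length A (A ⧸ Ideal.span {π}) = 1 := by
    rw [Module.length_eq_one_iff, isSimpleModule_iff_quot_maximal]
    have : (Ideal.span {π}).IsPrime := (Ideal.span_singleton_prime hπ.ne_zero).mpr hπ
    exact ⟨_, this.isMaximal (by rw [Ne, Ideal.span_singleton_eq_bot]; exact hπ.ne_zero),
      ⟨LinearEquiv.refl _ _⟩⟩
  rw [((Submodule.quotEquivOfEq _ _ hk).trans (LinearMap.quotKerEquivOfSurjective φ hφ)).length_eq,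
    Module.length_pi_of_fintype]
  simp [hs]

end PID

end DeltaFamily
end

/-! ### Local rings and residue fields of fibres over an affine base. -/

noncomputable section
namespace DeltaFamily

section FibreStalk

variable {A : Type u} [CommRing A] {X : Scheme.{u}} (f : X ⟶ Spec (CommRingCat.of A))

/-- The structure homomorphism of the sections of a scheme over `Spec A`. -/
def sectionsHom (U : X.Opens) : A →+* Γ(X, U) :=
  ((Scheme.ΓSpecIso (CommRingCat.of A)).inv ≫ f.appTop ≫ X.presheaf.map (homOfLE le_top).op).hom

/-- The structure homomorphism of the local rings of a scheme over `Spec A`. -/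
def stalkHom (x : X) : A →+* X.presheaf.stalk x :=
  ((Scheme.ΓSpecIso (CommRingCat.of A)).inv ≫ f.appTop ≫ X.presheaf.germ ⊤ x (Opens.mem_top x)).hom

lemma germ_sectionsHom (U : X.Opens) (x : X) (hx : x ∈ U) (a : A) :
    X.presheaf.germ U x hx (sectionsHom f U a) = stalkHom f x a := by
  simp only [sectionsHom, stalkHom, CommRingCat.hom_comp, RingHom.comp_apply]
  exact X.presheaf.germ_res_apply _ _ _ _

lemma stalkSpecializes_stalkHom {x y : X} (h : x ⤳ y) (a : A) :
    X.presheaf.stalkSpecializes h (stalkHom f y a) = stalkHom f x a := by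
  simp only [stalkHom, CommRingCat.hom_comp, RingHom.comp_apply]
  exact X.presheaf.germ_stalkSpecializes_apply _ h _

variable {Z : Scheme.{u}} (h : Z ⟶ X)

lemma app_sectionsHom (U : X.Opens) (a : A) :
    h.app U (sectionsHom f U a) = sectionsHom (h ≫ f) (h ⁻¹ᵁ U) a := by
  simp only [sectionsHom, CommRingCat.hom_comp, RingHom.comp_apply]
  rw [← CommRingCat.comp_apply, h.naturality]
  simp only [Scheme.Hom.comp_appTop, CommRingCat.hom_comp, RingHom.comp_apply]
  rfl

lemma stalkMap_stalkHom (z : Z) (a : A) :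
    h.stalkMap z (stalkHom f (h z) a) = stalkHom (h ≫ f) z a := by
  rw [← germ_sectionsHom f ⊤ (h z) (Opens.mem_top _), ← germ_sectionsHom (h ≫ f) ⊤ z (Opens.mem_top _),
    Scheme.Hom.germ_stalkMap_apply, app_sectionsHom]
  rfl

lemma fromSpecStalk_comp (x : X) :
    X.fromSpecStalk x ≫ f = Spec.map (CommRingCat.ofHom (stalkHom f x)) := by
  have h1 : f = X.toSpecΓ ≫ Spec.map ((Scheme.ΓSpecIso (CommRingCat.of A)).inv ≫ f.appTop) := by
    rw [Spec.map_comp, ← Scheme.toSpecΓ_naturality_assoc, ← SpecMap_ΓSpecIso_hom, ← Spec.map_comp]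
    simp
  conv_lhs => rw [h1]
  rw [Scheme.fromSpecStalk_toSpecΓ_assoc, ← Spec.map_comp]
  rfl

lemma comap_stalkHom_maximalIdeal (x : X) :
    (IsLocalRing.maximalIdeal (X.presheaf.stalk x)).comap (stalkHom f x) = (f x).asIdeal := by
  have h1 : (X.fromSpecStalk x ≫ f) (IsLocalRing.closedPoint (X.presheaf.stalk x)) = f x :=
    congrArg f Scheme.fromSpecStalk_closedPoint
  rw [← h1, fromSpecStalk_comp]
  rfl

lemma exists_eq_SpecMap_fromSpecStalk {Y : Scheme.{u}} {Q : CommRingCat.{u}} [IsLocalRing Q]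
    (j : Spec Q ⟶ Y) (y : Y) (hy : j (IsLocalRing.closedPoint Q) = y) :
    ∃ σ : Y.presheaf.stalk y ⟶ Q, j = Spec.map σ ≫ Y.fromSpecStalk y := by
  subst hy
  exact ⟨_, (Scheme.Spec_stalkClosedPointTo_fromSpecStalk j).symm⟩

/-- Morphisms from an affine scheme over `s` lift to the fibre over `s`. -/
lemma exists_lift_fiber {Q : CommRingCat.{u}} (j : Spec Q ⟶ X) (s : Spec (CommRingCat.of A))
    (φ : A →+* Q) (hφ : j ≫ f = Spec.map (CommRingCat.ofHom φ)) (h0 : s.asIdeal ≤ RingHom.ker φ)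
    (hu : ∀ a ∉ s.asIdeal, IsUnit (φ a)) : ∃ j' : Spec Q ⟶ f.fiber s, j' ≫ f.fiberι s = j := by
  have := s.isPrime
  let ψ : s.asIdeal.ResidueField →+* Q := Ideal.ResidueField.lift s.asIdeal φ h0 hu
  let g : Spec Q ⟶ Spec ((Spec (CommRingCat.of A)).residueField s) :=
    Spec.map ((Scheme.Spec.residueFieldIso (CommRingCat.of A) s).hom ≫ CommRingCat.ofHom ψ)
  refine ⟨pullback.lift j g ?_, pullback.lift_fst _ _ _⟩
  rw [hφ, ← Scheme.Spec.map_residueFieldIso_inv_eq_fromSpecResidueField, ← Spec.map_comp,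
    ← Spec.map_comp]
  congr 1
  rw [Category.assoc, Iso.inv_hom_id_assoc]
  ext a
  exact (Ideal.ResidueField.lift_algebraMap (I := s.asIdeal) φ h0 hu a).symm

lemma apply_fiberι (s : Spec (CommRingCat.of A)) (x : f.fiber s) : f (f.fiberι s x) = s := by
  have : f.fiberι s x ∈ Set.range (f.fiberι s) := ⟨x, rfl⟩
  rwa [f.range_fiberι] at this

instance (s : Spec (CommRingCat.of A)) : s.asIdeal.IsPrime := s.isPrime

/-- The homomorphism from `A` to the residue field of a point of `Spec A`. -/
def resHom (s : Spec (CommRingCat.of A)) : A →+* (Spec (CommRingCat.of A)).residueField s :=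
  (CommRingCat.ofHom (algebraMap A s.asIdeal.ResidueField) ≫
    (Scheme.Spec.residueFieldIso (CommRingCat.of A) s).inv).hom

lemma ker_resHom (s : Spec (CommRingCat.of A)) : RingHom.ker (resHom s) = s.asIdeal := by
  ext a
  have hinj := (ConcreteCategory.bijective_of_isIso
    (Scheme.Spec.residueFieldIso (CommRingCat.of A) s).inv).1
  rw [RingHom.mem_ker]
  change (Scheme.Spec.residueFieldIso (CommRingCat.of A) s).inv
    (algebraMap A s.asIdeal.ResidueField a) = 0 ↔ _
  rw [map_eq_zero_iff _ hinj, Ideal.algebraMap_residueField_eq_zero]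

lemma exists_eq_resHom_div (s : Spec (CommRingCat.of A))
    (z : (Spec (CommRingCat.of A)).residueField s) :
    ∃ a b : A, b ∉ s.asIdeal ∧ resHom s b * z = resHom s a := by
  let e := Scheme.Spec.residueFieldIso (CommRingCat.of A) s
  obtain ⟨⟨a, b⟩, hab⟩ := IsLocalization.surj (nonZeroDivisors (A ⧸ s.asIdeal)) (e.hom z)
  obtain ⟨a, rfl⟩ := Ideal.Quotient.mk_surjective a
  obtain ⟨b', hb'⟩ := Ideal.Quotient.mk_surjective b.1
  refine ⟨a, b', fun h => nonZeroDivisors.ne_zero b.2 ?_, ?_⟩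
  · rw [← hb']; exact Ideal.Quotient.eq_zero_iff_mem.mpr h
  · have hz : e.inv (e.hom z) = z := by
      rw [← CommRingCat.comp_apply, e.hom_inv_id]; rfl
    change e.inv (algebraMap A s.asIdeal.ResidueField b') * z =
      e.inv (algebraMap A s.asIdeal.ResidueField a)
    rw [← hz, ← map_mul]
    congr 1
    rw [mul_comm, IsScalarTower.algebraMap_apply A (A ⧸ s.asIdeal) s.asIdeal.ResidueField,
      IsScalarTower.algebraMap_apply A (A ⧸ s.asIdeal) s.asIdeal.ResidueField]
    rw [← hb'] at hab
    exact hab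

lemma fromSpecResidueField_eq (s : Spec (CommRingCat.of A)) :
    (Spec (CommRingCat.of A)).fromSpecResidueField s =
      Spec.map (CommRingCat.ofHom (resHom s)) := by
  rw [← Scheme.Spec.map_residueFieldIso_inv_eq_fromSpecResidueField, ← Spec.map_comp]
  rfl

/-- The residue field acts on the local rings of a fibre compatibly with the base ring. -/
lemma algebraMap_resHom (s : Spec (CommRingCat.of A)) (x : f.fiber s) (a : A) :
    algebraMap ((Spec (CommRingCat.of A)).residueField s) ((f.fiber s).presheaf.stalk x)
      (resHom s a) = stalkHom (f.fiberι s ≫ f) x a := by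
  have h1 : (Scheme.ΓSpecIso (CommRingCat.of A)).inv ≫ (f.fiberι s ≫ f).appTop =
      CommRingCat.ofHom (resHom s) ≫
        (Scheme.ΓSpecIso ((Spec (CommRingCat.of A)).residueField s)).inv ≫
        (f.fiberToSpecResidueField s).appTop := by
    rw [f.fiber_fac, Scheme.Hom.comp_appTop, fromSpecResidueField_eq,
      ← Scheme.ΓSpecIso_inv_naturality_assoc]
    rfl
  rw [stalkHom, ← Category.assoc, h1]
  rfl

lemma stalkHom_fiber_mem (s : Spec (CommRingCat.of A)) (x : f.fiber s) {a : A}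
    (ha : a ∈ s.asIdeal) : stalkHom (f.fiberι s ≫ f) x a = 0 := by
  rw [← algebraMap_resHom, RingHom.mem_ker.mp ((ker_resHom s).ge ha), map_zero]

/-- The local rings of a fibre. -/
lemma ker_stalkMap_fiberι (s : Spec (CommRingCat.of A)) (x : f.fiber s) :
    RingHom.ker ((f.fiberι s).stalkMap x).hom =
      s.asIdeal.map (stalkHom f (f.fiberι s x)) := by
  have hfx := apply_fiberι f s x
  have hcomap := comap_stalkHom_maximalIdeal f (f.fiberι s x)
  rw [hfx] at hcomap
  apply le_antisymm
  -- The spectrum of O/I maps to X over s, so it lifts to the fibre and sends its closed point to x.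
  -- Hence O → O/I factors through the local ring of the fibre, and the kernel of the stalk map is
  -- at most I.
  · let I := s.asIdeal.map (stalkHom f (f.fiberι s x))
    have hI : I ≤ IsLocalRing.maximalIdeal _ := by
      rw [Ideal.map_le_iff_le_comap, hcomap]
    have : Nontrivial (X.presheaf.stalk (f.fiberι s x) ⧸ I) :=
      Ideal.Quotient.nontrivial_iff.mpr fun h =>
        (IsLocalRing.maximalIdeal.isMaximal (X.presheaf.stalk (f.fiberι s x))).ne_top
          (top_le_iff.mp (h ▸ hI))
    have hloc : IsLocalRing (X.presheaf.stalk (f.fiberι s x) ⧸ I) :=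
      IsLocalRing.of_surjective' (Ideal.Quotient.mk I) Ideal.Quotient.mk_surjective
    let Q : CommRingCat := CommRingCat.of (X.presheaf.stalk (f.fiberι s x) ⧸ I)
    have hQ : IsLocalRing Q := hloc
    let q : X.presheaf.stalk (f.fiberι s x) ⟶ Q := CommRingCat.ofHom (Ideal.Quotient.mk I)
    let j : Spec Q ⟶ X := Spec.map q ≫ X.fromSpecStalk (f.fiberι s x)
    obtain ⟨j', hj'⟩ := exists_lift_fiber f j s ((Ideal.Quotient.mk I).comp (stalkHom f _))
      (by rw [Category.assoc, fromSpecStalk_comp, ← Spec.map_comp]; rfl)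
      (fun a ha => by
        rw [RingHom.mem_ker, RingHom.comp_apply, Ideal.Quotient.eq_zero_iff_mem]
        exact Ideal.mem_map_of_mem _ ha)
      (fun a ha => by
        refine IsUnit.map (Ideal.Quotient.mk I) ?_
        rw [← hcomap, Ideal.mem_comap, IsLocalRing.mem_maximalIdeal, mem_nonunits_iff,
          not_not] at ha
        exact ha)
    have hcl : j (IsLocalRing.closedPoint Q) = f.fiberι s x := by
      have : IsLocalHom q.hom := Function.Surjective.isLocalHom _ Ideal.Quotient.mk_surjective
      have h2 : Spec.map q (IsLocalRing.closedPoint Q) = IsLocalRing.closedPoint _ :=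
        IsLocalRing.comap_closedPoint q.hom
      exact (congrArg (X.fromSpecStalk (f.fiberι s x)) h2).trans Scheme.fromSpecStalk_closedPoint
    have hjx : j' (IsLocalRing.closedPoint Q) = x := by
      apply (f.fiberι s).isEmbedding.injective
      refine Eq.trans ?_ hcl
      rw [← hj']
      rfl
    obtain ⟨σ, hσ⟩ := exists_eq_SpecMap_fromSpecStalk j' x hjx
    have h3 : Spec.map ((f.fiberι s).stalkMap x ≫ σ) = Spec.map q := by
      rw [← cancel_mono (X.fromSpecStalk (f.fiberι s x)), Spec.map_comp, Category.assoc,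
        Scheme.SpecMap_stalkMap_fromSpecStalk, ← Category.assoc, ← hσ, hj']
    have h4 := Spec.map_injective h3
    intro a ha
    have h5 : q a = σ ((f.fiberι s).stalkMap x a) := by rw [← h4]; rfl
    rw [RingHom.mem_ker] at ha
    rw [ha, map_zero] at h5
    exact Ideal.Quotient.eq_zero_iff_mem.mp h5
  · rw [Ideal.map_le_iff_le_comap]
    intro a ha
    rw [Ideal.mem_comap, RingHom.mem_ker, ← stalkHom_fiber_mem f s x ha, ← stalkMap_stalkHom]

lemma surjective_stalkMap_fiberι (s : Spec (CommRingCat.of A)) (x : f.fiber s) :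
    Function.Surjective ((f.fiberι s).stalkMap x) :=
  (f.fiberι s).stalkMap_surjective x

end FibreStalk

/-! ### Primes of a local ring as generizations of the point. -/

section Generizations

open IsLocalRing

lemma isLocalization_atPrime_of_tower {G S T : Type*} [CommRing G] [CommRing S] [CommRing T]
    [Algebra G S] [Algebra S T] [Algebra G T] [IsScalarTower G S T] (M : Submonoid G)
    [IsLocalization M S] (P : Ideal S) [P.IsPrime]
    [IsLocalization.AtPrime T (P.comap (algebraMap G S))] : IsLocalization.AtPrime T P := by
  have := IsLocalization.isLocalization_isLocalization_atPrime_isLocalization M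
    (Localization.AtPrime P) P
  let e : Localization.AtPrime P ≃ₐ[G] T :=
    IsLocalization.algEquiv (P.comap (algebraMap G S)).primeCompl _ _
  have h : (e.toRingEquiv.toRingHom.comp (algebraMap S (Localization.AtPrime P))) =
      algebraMap S T := by
    refine IsLocalization.ringHom_ext M ?_
    ext g
    simp only [RingHom.comp_apply, ← IsScalarTower.algebraMap_apply]
    exact e.commutes g
  let e' : Localization.AtPrime P ≃ₐ[S] T :=
    AlgEquiv.ofRingEquiv (f := e.toRingEquiv) fun s => DFunLike.congr_fun h s
  exact IsLocalization.isLocalization_of_algEquiv P.primeCompl e'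

variable {Y : Scheme.{u}}

/-- The prime ideal of a local ring corresponding to a generization. -/
def genIdeal {x w : Y} (h : w ⤳ x) : Ideal (Y.presheaf.stalk x) :=
  (maximalIdeal (Y.presheaf.stalk w)).comap (Y.presheaf.stalkSpecializes h).hom

instance {x w : Y} (h : w ⤳ x) : (genIdeal h).IsPrime := Ideal.IsPrime.comap _

lemma fromSpecStalk_genIdeal {x w : Y} (h : w ⤳ x) :
    Y.fromSpecStalk x (⟨genIdeal h, inferInstance⟩ : PrimeSpectrum (Y.presheaf.stalk x)) = w := by
  have h1 : (Spec.map (Y.presheaf.stalkSpecializes h) ≫ Y.fromSpecStalk x)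
      (closedPoint (Y.presheaf.stalk w)) = w := by
    rw [Scheme.SpecMap_stalkSpecializes_fromSpecStalk]
    exact Scheme.fromSpecStalk_closedPoint
  exact h1

/-- The spectrum of the local ring embeds in the scheme with image the set of generizations of `x`;
ring-theoretic conditions on primes become conditions on points. -/
lemma exists_eq_genIdeal (x : Y) (P : Ideal (Y.presheaf.stalk x)) [hP : P.IsPrime] :
    ∃ (w : Y) (h : w ⤳ x), P = genIdeal h := by
  let w := Y.fromSpecStalk x (⟨P, hP⟩ : PrimeSpectrum (Y.presheaf.stalk x))
  have hw : w ∈ Set.range (Y.fromSpecStalk x) := ⟨_, rfl⟩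
  rw [Scheme.range_fromSpecStalk] at hw
  refine ⟨w, hw, ?_⟩
  have := (Y.fromSpecStalk x).isEmbedding.injective (fromSpecStalk_genIdeal (Y := Y) hw)
  exact (congrArg PrimeSpectrum.asIdeal this).symm

lemma genIdeal_refl (x : Y) : genIdeal (specializes_refl x) = maximalIdeal _ := by
  rw [genIdeal, Y.presheaf.stalkSpecializes_refl]
  exact Ideal.comap_id _

lemma genIdeal_eq_maximalIdeal_iff {x w : Y} (h : w ⤳ x) :
    genIdeal h = maximalIdeal _ ↔ w = x := by
  constructor
  · intro heq
    have e : (⟨genIdeal h, inferInstance⟩ : PrimeSpectrum (Y.presheaf.stalk x)) =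
        ⟨genIdeal (specializes_refl x), inferInstance⟩ :=
      PrimeSpectrum.ext (heq.trans (genIdeal_refl x).symm)
    exact (fromSpecStalk_genIdeal h).symm.trans
      ((congrArg (Y.fromSpecStalk x) e).trans (fromSpecStalk_genIdeal (specializes_refl x)))
  · rintro rfl
    exact genIdeal_refl w

/-- The local ring at a generization is a localization. -/
lemma isLocalization_stalkSpecializes {x w : Y} (h : w ⤳ x) :
    letI := (Y.presheaf.stalkSpecializes h).hom.toAlgebra
    IsLocalization.AtPrime (Y.presheaf.stalk w) (genIdeal h) := by
  obtain ⟨_, ⟨U, hU, rfl⟩, hxU, -⟩ :=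
    Y.isBasis_affineOpens.exists_subset_of_mem_open (Set.mem_univ x) isOpen_univ
  have hwU : w ∈ U := h.mem_open U.2 hxU
  let _ := (Y.presheaf.stalkSpecializes h).hom.toAlgebra
  let _ : Algebra Γ(Y, U) (Y.presheaf.stalk x) := (Y.presheaf.germ U x hxU).hom.toAlgebra
  let _ : Algebra Γ(Y, U) (Y.presheaf.stalk w) := (Y.presheaf.germ U w hwU).hom.toAlgebra
  have ht : IsScalarTower Γ(Y, U) (Y.presheaf.stalk x) (Y.presheaf.stalk w) :=
    IsScalarTower.of_algebraMap_eq fun g =>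
      (Y.presheaf.germ_stalkSpecializes_apply _ h g).symm
  have l1 : IsLocalization.AtPrime (Y.presheaf.stalk x) (hU.primeIdealOf ⟨x, hxU⟩).asIdeal :=
    hU.isLocalization_stalk ⟨x, hxU⟩
  have l2 : IsLocalization.AtPrime (Y.presheaf.stalk w) (hU.primeIdealOf ⟨w, hwU⟩).asIdeal :=
    hU.isLocalization_stalk ⟨w, hwU⟩
  have hc : (genIdeal h).comap (algebraMap Γ(Y, U) (Y.presheaf.stalk x)) =
      (hU.primeIdealOf ⟨w, hwU⟩).asIdeal := by
    rw [← IsLocalization.AtPrime.under_maximalIdeal (Y.presheaf.stalk w)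
      (hU.primeIdealOf ⟨w, hwU⟩).asIdeal, genIdeal, Ideal.comap_comap, Ideal.under_def,
      IsScalarTower.algebraMap_eq Γ(Y, U) (Y.presheaf.stalk x) (Y.presheaf.stalk w)]
    rfl
  have l3 : IsLocalization.AtPrime (Y.presheaf.stalk w)
      ((genIdeal h).comap (algebraMap Γ(Y, U) (Y.presheaf.stalk x))) := by
    rw [IsLocalization.AtPrime]
    convert l2
  exact isLocalization_atPrime_of_tower (G := Γ(Y, U)) (hU.primeIdealOf ⟨x, hxU⟩).asIdeal.primeCompl
    (genIdeal h)

lemma puncturedNormal_stalk {x : Y} (hx : ∀ w, w ⤳ x → w ≠ x → NormalAt Y w) :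
    PuncturedNormal (Y.presheaf.stalk x) := by
  intro q _ hq
  obtain ⟨w, h, rfl⟩ := exists_eq_genIdeal x q
  let _ := (Y.presheaf.stalkSpecializes h).hom.toAlgebra
  have := isLocalization_stalkSpecializes h
  exact isNormalDomain_of_isLocalization_atPrime (q := genIdeal h) (S := Y.presheaf.stalk w)
    (hx w h fun e => hq ((genIdeal_eq_maximalIdeal_iff h).mpr e))

lemma normalAt_of_specializes {x w : Y} (h : w ⤳ x) (hx : NormalAt Y x) : NormalAt Y w := by
  let _ := (Y.presheaf.stalkSpecializes h).hom.toAlgebra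
  have := isLocalization_stalkSpecializes h
  have := hx.1
  have := hx.2
  have hle : (genIdeal h).primeCompl ≤ nonZeroDivisors (Y.presheaf.stalk x) :=
    Ideal.primeCompl_le_nonZeroDivisors _
  exact ⟨IsLocalization.isDomain_of_le_nonZeroDivisors _ hle,
    isIntegrallyClosed_of_isLocalization _ _ hle⟩

lemma maximalIdeal_mem_minimalPrimes_stalk_iff (x : Y) :
    maximalIdeal (Y.presheaf.stalk x) ∈ minimalPrimes (Y.presheaf.stalk x) ↔
      ∀ w, w ⤳ x → w = x := by
  constructor
  · intro hmin w h
    rw [← genIdeal_eq_maximalIdeal_iff h]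
    exact le_antisymm (le_maximalIdeal (Ideal.IsPrime.ne_top inferInstance))
      (hmin.2 ⟨inferInstance, bot_le⟩ (le_maximalIdeal (Ideal.IsPrime.ne_top inferInstance)))
  · intro hx
    refine ⟨⟨inferInstance, bot_le⟩, fun q hq _ => ?_⟩
    have := hq.1
    obtain ⟨w, h, rfl⟩ := exists_eq_genIdeal x q
    exact ((genIdeal_eq_maximalIdeal_iff h).mpr (hx w h)).ge

end Generizations

end DeltaFamily
end

/-! ### Stalks of the direct image of the structure sheaf along an affine morphism. -/

noncomputable section
namespace DeltaFamily

section PushStalk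

open IsLocalRing Opposite

lemma exists_isAffineOpen_mem {X : Scheme.{u}} (x : X) :
    ∃ U : X.Opens, IsAffineOpen U ∧ x ∈ U := by
  obtain ⟨_, ⟨U, hU, rfl⟩, hx, -⟩ :=
    X.isBasis_affineOpens.exists_subset_of_mem_open (Set.mem_univ x) isOpen_univ
  exact ⟨U, hU, hx⟩

variable {X Z : Scheme.{u}} (h : Z ⟶ X)

/-- The direct image of the structure presheaf. -/
def pushPresheaf : TopCat.Presheaf CommRingCat.{u} X :=
  (TopCat.Presheaf.pushforward CommRingCat h.base).obj Z.presheaf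

/-- The stalks of the direct image of the structure sheaf. -/
def pushStalk (x : X) : CommRingCat.{u} := (pushPresheaf h).stalk x

/-- The germs of the sections of the direct image of the structure sheaf. -/
def pushGerm (U : X.Opens) (x : X) (hx : x ∈ U) : Γ(Z, h ⁻¹ᵁ U) ⟶ pushStalk h x :=
  (pushPresheaf h).germ U x hx

/-- The homomorphism from the local ring to the stalk of the direct image. -/
def pushMap (x : X) : X.presheaf.stalk x ⟶ pushStalk h x :=
  (TopCat.Presheaf.stalkFunctor CommRingCat.{u} x).map h.c

lemma pushMap_germ (U : X.Opens) (x : X) (hx : x ∈ U) (g : Γ(X, U)) :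
    pushMap h x (X.presheaf.germ U x hx g) = pushGerm h U x hx (h.app U g) :=
  TopCat.Presheaf.stalkFunctor_map_germ_apply U x hx h.c g

lemma pushGerm_res {U W : X.Opens} (i : W ≤ U) (x : X) (hx : x ∈ W) (c : Γ(Z, h ⁻¹ᵁ U)) :
    pushGerm h W x hx (Z.presheaf.map (homOfLE (h.preimage_mono i)).op c) =
      pushGerm h U x (i hx) c :=
  (pushPresheaf h).germ_res_apply (homOfLE i) x hx c

lemma exists_le_pushGerm_eq {x : X} (y : pushStalk h x) {W : X.Opens} (hW : x ∈ W) :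
    ∃ (U : X.Opens) (_ : U ≤ W) (hx : x ∈ U) (c : Γ(Z, h ⁻¹ᵁ U)), pushGerm h U x hx c = y := by
  obtain ⟨U, i, hx, c, hc⟩ := (pushPresheaf h).exists_le_germ_eq y hW
  exact ⟨U, i, hx, c, hc⟩

lemma exists_res_eq_of_pushGerm_eq {U : X.Opens} {x : X} (hx : x ∈ U) (c c' : Γ(Z, h ⁻¹ᵁ U))
    (hc : pushGerm h U x hx c = pushGerm h U x hx c') :
    ∃ (W : X.Opens) (i : W ≤ U), x ∈ W ∧
      Z.presheaf.map (homOfLE (h.preimage_mono i)).op c =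
        Z.presheaf.map (homOfLE (h.preimage_mono i)).op c' := by
  obtain ⟨W, hxW, i, i', e⟩ := (pushPresheaf h).germ_eq x hx hx c c' hc
  exact ⟨W, i.le, hxW, e⟩

/-- The specialization maps of the direct image. -/
def pushSpec {w x : X} (hwx : w ⤳ x) : pushStalk h x ⟶ pushStalk h w :=
  (pushPresheaf h).stalkSpecializes hwx

lemma pushSpec_pushGerm {w x : X} (hwx : w ⤳ x) {U : X.Opens} (hx : x ∈ U) (c : Γ(Z, h ⁻¹ᵁ U)) :
    pushSpec h hwx (pushGerm h U x hx c) = pushGerm h U w (hwx.mem_open U.2 hx) c :=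
  (pushPresheaf h).germ_stalkSpecializes_apply hx hwx c

lemma pushSpec_pushMap {w x : X} (hwx : w ⤳ x) (r : X.presheaf.stalk x) :
    pushSpec h hwx (pushMap h x r) = pushMap h w (X.presheaf.stalkSpecializes hwx r) := by
  obtain ⟨U, hx, g, rfl⟩ := X.presheaf.exists_germ_eq r
  rw [pushMap_germ, pushSpec_pushGerm, X.presheaf.germ_stalkSpecializes_apply, pushMap_germ]

/-- The homomorphism from the stalk of the direct image to a local ring. -/
def toStalk {z : Z} {x : X} (hz : h z ⤳ x) : pushStalk h x ⟶ Z.presheaf.stalk z :=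
  pushSpec h hz ≫ Z.presheaf.stalkPushforward CommRingCat h.base z

lemma toStalk_pushGerm {z : Z} {x : X} (hz : h z ⤳ x) (U : X.Opens) (hx : x ∈ U)
    (c : Γ(Z, h ⁻¹ᵁ U)) :
    toStalk h hz (pushGerm h U x hx c) =
      Z.presheaf.germ (h ⁻¹ᵁ U) z (hz.mem_open U.2 hx) c := by
  refine (congrArg (Z.presheaf.stalkPushforward CommRingCat h.base z)
    (pushSpec_pushGerm h hz hx c)).trans ?_
  exact CategoryTheory.ConcreteCategory.congr_hom (TopCat.Presheaf.stalkPushforward_germ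
    CommRingCat h.base Z.presheaf U z (hz.mem_open U.2 hx)) c

lemma toStalk_pushMap {z : Z} {x : X} (hz : h z ⤳ x) (r : X.presheaf.stalk x) :
    toStalk h hz (pushMap h x r) = h.stalkMap z (X.presheaf.stalkSpecializes hz r) := by
  obtain ⟨U, hx, g, rfl⟩ := X.presheaf.exists_germ_eq r
  rw [pushMap_germ, toStalk_pushGerm, X.presheaf.germ_stalkSpecializes_apply,
    Scheme.Hom.germ_stalkMap_apply]

instance (x : X) : Algebra (X.presheaf.stalk x) (pushStalk h x) := (pushMap h x).hom.toAlgebra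

lemma mem_primeCompl_primeIdealOf_iff {Y : Scheme.{u}} {U : Y.Opens} (hU : IsAffineOpen U) {x : Y}
    (hx : x ∈ U) (g : Γ(Y, U)) : g ∈ (hU.primeIdealOf ⟨x, hx⟩).asIdeal.primeCompl ↔
      IsUnit (Y.presheaf.germ U x hx g) := by
  let _ := (Y.presheaf.germ U x hx).hom.toAlgebra
  have : IsLocalization.AtPrime (Y.presheaf.stalk x) (hU.primeIdealOf ⟨x, hx⟩).asIdeal :=
    hU.isLocalization_stalk ⟨x, hx⟩
  exact (IsLocalization.AtPrime.isUnit_to_map_iff (Y.presheaf.stalk x) _ g).symm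

lemma comap_germ_maximalIdeal {Y : Scheme.{u}} {U : Y.Opens} (hU : IsAffineOpen U) {x : Y}
    (hx : x ∈ U) : (maximalIdeal (Y.presheaf.stalk x)).comap (Y.presheaf.germ U x hx).hom =
      (hU.primeIdealOf ⟨x, hx⟩).asIdeal := by
  ext g
  rw [← not_iff_not, Ideal.mem_comap, mem_maximalIdeal, mem_nonunits_iff, not_not]
  exact (mem_primeCompl_primeIdealOf_iff hU hx g).symm

variable [IsAffineHom h] {U : X.Opens} (hU : IsAffineOpen U) {x : X} (hx : x ∈ U)

include hU in
/-- The stalks of the direct image along an affine morphism are localizations. -/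
lemma isLocalization_pushStalk :
    letI := (h.app U).hom.toAlgebra
    letI := (pushGerm h U x hx).hom.toAlgebra
    IsLocalization (Algebra.algebraMapSubmonoid Γ(Z, h ⁻¹ᵁ U)
      (hU.primeIdealOf ⟨x, hx⟩).asIdeal.primeCompl) (pushStalk h x) := by
  let _ := (h.app U).hom.toAlgebra
  let _ := (pushGerm h U x hx).hom.toAlgebra
  have hZ : IsAffineOpen (h ⁻¹ᵁ U) := hU.preimage h
  have hmem : ∀ g : Γ(X, U), g ∈ (hU.primeIdealOf ⟨x, hx⟩).asIdeal.primeCompl ↔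
      x ∈ X.basicOpen g := fun g => by
    rw [X.mem_basicOpen g x hx, mem_primeCompl_primeIdealOf_iff]
  have hbas : ∀ W : X.Opens, x ∈ W → ∃ g : Γ(X, U), x ∈ X.basicOpen g ∧ X.basicOpen g ≤ W := by
    intro W hxW
    obtain ⟨g, hg, hxg⟩ := hU.exists_basicOpen_le ⟨x, hxW⟩ hx
    exact ⟨g, hxg, hg⟩
  -- Basic open subsets of `U` form a basis of neighbourhoods of x, and their preimages are basic
  -- open in the affine preimage of `U`. So every germ of the direct image is a fraction with
  -- denominator a power of some `h.app U g`.
  have hloc : ∀ g : Γ(X, U), letI := (Z.presheaf.map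
      (homOfLE (h.preimage_mono (X.basicOpen_le g))).op).hom.toAlgebra
      IsLocalization.Away (h.app U g) Γ(Z, h ⁻¹ᵁ X.basicOpen g) := fun g =>
    hZ.isLocalization_of_eq_basicOpen (h.app U g) (homOfLE (h.preimage_mono (X.basicOpen_le g)))
      (Scheme.preimage_basicOpen h g)
  refine ⟨?_, ?_, ?_⟩
  · rintro ⟨_, g, hg, rfl⟩
    have hu : IsUnit (X.presheaf.germ U x hx g) := by
      rwa [← X.mem_basicOpen g x hx, ← hmem]
    have := hu.map (pushMap h x).hom
    change IsUnit (pushMap h x (X.presheaf.germ U x hx g)) at this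
    rwa [pushMap_germ] at this
  · intro y
    obtain ⟨W, hWU, hxW, c, rfl⟩ := exists_le_pushGerm_eq h y hx
    obtain ⟨g, hxg, hg⟩ := hbas W hxW
    let _ := (Z.presheaf.map (homOfLE (h.preimage_mono (X.basicOpen_le g))).op).hom.toAlgebra
    have := hloc g
    obtain ⟨⟨d, _, n, rfl⟩, hd⟩ := IsLocalization.surj (Submonoid.powers (h.app U g))
      (Z.presheaf.map (homOfLE (h.preimage_mono hg)).op c)
    refine ⟨⟨d, (h.app U g) ^ n, g ^ n,
      pow_mem ((hmem g).mpr hxg) n, map_pow _ _ _⟩, ?_⟩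
    have h1 := congrArg (pushGerm h (X.basicOpen g) x hxg) hd
    rw [map_mul, pushGerm_res h hg] at h1
    change _ * pushGerm h _ x hxg (Z.presheaf.map
      (homOfLE (h.preimage_mono (X.basicOpen_le g))).op _) =
      pushGerm h _ x hxg (Z.presheaf.map
        (homOfLE (h.preimage_mono (X.basicOpen_le g))).op _) at h1
    rw [pushGerm_res h (X.basicOpen_le g), pushGerm_res h (X.basicOpen_le g)] at h1
    have h2 : pushGerm h W x hxW c * pushGerm h U x hx ((h.app U g) ^ n) =
      pushGerm h U x hx d := h1
    exact h2
  · intro c d hcd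
    obtain ⟨W, hWU, hxW, e⟩ := exists_res_eq_of_pushGerm_eq h hx c d hcd
    obtain ⟨g, hxg, hg⟩ := hbas W hxW
    let _ := (Z.presheaf.map (homOfLE (h.preimage_mono (X.basicOpen_le g))).op).hom.toAlgebra
    have := hloc g
    have e' : Z.presheaf.map (homOfLE (h.preimage_mono (X.basicOpen_le g))).op c =
        Z.presheaf.map (homOfLE (h.preimage_mono (X.basicOpen_le g))).op d := by
      have := congrArg (Z.presheaf.map (homOfLE (h.preimage_mono hg)).op) e
      rw [← CommRingCat.comp_apply, ← CommRingCat.comp_apply, ← Z.presheaf.map_comp] at this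
      exact this
    obtain ⟨⟨_, n, rfl⟩, hn⟩ :=
      (IsLocalization.eq_iff_exists (Submonoid.powers (h.app U g)) _).mp e'
    exact ⟨⟨(h.app U g) ^ n, g ^ n, pow_mem ((hmem g).mpr hxg) n, map_pow _ _ _⟩, hn⟩

/-- The direct image of the structure sheaf is quasi-coherent. -/
lemma isLocalization_pushSpec {w : X} (hwx : w ⤳ x) :
    letI := (pushSpec h hwx).hom.toAlgebra
    IsLocalization (Algebra.algebraMapSubmonoid (pushStalk h x) (genIdeal hwx).primeCompl)
      (pushStalk h w) := by
  obtain ⟨U, hU, hx⟩ := exists_isAffineOpen_mem x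
  have hw : w ∈ U := hwx.mem_open U.2 hx
  let _ := (h.app U).hom.toAlgebra
  let _ := (pushGerm h U x hx).hom.toAlgebra
  let _ := (pushGerm h U w hw).hom.toAlgebra
  let _ := (pushSpec h hwx).hom.toAlgebra
  have lx := isLocalization_pushStalk h hU hx
  have lw := isLocalization_pushStalk h hU hw
  have : IsScalarTower Γ(Z, h ⁻¹ᵁ U) (pushStalk h x) (pushStalk h w) :=
    IsScalarTower.of_algebraMap_eq fun c => (pushSpec_pushGerm h hwx hx c).symm
  have hle : Algebra.algebraMapSubmonoid Γ(Z, h ⁻¹ᵁ U)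
      (hU.primeIdealOf ⟨x, hx⟩).asIdeal.primeCompl ≤
      Algebra.algebraMapSubmonoid Γ(Z, h ⁻¹ᵁ U) (hU.primeIdealOf ⟨w, hw⟩).asIdeal.primeCompl := by
    rintro _ ⟨g, hg, rfl⟩
    refine ⟨g, ?_, rfl⟩
    change g ∈ (hU.primeIdealOf ⟨x, hx⟩).asIdeal.primeCompl at hg
    change g ∈ (hU.primeIdealOf ⟨w, hw⟩).asIdeal.primeCompl
    rw [mem_primeCompl_primeIdealOf_iff] at hg ⊢
    have := hg.map (X.presheaf.stalkSpecializes hwx).hom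
    change IsUnit (X.presheaf.stalkSpecializes hwx (X.presheaf.germ U x hx g)) at this
    rwa [X.presheaf.germ_stalkSpecializes_apply] at this
  have l := IsLocalization.isLocalization_of_submonoid_le (pushStalk h x) (pushStalk h w) _ _ hle
  -- Inverting the elements that come from sections over `U` is enough: the remaining elements
  -- outside the prime are already units in the target.
  refine IsLocalization.of_le ((Algebra.algebraMapSubmonoid
    Γ(Z, h ⁻¹ᵁ U) (hU.primeIdealOf ⟨w, hw⟩).asIdeal.primeCompl).map
      (algebraMap Γ(Z, h ⁻¹ᵁ U) (pushStalk h x))) _ ?_ ?_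
  · rintro _ ⟨_, ⟨g, hg, rfl⟩, rfl⟩
    refine ⟨X.presheaf.germ U x hx g, ?_, pushMap_germ h U x hx g⟩
    have hu := (mem_primeCompl_primeIdealOf_iff hU hw g).mp hg
    intro hm
    change X.presheaf.stalkSpecializes hwx (X.presheaf.germ U x hx g) ∈ maximalIdeal _ at hm
    rw [X.presheaf.germ_stalkSpecializes_apply] at hm
    exact hm hu
  · rintro _ ⟨r, hr, rfl⟩
    have hu : IsUnit (X.presheaf.stalkSpecializes hwx r) := not_not.mp hr
    have := hu.map (pushMap h w).hom
    change IsUnit (pushMap h w _) at this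
    rwa [← pushSpec_pushMap] at this

/-- The prime ideal of the stalk of the direct image corresponding to a point. -/
def pushIdeal {z : Z} {x : X} (hz : h z ⤳ x) : Ideal (pushStalk h x) :=
  (maximalIdeal (Z.presheaf.stalk z)).comap (toStalk h hz).hom

instance {z : Z} {x : X} (hz : h z ⤳ x) : (pushIdeal h hz).IsPrime := Ideal.IsPrime.comap _

lemma comap_pushGerm_pushIdeal {z : Z} {x : X} (hz : h z ⤳ x) {U : X.Opens} (hU : IsAffineOpen U)
    (hx : x ∈ U) (hzU : z ∈ h ⁻¹ᵁ U) : (pushIdeal h hz).comap (pushGerm h U x hx).hom =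
      ((hU.preimage h).primeIdealOf ⟨z, hzU⟩).asIdeal := by
  rw [← comap_germ_maximalIdeal]
  ext c
  change toStalk h hz (pushGerm h U x hx c) ∈ maximalIdeal _ ↔
    Z.presheaf.germ (h ⁻¹ᵁ U) z hzU c ∈ maximalIdeal _
  rw [toStalk_pushGerm]

lemma isLocalization_toStalk {z : Z} {x : X} (hz : h z ⤳ x) :
    letI := (toStalk h hz).hom.toAlgebra
    IsLocalization.AtPrime (Z.presheaf.stalk z) (pushIdeal h hz) := by
  obtain ⟨U, hU, hx⟩ := exists_isAffineOpen_mem x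
  have hzU : z ∈ h ⁻¹ᵁ U := hz.mem_open U.2 hx
  let _ := (h.app U).hom.toAlgebra
  let _ := (pushGerm h U x hx).hom.toAlgebra
  let _ := (toStalk h hz).hom.toAlgebra
  let _ : Algebra Γ(Z, h ⁻¹ᵁ U) (Z.presheaf.stalk z) := (Z.presheaf.germ _ z hzU).hom.toAlgebra
  have lx := isLocalization_pushStalk h hU hx
  have : IsScalarTower Γ(Z, h ⁻¹ᵁ U) (pushStalk h x) (Z.presheaf.stalk z) :=
    IsScalarTower.of_algebraMap_eq fun c => (toStalk_pushGerm h hz U hx c).symm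
  have l2 : IsLocalization.AtPrime (Z.presheaf.stalk z)
      ((hU.preimage h).primeIdealOf ⟨z, hzU⟩).asIdeal :=
    (hU.preimage h).isLocalization_stalk ⟨z, hzU⟩
  have hc : (pushIdeal h hz).comap (algebraMap Γ(Z, h ⁻¹ᵁ U) (pushStalk h x)) =
      ((hU.preimage h).primeIdealOf ⟨z, hzU⟩).asIdeal := comap_pushGerm_pushIdeal h hz hU hx hzU
  have l3 : IsLocalization.AtPrime (Z.presheaf.stalk z)
      ((pushIdeal h hz).comap (algebraMap Γ(Z, h ⁻¹ᵁ U) (pushStalk h x))) := by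
    rw [IsLocalization.AtPrime]
    convert l2
  exact isLocalization_atPrime_of_tower (G := Γ(Z, h ⁻¹ᵁ U))
    (Algebra.algebraMapSubmonoid Γ(Z, h ⁻¹ᵁ U) (hU.primeIdealOf ⟨x, hx⟩).asIdeal.primeCompl)
    (pushIdeal h hz)

/-- The prime contracts to the prime of the affine preimage of `U` that corresponds to the point. -/
lemma pushIdeal_injective {z z' : Z} {x : X} (hz : h z ⤳ x) (hz' : h z' ⤳ x)
    (he : pushIdeal h hz = pushIdeal h hz') : z = z' := by
  obtain ⟨U, hU, hx⟩ := exists_isAffineOpen_mem x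
  have hzU : z ∈ h ⁻¹ᵁ U := hz.mem_open U.2 hx
  have hzU' : z' ∈ h ⁻¹ᵁ U := hz'.mem_open U.2 hx
  have h1 := comap_pushGerm_pushIdeal h hz hU hx hzU
  rw [he, comap_pushGerm_pushIdeal h hz' hU hx hzU'] at h1
  have h2 := congrArg (hU.preimage h).fromSpec (PrimeSpectrum.ext h1)
  exact (((hU.preimage h).fromSpec_primeIdealOf ⟨z', hzU'⟩).symm.trans
    (h2.trans ((hU.preimage h).fromSpec_primeIdealOf ⟨z, hzU⟩))).symm

/-- Contracting `I` to the sections over the affine preimage of `U` gives a point of `Z`. So the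
primes of the stalk lying over the maximal ideal enumerate the points of `Z` over x. -/
lemma exists_eq_pushIdeal {x : X} (I : Ideal (pushStalk h x)) [I.IsPrime]
    (hI : I.comap (pushMap h x).hom = maximalIdeal _) :
    ∃ (z : Z) (hz : h z = x), I = pushIdeal h (specializes_of_eq hz) := by
  obtain ⟨U, hU, hx⟩ := exists_isAffineOpen_mem x
  let _ := (h.app U).hom.toAlgebra
  let _ := (pushGerm h U x hx).hom.toAlgebra
  have lx := isLocalization_pushStalk h hU hx
  let P : PrimeSpectrum Γ(Z, h ⁻¹ᵁ U) := ⟨I.comap (pushGerm h U x hx).hom, inferInstance⟩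
  let z : Z := (hU.preimage h).fromSpec P
  have hzU : z ∈ h ⁻¹ᵁ U := by
    have : z ∈ Set.range (hU.preimage h).fromSpec := ⟨P, rfl⟩
    rwa [(hU.preimage h).range_fromSpec] at this
  have hP : (hU.preimage h).primeIdealOf ⟨z, hzU⟩ = P :=
    (hU.preimage h).fromSpec.isOpenEmbedding.injective
      ((hU.preimage h).fromSpec_primeIdealOf ⟨z, hzU⟩)
  have hz' : h z ∈ U := hzU
  -- Both points have the same prime in `U`: stalk maps are local, so units at `h z` are detected at
  -- `z`, that is by `I`, which lies over the maximal ideal at x.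
  have hz : h z = x := by
    have h1 : (hU.primeIdealOf ⟨h z, hz'⟩).asIdeal = (hU.primeIdealOf ⟨x, hx⟩).asIdeal := by
      rw [← comap_germ_maximalIdeal hU hx, ← hI]
      ext g
      rw [← not_iff_not]
      change g ∈ (hU.primeIdealOf ⟨h z, hz'⟩).asIdeal.primeCompl ↔
        ¬ (pushMap h x (X.presheaf.germ U x hx g) ∈ I)
      rw [mem_primeCompl_primeIdealOf_iff, pushMap_germ]
      have h2 : IsUnit (X.presheaf.germ U (h z) hz' g) ↔
          IsUnit (Z.presheaf.germ (h ⁻¹ᵁ U) z hzU (h.app U g)) := by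
        have h3 : h.stalkMap z (X.presheaf.germ U (h z) hz' g) =
          Z.presheaf.germ (h ⁻¹ᵁ U) z hzU (h.app U g) := Scheme.Hom.germ_stalkMap_apply h U z hz' g
        rw [← h3]
        exact (isUnit_map_iff (h.stalkMap z).hom _).symm
      rw [h2, ← mem_primeCompl_primeIdealOf_iff (hU.preimage h), hP]
      rfl
    exact (hU.fromSpec_primeIdealOf ⟨h z, hz'⟩).symm.trans
      ((congrArg hU.fromSpec (PrimeSpectrum.ext h1)).trans (hU.fromSpec_primeIdealOf ⟨x, hx⟩))
  refine ⟨z, hz, ?_⟩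
  have h3 := comap_pushGerm_pushIdeal h (specializes_of_eq hz) hU hx hzU
  rw [hP] at h3
  have m1 := IsLocalization.map_under (Algebra.algebraMapSubmonoid Γ(Z, h ⁻¹ᵁ U)
    (hU.primeIdealOf ⟨x, hx⟩).asIdeal.primeCompl) (pushStalk h x) I
  have m2 := IsLocalization.map_under (Algebra.algebraMapSubmonoid Γ(Z, h ⁻¹ᵁ U)
    (hU.primeIdealOf ⟨x, hx⟩).asIdeal.primeCompl) (pushStalk h x)
    (pushIdeal h (specializes_of_eq hz))
  rw [← m1, ← m2]
  congr 1
  exact h3.symm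

end PushStalk

end DeltaFamily
end

/-! ### Local invariants of H/π, expressed through the reduction of O → H. -/

noncomputable section
namespace DeltaFamily

section Reduction

open IsLocalRing

/-- Localization commutes with quotients. Applied to quotients by π, it presents the local rings of
Z_s as localizations of H/π. -/
lemma isLocalization_reduction {H S R' W : Type*} [CommRing H] [CommRing S] [CommRing R']
    [CommRing W] [Algebra H S] [Algebra R' W] (P : Ideal H) [P.IsPrime]
    [IsLocalization.AtPrime S P] (φ : H →+* R') (hφ : Function.Surjective φ) (ψ : S →+* W)
    (hψ : Function.Surjective ψ) (hc : ψ.comp (algebraMap H S) = (algebraMap R' W).comp φ)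
    (hk : RingHom.ker ψ ≤ (RingHom.ker φ).map (algebraMap H S)) (n : Ideal R') [n.IsPrime]
    (hn : n.comap φ = P) : IsLocalization.AtPrime W n := by
  have h := IsLocalization.of_surjective P.primeCompl S φ hφ ψ hψ hc hk
  have e : P.primeCompl.map φ = n.primeCompl := by
    subst hn
    ext y
    constructor
    · rintro ⟨x, hx, rfl⟩
      exact hx
    · intro hy
      obtain ⟨x, rfl⟩ := hφ y
      exact ⟨x, hy, rfl⟩
  rw [e] at h
  exact h

variable {k O R H : Type u} [Field k] [CommRing O] [IsLocalRing O] [IsNoetherianRing O]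
  [CommRing R] [IsLocalRing R] [Algebra k R] [CommRing H] [Algebra O H] [Module.Finite O H]

/-- The local invariants of the reduction modulo `π` of a finite modification. -/
theorem invariants_reduction (π : O) (q : O →+* R) (hq : Function.Surjective q)
    (hkq : RingHom.ker q = Ideal.span {π}) (hPN : PuncturedNormal R)
    (hmin : maximalIdeal R ∉ minimalPrimes R) [Module.Finite R (NormRing R)]
    [Module.Finite k (ResidueField R)]
    (hl1 : Module.length O (LinearMap.ker (cotorsMap π (Algebra.linearMap O H))) ≠ ⊤)
    (hl2 : Module.length O
      (cotors π H ⧸ LinearMap.range (cotorsMap π (Algebra.linearMap O H))) ≠ ⊤)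
    {ι : Type*} [Fintype ι] (S W : ι → Type u) [∀ i, CommRing (S i)] [∀ i, CommRing (W i)]
    [∀ i, IsLocalRing (W i)] [∀ i, Algebra H (S i)] (P : ι → Ideal H) [∀ i, (P i).IsPrime]
    [∀ i, IsLocalization.AtPrime (S i) (P i)]
    (hP : ∀ i, (P i).comap (algebraMap O H) = maximalIdeal O) (hinj : Function.Injective P)
    (hsurj : ∀ I : Ideal H, I.IsPrime → I.comap (algebraMap O H) = maximalIdeal O →
      I ∈ Set.range P)
    (ψ : ∀ i, S i →+* W i) (hψ : ∀ i, Function.Surjective (ψ i))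
    (hkψ : ∀ i, RingHom.ker (ψ i) = Ideal.span {algebraMap H (S i) (algebraMap O H π)})
    [∀ i, Algebra k (W i)]
    (hk : ∀ i (c : k) (o : O), q o = algebraMap k R c →
      algebraMap k (W i) c = ψ i (algebraMap H (S i) (algebraMap O H o)))
    (hW : ∀ i, maximalIdeal (W i) ∉ minimalPrimes (W i)) :
    (∀ i, LocalFinite k (W i)) ∧
    (∑ i, localDelta k (W i) =
      (Module.finrank k (ResidueField R) : ℤ) * ((Module.length R (NormCoker R)).toNat -
        (Module.length R (nilradical R)).toNat -
        ((Module.length O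
          (cotors π H ⧸ LinearMap.range (cotorsMap π (Algebra.linearMap O H)))).toNat -
          (Module.length O
            (LinearMap.ker (cotorsMap π (Algebra.linearMap O H)))).toNat))) ∧
    (Function.Surjective (algebraMap O H) →
      (∀ o : O, algebraMap O H o = 0 → IsNilpotent o) →
      ∑ i, localEpsilon k (W i) + ∑ i, localDelta k (W i) =
        (Module.finrank k (ResidueField R) : ℤ) * (Module.length R (NormCoker R)).toNat) := by
  have hqπ : q π = 0 := by
    have : π ∈ RingHom.ker q := hkq ▸ Ideal.mem_span_singleton_self π
    exact this
  have hπ : π ∈ maximalIdeal O := by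
    refine (mem_maximalIdeal π).mpr fun hu => ?_
    have := hu.map q
    rw [hqπ] at this
    exact not_isUnit_zero this
  let J : Ideal H := Ideal.span {algebraMap O H π}
  let _ : Algebra O R := q.toAlgebra
  have hNR : IsNoetherianRing R := isNoetherianRing_of_surjective O R q hq
  -- `R` is O/π and `H ⧸ J` is H/π, so `r` is the finite modification of `R` to which the local
  -- theory applies; its maximal ideals come from the primes `P i`.
  let r : R →+* H ⧸ J := RingHom.liftOfSurjective q hq ⟨(Ideal.Quotient.mk J).comp (algebraMap O H),
    by
      rw [hkq, Ideal.span_singleton_le_iff_mem, RingHom.mem_ker, RingHom.comp_apply]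
      exact Ideal.Quotient.eq_zero_iff_mem.mpr (Ideal.mem_span_singleton_self _)⟩
  have hr : ∀ o, r (q o) = Ideal.Quotient.mk J (algebraMap O H o) := fun o =>
    RingHom.liftOfRightInverse_comp_apply q _ (Function.rightInverse_surjInv hq) _ o
  let _ : Algebra R (H ⧸ J) := r.toAlgebra
  have t1 : IsScalarTower O R (H ⧸ J) := IsScalarTower.of_algebraMap_eq fun o => (hr o).symm
  let _ : Algebra k (H ⧸ J) := (r.comp (algebraMap k R)).toAlgebra
  have t2 : IsScalarTower k R (H ⧸ J) := IsScalarTower.of_algebraMap_eq fun o => rfl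
  have : Module.Finite O (H ⧸ J) := inferInstance
  have : Module.Finite R (H ⧸ J) := Module.Finite.of_restrictScalars_finite O R (H ⧸ J)
  have hsH : Function.Surjective (algebraMap H (H ⧸ J)) := Ideal.Quotient.mk_surjective
  have hkH : RingHom.ker (algebraMap H (H ⧸ J)) = Ideal.span {algebraMap O H π} := Ideal.mk_ker
  have L1 := length_ker_reduction π hq hkq hsH hkH
  have L2 := length_coker_reduction π hq hkq hsH hkH
  have hJP : ∀ i, J ≤ P i := fun i => by
    rw [Ideal.span_singleton_le_iff_mem, ← Ideal.mem_comap, hP]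
    exact hπ
  let n : ι → Ideal (H ⧸ J) := fun i => (P i).map (Ideal.Quotient.mk J)
  have hnP : ∀ i, (n i).comap (Ideal.Quotient.mk J) = P i := fun i => by
    rw [Ideal.comap_map_of_surjective _ Ideal.Quotient.mk_surjective, ← RingHom.ker_eq_comap_bot,
      Ideal.mk_ker, sup_eq_left.mpr (hJP i)]
  have hnp : ∀ i, (n i).IsPrime := fun i =>
    Ideal.map_isPrime_of_surjective Ideal.Quotient.mk_surjective (by
      rw [Ideal.mk_ker]; exact hJP i)
  have hcomap : ∀ I : Ideal (H ⧸ J), I.IsPrime →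
      ((I.comap (Ideal.Quotient.mk J)).comap (algebraMap O H) = maximalIdeal O ↔
        I.IsMaximal) := by
    intro I hI
    rw [← comap_isMaximal_iff (R := O) I]
    rfl
  have hnmax : ∀ i, (n i).IsMaximal := fun i => by
    rw [← hcomap _ (hnp i), hnP, hP]
  have hninj : Function.Injective n := fun i j hij => hinj (by rw [← hnP, ← hnP, hij])
  have hnsurj : ∀ I : Ideal (H ⧸ J), I.IsMaximal → I ∈ Set.range n := by
    intro I hI
    obtain ⟨i, hi⟩ := hsurj (I.comap (Ideal.Quotient.mk J)) inferInstance
      ((hcomap I hI.isPrime).mpr hI)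
    refine ⟨i, ?_⟩
    change (P i).map _ = I
    rw [hi, Ideal.map_comap_of_surjective _ Ideal.Quotient.mk_surjective]
  let w : ∀ i, H ⧸ J →+* W i := fun i => Ideal.Quotient.lift J ((ψ i).comp (algebraMap H (S i)))
    (fun a ha => by
      have : J ≤ RingHom.ker ((ψ i).comp (algebraMap H (S i))) := by
        rw [Ideal.span_singleton_le_iff_mem, RingHom.mem_ker, RingHom.comp_apply,
          ← RingHom.mem_ker, hkψ]
        exact Ideal.mem_span_singleton_self _
      exact this ha)
  let _ : ∀ i, Algebra (H ⧸ J) (W i) := fun i => (w i).toAlgebra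
  have t3 : ∀ i, IsScalarTower k (H ⧸ J) (W i) := fun i =>
    IsScalarTower.of_algebraMap_eq fun c => by
      obtain ⟨o, ho⟩ := hq (algebraMap k R c)
      rw [hk i c o ho]
      change _ = w i (r (algebraMap k R c))
      rw [← ho, hr]
      rfl
  have t4 : ∀ i, IsLocalization.AtPrime (W i) (n i) := fun i =>
    isLocalization_reduction (S := S i) (P i) (Ideal.Quotient.mk J) Ideal.Quotient.mk_surjective
      (ψ i) (hψ i) rfl (by
        rw [hkψ, Ideal.mk_ker, Ideal.map_span, Set.image_singleton]) (n i) (hnP i)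
  have hmax : ∀ m : Ideal (H ⧸ J), m.IsMaximal → m ∉ minimalPrimes (H ⧸ J) := by
    intro m hm
    obtain ⟨i, rfl⟩ := hnsurj m hm
    exact notMem_minimalPrimes_of_isLocalization (W := W i) (n i) (hW i)
  have hf1 : IsFiniteLength R (LinearMap.ker (Algebra.linearMap R (H ⧸ J))) :=
    Module.length_ne_top_iff.mp (L1 ▸ hl1)
  have hf2 : IsFiniteLength R ((H ⧸ J) ⧸ LinearMap.range (Algebra.linearMap R (H ⧸ J))) :=
    Module.length_ne_top_iff.mp (L2 ▸ hl2)
  have eκ : ResidueField R ≃ₗ[R] R ⧸ maximalIdeal R := LinearEquiv.refl R _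
  obtain ⟨c1, c2, c3⟩ := invariants_modification (k := k) hPN hf1 hf2 hmin hmax eκ n hninj hnsurj W
  refine ⟨c1, by rw [c3, L1, L2], fun hs hnil => ?_⟩
  have hsr : Function.Surjective (algebraMap R (H ⧸ J)) := by
    intro y
    obtain ⟨y, rfl⟩ := Ideal.Quotient.mk_surjective y
    obtain ⟨o, rfl⟩ := hs y
    exact ⟨q o, hr o⟩
  have key := length_modification hPN hf1 hf2 hmin hmax
  have hz : Module.length R ((H ⧸ J) ⧸ LinearMap.range (Algebra.linearMap R (H ⧸ J))) = 0 := by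
    rw [Module.length_eq_zero_iff, Submodule.Quotient.subsingleton_iff]
    exact LinearMap.range_eq_top.mpr hsr
  have hknil : LinearMap.ker (Algebra.linearMap R (H ⧸ J)) ≤ nilradical R := by
    intro x hx
    obtain ⟨o, rfl⟩ := hq x
    have h1 : Ideal.Quotient.mk J (algebraMap O H o) = 0 := by rw [← hr]; exact hx
    obtain ⟨y, hy⟩ := Ideal.mem_span_singleton'.mp (Ideal.Quotient.eq_zero_iff_mem.mp h1)
    obtain ⟨p, rfl⟩ := hs y
    have h2 := (hnil (o - p * π) (by rw [map_sub, map_mul, hy, sub_self])).map q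
    rw [map_sub, map_mul, hqπ, mul_zero, sub_zero] at h2
    exact h2
  -- If O → H is surjective with nilpotent kernel, the nilradical of `R` is an extension of that of
  -- `H ⧸ J` by the kernel of `r`. All nilpotent terms then cancel in ε + δ, leaving the colength of
  -- the normalization.
  have hnl : Module.length R (nilradical R) =
      Module.length R (LinearMap.ker (Algebra.linearMap R (H ⧸ J))) +
        Module.length R (nilradical (H ⧸ J)) := by
    let b : nilradical R →ₗ[R] ((nilradical (H ⧸ J)).restrictScalars R : Submodule R (H ⧸ J)) :=
      LinearMap.codRestrict _ ((Algebra.linearMap R (H ⧸ J)) ∘ₗ (nilradical R).subtype)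
        (fun x => (mem_nilradical.mp x.2).map (algebraMap R (H ⧸ J)))
    refine Module.length_eq_add_of_exact (Submodule.inclusion hknil) b
      (Submodule.inclusion_injective _) ?_ ?_
    · rintro ⟨y, hy⟩
      obtain ⟨x, rfl⟩ := hsr y
      obtain ⟨N, hN⟩ := mem_nilradical.mp hy
      rw [← map_pow] at hN
      obtain ⟨M, hM⟩ := mem_nilradical.mp (hknil hN)
      exact ⟨⟨x, mem_nilradical.mpr ⟨N * M, by rw [pow_mul, hM]⟩⟩, rfl⟩
    · intro x
      constructor
      · intro hx
        exact ⟨⟨x.1, congrArg Subtype.val hx⟩, rfl⟩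
      · rintro ⟨y, rfl⟩
        exact Subtype.ext y.2
  have l1 := Module.length_ne_top_iff.mpr hf1
  have l2 := Module.length_ne_top_iff.mpr
    (isFiniteLength_nilradical_of_modification hPN hf1 hf2)
  have l0 := Module.length_ne_top_iff.mpr (isFiniteLength_nilradical hPN)
  have hnl' := congrArg ENat.toNat hnl
  rw [ENat.toNat_add l1 l2] at hnl'
  rw [c2, c3, hz, hnl']
  push_cast
  simp
  ring

end Reduction

end DeltaFamily
end

/-! ### Localization of kernels, and comparison of lengths at primes. -/

noncomputable section
namespace DeltaFamily

section LocalizedKernel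

variable {G G' : Type u} [CommRing G] [CommRing G'] [Algebra G G'] (S : Submonoid G)
  [IsLocalization S G']

/-- The kernel of the structure map of an algebra commutes with localization. -/
lemma exists_isLocalizedModule_ker {H H' : Type*} [CommRing H] [CommRing H'] [Algebra G H]
    [Algebra G' H'] [Algebra G H'] [Algebra H H'] [IsScalarTower G H H'] [IsScalarTower G G' H']
    [IsLocalization (Algebra.algebraMapSubmonoid H S) H'] :
    ∃ f : LinearMap.ker (Algebra.linearMap G H) →ₗ[G] LinearMap.ker (Algebra.linearMap G' H'),
      IsLocalizedModule S f := by
  let f : LinearMap.ker (Algebra.linearMap G H) →ₗ[G] LinearMap.ker (Algebra.linearMap G' H') :=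
    LinearMap.codRestrict ((LinearMap.ker (Algebra.linearMap G' H')).restrictScalars G)
      ((Algebra.linearMap G G') ∘ₗ (LinearMap.ker (Algebra.linearMap G H)).subtype) (fun x => by
        change algebraMap G' H' (algebraMap G G' x.1) = 0
        have hx : algebraMap G H x.1 = 0 := x.2
        rw [← IsScalarTower.algebraMap_apply, IsScalarTower.algebraMap_apply G H H', hx, map_zero])
  have hf : ∀ x, (f x).1 = algebraMap G G' x.1 := fun x => rfl
  refine ⟨f, ⟨fun s => isUnit_end_of_isLocalization (G' := G') S s, fun y => ?_, ?_⟩⟩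
  · obtain ⟨⟨x, s⟩, h⟩ := IsLocalization.surj S y.1
    have hy : algebraMap G' H' y.1 = 0 := y.2
    have hx : algebraMap H H' (algebraMap G H x) = 0 := by
      rw [← IsScalarTower.algebraMap_apply, IsScalarTower.algebraMap_apply G G' H', ← h, map_mul,
        hy, zero_mul]
    obtain ⟨⟨_, c, hc, rfl⟩, h0⟩ :=
      (IsLocalization.map_eq_zero_iff (Algebra.algebraMapSubmonoid H S) H' _).mp hx
    refine ⟨(⟨c * x, ?_⟩, ⟨c, hc⟩ * s), Subtype.ext ?_⟩
    · change algebraMap G H (c * x) = 0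
      rw [map_mul]
      exact h0
    · rw [hf]
      change (c * (s : G)) • y.1 = algebraMap G G' (c * x)
      rw [Algebra.smul_def, map_mul, map_mul, ← h]; ring
  · intro x y hxy
    have h1 : algebraMap G G' x.1 = algebraMap G G' y.1 := congrArg Subtype.val hxy
    obtain ⟨c, hc⟩ := (IsLocalization.eq_iff_exists S G').mp h1
    exact ⟨c, Subtype.ext hc⟩

lemma notMem_support_of_isLocalizedModule {M M' : Type*} [AddCommGroup M] [AddCommGroup M']
    [Module G M] [Module G M'] (q : PrimeSpectrum G) (f : M →ₗ[G] M')
    [IsLocalizedModule q.asIdeal.primeCompl f] [Subsingleton M'] : q ∉ Module.support G M := by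
  rw [Module.mem_support_iff']
  rintro ⟨m, hm⟩
  obtain ⟨c, hc⟩ := (IsLocalizedModule.eq_zero_iff q.asIdeal.primeCompl f).mp
    (Subsingleton.elim (f m) 0)
  exact hm c c.2 hc

lemma length_localizedModule_eq (q : Ideal G) [q.IsPrime] [IsLocalization.AtPrime G' q]
    {M M' : Type*} [AddCommGroup M] [AddCommGroup M'] [Module G M] [Module G M'] [Module G' M']
    [IsScalarTower G G' M'] (f : M →ₗ[G] M') [IsLocalizedModule q.primeCompl f] :
    Module.length (Localization.AtPrime q) (LocalizedModule q.primeCompl M) =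
      Module.length G' M' := by
  let ρ : Localization.AtPrime q ≃ₐ[G] G' := IsLocalization.algEquiv q.primeCompl _ _
  let _ : Module (Localization.AtPrime q) M' := Module.compHom M' ρ.toRingEquiv.toRingHom
  let _ : Algebra (Localization.AtPrime q) G' := ρ.toRingEquiv.toRingHom.toAlgebra
  have t1 : IsScalarTower (Localization.AtPrime q) G' M' := ⟨fun a b c => by
    rw [Algebra.smul_def, mul_smul]; rfl⟩
  have t2 : IsScalarTower G (Localization.AtPrime q) M' := ⟨fun a b c => by
    change ρ (a • b) • c = a • (ρ b • c)
    rw [map_smul, smul_assoc]⟩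
  rw [← Module.length_eq_of_surjective (S := Localization.AtPrime q) (R := G') (M := M')
    ρ.surjective]
  exact ((IsLocalizedModule.iso q.primeCompl f).extendScalarsOfIsLocalization q.primeCompl
    (Localization.AtPrime q)).length_eq

end LocalizedKernel

/-! ### Kernel and cokernel of the local ring in the stalk of a direct image. -/

section PushModules

variable {X Z : Scheme.{u}} (h : Z ⟶ X)

/-- The cokernel of a local ring in the stalk of a direct image. -/
abbrev pushCoker (x : X) : Type u :=
  pushStalk h x ⧸ LinearMap.range (Algebra.linearMap (X.presheaf.stalk x) (pushStalk h x))

/-- The kernel of a local ring in the stalk of a direct image. -/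
abbrev pushKer (x : X) : Submodule (X.presheaf.stalk x) (X.presheaf.stalk x) :=
  LinearMap.ker (Algebra.linearMap (X.presheaf.stalk x) (pushStalk h x))

section Affine

variable [IsAffineHom h] {w x : X} (hwx : w ⤳ x)

/-- Kernel and cokernel commute with localization, so what is seen at a generization w inside the
local ring at x depends on w alone; it vanishes where the map of stalks at w is bijective. -/
lemma length_localizedModule_push :
    (Module.length (Localization.AtPrime (genIdeal hwx))
      (LocalizedModule (genIdeal hwx).primeCompl (pushCoker h x)) =
        Module.length (X.presheaf.stalk w) (pushCoker h w) ∧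
    Module.length (Localization.AtPrime (genIdeal hwx))
      (LocalizedModule (genIdeal hwx).primeCompl (pushKer h x)) =
        Module.length (X.presheaf.stalk w) (pushKer h w)) ∧
    (Function.Bijective (pushMap h w) → ∀ q : PrimeSpectrum (X.presheaf.stalk x),
      q.asIdeal = genIdeal hwx → q ∉ Module.support (X.presheaf.stalk x) (pushCoker h x) ∧
        q ∉ Module.support (X.presheaf.stalk x) (pushKer h x)) := by
  let _ : Algebra (X.presheaf.stalk x) (X.presheaf.stalk w) :=
    (X.presheaf.stalkSpecializes hwx).hom.toAlgebra
  let _ : Algebra (X.presheaf.stalk x) (pushStalk h w) :=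
    ((pushMap h w).hom.comp (X.presheaf.stalkSpecializes hwx).hom).toAlgebra
  let _ : Algebra (pushStalk h x) (pushStalk h w) := (pushSpec h hwx).hom.toAlgebra
  have t1 : IsScalarTower (X.presheaf.stalk x) (X.presheaf.stalk w) (pushStalk h w) :=
    IsScalarTower.of_algebraMap_eq fun r => rfl
  have t2 : IsScalarTower (X.presheaf.stalk x) (pushStalk h x) (pushStalk h w) :=
    IsScalarTower.of_algebraMap_eq fun r => (pushSpec_pushMap h hwx r).symm
  have l1 := isLocalization_stalkSpecializes hwx
  have l2 := isLocalization_pushSpec h hwx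
  obtain ⟨f, hf, -⟩ := exists_isLocalizedModule_coker (G := X.presheaf.stalk x)
    (G' := X.presheaf.stalk w) (genIdeal hwx).primeCompl (H := pushStalk h x) (H' := pushStalk h w)
  obtain ⟨g, hg⟩ := exists_isLocalizedModule_ker (G := X.presheaf.stalk x)
    (G' := X.presheaf.stalk w) (genIdeal hwx).primeCompl (H := pushStalk h x) (H' := pushStalk h w)
  refine ⟨⟨length_localizedModule_eq _ f, length_localizedModule_eq _ g⟩, ?_⟩
  rintro ⟨hi, hs⟩ ⟨q, hq⟩ rfl
  have s1 : Subsingleton (pushCoker h w) :=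
    Submodule.Quotient.subsingleton_iff.mpr (LinearMap.range_eq_top.mpr hs)
  have s2 : Subsingleton (pushKer h w) := by
    refine ⟨fun a b => Subtype.ext (hi ?_)⟩
    exact (show pushMap h w a.1 = 0 from a.2).trans (show pushMap h w b.1 = 0 from b.2).symm
  exact ⟨notMem_support_of_isLocalizedModule ⟨_, hq⟩ f, notMem_support_of_isLocalizedModule ⟨_, hq⟩ g⟩

end Affine

lemma finite_pushStalk [IsFinite h] (x : X) :
    Module.Finite (X.presheaf.stalk x) (pushStalk h x) := by
  obtain ⟨U, hU, hx⟩ := exists_isAffineOpen_mem x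
  let _ := (h.app U).hom.toAlgebra
  let _ := (pushGerm h U x hx).hom.toAlgebra
  let _ := (X.presheaf.germ U x hx).hom.toAlgebra
  let _ : Algebra Γ(X, U) (pushStalk h x) :=
    ((pushGerm h U x hx).hom.comp (h.app U).hom).toAlgebra
  have t1 : IsScalarTower Γ(X, U) Γ(Z, h ⁻¹ᵁ U) (pushStalk h x) :=
    IsScalarTower.of_algebraMap_eq fun r => rfl
  have t2 : IsScalarTower Γ(X, U) (X.presheaf.stalk x) (pushStalk h x) :=
    IsScalarTower.of_algebraMap_eq fun r => (pushMap_germ h U x hx r).symm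
  have l1 : IsLocalization.AtPrime (X.presheaf.stalk x) (hU.primeIdealOf ⟨x, hx⟩).asIdeal :=
    hU.isLocalization_stalk ⟨x, hx⟩
  have l2 := isLocalization_pushStalk h hU hx
  have : Module.Finite Γ(X, U) Γ(Z, h ⁻¹ᵁ U) := h.finite_app U hU
  exact Module.Finite.of_isLocalization Γ(X, U) Γ(Z, h ⁻¹ᵁ U)
    (hU.primeIdealOf ⟨x, hx⟩).asIdeal.primeCompl


/-! ### Torsion-freeness and modifications. -/

section Modification

variable {A : Type u} [CommRing A]

/-- The sections over affine open subsets are torsion-free over the base. -/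
def TorsionFree (f : X ⟶ Spec (CommRingCat.of A)) : Prop :=
  ∀ U : X.Opens, IsAffineOpen U → ∀ a : A, a ≠ 0 → ∀ g : Γ(X, U), sectionsHom f U a * g = 0 → g = 0

lemma TorsionFree.stalk {f : X ⟶ Spec (CommRingCat.of A)} (hf : TorsionFree f) (x : X) {a : A}
    (ha : a ≠ 0) (r : X.presheaf.stalk x) (hr : stalkHom f x a * r = 0) : r = 0 := by
  obtain ⟨U, hU, hx⟩ := exists_isAffineOpen_mem x
  let _ := (X.presheaf.germ U x hx).hom.toAlgebra
  have l1 : IsLocalization.AtPrime (X.presheaf.stalk x) (hU.primeIdealOf ⟨x, hx⟩).asIdeal :=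
    hU.isLocalization_stalk ⟨x, hx⟩
  obtain ⟨⟨g, c⟩, hgc⟩ := IsLocalization.surj (hU.primeIdealOf ⟨x, hx⟩).asIdeal.primeCompl r
  have h1 : algebraMap Γ(X, U) (X.presheaf.stalk x) (sectionsHom f U a * g) = 0 := by
    rw [map_mul, ← hgc]
    change X.presheaf.germ U x hx (sectionsHom f U a) * _ = 0
    rw [germ_sectionsHom, ← mul_assoc, hr, zero_mul]
  obtain ⟨d, hd⟩ := (IsLocalization.map_eq_zero_iff
    (hU.primeIdealOf ⟨x, hx⟩).asIdeal.primeCompl _ _).mp h1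
  have h2 : algebraMap Γ(X, U) (X.presheaf.stalk x) (d * g) = 0 := by
    rw [hf U hU a ha (d * g) (by rw [mul_left_comm, hd]), map_zero]
  rw [map_mul] at h2
  have h3 := ((IsLocalization.map_units (X.presheaf.stalk x) d).mul_right_eq_zero).mp h2
  rw [← hgc] at h3
  exact ((IsLocalization.map_units (X.presheaf.stalk x) c).mul_left_eq_zero).mp h3

lemma TorsionFree.pushStalk [IsAffineHom h] {f : X ⟶ Spec (CommRingCat.of A)}
    (hf : TorsionFree (h ≫ f)) (x : X) {a : A}
    (ha : a ≠ 0) (r : pushStalk h x) (hr : pushMap h x (stalkHom f x a) * r = 0) : r = 0 := by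
  obtain ⟨U, hU, hx⟩ := exists_isAffineOpen_mem x
  let _ := (h.app U).hom.toAlgebra
  let _ := (pushGerm h U x hx).hom.toAlgebra
  have l1 := isLocalization_pushStalk h hU hx
  obtain ⟨⟨g, c⟩, hgc⟩ := IsLocalization.surj (Algebra.algebraMapSubmonoid Γ(Z, h ⁻¹ᵁ U)
      (hU.primeIdealOf ⟨x, hx⟩).asIdeal.primeCompl) r
  have h1 : algebraMap Γ(Z, h ⁻¹ᵁ U) (DeltaFamily.pushStalk h x)
      (sectionsHom (h ≫ f) (h ⁻¹ᵁ U) a * g) = 0 := by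
    rw [map_mul, ← hgc]
    change pushGerm h U x hx (sectionsHom (h ≫ f) (h ⁻¹ᵁ U) a) * _ = 0
    rw [← app_sectionsHom, ← pushMap_germ, germ_sectionsHom, ← mul_assoc, hr, zero_mul]
  obtain ⟨d, hd⟩ := (IsLocalization.map_eq_zero_iff (Algebra.algebraMapSubmonoid Γ(Z, h ⁻¹ᵁ U)
    (hU.primeIdealOf ⟨x, hx⟩).asIdeal.primeCompl) _ _).mp h1
  have h2 : algebraMap Γ(Z, h ⁻¹ᵁ U) (DeltaFamily.pushStalk h x) (d * g) = 0 := by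
    rw [hf _ (hU.preimage h) a ha (d * g) (by rw [mul_left_comm, hd]), map_zero]
  rw [map_mul] at h2
  have h3 := ((IsLocalization.map_units (DeltaFamily.pushStalk h x) d).mul_right_eq_zero).mp h2
  rw [← hgc] at h3
  exact ((IsLocalization.map_units (DeltaFamily.pushStalk h x) c).mul_left_eq_zero).mp h3

/-- A finite morphism which is an isomorphism away from the extended conductor scheme, without
torsion over the base, and whose fibres over the base have no isolated points. -/
structure IsModification (f : X ⟶ Spec (CommRingCat.of A)) (h : Z ⟶ X) : Prop where
  isFinite : IsFinite h
  exists_app_eq : ∀ U : X.affineOpens, ∀ j ∈ (extConductorIdealSheaf X).ideal U,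
    ∀ c : Γ(Z, h ⁻¹ᵁ U.1), ∃ g, h.app U.1 g = h.app U.1 j * c
  mul_eq_zero : ∀ U : X.affineOpens, ∀ j ∈ (extConductorIdealSheaf X).ideal U,
    ∀ g, h.app U.1 g = 0 → j * g = 0
  torsionFree : TorsionFree (h ≫ f)
  not_isIsolatedPoint : ∀ s (z : (h ≫ f).fiber s), ¬ IsIsolatedPoint ((h ≫ f).fiber s) z

variable {h} {f : X ⟶ Spec (CommRingCat.of A)}

/-- Off the conductor scheme some section `j` of its ideal is a unit at x. Since `j` kills the
kernel and the cokernel on sections, both vanish at the stalk. -/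
lemma IsModification.bijective_pushMap (hm : IsModification f h) {x : X}
    (hx : x ∉ (extConductorIdealSheaf X).support) : Function.Bijective (pushMap h x) := by
  have := hm.isFinite
  obtain ⟨U, hU, hxU⟩ := exists_isAffineOpen_mem x
  rw [Scheme.IdealSheafData.mem_support_iff_of_mem (U := ⟨U, hU⟩) hxU,
    Scheme.mem_zeroLocus_iff] at hx
  push Not at hx
  obtain ⟨j, hj, hxj⟩ := hx
  have hu : IsUnit (X.presheaf.germ U x hxU j) := (X.mem_basicOpen j x hxU).mp hxj
  let _ := (h.app U).hom.toAlgebra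
  let _ := (pushGerm h U x hxU).hom.toAlgebra
  let _ := (X.presheaf.germ U x hxU).hom.toAlgebra
  have l0 : IsLocalization.AtPrime (X.presheaf.stalk x) (hU.primeIdealOf ⟨x, hxU⟩).asIdeal :=
    hU.isLocalization_stalk ⟨x, hxU⟩
  have l1 := isLocalization_pushStalk h hU hxU
  constructor
  · rw [injective_iff_map_eq_zero]
    intro r hr
    obtain ⟨⟨g, c⟩, hgc⟩ := IsLocalization.surj (hU.primeIdealOf ⟨x, hxU⟩).asIdeal.primeCompl r
    have h1 : pushGerm h U x hxU (h.app U g) = 0 := by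
      rw [← pushMap_germ]
      change pushMap h x (algebraMap Γ(X, U) _ g) = 0
      rw [← hgc, map_mul, hr, zero_mul]
    obtain ⟨⟨_, d, hd, rfl⟩, hd'⟩ := (IsLocalization.map_eq_zero_iff
      (Algebra.algebraMapSubmonoid Γ(Z, h ⁻¹ᵁ U)
        (hU.primeIdealOf ⟨x, hxU⟩).asIdeal.primeCompl) (pushStalk h x) _).mp h1
    have h2 := hm.mul_eq_zero ⟨U, hU⟩ j hj (d * g) (by rw [map_mul]; exact hd')
    have h3 := congrArg (X.presheaf.germ U x hxU) h2
    rw [map_mul, map_mul, map_zero, hu.mul_right_eq_zero,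
      ((mem_primeCompl_primeIdealOf_iff hU hxU d).mp hd).mul_right_eq_zero] at h3
    have h4 : r * algebraMap Γ(X, U) (X.presheaf.stalk x) c = 0 := hgc.trans h3
    exact ((IsLocalization.map_units (X.presheaf.stalk x) c).mul_left_eq_zero).mp h4
  · intro y
    obtain ⟨⟨c, ⟨_, d, hd, rfl⟩⟩, hcd⟩ := IsLocalization.surj
      (Algebra.algebraMapSubmonoid Γ(Z, h ⁻¹ᵁ U)
        (hU.primeIdealOf ⟨x, hxU⟩).asIdeal.primeCompl) y
    have hcd' : y * pushGerm h U x hxU (h.app U d) = pushGerm h U x hxU c := hcd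
    obtain ⟨g, hg⟩ := hm.exists_app_eq ⟨U, hU⟩ j hj c
    obtain ⟨u, hu'⟩ := ((mem_primeCompl_primeIdealOf_iff hU hxU d).mp hd).mul hu
    refine ⟨↑u⁻¹ * X.presheaf.germ U x hxU g, ?_⟩
    have hv : IsUnit (pushMap h x u.1) := u.isUnit.map (pushMap h x).hom
    apply hv.mul_left_cancel
    rw [← map_mul, Units.mul_inv_cancel_left, hu', map_mul, pushMap_germ, pushMap_germ,
      pushMap_germ]
    erw [hg]
    rw [map_mul, ← hcd']
    ring

end Modification

end PushModules

end DeltaFamily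
end

/-! ### Invariants of the points of Z_s over one point of X_s. -/

noncomputable section
namespace DeltaFamily

section PointInvariants

open IsLocalRing

variable {A : Type u} [CommRing A] {X Z : Scheme.{u}} {h : Z ⟶ X}
  {f : X ⟶ Spec (CommRingCat.of A)}

lemma toStalk_pushMap_stalkHom (z : Z) {x : X} (hz : h z ⤳ x) (a : A) :
    toStalk h hz (pushMap h x (stalkHom f x a)) = stalkHom (h ≫ f) z a := by
  rw [toStalk_pushMap, stalkSpecializes_stalkHom, stalkMap_stalkHom]

lemma comap_pushMap_pushIdeal {z : Z} {x : X} (hz : h z ⤳ x) :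
    (pushIdeal h hz).comap (pushMap h x).hom = genIdeal hz := by
  ext r
  change toStalk h hz (pushMap h x r) ∈ maximalIdeal _ ↔ X.presheaf.stalkSpecializes hz r ∈
    maximalIdeal _
  rw [toStalk_pushMap, mem_maximalIdeal, mem_maximalIdeal, mem_nonunits_iff, mem_nonunits_iff]
  exact not_congr (isUnit_map_iff (h.stalkMap z).hom _)

lemma span_stalkHom_eq_ker (s : Spec (CommRingCat.of A)) (x' : f.fiber s) {π : A}
    (hs : s.asIdeal = Ideal.span {π}) :
    RingHom.ker ((f.fiberι s).stalkMap x').hom =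
      Ideal.span {stalkHom f (f.fiberι s x') π} := by
  rw [ker_stalkMap_fiberι, hs, Ideal.map_span, Set.image_singleton]

/-- An element of κ(s) is a fraction a/b of images from `A`. The two ways to act agree on images of
`A`, and b becomes a unit, so they agree on the fraction. -/
lemma algebraMap_eq_of_stalkMap_eq (s : Spec (CommRingCat.of A)) (x' : f.fiber s)
    (z' : (h ≫ f).fiber s) (hz : h ((h ≫ f).fiberι s z') ⤳ f.fiberι s x')
    (c : (Spec (CommRingCat.of A)).residueField s) (o : X.presheaf.stalk (f.fiberι s x'))
    (ho : (f.fiberι s).stalkMap x' o = algebraMap _ ((f.fiber s).presheaf.stalk x') c) :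
    algebraMap _ (((h ≫ f).fiber s).presheaf.stalk z') c =
      ((h ≫ f).fiberι s).stalkMap z' (toStalk h hz (pushMap h _ o)) := by
  obtain ⟨a, b, hb, hab⟩ := exists_eq_resHom_div s c
  let θ : X.presheaf.stalk (f.fiberι s x') →+* ((h ≫ f).fiber s).presheaf.stalk z' :=
    (((h ≫ f).fiberι s).stalkMap z').hom.comp ((toStalk h hz).hom.comp (pushMap h _).hom)
  have hθ : ∀ a : A, θ (stalkHom f _ a) = algebraMap _ _ (resHom s a) := fun a => by
    rw [algebraMap_resHom, ← stalkMap_stalkHom]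
    exact congrArg (((h ≫ f).fiberι s).stalkMap z') (toStalk_pushMap_stalkHom (f := f) _ hz a)
  have hker : RingHom.ker ((f.fiberι s).stalkMap x').hom ≤ RingHom.ker θ := by
    rw [ker_stalkMap_fiberι, Ideal.map_le_iff_le_comap]
    intro a ha
    rw [Ideal.mem_comap, RingHom.mem_ker, hθ, RingHom.mem_ker.mp ((ker_resHom s).ge ha), map_zero]
  have h1 : stalkHom f _ b * o - stalkHom f _ a ∈ RingHom.ker ((f.fiberι s).stalkMap x').hom := by
    rw [RingHom.mem_ker, map_sub, map_mul]
    change (f.fiberι s).stalkMap x' (stalkHom f _ b) * (f.fiberι s).stalkMap x' o -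
      (f.fiberι s).stalkMap x' (stalkHom f _ a) = 0
    rw [ho, stalkMap_stalkHom, stalkMap_stalkHom, ← algebraMap_resHom, ← algebraMap_resHom,
      ← map_mul, hab, sub_self]
  have h2 := RingHom.mem_ker.mp (hker h1)
  rw [map_sub, map_mul, hθ, hθ, ← hab, map_mul, ← mul_sub] at h2
  have hbu : IsUnit (resHom s b) := by
    refine IsUnit.mk0 _ fun h0 => hb ?_
    rw [← ker_resHom]
    exact h0
  exact (sub_eq_zero.mp ((hbu.map (algebraMap _ _)).mul_right_eq_zero.mp h2)).symm

/-- The local invariants of the points of a modification over a point of a fibre. -/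
theorem point_invariants [IsNoetherian X] [IsFinite h] (s : Spec (CommRingCat.of A))
    (x' : f.fiber s) {π : A} (hs : s.asIdeal = Ideal.span {π})
    (hPN : PuncturedNormal ((f.fiber s).presheaf.stalk x'))
    (hmin : maximalIdeal ((f.fiber s).presheaf.stalk x') ∉
      minimalPrimes ((f.fiber s).presheaf.stalk x'))
    [Module.Finite ((f.fiber s).presheaf.stalk x') (NormRing ((f.fiber s).presheaf.stalk x'))]
    [Module.Finite ((Spec (CommRingCat.of A)).residueField s)
      (ResidueField ((f.fiber s).presheaf.stalk x'))]
    (hl1 : Module.length (X.presheaf.stalk (f.fiberι s x')) (LinearMap.ker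
      (cotorsMap (stalkHom f (f.fiberι s x') π)
        (Algebra.linearMap (X.presheaf.stalk (f.fiberι s x'))
          (pushStalk h (f.fiberι s x'))))) ≠ ⊤)
    (hl2 : Module.length (X.presheaf.stalk (f.fiberι s x'))
      (cotors (stalkHom f (f.fiberι s x') π) (pushStalk h (f.fiberι s x')) ⧸ LinearMap.range
      (cotorsMap (stalkHom f (f.fiberι s x') π)
        (Algebra.linearMap (X.presheaf.stalk (f.fiberι s x'))
          (pushStalk h (f.fiberι s x'))))) ≠ ⊤)
    (F : Finset ((h ≫ f).fiber s))
    (hF : ∀ z', z' ∈ F ↔ h ((h ≫ f).fiberι s z') = f.fiberι s x')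
    (hW : ∀ z' ∈ F, maximalIdeal (((h ≫ f).fiber s).presheaf.stalk z') ∉
      minimalPrimes (((h ≫ f).fiber s).presheaf.stalk z')) :
    (∀ z' ∈ F, LocalFinite ((Spec (CommRingCat.of A)).residueField s)
      (((h ≫ f).fiber s).presheaf.stalk z')) ∧
    (∑ z' ∈ F, localDelta ((Spec (CommRingCat.of A)).residueField s)
      (((h ≫ f).fiber s).presheaf.stalk z') =
      (Module.finrank ((Spec (CommRingCat.of A)).residueField s)
        (ResidueField ((f.fiber s).presheaf.stalk x')) : ℤ) *
        ((Module.length ((f.fiber s).presheaf.stalk x')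
          (NormCoker ((f.fiber s).presheaf.stalk x'))).toNat -
        (Module.length ((f.fiber s).presheaf.stalk x')
          (nilradical ((f.fiber s).presheaf.stalk x'))).toNat -
        ((Module.length (X.presheaf.stalk (f.fiberι s x'))
      (cotors (stalkHom f (f.fiberι s x') π) (pushStalk h (f.fiberι s x')) ⧸ LinearMap.range
      (cotorsMap (stalkHom f (f.fiberι s x') π)
        (Algebra.linearMap (X.presheaf.stalk (f.fiberι s x'))
          (pushStalk h (f.fiberι s x')))))).toNat -
          (Module.length (X.presheaf.stalk (f.fiberι s x')) (LinearMap.ker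
      (cotorsMap (stalkHom f (f.fiberι s x') π)
        (Algebra.linearMap (X.presheaf.stalk (f.fiberι s x'))
          (pushStalk h (f.fiberι s x')))))).toNat))) ∧
    (Function.Surjective (pushMap h (f.fiberι s x')) →
      (∀ o, pushMap h (f.fiberι s x') o = 0 → IsNilpotent o) →
      ∑ z' ∈ F, localEpsilon ((Spec (CommRingCat.of A)).residueField s)
        (((h ≫ f).fiber s).presheaf.stalk z') +
      ∑ z' ∈ F, localDelta ((Spec (CommRingCat.of A)).residueField s)
        (((h ≫ f).fiber s).presheaf.stalk z') =
        (Module.finrank ((Spec (CommRingCat.of A)).residueField s)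
          (ResidueField ((f.fiber s).presheaf.stalk x')) : ℤ) *
          (Module.length ((f.fiber s).presheaf.stalk x')
            (NormCoker ((f.fiber s).presheaf.stalk x'))).toNat) := by
  have hz : ∀ i : F, h ((h ≫ f).fiberι s i.1) ⤳ f.fiberι s x' := fun i =>
    specializes_of_eq ((hF i.1).mp i.2)
  let _ : ∀ i : F, Algebra (pushStalk h (f.fiberι s x'))
    (Z.presheaf.stalk ((h ≫ f).fiberι s i.1)) := fun i => (toStalk h (hz i)).hom.toAlgebra
  have hloc : ∀ i : F, IsLocalization.AtPrime (Z.presheaf.stalk ((h ≫ f).fiberι s i.1))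
    (pushIdeal h (hz i)) := fun i => isLocalization_toStalk h (hz i)
  have := finite_pushStalk h (f.fiberι s x')
  have key := invariants_reduction (k := (Spec (CommRingCat.of A)).residueField s)
    (O := X.presheaf.stalk (f.fiberι s x'))
    (R := (f.fiber s).presheaf.stalk x') (H := pushStalk h (f.fiberι s x'))
    (stalkHom f (f.fiberι s x') π) ((f.fiberι s).stalkMap x').hom
    (surjective_stalkMap_fiberι f s x') (span_stalkHom_eq_ker s x' hs) hPN hmin hl1 hl2
    (ι := F) (fun i => Z.presheaf.stalk ((h ≫ f).fiberι s i.1))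
    (fun i => ((h ≫ f).fiber s).presheaf.stalk i.1) (fun i => pushIdeal h (hz i))
    (fun i => by
      refine (comap_pushMap_pushIdeal (hz i)).trans ?_
      exact (genIdeal_eq_maximalIdeal_iff (hz i)).mpr ((hF i.1).mp i.2))
    (fun i j hij => by
      have := pushIdeal_injective h (hz i) (hz j) hij
      exact Subtype.ext (((h ≫ f).fiberι s).isEmbedding.injective this))
    -- A prime of the stalk over the maximal ideal is a point of `Z` over x, which lies in the fibre
    -- over s because x does.
    (fun I hI hIm => by
      obtain ⟨z, hzx, rfl⟩ := exists_eq_pushIdeal h I hIm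
      have hzs : z ∈ Set.range ((h ≫ f).fiberι s) := by
        rw [(h ≫ f).range_fiberι]
        have : f (h z) = s := by rw [hzx, apply_fiberι]
        exact this
      obtain ⟨z', rfl⟩ := hzs
      exact ⟨⟨z', (hF z').mpr hzx⟩, rfl⟩)
    (fun i => (((h ≫ f).fiberι s).stalkMap i.1).hom)
    (fun i => surjective_stalkMap_fiberι (h ≫ f) s i.1)
    (fun i => by
      rw [span_stalkHom_eq_ker s i.1 hs, ← toStalk_pushMap_stalkHom (f := f) _ (hz i) π]
      rfl)
    (fun i c o ho => algebraMap_eq_of_stalkMap_eq s x' i.1 (hz i) c o ho)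
    (fun i => hW i.1 i.2)
  obtain ⟨k1, k2, k3⟩ := key
  refine ⟨fun z hz => k1 ⟨z, hz⟩, ?_, fun a b => ?_⟩
  · rw [← k2]
    exact (Finset.sum_coe_sort F _).symm
  · rw [← k3 a b]
    congr 1
    · exact (Finset.sum_coe_sort F (fun z' => localEpsilon
        ((Spec (CommRingCat.of A)).residueField s) (((h ≫ f).fiber s).presheaf.stalk z'))).symm
    · exact (Finset.sum_coe_sort F (fun z' => localDelta
        ((Spec (CommRingCat.of A)).residueField s) (((h ≫ f).fiber s).presheaf.stalk z'))).symm

end PointInvariants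

end DeltaFamily
end

/-! ### The degree of a finite domain computed in a closed fibre. -/

noncomputable section
namespace DeltaFamily

section Degree

open IsLocalRing

lemma exists_isLocalizedModule_cotors {k D T : Type*} [CommRing k] [CommRing D] [CommRing T]
    [Algebra k D] [Algebra D T] [Algebra k T] [IsScalarTower k D T] (M : Submonoid D)
    [IsLocalization M T] (π : D) :
    ∃ f : (D ⧸ LinearMap.range (LinearMap.lsmul D D π)) →ₗ[D]
      (T ⧸ LinearMap.range (LinearMap.lsmul D T π)), IsLocalizedModule M f := by
  let f : (D ⧸ LinearMap.range (LinearMap.lsmul D D π)) →ₗ[D]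
      (T ⧸ LinearMap.range (LinearMap.lsmul D T π)) := cotorsMap π (Algebra.linearMap D T)
  have hf : ∀ d, f (Submodule.Quotient.mk d) = Submodule.Quotient.mk (algebraMap D T d) :=
    fun d => rfl
  refine ⟨f, ⟨fun s => ?_, fun y => ?_, ?_⟩⟩
  · obtain ⟨u, hu⟩ := IsLocalization.map_units T s
    refine (Module.End.isUnit_iff _).mpr ⟨?_, fun w => ?_⟩
    · rw [← LinearMap.ker_eq_bot, LinearMap.ker_eq_bot']
      intro v hv
      obtain ⟨v, rfl⟩ := Submodule.Quotient.mk_surjective _ v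
      have hv' : (Submodule.Quotient.mk ((s : D) • v) :
        T ⧸ LinearMap.range (LinearMap.lsmul D T π)) = 0 := hv
      rw [Submodule.Quotient.mk_eq_zero] at hv' ⊢
      obtain ⟨t, ht⟩ := hv'
      refine ⟨↑u⁻¹ * t, ?_⟩
      change π • (↑u⁻¹ * t) = v
      change π • t = _ at ht
      rw [← mul_smul_comm, ht, Algebra.smul_def, ← hu, Units.inv_mul_cancel_left]
    · obtain ⟨w, rfl⟩ := Submodule.Quotient.mk_surjective _ w
      refine ⟨Submodule.Quotient.mk (↑u⁻¹ * w), ?_⟩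
      change Submodule.Quotient.mk ((s : D) • (↑u⁻¹ * w)) = _
      rw [Algebra.smul_def, ← hu, Units.mul_inv_cancel_left]
  · obtain ⟨y, rfl⟩ := Submodule.Quotient.mk_surjective _ y
    obtain ⟨⟨x, s⟩, h⟩ := IsLocalization.surj M y
    refine ⟨(Submodule.Quotient.mk x, s), ?_⟩
    change Submodule.Quotient.mk ((s : D) • y) = f (Submodule.Quotient.mk x)
    rw [hf, ← h, Algebra.smul_def, mul_comm]
  · intro x y hxy
    obtain ⟨x, rfl⟩ := Submodule.Quotient.mk_surjective _ x
    obtain ⟨y, rfl⟩ := Submodule.Quotient.mk_surjective _ y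
    rw [hf, hf, Submodule.Quotient.eq] at hxy
    obtain ⟨t, ht⟩ := hxy
    obtain ⟨⟨d, s⟩, hd⟩ := IsLocalization.surj M t
    have h1 : algebraMap D T (s * (x - y)) = algebraMap D T (π * d) := by
      rw [map_mul, map_mul, map_sub, ← hd, ← ht]
      change _ * (π • t) = _
      rw [Algebra.smul_def]; ring
    obtain ⟨c, hc⟩ := (IsLocalization.eq_iff_exists M T).mp h1
    refine ⟨c * s, ?_⟩
    change (Submodule.Quotient.mk ((c * s : D) • x) : D ⧸ _) = Submodule.Quotient.mk ((c * s : D) • y)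
    rw [Submodule.Quotient.eq]
    refine ⟨c * d, ?_⟩
    change π * (c * d) = c * s * x - c * s * y
    linear_combination -hc

lemma length_cotors_restrictScalars {k D T : Type*} [CommRing k] [CommRing D] [CommRing T]
    [Algebra k D] [Algebra D T] [Algebra k T] [IsScalarTower k D T] (π : k) :
    Module.length k (cotors (algebraMap k D π) T) = Module.length k (cotors π T) := by
  have h : (LinearMap.range (LinearMap.lsmul D T (algebraMap k D π))).restrictScalars k =
      LinearMap.range (LinearMap.lsmul k T π) := by
    ext t
    constructor
    · rintro ⟨t, rfl⟩
      exact ⟨t, (algebraMap_smul D π t).symm⟩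
    · rintro ⟨t, rfl⟩
      exact ⟨t, algebraMap_smul D π t⟩
  exact ((Submodule.Quotient.restrictScalarsEquiv k _).symm.trans
    (Submodule.quotEquivOfEq _ _ h)).length_eq

/-- The degree of a one-dimensional finite domain over a principal ideal domain, computed in a
closed fibre. -/
theorem sum_length_cotors_eq_finrank {A B K L : Type*} [CommRing A] [IsDomain A]
    [IsPrincipalIdealRing A] [CommRing B] [Algebra A B] [Module.Finite A B] [Field K] [Field L]
    [Algebra A K] [IsFractionRing A K] [Algebra K L] (β : B →+* L)
    (hβ : ∀ y : L, ∃ b b' : B, β b' ≠ 0 ∧ y * β b' = β b)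
    (hβA : ∀ a : A, algebraMap K L (algebraMap A K a) = β (algebraMap A B a))
    {π : A} (hπ : Prime π)
    {ι : Type*} [Fintype ι] (S O κ : ι → Type*) [∀ i, CommRing (S i)] [∀ i, Algebra B (S i)]
    (P : ι → Ideal B) [∀ i, (P i).IsPrime] [∀ i, IsLocalization.AtPrime (S i) (P i)]
    (hp : ∀ i, RingHom.ker β ≤ P i) (hπP : ∀ i, algebraMap A B π ∈ P i)
    (hinj : Function.Injective P)
    (hsurj : ∀ I : Ideal B, I.IsPrime → RingHom.ker β ≤ I → algebraMap A B π ∈ I →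
      I ∈ Set.range P)
    [∀ i, CommRing (O i)] [∀ i, IsLocalRing (O i)] [∀ i, Algebra A (O i)]
    (θ : ∀ i, O i →+* S i) (hθ : ∀ i, Function.Surjective (θ i))
    (hθA : ∀ i a, θ i (algebraMap A (O i) a) = algebraMap B (S i) (algebraMap A B a))
    [∀ i, AddCommGroup (κ i)] [∀ i, Module (O i) (κ i)] [∀ i, Module A (κ i)]
    [∀ i, IsScalarTower A (O i) (κ i)] (eκ : ∀ i, κ i ≃ₗ[O i] O i ⧸ maximalIdeal (O i)) :
    ∑ i, Module.length (O i) (cotors (algebraMap A (O i) π)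
      (O i ⧸ ((RingHom.ker β).map (algebraMap B (S i))).comap (θ i))) * Module.length A (κ i) =
      Module.finrank K L := by
  let p : Ideal B := RingHom.ker β
  have hpp : p.IsPrime := RingHom.ker_isPrime β
  -- `D` is a finite torsion-free domain over `A` with fraction field `L`, so the length of D/π over
  -- `A` is the degree of `L` over `K`.
  let D := B ⧸ p
  let T : ι → Type _ := fun i => S i ⧸ p.map (algebraMap B (S i))
  let _ : Algebra D L := (Ideal.Quotient.lift p β fun a ha => ha).toAlgebra
  have hDL : ∀ b, algebraMap D L (Ideal.Quotient.mk p b) = β b := fun b => rfl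
  have hinjD : Function.Injective (algebraMap D L) := by
    rw [injective_iff_map_eq_zero]
    intro d hd
    obtain ⟨b, rfl⟩ := Ideal.Quotient.mk_surjective d
    exact Ideal.Quotient.eq_zero_iff_mem.mpr hd
  have hfs : FaithfulSMul D L := (faithfulSMul_iff_algebraMap_injective D L).mpr hinjD
  have hfrac : IsFractionRing D L := IsFractionRing.of_field D L fun y => by
    obtain ⟨b, b', hb', h⟩ := hβ y
    exact ⟨Ideal.Quotient.mk p b, Ideal.Quotient.mk p b', eq_div_of_mul_eq hb' h⟩
  let _ : Algebra A L := ((algebraMap K L).comp (algebraMap A K)).toAlgebra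
  have t1 : IsScalarTower A K L := IsScalarTower.of_algebraMap_eq fun a => rfl
  have t2 : IsScalarTower A D L := IsScalarTower.of_algebraMap_eq fun a => hβA a
  have hAD : Function.Injective (algebraMap A D) := by
    have : Function.Injective (algebraMap A L) :=
      (algebraMap K L).injective.comp (IsFractionRing.injective A K)
    rw [IsScalarTower.algebraMap_eq A D L, RingHom.coe_comp] at this
    exact Function.Injective.of_comp this
  have hfa : FaithfulSMul A D := (faithfulSMul_iff_algebraMap_injective A D).mpr hAD
  have hdeg := length_cotors_eq_finrank (D := D) hπ K L
  rw [← length_cotors_restrictScalars (D := D) π] at hdeg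
  let n : ι → Ideal D := fun i => (P i).map (Ideal.Quotient.mk p)
  have hnP : ∀ i, (n i).comap (Ideal.Quotient.mk p) = P i := fun i => by
    rw [Ideal.comap_map_of_surjective _ Ideal.Quotient.mk_surjective, ← RingHom.ker_eq_comap_bot,
      Ideal.mk_ker, sup_eq_left.mpr (hp i)]
  have hnp : ∀ i, (n i).IsPrime := fun i =>
    Ideal.map_isPrime_of_surjective Ideal.Quotient.mk_surjective (by
      rw [Ideal.mk_ker]; exact hp i)
  -- The contraction to `A` contains π ≠ 0, so it is maximal, and `D` is integral over `A`.
  have hnmax : ∀ i, (n i).IsMaximal := fun i => by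
    refine Ideal.isMaximal_of_isIntegral_of_isMaximal_comap (R := A) (n i) ?_
    refine IsPrime.to_maximal_ideal (hpi := inferInstance) fun h0 => hπ.ne_zero ?_
    rw [← Ideal.mem_bot, ← h0, Ideal.mem_comap]
    exact Ideal.mem_map_of_mem _ (hπP i)
  have hninj : Function.Injective n := fun i j hij => hinj (by rw [← hnP, ← hnP, hij])
  have hV : Module.length A (cotors (algebraMap A D π) D) ≠ ⊤ := by
    rw [hdeg]; exact ENat.natCast_ne_top _
  have hVf : IsFiniteLength D (cotors (algebraMap A D π) D) :=
    isFiniteLength_of_tower (Module.length_ne_top_iff.mp hV)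
  let _ : ∀ i, Algebra A (S i) := fun i =>
    ((algebraMap B (S i)).comp (algebraMap A B)).toAlgebra
  have t3 : ∀ i, IsScalarTower A B (S i) := fun i => IsScalarTower.of_algebraMap_eq fun a => rfl
  have t4 : ∀ i, IsScalarTower A D (T i) := fun i => IsScalarTower.of_algebraMap_eq fun a => by
    change Ideal.Quotient.mk _ (algebraMap A (S i) a) = _
    rw [IsScalarTower.algebraMap_apply A B (S i)]
    rfl
  have hT : ∀ i, IsLocalization (n i).primeCompl (T i) := fun i =>
    isLocalization_reduction (S := S i) (P i) (Ideal.Quotient.mk p) Ideal.Quotient.mk_surjective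
      (Ideal.Quotient.mk _) Ideal.Quotient.mk_surjective rfl (by rw [Ideal.mk_ker, Ideal.mk_ker])
      (n i) (hnP i)
  choose f hf using fun i => exists_isLocalizedModule_cotors (k := A) (T := T i) (n i).primeCompl
    (algebraMap A D π)
  -- D/π is the sum of its localizations, and the maximal ideals containing its annihilator contain
  -- π, so they come from the listed primes `P i`.
  have hsum := length_eq_sum_of_isLocalizedModule (k := A) n hninj hVf (fun I hI hann => by
    have hπI : algebraMap A D π ∈ I := hann (by
      rw [Module.mem_annihilator]
      intro m
      obtain ⟨m, rfl⟩ := Submodule.Quotient.mk_surjective _ m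
      rw [← Submodule.Quotient.mk_smul, Submodule.Quotient.mk_eq_zero]
      exact ⟨m, rfl⟩)
    obtain ⟨i, hi⟩ := hsurj (I.comap (Ideal.Quotient.mk p)) inferInstance (by
      intro b hb
      rw [Ideal.mem_comap, Ideal.Quotient.eq_zero_iff_mem.mpr hb]
      exact zero_mem _) hπI
    refine ⟨i, ?_⟩
    change (P i).map _ = I
    rw [hi, Ideal.map_comap_of_surjective _ Ideal.Quotient.mk_surjective]) (fun i =>
      cotors (algebraMap A D π) (T i)) f
  have hfin : ∀ i, Module.length A (cotors (algebraMap A D π) (T i)) ≠ ⊤ := fun i h0 => by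
    have h1 := Finset.single_le_sum (f := fun i => Module.length A (cotors (algebraMap A D π) (T i)))
      (fun _ _ => zero_le) (Finset.mem_univ i)
    rw [← hsum] at h1
    exact hV (top_le_iff.mp (h0 ▸ h1))
  rw [← hdeg, hsum]
  refine Finset.sum_congr rfl fun i _ => ?_
  let _ : Algebra (O i) (S i) := (θ i).toAlgebra
  have t5 : IsScalarTower A (O i) (S i) := IsScalarTower.of_algebraMap_eq fun a => (hθA i a).symm
  have t6 : IsScalarTower A (O i) (T i) := IsScalarTower.of_algebraMap_eq fun a => by
    change Ideal.Quotient.mk _ (algebraMap A (S i) a) = _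
    rw [IsScalarTower.algebraMap_apply A (O i) (S i)]
    rfl
  let ψ : O i →ₗ[O i] T i := (Algebra.linearMap (O i) (T i))
  have hψs : Function.Surjective ψ := fun y => by
    obtain ⟨y, rfl⟩ := Ideal.Quotient.mk_surjective y
    obtain ⟨o, rfl⟩ := hθ i y
    exact ⟨o, rfl⟩
  have hψk : ((RingHom.ker β).map (algebraMap B (S i))).comap (θ i) = LinearMap.ker ψ := by
    ext o
    exact (Ideal.Quotient.eq_zero_iff_mem (I := p.map (algebraMap B (S i)))).symm
  let e : (O i ⧸ ((RingHom.ker β).map (algebraMap B (S i))).comap (θ i)) ≃ₗ[O i] T i :=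
    (Submodule.quotEquivOfEq _ _ hψk).trans (ψ.quotKerEquivOfSurjective hψs)
  rw [length_cotors_congr _ e]
  have h1 : Module.length A (cotors (algebraMap A D π) (T i)) =
      Module.length A (cotors (algebraMap A (O i) π) (T i)) := by
    rw [length_cotors_restrictScalars, length_cotors_restrictScalars]
  rw [h1]
  have h2 : IsFiniteLength (O i) (cotors (algebraMap A (O i) π) (T i)) :=
    isFiniteLength_of_tower (R := A) (Module.length_ne_top_iff.mp (h1 ▸ hfin i))
  exact (length_eq_length_mul_residue (eκ i) h2).symm

end Degree

end DeltaFamily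
end

/-! ### Closed subschemes finite over the base: residue fields and degrees. -/

noncomputable section
namespace DeltaFamily

section FiniteSubscheme

open IsLocalRing

/-- Finitely many generators of `B` over `A` are integral over `k` and generate `L` as a field. -/
lemma finite_of_fractions {A B k L : Type*} [CommRing A] [CommRing B] [Algebra A B]
    [Module.Finite A B] [Field k] [Field L] [Algebra k L] (α : A →+* k) (β : B →+* L)
    (hβ : ∀ y : L, ∃ b b' : B, β b' ≠ 0 ∧ y * β b' = β b)
    (hβA : ∀ a : A, algebraMap k L (α a) = β (algebraMap A B a)) : Module.Finite k L := by
  obtain ⟨G, hG⟩ := (inferInstance : Module.Finite A B).1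
  let E : IntermediateField k L := IntermediateField.adjoin k (β '' G)
  have hmem : ∀ b : B, β b ∈ E := by
    intro b
    have hb : b ∈ Submodule.span A (G : Set B) := hG ▸ Submodule.mem_top
    induction hb using Submodule.span_induction with
    | mem x hx => exact IntermediateField.subset_adjoin k _ ⟨x, hx, rfl⟩
    | zero => rw [map_zero]; exact zero_mem E
    | add x y _ _ hx hy => rw [map_add]; exact add_mem hx hy
    | smul a x _ hx =>
      rw [Algebra.smul_def, map_mul, ← hβA]
      exact mul_mem (E.algebraMap_mem _) hx
  have htop : E = ⊤ := by
    rw [eq_top_iff]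
    intro y _
    obtain ⟨b, b', hb', h⟩ := hβ y
    rw [eq_div_of_mul_eq hb' h]
    exact div_mem (hmem b) (hmem b')
  have hint : ∀ x ∈ β '' (G : Set B), IsIntegral k x := by
    rintro _ ⟨b, -, rfl⟩
    obtain ⟨q, hq, h0⟩ := Algebra.IsIntegral.isIntegral (R := A) b
    refine ⟨q.map α, hq.map α, ?_⟩
    rw [Polynomial.eval₂_map, show (algebraMap k L).comp α = β.comp (algebraMap A B) from
      RingHom.ext hβA, ← Polynomial.hom_eval₂, h0, map_zero]
  have : Finite (β '' (G : Set B)) := (G.finite_toSet.image β).to_subtype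
  have hfin : FiniteDimensional k E := IntermediateField.finiteDimensional_adjoin hint
  rw [htop] at hfin
  exact Module.Finite.equiv (IntermediateField.topEquiv (F := k) (E := L)).toLinearEquiv

lemma nonempty_residue_equiv {O κ : Type*} [CommRing O] [IsLocalRing O] [Field κ] [Algebra O κ]
    (h : Function.Surjective (algebraMap O κ)) : Nonempty (κ ≃ₗ[O] O ⧸ maximalIdeal O) := by
  have hk : maximalIdeal O = LinearMap.ker (Algebra.linearMap O κ) :=
    (eq_maximalIdeal (RingHom.ker_isMaximal_of_surjective (algebraMap O κ) h)).symm
  exact ⟨((Submodule.quotEquivOfEq _ _ hk).trans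
    ((Algebra.linearMap O κ).quotKerEquivOfSurjective h)).symm⟩

variable {A : Type u} [CommRing A] {X Y : Scheme.{u}} (i : Y ⟶ X)
  (f : X ⟶ Spec (CommRingCat.of A))

/-- The homomorphism of local rings at points related by a morphism and a specialization. -/
def stalkTo {y : Y} {x : X} (hy : i y ⤳ x) : X.presheaf.stalk x ⟶ Y.presheaf.stalk y :=
  X.presheaf.stalkSpecializes hy ≫ i.stalkMap y

lemma stalkTo_apply {y : Y} {x : X} (hy : i y ⤳ x) (r : X.presheaf.stalk x) :
    stalkTo i hy r = i.stalkMap y (X.presheaf.stalkSpecializes hy r) := rfl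

lemma stalkTo_stalkHom {y : Y} {x : X} (hy : i y ⤳ x) (a : A) :
    stalkTo i hy (stalkHom f x a) = stalkHom (i ≫ f) y a := by
  rw [stalkTo_apply, stalkSpecializes_stalkHom, stalkMap_stalkHom]

lemma comap_stalkTo_maximalIdeal {y : Y} {x : X} (hy : i y ⤳ x) :
    (maximalIdeal (Y.presheaf.stalk y)).comap (stalkTo i hy).hom = genIdeal hy := by
  ext r
  change stalkTo i hy r ∈ maximalIdeal _ ↔ X.presheaf.stalkSpecializes hy r ∈ maximalIdeal _
  rw [stalkTo_apply, mem_maximalIdeal, mem_maximalIdeal, mem_nonunits_iff, mem_nonunits_iff]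
  exact not_congr (isUnit_map_iff (i.stalkMap y).hom _)

lemma genIdeal_congr {w w' x : X} (e : w = w') (h : w ⤳ x) (h' : w' ⤳ x) :
    genIdeal h = genIdeal h' := by
  subst e
  rfl

lemma stalkSpecializes_stalkTo {y w : Y} {x : X} (hw : w ⤳ y) (hy : i y ⤳ x)
    (hwx : i w ⤳ x) (r : X.presheaf.stalk x) :
    Y.presheaf.stalkSpecializes hw (stalkTo i hy r) = stalkTo i hwx r := by
  rw [stalkTo_apply, stalkTo_apply, ← Scheme.Hom.stalkSpecializes_stalkMap_apply]
  congr 1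
  have := X.presheaf.stalkSpecializes_comp (i.base.hom.map_specializes hw) hy
  exact CategoryTheory.ConcreteCategory.congr_hom this r

lemma comap_stalkTo_genIdeal {y w : Y} {x : X} (hw : w ⤳ y) (hy : i y ⤳ x) (hwx : i w ⤳ x) :
    (genIdeal hw).comap (stalkTo i hy).hom = genIdeal hwx := by
  rw [← comap_stalkTo_maximalIdeal]
  ext r
  change Y.presheaf.stalkSpecializes hw (stalkTo i hy r) ∈ maximalIdeal _ ↔
    stalkTo i hwx r ∈ maximalIdeal _
  rw [stalkSpecializes_stalkTo]

lemma surjective_stalkTo [IsPreimmersion i] {y : Y} {x : X} (hy : i y = x) :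
    Function.Surjective (stalkTo i (specializes_of_eq hy)) := by
  subst hy
  intro t
  obtain ⟨r, rfl⟩ := i.stalkMap_surjective y t
  refine ⟨r, ?_⟩
  rw [stalkTo_apply, X.presheaf.stalkSpecializes_refl]
  rfl

/-- The local rings of `Y` and of the fibre at the point are both quotients of the local ring of
`X`, so all three have the same residue field, which is therefore made of fractions of sections of
`Y`. -/
lemma exists_residue_sections [IsPreimmersion i] [IsAffine Y] (s : Spec (CommRingCat.of A))
    (x' : f.fiber s) (y : Y) (hy : i y = f.fiberι s x') :
    ∃ β : Γ(Y, ⊤) →+* ResidueField ((f.fiber s).presheaf.stalk x'),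
      RingHom.ker β = ((isAffineOpen_top Y).primeIdealOf ⟨y, Opens.mem_top y⟩).asIdeal ∧
      (∀ z, ∃ b b', β b' ≠ 0 ∧ z * β b' = β b) ∧
      ∀ a : A, algebraMap _ _ (resHom s a) = β (sectionsHom (i ≫ f) ⊤ a) := by
  let R := (f.fiber s).presheaf.stalk x'
  let O := X.presheaf.stalk (f.fiberι s x')
  let θ : O →+* Y.presheaf.stalk y := (stalkTo i (specializes_of_eq hy)).hom
  have hθ : Function.Surjective θ := surjective_stalkTo i hy
  let q : O →+* R := ((f.fiberι s).stalkMap x').hom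
  let ρ : O →+* ResidueField R := (residue R).comp q
  have hρk : RingHom.ker ρ = maximalIdeal O := by
    ext r
    rw [RingHom.mem_ker, RingHom.comp_apply, residue_eq_zero_iff, mem_maximalIdeal,
      mem_maximalIdeal, mem_nonunits_iff, mem_nonunits_iff]
    exact not_congr (isUnit_map_iff ((f.fiberι s).stalkMap x').hom _)
  have hθk : RingHom.ker θ ≤ RingHom.ker ρ := by
    rw [hρk]
    intro r hr
    have h1 : r ∈ (maximalIdeal (Y.presheaf.stalk y)).comap θ := by
      rw [Ideal.mem_comap, RingHom.mem_ker.mp hr]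
      exact zero_mem _
    have h2 := (comap_stalkTo_maximalIdeal i (specializes_of_eq hy)).le h1
    rwa [(genIdeal_eq_maximalIdeal_iff (specializes_of_eq hy)).mpr hy] at h2
  let σ : Y.presheaf.stalk y →+* ResidueField R := RingHom.liftOfSurjective θ hθ ⟨ρ, hθk⟩
  have hσ : ∀ r, σ (θ r) = ρ r := fun r =>
    RingHom.liftOfRightInverse_comp_apply θ _ (Function.rightInverse_surjInv hθ) _ r
  have hσs : Function.Surjective σ := by
    intro z
    obtain ⟨z, rfl⟩ := residue_surjective z
    obtain ⟨r, rfl⟩ := surjective_stalkMap_fiberι f s x' z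
    exact ⟨θ r, hσ r⟩
  have hσk : RingHom.ker σ = maximalIdeal (Y.presheaf.stalk y) :=
    eq_maximalIdeal (RingHom.ker_isMaximal_of_surjective σ hσs)
  let g : Γ(Y, ⊤) →+* Y.presheaf.stalk y := (Y.presheaf.germ ⊤ y (Opens.mem_top y)).hom
  have hker : RingHom.ker (σ.comp g) =
      ((isAffineOpen_top Y).primeIdealOf ⟨y, Opens.mem_top y⟩).asIdeal := by
    rw [← comap_germ_maximalIdeal, ← hσk]
    rfl
  refine ⟨σ.comp g, hker, fun z => ?_, fun a => ?_⟩
  · obtain ⟨t, rfl⟩ := hσs z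
    let _ := g.toAlgebra
    have l1 : IsLocalization.AtPrime (Y.presheaf.stalk y)
        ((isAffineOpen_top Y).primeIdealOf ⟨y, Opens.mem_top y⟩).asIdeal :=
      (isAffineOpen_top Y).isLocalization_stalk ⟨y, Opens.mem_top y⟩
    obtain ⟨⟨b, c⟩, hbc⟩ := IsLocalization.surj
      ((isAffineOpen_top Y).primeIdealOf ⟨y, Opens.mem_top y⟩).asIdeal.primeCompl t
    refine ⟨b, c, fun h0 => c.2 (hker.le (RingHom.mem_ker.mpr h0)), ?_⟩
    rw [RingHom.comp_apply, RingHom.comp_apply, ← map_mul]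
    exact congrArg σ hbc
  · have h1 : g (sectionsHom (i ≫ f) ⊤ a) = θ (stalkHom f _ a) :=
      (germ_sectionsHom (i ≫ f) ⊤ y (Opens.mem_top y) a).trans
        (stalkTo_stalkHom i f (specializes_of_eq hy) a).symm
    rw [RingHom.comp_apply, h1, hσ]
    change _ = residue R ((f.fiberι s).stalkMap x' (stalkHom f _ a))
    rw [stalkMap_stalkHom, ← algebraMap_resHom]
    rfl

lemma finite_sectionsHom [IsAffine Y] (g : Y ⟶ Spec (CommRingCat.of A)) [IsFinite g] :
    (sectionsHom g ⊤).Finite := by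
  have h1 : (g.app ⊤).hom.Finite := g.finite_app ⊤ (isAffineOpen_top _)
  have h2 : Function.Surjective (Scheme.ΓSpecIso (CommRingCat.of A)).inv.hom :=
    (ConcreteCategory.bijective_of_isIso (Scheme.ΓSpecIso (CommRingCat.of A)).inv).2
  have h3 := h1.comp (RingHom.Finite.of_surjective _ h2)
  have h4 : sectionsHom g ⊤ = (g.app ⊤).hom.comp (Scheme.ΓSpecIso (CommRingCat.of A)).inv.hom := by
    rw [sectionsHom]
    have : Y.presheaf.map (homOfLE (le_top : (⊤ : Y.Opens) ≤ ⊤)).op = 𝟙 _ := Y.presheaf.map_id _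
    rw [this, Category.comp_id]
    rfl
  rw [h4]
  exact h3

lemma finite_residueField [IsPreimmersion i] [IsFinite (i ≫ f)] (s : Spec (CommRingCat.of A))
    (x' : f.fiber s) (y : Y) (hy : i y = f.fiberι s x') :
    Module.Finite ((Spec (CommRingCat.of A)).residueField s)
      (ResidueField ((f.fiber s).presheaf.stalk x')) := by
  have : IsAffine Y := isAffine_of_isAffineHom (i ≫ f)
  obtain ⟨β, -, h1, h2⟩ := exists_residue_sections i f s x' y hy
  let _ := (sectionsHom (i ≫ f) ⊤).toAlgebra
  have : Module.Finite A Γ(Y, ⊤) := finite_sectionsHom (i ≫ f)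
  exact finite_of_fractions (resHom s) β h1 h2

/-- Fibres of finite morphisms are discrete, so they contain no proper specializations. -/
lemma eq_of_specializes_of_isFinite {S : Scheme.{u}} (g : Y ⟶ S) [IsFinite g] {y w : Y}
    (hw : w ⤳ y) (hg : g w = g y) : w = y := by
  have h := g.isDiscrete_preimage_singleton (g y)
  have hd : DiscreteTopology (g ⁻¹' {g y}) := h.to_subtype
  have hs : (⟨w, hg⟩ : g ⁻¹' {g y}) ⤳ ⟨y, rfl⟩ := by
    rw [← Topology.IsInducing.subtypeVal.specializes_iff]
    exact hw
  exact congrArg Subtype.val hs.eq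

lemma primeIdealOf_le_iff [IsAffine Y] (y w : Y) :
    ((isAffineOpen_top Y).primeIdealOf ⟨w, Opens.mem_top w⟩).asIdeal ≤
      ((isAffineOpen_top Y).primeIdealOf ⟨y, Opens.mem_top y⟩).asIdeal ↔ w ⤳ y := by
  have h1 := PrimeSpectrum.le_iff_specializes
    ((isAffineOpen_top Y).primeIdealOf ⟨w, Opens.mem_top w⟩)
    ((isAffineOpen_top Y).primeIdealOf ⟨y, Opens.mem_top y⟩)
  refine h1.trans ((isAffineOpen_top Y).fromSpec.isOpenEmbedding.isInducing.specializes_iff.symm.trans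
    ?_)
  have e1 := (isAffineOpen_top Y).fromSpec_primeIdealOf ⟨w, Opens.mem_top w⟩
  have e2 := (isAffineOpen_top Y).fromSpec_primeIdealOf ⟨y, Opens.mem_top y⟩
  exact Iff.of_eq (congrArg₂ (fun a b => a ⤳ b) e1 e2)

lemma resHom_surjective (s : Spec (CommRingCat.of A)) (hs : s.asIdeal.IsMaximal) :
    Function.Surjective (resHom s) := by
  intro z
  obtain ⟨a, b, hb, h⟩ := exists_eq_resHom_div s z
  obtain ⟨c, hc⟩ := Ideal.Quotient.exists_inv (I := s.asIdeal) (a := Ideal.Quotient.mk _ b)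
    (fun h0 => hb (Ideal.Quotient.eq_zero_iff_mem.mp h0))
  obtain ⟨c, rfl⟩ := Ideal.Quotient.mk_surjective c
  rw [← map_mul, ← map_one (Ideal.Quotient.mk s.asIdeal), Ideal.Quotient.eq, ← ker_resHom,
    RingHom.mem_ker, map_sub, map_one, sub_eq_zero, map_mul] at hc
  exact ⟨c * a, by rw [map_mul, ← h, ← mul_assoc, mul_comm (resHom s c), hc, one_mul]⟩

open Classical in
/-- The length of the closed fibre of the closure of a point at one of its specializations. -/
def fibreLength (π : A) (z x : X) : ℕ∞ :=
  if h : z ⤳ x then Module.length (X.presheaf.stalk x)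
    (cotors (stalkHom f x π) (X.presheaf.stalk x ⧸ genIdeal h)) else 0

/-- The degree over the generic point of a finite subscheme, computed in a closed fibre. -/
theorem sum_fibreLength_eq_finrank [IsDomain A] [IsPrincipalIdealRing A] [IsClosedImmersion i]
    [IsFinite (i ≫ f)] {η : Spec (CommRingCat.of A)} (hη : η.asIdeal = ⊥) (z' : f.fiber η)
    (w : Y) (hw : i w = f.fiberι η z') {π : A} (hπ : Prime π) (s : Spec (CommRingCat.of A))
    (hs : s.asIdeal = Ideal.span {π}) (F : Finset (f.fiber s))
    (hF : ∀ x', f.fiberι η z' ⤳ f.fiberι s x' → x' ∈ F) :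
    ∑ x' ∈ F, fibreLength f π (f.fiberι η z') (f.fiberι s x') *
      (Module.finrank ((Spec (CommRingCat.of A)).residueField s)
        (ResidueField ((f.fiber s).presheaf.stalk x')) : ℕ∞) =
      Module.finrank ((Spec (CommRingCat.of A)).residueField η)
        (ResidueField ((f.fiber η).presheaf.stalk z')) := by
  classical
  have hsm : s.asIdeal.IsMaximal := by
    refine IsPrime.to_maximal_ideal (hpi := s.isPrime) fun h0 => hπ.ne_zero ?_
    rw [← Ideal.mem_bot, ← h0, hs]
    exact Ideal.mem_span_singleton_self π
  have : IsAffine Y := isAffine_of_isAffineHom (i ≫ f)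
  let _ := (sectionsHom (i ≫ f) ⊤).toAlgebra
  have hfB : Module.Finite A Γ(Y, ⊤) := finite_sectionsHom (i ≫ f)
  let K := (Spec (CommRingCat.of A)).residueField η
  let L := ResidueField ((f.fiber η).presheaf.stalk z')
  let _ : Algebra A K := (resHom η).toAlgebra
  have hfs : FaithfulSMul A K := (faithfulSMul_iff_algebraMap_injective A K).mpr (by
    rw [injective_iff_map_eq_zero]
    intro a ha
    have : a ∈ η.asIdeal := (ker_resHom η).le (RingHom.mem_ker.mpr ha)
    rwa [hη] at this)
  have hfr : IsFractionRing A K := IsFractionRing.of_field A K fun y => by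
    obtain ⟨a, b, hb, h⟩ := exists_eq_resHom_div η y
    refine ⟨a, b, eq_div_of_mul_eq (fun h0 => hb ?_) ((mul_comm _ _).trans h)⟩
    exact (ker_resHom η).le (RingHom.mem_ker.mpr h0)
  obtain ⟨β, hβk, hβ, hβA⟩ := exists_residue_sections i f η z' w hw
  let ι := {x' : f.fiber s // f.fiberι η z' ⤳ f.fiberι s x'}
  have hfin : Fintype ι := Fintype.ofInjective
    (fun x : ι => (⟨x.1, hF x.1 x.2⟩ : F)) fun a b hab => Subtype.ext (congrArg (fun v : F => v.1) hab)
  -- `Y` is closed in `X` and contains the generic point in question, so it contains all its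
  -- specializations.
  have hy : ∀ x : ι, ∃ y : Y, i y = f.fiberι s x.1 := fun x =>
    x.2.mem_closed i.isClosedEmbedding.isClosed_range ⟨w, hw⟩
  choose y hy using hy
  have hwy : ∀ x : ι, w ⤳ y x := fun x => by
    rw [← i.isClosedEmbedding.isInducing.specializes_iff, hw, hy]
    exact x.2
  have hmem : ∀ (v : Y), algebraMap A Γ(Y, ⊤) π ∈
      ((isAffineOpen_top Y).primeIdealOf ⟨v, Opens.mem_top v⟩).asIdeal ↔ (i ≫ f) v = s := by
    intro v
    have h0 : algebraMap A Γ(Y, ⊤) π ∈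
      ((isAffineOpen_top Y).primeIdealOf ⟨v, Opens.mem_top v⟩).asIdeal ↔
        π ∈ ((i ≫ f) v).asIdeal := by
      rw [← comap_germ_maximalIdeal, ← comap_stalkHom_maximalIdeal (i ≫ f) v]
      change Y.presheaf.germ ⊤ v (Opens.mem_top v) (sectionsHom (i ≫ f) ⊤ π) ∈ maximalIdeal _ ↔
        stalkHom (i ≫ f) v π ∈ maximalIdeal _
      rw [germ_sectionsHom]
    rw [h0]
    constructor
    · intro h1
      refine PrimeSpectrum.ext (hsm.eq_of_le ((i ≫ f) v).isPrime.ne_top ?_).symm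
      rwa [hs, Ideal.span_singleton_le_iff_mem]
    · intro h1
      have h2 : ((i ≫ f) v).asIdeal = s.asIdeal := congrArg PrimeSpectrum.asIdeal h1
      rw [h2, hs]
      exact Ideal.mem_span_singleton_self π
  let P : ι → Ideal Γ(Y, ⊤) := fun x =>
    ((isAffineOpen_top Y).primeIdealOf ⟨y x, Opens.mem_top (y x)⟩).asIdeal
  let _ : ∀ x : ι, Algebra Γ(Y, ⊤) (Y.presheaf.stalk (y x)) := fun x =>
    (Y.presheaf.germ ⊤ (y x) (Opens.mem_top _)).hom.toAlgebra
  have hP : ∀ x, (P x).IsPrime := fun x => PrimeSpectrum.isPrime _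
  have hloc : ∀ x, IsLocalization.AtPrime (Y.presheaf.stalk (y x)) (P x) := fun x =>
    (isAffineOpen_top Y).isLocalization_stalk ⟨y x, Opens.mem_top _⟩
  let _ : ∀ x : ι, Algebra A (X.presheaf.stalk (f.fiberι s x.1)) := fun x =>
    (stalkHom f _).toAlgebra
  let ρ : ∀ x : ι, X.presheaf.stalk (f.fiberι s x.1) →+*
    ResidueField ((f.fiber s).presheaf.stalk x.1) := fun x =>
      (residue _).comp ((f.fiberι s).stalkMap x.1).hom
  have hρs : ∀ x, Function.Surjective (ρ x) := fun x =>
    residue_surjective.comp (surjective_stalkMap_fiberι f s x.1)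
  let _ : ∀ x : ι, Algebra (X.presheaf.stalk (f.fiberι s x.1))
    (ResidueField ((f.fiber s).presheaf.stalk x.1)) := fun x => (ρ x).toAlgebra
  let _ : ∀ x : ι, Algebra A (ResidueField ((f.fiber s).presheaf.stalk x.1)) := fun x =>
    ((algebraMap _ _).comp (resHom s)).toAlgebra
  let _ : Algebra A ((Spec (CommRingCat.of A)).residueField s) := (resHom s).toAlgebra
  have tA : ∀ x : ι, IsScalarTower A (X.presheaf.stalk (f.fiberι s x.1))
    (ResidueField ((f.fiber s).presheaf.stalk x.1)) := fun x =>
      IsScalarTower.of_algebraMap_eq fun a => by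
        change algebraMap _ _ (resHom s a) = residue _ ((f.fiberι s).stalkMap x.1 (stalkHom f _ a))
        rw [stalkMap_stalkHom, ← algebraMap_resHom]
        rfl
  have tB : ∀ x : ι, IsScalarTower A ((Spec (CommRingCat.of A)).residueField s)
    (ResidueField ((f.fiber s).presheaf.stalk x.1)) := fun x =>
      IsScalarTower.of_algebraMap_eq fun a => rfl
  have eκ : ∀ x : ι, ResidueField ((f.fiber s).presheaf.stalk x.1) ≃ₗ[X.presheaf.stalk
      (f.fiberι s x.1)] X.presheaf.stalk (f.fiberι s x.1) ⧸ maximalIdeal _ := fun x =>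
    (nonempty_residue_equiv (hρs x)).some
  -- The prime of the generic point on `Y`, extended to a local ring of `Y` and pulled back to `X`,
  -- is the prime of the generization; the local lengths are thus those of `fibreLength`.
  have hQ : ∀ x : ι, ((RingHom.ker β).map (algebraMap Γ(Y, ⊤) (Y.presheaf.stalk (y x)))).comap
      (stalkTo i (specializes_of_eq (hy x))).hom = genIdeal x.2 := fun x => by
    have h1 : RingHom.ker β = (genIdeal (hwy x)).comap
        (algebraMap Γ(Y, ⊤) (Y.presheaf.stalk (y x))) := by
      rw [hβk, ← comap_germ_maximalIdeal]
      ext b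
      change _ ↔ Y.presheaf.stalkSpecializes (hwy x) (Y.presheaf.germ ⊤ (y x) (Opens.mem_top _) b)
        ∈ maximalIdeal _
      rw [Y.presheaf.germ_stalkSpecializes_apply]
      rfl
    have h2 := IsLocalization.map_under (P x).primeCompl (Y.presheaf.stalk (y x))
      (genIdeal (hwy x))
    rw [h1]
    refine (congrArg (Ideal.comap (stalkTo i (specializes_of_eq (hy x))).hom) h2).trans ?_
    exact (comap_stalkTo_genIdeal i (hwy x) (specializes_of_eq (hy x))
      ((specializes_of_eq hw).trans x.2)).trans (genIdeal_congr hw _ _)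
  have key := sum_length_cotors_eq_finrank (A := A) (B := Γ(Y, ⊤)) (K := K) (L := L) β hβ hβA hπ
    (fun x : ι => Y.presheaf.stalk (y x)) (fun x : ι => X.presheaf.stalk (f.fiberι s x.1))
    (fun x : ι => ResidueField ((f.fiber s).presheaf.stalk x.1)) P
    (fun x => by rw [hβk]; exact (primeIdealOf_le_iff (y x) w).mpr (hwy x))
    (fun x => (hmem (y x)).mpr ((congrArg f (hy x)).trans (apply_fiberι f s x.1)))
    (fun a b hab => by
      have h1 : y a = y b := by
        have h2 := congrArg (isAffineOpen_top Y).fromSpec (PrimeSpectrum.ext hab)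
        exact ((isAffineOpen_top Y).fromSpec_primeIdealOf ⟨y a, Opens.mem_top _⟩).symm.trans
          (h2.trans ((isAffineOpen_top Y).fromSpec_primeIdealOf ⟨y b, Opens.mem_top _⟩))
      refine Subtype.ext ((f.fiberι s).isEmbedding.injective ?_)
      rw [← hy a, ← hy b, h1])
    (fun I hI hβI hπI => by
      let v : Y := (isAffineOpen_top Y).fromSpec ⟨I, hI⟩
      have hv : (isAffineOpen_top Y).primeIdealOf ⟨v, Opens.mem_top v⟩ = ⟨I, hI⟩ :=
        (isAffineOpen_top Y).fromSpec.isOpenEmbedding.injective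
          ((isAffineOpen_top Y).fromSpec_primeIdealOf ⟨v, Opens.mem_top v⟩)
      have hv' : ((isAffineOpen_top Y).primeIdealOf ⟨v, Opens.mem_top v⟩).asIdeal = I :=
        congrArg PrimeSpectrum.asIdeal hv
      have h1 : (i ≫ f) v = s := (hmem v).mp (by rw [hv']; exact hπI)
      have h2 : w ⤳ v := (primeIdealOf_le_iff v w).mp (by rw [hv', ← hβk]; exact hβI)
      have h3 : i v ∈ Set.range (f.fiberι s) := by
        rw [f.range_fiberι]; exact h1
      obtain ⟨x', hx'⟩ := h3
      have h4 : f.fiberι η z' ⤳ f.fiberι s x' := by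
        rw [← hw, hx']
        exact i.base.hom.map_specializes h2
      have h5 : y ⟨x', h4⟩ = v := i.isClosedEmbedding.injective ((hy ⟨x', h4⟩).trans hx')
      refine ⟨⟨x', h4⟩, ?_⟩
      rw [← hv']
      change ((isAffineOpen_top Y).primeIdealOf ⟨y ⟨x', h4⟩, _⟩).asIdeal = _
      congr 3)
    (fun x => (stalkTo i (specializes_of_eq (hy x))).hom)
    (fun x => surjective_stalkTo i (hy x))
    (fun x a => (stalkTo_stalkHom i f (specializes_of_eq (hy x)) a).trans
      (germ_sectionsHom (i ≫ f) ⊤ (y x) (Opens.mem_top _) a).symm) eκ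
  rw [← key]
  -- Points of `F` outside the closure contribute zero by the default value of `fibreLength`, so any
  -- sufficiently large `F` is allowed.
  have hsub : ∑ x' ∈ F, fibreLength f π (f.fiberι η z') (f.fiberι s x') *
      (Module.finrank ((Spec (CommRingCat.of A)).residueField s)
        (ResidueField ((f.fiber s).presheaf.stalk x')) : ℕ∞) =
      ∑ x' ∈ F with f.fiberι η z' ⤳ f.fiberι s x',
        fibreLength f π (f.fiberι η z') (f.fiberι s x') *
        (Module.finrank ((Spec (CommRingCat.of A)).residueField s)
        (ResidueField ((f.fiber s).presheaf.stalk x')) : ℕ∞) := by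
    refine (Finset.sum_filter_of_ne fun x' _ hne => ?_).symm
    by_contra hcon
    rw [fibreLength, dif_neg hcon, zero_mul] at hne
    exact hne rfl
  rw [hsub, Finset.sum_subtype (p := fun x' => f.fiberι η z' ⤳ f.fiberι s x') _ (fun x' => by
    rw [Finset.mem_filter]
    exact ⟨fun h => h.2, fun h => ⟨hF _ h, h⟩⟩)]
  refine Finset.sum_congr rfl fun x _ => ?_
  rw [fibreLength, dif_pos x.2]
  have := finite_residueField i f s x.1 (y x) (hy x)
  congr 1
  · have : ∀ Q : Ideal (X.presheaf.stalk (f.fiberι s x.1)), Q = genIdeal x.2 →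
      Module.length (X.presheaf.stalk (f.fiberι s x.1))
        (cotors (stalkHom f (f.fiberι s x.1) π) (X.presheaf.stalk (f.fiberι s x.1) ⧸ genIdeal x.2)) =
      Module.length (X.presheaf.stalk (f.fiberι s x.1))
        (cotors (stalkHom f (f.fiberι s x.1) π) (X.presheaf.stalk (f.fiberι s x.1) ⧸ Q)) := by
      rintro _ rfl
      rfl
    exact this _ (hQ x)
  -- As s is closed, A → κ(s) is surjective and lengths over `A` are dimensions over κ(s).
  · rw [Module.length_eq_of_surjective (S := A)
      (R := (Spec (CommRingCat.of A)).residueField s) (resHom_surjective s hsm),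
      Module.length_eq_finrank]

end FiniteSubscheme

end DeltaFamily
end

/-! ### Normal points, isolated points and closed points of fibres. -/

noncomputable section
namespace DeltaFamily

open IsLocalRing

section NormalPoints

lemma subsingleton_normCoker {R : Type u} [CommRing R] (h : IsNormalDomain R) :
    Subsingleton (NormCoker R) := by
  obtain ⟨h1, h2⟩ := h
  rw [Submodule.Quotient.subsingleton_iff, LinearMap.range_eq_top]
  let e : R ≃+* R ⧸ nilradical R :=
    RingEquiv.ofBijective (algebraMap R (R ⧸ nilradical R)) ⟨by
      rw [injective_iff_map_eq_zero]
      intro a ha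
      have := Ideal.Quotient.eq_zero_iff_mem.mp ha
      rwa [nilradical_eq_zero R] at this, Ideal.Quotient.mk_surjective⟩
  have h3 : IsDomain (R ⧸ nilradical R) := e.symm.toMulEquiv.isDomain R
  have h4 : IsIntegrallyClosed (R ⧸ nilradical R) := IsIntegrallyClosed.of_equiv e
  intro y
  obtain ⟨b, hb⟩ := IsIntegrallyClosed.isIntegral_iff.mp y.2
  obtain ⟨r, rfl⟩ := Ideal.Quotient.mk_surjective b
  exact ⟨r, Subtype.ext hb⟩

lemma puncturedNormal_of_isNormalDomain {R : Type*} [CommRing R] [IsLocalRing R]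
    (h : IsNormalDomain R) : PuncturedNormal R := by
  intro q _ _
  have := h.1
  have := h.2
  have hle : q.primeCompl ≤ nonZeroDivisors R := Ideal.primeCompl_le_nonZeroDivisors _
  exact ⟨IsLocalization.isDomain_of_le_nonZeroDivisors _ hle,
    isIntegrallyClosed_of_isLocalization _ _ hle⟩

/-- A normal domain is its own normalization and has no nilpotents. This makes it harmless to sum
the invariants over more points than the special ones. -/
lemma localInvariants_of_isNormalDomain (k : Type u) {R : Type u} [Field k] [CommRing R]
    [IsLocalRing R] [IsNoetherianRing R] [Algebra k R] (h : IsNormalDomain R)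
    (hmin : maximalIdeal R ∉ minimalPrimes R) :
    localEpsilon k R = 0 ∧ localDelta k R = 0 := by
  have h1 := subsingleton_normCoker h
  have hd := h.1
  have h2 : H0m R = ⊥ := by
    rw [H0m_eq_nilradical (puncturedNormal_of_isNormalDomain h) hmin, nilradical_eq_zero]
    rfl
  have h3 : Subsingleton (H0m R) := by rw [h2]; infer_instance
  constructor
  · simp [localEpsilon, Module.finrank_zero_of_subsingleton]
  · simp [localDelta, localEpsilon, Module.finrank_zero_of_subsingleton]

lemma isNormalDomain_of_ker_eq {O R W : Type*} [CommRing O] [CommRing R] [CommRing W]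
    (α : O →+* R) (β : O →+* W) (hα : Function.Surjective α) (hβ : Function.Surjective β)
    (h : RingHom.ker α = RingHom.ker β) (hR : IsNormalDomain R) : IsNormalDomain W :=
  hR.of_ringEquiv ((RingHom.quotientKerEquivOfSurjective hα).symm.trans
    ((Ideal.quotEquivOfEq h).trans (RingHom.quotientKerEquivOfSurjective hβ)))

lemma comap_map_ringEquiv {A O S : Type*} [CommRing A] [CommRing O] [CommRing S] (ψ : O ≃+* S)
    (a : A →+* O) (b : A →+* S) (hab : ∀ x, ψ (a x) = b x) (I : Ideal A) :
    (I.map b).comap ψ.toRingHom = I.map a := by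
  have : b = (ψ : O →+* S).comp a := RingHom.ext fun x => (hab x).symm
  rw [this, ← Ideal.map_map]
  exact Ideal.comap_map_of_bijective _ ψ.bijective

end NormalPoints

section FibrePoints

/-- The closure of an irreducible set containing x has a generic point, which specializes to x and
hence is x. -/
lemma isIsolatedPoint_of_specializes {Y : Scheme.{u}} {x : Y} (h1 : ∀ w, x ⤳ w → w = x)
    (h2 : ∀ w, w ⤳ x → w = x) : IsIsolatedPoint Y x := by
  refine ⟨isIrreducible_singleton, fun T hT hxT => ?_⟩
  have hg := hT.closure.isGenericPoint_genericPoint_closure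
  rw [closure_closure] at hg
  have hw := h2 _ (hg.specializes (subset_closure (hxT rfl)))
  rw [hw] at hg
  intro y hy
  exact h1 y (hg.specializes (subset_closure hy))

variable {A : Type u} [CommRing A] {X Z : Scheme.{u}} (f : X ⟶ Spec (CommRingCat.of A))
  (s : Spec (CommRingCat.of A))

/-- A point of a fibre whose residue field is finite is closed. -/
lemma eq_of_specializes_of_finite_residueField {x w : f.fiber s} (hw : x ⤳ w)
    [Module.Finite ((Spec (CommRingCat.of A)).residueField s)
      (ResidueField ((f.fiber s).presheaf.stalk x))] : w = x := by
  let _ : Algebra ((f.fiber s).presheaf.stalk w) (ResidueField ((f.fiber s).presheaf.stalk x)) :=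
    ((residue _).comp ((f.fiber s).presheaf.stalkSpecializes hw).hom).toAlgebra
  have : IsScalarTower ((Spec (CommRingCat.of A)).residueField s) ((f.fiber s).presheaf.stalk w)
      (ResidueField ((f.fiber s).presheaf.stalk x)) := by
    refine IsScalarTower.of_algebraMap_eq fun c => ?_
    change residue _ (algebraMap _ ((f.fiber s).presheaf.stalk x) c) =
      residue _ ((f.fiber s).presheaf.stalkSpecializes hw (algebraMap _ _ c))
    refine congrArg (residue _) ?_
    refine Eq.symm (ConcreteCategory.congr_hom ((f.fiber s).presheaf.germ_stalkSpecializes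
      (U := ⊤) (Opens.mem_top _) hw) _)
  have : Module.Finite ((f.fiber s).presheaf.stalk w)
      (ResidueField ((f.fiber s).presheaf.stalk x)) := Module.Finite.of_restrictScalars_finite
    ((Spec (CommRingCat.of A)).residueField s) _ _
  -- κ(x) is finite over κ(s), hence over the local ring at w, so the kernel of the latter in κ(x)
  -- is maximal. This kernel is the prime of x.
  have h1 := Ideal.isMaximal_comap_of_isIntegral_of_isMaximal
    (R := (f.fiber s).presheaf.stalk w) (⊥ : Ideal (ResidueField ((f.fiber s).presheaf.stalk x)))
  have h2 : (⊥ : Ideal (ResidueField ((f.fiber s).presheaf.stalk x))).comap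
      (algebraMap ((f.fiber s).presheaf.stalk w) _) = genIdeal hw := by
    ext r
    change residue _ _ = 0 ↔ _
    rw [residue_eq_zero_iff]
    rfl
  rw [h2] at h1
  exact ((genIdeal_eq_maximalIdeal_iff hw).mp (eq_maximalIdeal h1)).symm

lemma notMem_minimalPrimes_of_finite_residueField {x : f.fiber s}
    (hx : ¬ IsIsolatedPoint (f.fiber s) x)
    (hcl : ∀ w, x ⤳ w → w = x) :
    maximalIdeal ((f.fiber s).presheaf.stalk x) ∉
      minimalPrimes ((f.fiber s).presheaf.stalk x) := by
  rw [maximalIdeal_mem_minimalPrimes_stalk_iff]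
  exact fun h => hx (isIsolatedPoint_of_specializes hcl h)

lemma isNagataRing_stalk_fiber (hX : IsNagata X) (x : f.fiber s) :
    IsNagataRing ((f.fiber s).presheaf.stalk x) := by
  obtain ⟨U, hxU, hU, hN⟩ := hX (f.fiberι s x)
  let _ := (X.presheaf.germ U _ hxU).hom.toAlgebra
  have : IsLocalization.AtPrime (X.presheaf.stalk (f.fiberι s x))
    (hU.primeIdealOf ⟨_, hxU⟩).asIdeal := hU.isLocalization_stalk ⟨_, hxU⟩
  exact IsNagataRing.of_surjective ((f.fiberι s).stalkMap x).hom (surjective_stalkMap_fiberι f s x)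
    (hN.of_isLocalization (G' := X.presheaf.stalk (f.fiberι s x))
      (hU.primeIdealOf ⟨_, hxU⟩).asIdeal.primeCompl)

variable {f} (h : Z ⟶ X)

/-- If the stalk of the direct image is the local ring at x, it is local, and z over x corresponds
to its maximal ideal; localizing there changes nothing. -/
lemma bijective_stalkMap_of_bijective_pushMap [IsAffineHom h] {z : Z} {x : X} (hz : h z = x)
    (hb : Function.Bijective (pushMap h x)) :
    Function.Bijective (toStalk h (specializes_of_eq hz) ∘ pushMap h x) := by
  refine Function.Bijective.comp ?_ hb
  let e := RingEquiv.ofBijective (pushMap h x).hom hb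
  have : IsLocalRing (pushStalk h x) := e.isLocalRing
  let _ := (toStalk h (specializes_of_eq hz)).hom.toAlgebra
  have l := isLocalization_toStalk h (specializes_of_eq hz)
  have h1 : (pushIdeal h (specializes_of_eq hz)).IsMaximal := by
    have h2 : (pushIdeal h (specializes_of_eq hz)).comap e.toRingHom = maximalIdeal _ :=
      (comap_pushMap_pushIdeal (specializes_of_eq hz)).trans
        ((genIdeal_eq_maximalIdeal_iff (specializes_of_eq hz)).mpr hz)
    have h3 := Ideal.comap_isMaximal_of_surjective (K := maximalIdeal (X.presheaf.stalk x))
      e.symm.toRingHom e.symm.surjective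
    rw [← h2, Ideal.comap_comap] at h3
    have h4 : e.toRingHom.comp e.symm.toRingHom = RingHom.id _ := by ext; simp
    rwa [h4, Ideal.comap_id] at h3
  have h2 : (pushIdeal h (specializes_of_eq hz)).primeCompl ≤ IsUnit.submonoid _ := by
    intro r hr
    by_contra hu
    exact hr ((eq_maximalIdeal h1).symm ▸ (mem_maximalIdeal r).mpr hu)
  have h3 := (IsLocalization.atUnits (pushStalk h x)
    (pushIdeal h (specializes_of_eq hz)).primeCompl (S := Z.presheaf.stalk z) h2)
  have h4 : ⇑h3 = toStalk h (specializes_of_eq hz) := funext fun r => h3.commutes r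
  rw [← h4]
  exact h3.bijective

/-- Where the direct image of the structure sheaf is the structure sheaf, normality of points of
fibres lifts. -/
lemma normalAt_of_bijective_pushMap [IsAffineHom h] (x' : f.fiber s) (z' : (h ≫ f).fiber s)
    (hz : h ((h ≫ f).fiberι s z') = f.fiberι s x')
    (hb : Function.Bijective (pushMap h (f.fiberι s x'))) (hx : NormalAt (f.fiber s) x') :
    NormalAt ((h ≫ f).fiber s) z' := by
  have hb' := bijective_stalkMap_of_bijective_pushMap h hz hb
  let ψ : X.presheaf.stalk (f.fiberι s x') ≃+* Z.presheaf.stalk ((h ≫ f).fiberι s z') :=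
    RingEquiv.ofBijective ((toStalk h (specializes_of_eq hz)).hom.comp (pushMap h _).hom) hb'
  refine isNormalDomain_of_ker_eq ((f.fiberι s).stalkMap x').hom
    ((((h ≫ f).fiberι s).stalkMap z').hom.comp ψ.toRingHom) (surjective_stalkMap_fiberι f s x')
    ((surjective_stalkMap_fiberι (h ≫ f) s z').comp ψ.surjective) ?_ hx
  rw [← RingHom.comap_ker, ker_stalkMap_fiberι, ker_stalkMap_fiberι]
  exact (comap_map_ringEquiv ψ _ _ (toStalk_pushMap_stalkHom _ _) _).symm

end FibrePoints

end DeltaFamily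
end

/-! ### The defect of a modification modulo π, at the generic and at closed points of the base. -/

noncomputable section
namespace DeltaFamily

open IsLocalRing

section Defect

lemma toNat_sub_toNat_eq_sum {ι : Type*} [Fintype ι] {c k t : ℕ∞} {a b l : ι → ℕ∞} (ht : t ≠ ⊤)
    (ha : ∀ i, a i * l i ≠ ⊤) (hb : ∀ i, b i * l i ≠ ⊤) (hc : c = t + ∑ i, a i * l i)
    (hk : k = ∑ i, b i * l i + t) :
    k ≠ ⊤ ∧ c ≠ ⊤ ∧
      (c.toNat : ℤ) - k.toNat = ∑ i, (((a i).toNat : ℤ) - (b i).toNat) * (l i).toNat := by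
  have ha' : ∑ i, a i * l i ≠ ⊤ := by simpa [WithTop.sum_eq_top] using ha
  have hb' : ∑ i, b i * l i ≠ ⊤ := by simpa [WithTop.sum_eq_top] using hb
  refine ⟨by simp [hk, hb', ht], by simp [hc, ha', ht], ?_⟩
  rw [hc, hk, ENat.toNat_add ht ha', ENat.toNat_add hb' ht, ENat.toNat_sum fun i _ => ha i,
    ENat.toNat_sum fun i _ => hb i]
  simp only [ENat.toNat_mul, sub_mul, Finset.sum_sub_distrib]
  push_cast
  ring

variable {A : Type u} [CommRing A] {X Z : Scheme.{u}} {f : X ⟶ Spec (CommRingCat.of A)}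
  {h : Z ⟶ X}

lemma specializes_of_genIdeal_le {w w' x : X} (hw : w ⤳ x) (hw' : w' ⤳ x)
    (hle : genIdeal hw ≤ genIdeal hw') : w ⤳ w' := by
  have h1 := (PrimeSpectrum.le_iff_specializes
    (⟨genIdeal hw, inferInstance⟩ : PrimeSpectrum (X.presheaf.stalk x))
    ⟨genIdeal hw', inferInstance⟩).mp hle
  have h2 := h1.map (X.fromSpecStalk x).continuous
  exact (fromSpecStalk_genIdeal hw) ▸ (fromSpecStalk_genIdeal hw') ▸ h2

/-- Within one fibre over the base, a finite subscheme has no proper specializations. This is how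
finiteness of the conductor scheme bounds the supports. -/
lemma eq_of_specializes_of_mem_support (J : X.IdealSheafData) [IsFinite (J.subschemeι ≫ f)]
    {w x : X} (hwx : w ⤳ x) (hw : w ∈ J.support) (hf : f w = f x) : w = x := by
  have hr := J.range_subschemeι
  have hx : x ∈ Set.range J.subschemeι := hr ▸ hwx.mem_closed J.support.isClosed hw
  have hw' : w ∈ Set.range J.subschemeι := hr ▸ hw
  obtain ⟨w, rfl⟩ := hw'
  obtain ⟨x, rfl⟩ := hx
  rw [eq_of_specializes_of_isFinite (J.subschemeι ≫ f)
    (J.subschemeι.isEmbedding.isInducing.specializes_iff.mp hwx) hf]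

/-- The difference between the lengths of the cokernel and the kernel of the homomorphism from a
local ring to the stalk of a direct image. -/
def defect (h : Z ⟶ X) (z : X) : ℤ :=
  ((Module.length (X.presheaf.stalk z) (pushCoker h z)).toNat : ℤ) -
    (Module.length (X.presheaf.stalk z) (pushKer h z)).toNat

lemma defect_eq_zero (hm : IsModification f h) {z : X}
    (hz : z ∉ (extConductorIdealSheaf X).support) : defect h z = 0 := by
  obtain ⟨hi, hs⟩ := hm.bijective_pushMap hz
  have s1 : Subsingleton (pushCoker h z) :=
    Submodule.Quotient.subsingleton_iff.mpr (LinearMap.range_eq_top.mpr hs)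
  have s2 : Subsingleton (pushKer h z) := by
    refine ⟨fun a b => Subtype.ext (hi ?_)⟩
    exact (show pushMap h z a.1 = 0 from a.2).trans (show pushMap h z b.1 = 0 from b.2).symm
  rw [defect, Module.length_eq_zero, Module.length_eq_zero]
  rfl

/-- The kernel and the cokernel of the reduction modulo `π` of a modification at a point. -/
abbrev reductionMap (f : X ⟶ Spec (CommRingCat.of A)) (h : Z ⟶ X) (π : A) (x : X) :=
  cotorsMap (stalkHom f x π) (Algebra.linearMap (X.presheaf.stalk x) (pushStalk h x))

lemma exists_of_mem_support_push (hm : IsModification f h) {x : X}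
    (q : PrimeSpectrum (X.presheaf.stalk x))
    (hq : q ∈ Module.support _ (pushCoker h x) ∨ q ∈ Module.support _ (pushKer h x)) :
    ∃ (w : X) (hw : w ⤳ x), q.asIdeal = genIdeal hw ∧
      w ∈ (extConductorIdealSheaf X).support := by
  have := hm.isFinite
  obtain ⟨w, hw, hqw⟩ := exists_eq_genIdeal x q.asIdeal
  refine ⟨w, hw, hqw, ?_⟩
  by_contra hV
  have := (length_localizedModule_push h hw).2 (hm.bijective_pushMap hV) q hqw
  tauto

variable [IsLocallyNoetherian X] [IsFinite ((extConductorIdealSheaf X).subschemeι ≫ f)]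

/-- Reduction modulo 0 changes nothing. Kernel and cokernel live on the conductor scheme, which over
the generic point has no specializations, so they are supported at the closed point. -/
lemma reduction_generic (hm : IsModification f h) {η : Spec (CommRingCat.of A)}
    (hη : ∀ t : Spec (CommRingCat.of A), t ⤳ η → t = η) {x : X} (hx : f x = η) {π : A}
    (hπ : π = 0) :
    Module.length (X.presheaf.stalk x) (LinearMap.ker (reductionMap f h π x)) ≠ ⊤ ∧
    Module.length (X.presheaf.stalk x)
      (cotors (stalkHom f x π) (pushStalk h x) ⧸ LinearMap.range (reductionMap f h π x)) ≠ ⊤ ∧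
    ((Module.length (X.presheaf.stalk x)
      (cotors (stalkHom f x π) (pushStalk h x) ⧸
        LinearMap.range (reductionMap f h π x))).toNat : ℤ) -
      (Module.length (X.presheaf.stalk x) (LinearMap.ker (reductionMap f h π x))).toNat =
      defect h x := by
  have := hm.isFinite
  have := finite_pushStalk h x
  have hsup : ∀ q : PrimeSpectrum (X.presheaf.stalk x), (q ∈ Module.support _ (pushCoker h x) ∨
      q ∈ Module.support _ (pushKer h x)) → q.asIdeal = maximalIdeal _ := by
    intro q hq
    obtain ⟨w, hw, hqw, hV⟩ := exists_of_mem_support_push hm q hq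
    have hfw : f w = f x := by
      rw [hx]
      exact hη _ (hx ▸ hw.map f.continuous)
    rw [hqw, genIdeal_eq_maximalIdeal_iff]
    exact eq_of_specializes_of_mem_support _ hw hV hfw
  have e1 : Module.length (X.presheaf.stalk x) (LinearMap.ker (reductionMap f h π x)) =
      Module.length (X.presheaf.stalk x) (pushKer h x) := by
    refine (length_ker_reduction (O := X.presheaf.stalk x) (R := X.presheaf.stalk x)
      (R' := pushStalk h x) (H := pushStalk h x) (stalkHom f x π) Function.surjective_id ?_
      Function.surjective_id ?_).symm
    · rw [hπ, map_zero, Ideal.span_singleton_eq_bot.mpr rfl]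
      exact (RingHom.injective_iff_ker_eq_bot _).mp Function.injective_id
    · rw [hπ, map_zero, map_zero, Ideal.span_singleton_eq_bot.mpr rfl]
      exact (RingHom.injective_iff_ker_eq_bot _).mp Function.injective_id
  have e2 : Module.length (X.presheaf.stalk x)
      (cotors (stalkHom f x π) (pushStalk h x) ⧸ LinearMap.range (reductionMap f h π x)) =
      Module.length (X.presheaf.stalk x) (pushCoker h x) := by
    refine (length_coker_reduction (O := X.presheaf.stalk x) (R := X.presheaf.stalk x)
      (R' := pushStalk h x) (H := pushStalk h x) (stalkHom f x π) Function.surjective_id ?_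
      Function.surjective_id ?_).symm
    · rw [hπ, map_zero, Ideal.span_singleton_eq_bot.mpr rfl]
      exact (RingHom.injective_iff_ker_eq_bot _).mp Function.injective_id
    · rw [hπ, map_zero, map_zero, Ideal.span_singleton_eq_bot.mpr rfl]
      exact (RingHom.injective_iff_ker_eq_bot _).mp Function.injective_id
  rw [e1, e2]
  exact ⟨Module.length_ne_top_iff.mpr (isFiniteLength_of_support fun q hq => hsup q (.inr hq)),
    Module.length_ne_top_iff.mpr (isFiniteLength_of_support fun q hq => hsup q (.inl hq)), rfl⟩

/-- The reduction has cokernel M/π and a kernel of length ℓ(K/π) + ℓ(M[π]), so its defect is the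
Euler characteristic of π on M minus that on K, which has no π-torsion. `length_cotors_eq` expresses
both through the conductor points of the generic fibre. -/
lemma reduction_special [IsDomain A] [IsPrincipalIdealRing A] (hm : IsModification f h)
    (hf : TorsionFree f) {η : Spec (CommRingCat.of A)} (hη : η.asIdeal = ⊥) {π : A} (hπ : Prime π)
    {x : X} (hx : (f x).asIdeal = Ideal.span {π}) (D : Finset (f.fiber η))
    (hD : ∀ z', z' ∈ D ↔ f.fiberι η z' ∈ (extConductorIdealSheaf X).support) :
    Module.length (X.presheaf.stalk x) (LinearMap.ker (reductionMap f h π x)) ≠ ⊤ ∧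
    Module.length (X.presheaf.stalk x)
      (cotors (stalkHom f x π) (pushStalk h x) ⧸ LinearMap.range (reductionMap f h π x)) ≠ ⊤ ∧
    ((Module.length (X.presheaf.stalk x)
      (cotors (stalkHom f x π) (pushStalk h x) ⧸
        LinearMap.range (reductionMap f h π x))).toNat : ℤ) -
      (Module.length (X.presheaf.stalk x) (LinearMap.ker (reductionMap f h π x))).toNat =
      ∑ z' ∈ D, defect h (f.fiberι η z') * (fibreLength f π (f.fiberι η z') x).toNat := by
  classical
  have := hm.isFinite
  have := finite_pushStalk h x
  let I := {z' : f.fiber η // z' ∈ D ∧ f.fiberι η z' ⤳ x}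
  have : Finite I := Finite.of_injective (fun i : I => (⟨i.1, i.2.1⟩ : D))
    fun i j hij => Subtype.ext (congrArg (fun k : D => k.1) hij)
  let _ : Fintype I := Fintype.ofFinite _
  let P : I → Ideal (X.presheaf.stalk x) := fun i => genIdeal i.2.2
  have hsup : ∀ q : PrimeSpectrum (X.presheaf.stalk x), (q ∈ Module.support _ (pushCoker h x) ∨
      q ∈ Module.support _ (pushKer h x)) → q.asIdeal = maximalIdeal _ ∨ ∃ i, q.asIdeal = P i := by
    intro q hq
    obtain ⟨w, hw, hqw, hV⟩ := exists_of_mem_support_push hm q hq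
    have hle : (f w).asIdeal ≤ Ideal.span {π} := by
      rw [← hx]
      exact (PrimeSpectrum.le_iff_specializes _ _).mpr (hw.map f.continuous)
    by_cases hb : (f w).asIdeal = ⊥
    · have hwη : f w = η := PrimeSpectrum.ext (hb.trans hη.symm)
      obtain ⟨z', rfl⟩ : w ∈ Set.range (f.fiberι η) := by
        rw [f.range_fiberι]
        exact hwη
      exact .inr ⟨⟨z', (hD z').mpr hV, hw⟩, hqw⟩
    · left
      have hmax := IsPrime.to_maximal_ideal (S := (f w).asIdeal) hb
      have hne : (f x).asIdeal ≠ ⊤ := (f x).isPrime.ne_top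
      have hfw : f w = f x := PrimeSpectrum.ext ((hmax.eq_of_le hne (hle.trans hx.ge)))
      rw [hqw, genIdeal_eq_maximalIdeal_iff]
      exact eq_of_specializes_of_mem_support _ hw hV hfw
  -- Inclusion of primes is specialization, and conductor points in the generic fibre do not
  -- specialize to each other.
  have hinj : ∀ i j, P i ≤ P j → i = j := by
    intro i j hij
    have h1 := specializes_of_genIdeal_le i.2.2 j.2.2 hij
    have h2 := eq_of_specializes_of_mem_support (f := f) _ h1 ((hD i.1).mp i.2.1)
      ((apply_fiberι f η i.1).trans (apply_fiberι f η j.1).symm)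
    exact Subtype.ext ((f.fiberι η).isEmbedding.injective h2)
  have hπP : ∀ i, stalkHom f x π ∉ P i := by
    intro i hi
    have h1 : stalkHom f (f.fiberι η i.1) π ∈ maximalIdeal _ := by
      rw [← stalkSpecializes_stalkHom f i.2.2]
      exact hi
    have h2 := (comap_stalkHom_maximalIdeal f (f.fiberι η i.1)).le h1
    rw [apply_fiberι, hη] at h2
    exact hπ.ne_zero h2
  have hπm : stalkHom f x π ∈ maximalIdeal _ :=
    (comap_stalkHom_maximalIdeal f x).ge (hx.ge (Ideal.mem_span_singleton_self π))
  obtain ⟨m1, m2, m3⟩ := length_cotors_eq (stalkHom f x π) P hinj hπP hπm (pushCoker h x)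
    fun q hq => hsup q (.inl hq)
  obtain ⟨n1, n2, n3⟩ := length_cotors_eq (stalkHom f x π) P hinj hπP hπm (pushKer h x)
    fun q hq => hsup q (.inr hq)
  have t1 := hf.stalk x hπ.ne_zero
  have t2 : ∀ r : pushStalk h x, stalkHom f x π • r = 0 → r = 0 := fun r hr =>
    hm.torsionFree.pushStalk h x hπ.ne_zero r (by rw [Algebra.smul_def] at hr; exact hr)
  -- The kernel is an ideal of the local ring of `X`, which is torsion-free over `A`.
  have n4 : Module.length (X.presheaf.stalk x) (tors (stalkHom f x π) (pushKer h x)) = 0 := by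
    rw [Module.length_eq_zero_iff]
    refine ⟨fun a b => Subtype.ext (Subtype.ext ?_)⟩
    rw [t1 _ (congrArg Subtype.val a.2), t1 _ (congrArg Subtype.val b.2)]
  obtain ⟨k1, k2, k3⟩ := toNat_sub_toNat_eq_sum m1 m2 n2
    ((length_coker_cotorsMap (stalkHom f x π) (pushStalk h x)).trans m3)
    ((length_ker_cotorsMap (stalkHom f x π) (pushStalk h x) t1 t2).trans
      (congrArg (· + _) (n3.trans (by rw [n4, zero_add]))))
  refine ⟨k1, k2, k3.trans ?_⟩
  rw [← Finset.sum_filter_of_ne (p := fun z' => f.fiberι η z' ⤳ x),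
    Finset.sum_subtype (D.filter _) (p := fun z' => z' ∈ D ∧ f.fiberι η z' ⤳ x)
      (fun z' => Finset.mem_filter)]
  · refine Finset.sum_congr rfl fun i _ => ?_
    obtain ⟨⟨l1, l2⟩, -⟩ := length_localizedModule_push h i.2.2
    rw [l1, l2, fibreLength, dif_pos i.2.2]
    rfl
  · intro z' _ hne
    by_contra hn
    exact hne (by rw [fibreLength, dif_neg hn]; simp)

end Defect

end DeltaFamily
end

/-! ### The delta formula for the fibres of a modification. -/

noncomputable section
namespace DeltaFamily

open IsLocalRing

section FibreInvariants

variable {A : Type u} [CommRing A] {X Z : Scheme.{u}} {f : X ⟶ Spec (CommRingCat.of A)}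
  {h : Z ⟶ X}

/-- The points of a fibre which are not normal or lie on the extended conductor scheme. -/
def badPoints (f : X ⟶ Spec (CommRingCat.of A)) (s : Spec (CommRingCat.of A)) :
    Set (f.fiber s) :=
  {x | ¬ NormalAt (f.fiber s) x ∨ f.fiberι s x ∈ (extConductorIdealSheaf X).support}

lemma finite_conductor_fiber [IsFinite ((extConductorIdealSheaf X).subschemeι ≫ f)]
    (s : Spec (CommRingCat.of A)) :
    {x : f.fiber s | f.fiberι s x ∈ (extConductorIdealSheaf X).support}.Finite := by
  have h1 : ((extConductorIdealSheaf X).subschemeι ''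
      (((extConductorIdealSheaf X).subschemeι ≫ f) ⁻¹' {s})).Finite :=
    (Scheme.Hom.finite_preimage_singleton _ s).image _
  refine (h1.preimage (f.fiberι s).isEmbedding.injective.injOn).subset fun x hx => ?_
  rw [Set.mem_ofPred_eq, ← SetLike.mem_coe, ← Scheme.IdealSheafData.range_subschemeι] at hx
  obtain ⟨y, hy⟩ := hx
  refine ⟨y, ?_, hy⟩
  change f ((extConductorIdealSheaf X).subschemeι y) = s
  rw [hy, apply_fiberι]

lemma finite_badPoints [IsFinite ((extConductorIdealSheaf X).subschemeι ≫ f)]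
    {s : Spec (CommRingCat.of A)} (hfib : FibreHasFinitelyManyINNS f s) :
    (badPoints f s).Finite :=
  hfib.1.union (finite_conductor_fiber s)

/-- Non-normal points are controlled by the hypothesis on the fibre, conductor points by finiteness
of the conductor scheme. In both cases the residue field is finite, so the point is closed. -/
lemma badPoints_spec [IsFinite ((extConductorIdealSheaf X).subschemeι ≫ f)]
    {s : Spec (CommRingCat.of A)} (hfib : FibreHasFinitelyManyINNS f s)
    {x : f.fiber s} (hx : x ∈ badPoints f s) :
    PuncturedNormal ((f.fiber s).presheaf.stalk x) ∧
    Module.Finite ((Spec (CommRingCat.of A)).residueField s)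
      (ResidueField ((f.fiber s).presheaf.stalk x)) ∧ ∀ w, x ⤳ w → w = x := by
  have h1 : Module.Finite ((Spec (CommRingCat.of A)).residueField s)
      (ResidueField ((f.fiber s).presheaf.stalk x)) := by
    rcases hx with hx | hx
    · exact (hfib.2 x hx).2
    · rw [← SetLike.mem_coe, ← Scheme.IdealSheafData.range_subschemeι] at hx
      obtain ⟨y, hy⟩ := hx
      exact finite_residueField _ f s x y hy
  refine ⟨puncturedNormal_stalk fun w hw hne => ?_, h1,
    fun w hw => eq_of_specializes_of_finite_residueField f s hw⟩
  by_cases hn : NormalAt (f.fiber s) x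
  · exact normalAt_of_specializes hw hn
  · obtain ⟨U, hxU, hU⟩ := (hfib.2 x hn).1
    exact hU w (hw.mem_open U.isOpen hxU) hne

lemma finite_fibre_over [IsFinite h] (s : Spec (CommRingCat.of A)) (x : X) :
    {z : (h ≫ f).fiber s | h ((h ≫ f).fiberι s z) = x}.Finite :=
  (Scheme.Hom.finite_preimage_singleton h x).preimage
    ((h ≫ f).fiberι s).isEmbedding.injective.injOn

lemma eq_of_specializes_over [IsFinite h] {s : Spec (CommRingCat.of A)} {x : f.fiber s}
    (hx : ∀ w, x ⤳ w → w = x) {z w : (h ≫ f).fiber s}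
    (hz : h ((h ≫ f).fiberι s z) = f.fiberι s x) (hw : z ⤳ w) : w = z := by
  have h1 : (h ≫ f).fiberι s z ⤳ (h ≫ f).fiberι s w := hw.map ((h ≫ f).fiberι s).continuous
  have h2 : h ((h ≫ f).fiberι s w) ∈ Set.range (f.fiberι s) := by
    rw [f.range_fiberι]
    exact apply_fiberι (h ≫ f) s w
  obtain ⟨w', hw'⟩ := h2
  have h3 : f.fiberι s x ⤳ f.fiberι s w' := by
    rw [hw', ← hz]
    exact h1.map h.continuous
  have h4 := hx w' ((f.fiberι s).isEmbedding.isInducing.specializes_iff.mp h3)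
  rw [h4] at hw'
  exact (((h ≫ f).fiberι s).isEmbedding.injective
    (eq_of_specializes_of_isFinite h h1 (hz.trans hw'))).symm

instance [IsLocallyNoetherian Z] (g : Z ⟶ Spec (CommRingCat.of A)) (s : Spec (CommRingCat.of A))
    (z : g.fiber s) : IsNoetherianRing ((g.fiber s).presheaf.stalk z) :=
  isNoetherianRing_of_surjective (Z.presheaf.stalk (g.fiberι s z)) _
    ((g.fiberι s).stalkMap z).hom (surjective_stalkMap_fiberι g s z)

/-- The degree of the residue field of a point of a fibre. -/
def fibreDegree (f : X ⟶ Spec (CommRingCat.of A)) (s : Spec (CommRingCat.of A))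
    (x : f.fiber s) : ℕ :=
  Module.finrank ((Spec (CommRingCat.of A)).residueField s)
    (ResidueField ((f.fiber s).presheaf.stalk x))

/-- The length of the cokernel of the normalization of a local ring of a fibre. -/
def normLength (f : X ⟶ Spec (CommRingCat.of A)) (s : Spec (CommRingCat.of A))
    (x : f.fiber s) : ℤ :=
  (Module.length ((f.fiber s).presheaf.stalk x) (NormCoker ((f.fiber s).presheaf.stalk x))).toNat

/-- The length of the nilradical of a local ring of a fibre. -/
def nilLength (f : X ⟶ Spec (CommRingCat.of A)) (s : Spec (CommRingCat.of A))
    (x : f.fiber s) : ℤ :=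
  (Module.length ((f.fiber s).presheaf.stalk x) (nilradical ((f.fiber s).presheaf.stalk x))).toNat

/-- The difference of the lengths of the cokernel and the kernel of the reduction of a
modification. -/
def reductionDefect (f : X ⟶ Spec (CommRingCat.of A)) (h : Z ⟶ X) (π : A) (x : X) : ℤ :=
  ((Module.length (X.presheaf.stalk x)
      (cotors (stalkHom f x π) (pushStalk h x) ⧸
        LinearMap.range (reductionMap f h π x))).toNat : ℤ) -
      (Module.length (X.presheaf.stalk x) (LinearMap.ker (reductionMap f h π x))).toNat

/-- The contributions of `point_invariants` are summed over the bad points of X_s. This accounts for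
all of Z_s: off the bad points normality lifts, and normal points over bad ones have zero
invariants. -/
theorem fibre_invariants [IsNoetherian X]
    [IsFinite ((extConductorIdealSheaf X).subschemeι ≫ f)] (hN : IsNagata X)
    (hm : IsModification f h) {s : Spec (CommRingCat.of A)}
    (hiso : ∀ x : f.fiber s, ¬ IsIsolatedPoint (f.fiber s) x)
    (hfib : FibreHasFinitelyManyINNS f s) {π : A} (hs : s.asIdeal = Ideal.span {π})
    (hl : ∀ x ∈ badPoints f s, Module.length (X.presheaf.stalk (f.fiberι s x))
        (LinearMap.ker (reductionMap f h π (f.fiberι s x))) ≠ ⊤ ∧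
      Module.length (X.presheaf.stalk (f.fiberι s x))
        (cotors (stalkHom f _ π) (pushStalk h (f.fiberι s x)) ⧸
          LinearMap.range (reductionMap f h π (f.fiberι s x))) ≠ ⊤) (E : Finset (f.fiber s))
    (hE : ∀ x, x ∈ E ↔ x ∈ badPoints f s) :
    FiniteInvariants (h ≫ f) s ∧
    delta (h ≫ f) s = ∑ x ∈ E, (fibreDegree f s x : ℤ) *
      (normLength f s x - nilLength f s x - reductionDefect f h π (f.fiberι s x)) ∧
    ((∀ x, Function.Surjective (pushMap h x)) →
      (∀ x o, pushMap h x o = 0 → IsNilpotent o) →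
      epsilon (h ≫ f) s + delta (h ≫ f) s =
        ∑ x ∈ E, (fibreDegree f s x : ℤ) * normLength f s x) := by
  classical
  have := hm.isFinite
  have hZ : IsLocallyNoetherian Z := LocallyOfFiniteType.isLocallyNoetherian h
  let F : f.fiber s → Finset ((h ≫ f).fiber s) := fun x =>
    (finite_fibre_over (h := h) (f := f) s (f.fiberι s x)).toFinset
  have hF : ∀ x z, z ∈ F x ↔ h ((h ≫ f).fiberι s z) = f.fiberι s x := fun x z => by
    simp [F]
  have hmin : ∀ x ∈ E, ∀ z ∈ F x, maximalIdeal (((h ≫ f).fiber s).presheaf.stalk z) ∉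
      minimalPrimes (((h ≫ f).fiber s).presheaf.stalk z) := fun x hx z hz =>
    notMem_minimalPrimes_of_finite_residueField (h ≫ f) s (hm.not_isIsolatedPoint s z)
      fun w hw => eq_of_specializes_over (badPoints_spec hfib ((hE x).mp hx)).2.2
        ((hF x z).mp hz) hw
  have hpt : ∀ x ∈ E, _ := fun x hx => by
    obtain ⟨h1, h2, h3⟩ := badPoints_spec hfib ((hE x).mp hx)
    have h4 := (isNagataRing_stalk_fiber f s hN x).finite_normRing
    obtain ⟨h5, h6⟩ := hl x ((hE x).mp hx)
    exact point_invariants (h := h) s x hs h1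
      (notMem_minimalPrimes_of_finite_residueField f s (hiso x) h3) h5 h6 (F x) (hF x) (hmin x hx)
  let G := E.biUnion F
  -- Over a point that is not bad, Z → X is an isomorphism on local rings, so a special point must
  -- lie over a bad one.
  have hspec : specialPoints (h ≫ f) s ⊆ G := by
    intro z hz
    have hz' := hz.resolve_right (hm.not_isIsolatedPoint s z)
    have h2 : h ((h ≫ f).fiberι s z) ∈ Set.range (f.fiberι s) := by
      rw [f.range_fiberι]
      exact apply_fiberι (h ≫ f) s z
    obtain ⟨x, hx⟩ := h2
    rw [Finset.mem_coe, Finset.mem_biUnion]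
    refine ⟨x, ?_, (hF x z).mpr hx.symm⟩
    by_contra hxE
    rw [hE, badPoints, Set.mem_ofPred_eq, not_or, not_not] at hxE
    exact hz' (normalAt_of_bijective_pushMap s h x z hx.symm (hm.bijective_pushMap hxE.2) hxE.1)
  have hfin : (specialPoints (h ≫ f) s).Finite := G.finite_toSet.subset hspec
  have hnorm : ∀ z ∈ G, z ∉ hfin.toFinset →
      localEpsilon ((Spec (CommRingCat.of A)).residueField s)
        (((h ≫ f).fiber s).presheaf.stalk z) = 0 ∧
      localDelta ((Spec (CommRingCat.of A)).residueField s)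
        (((h ≫ f).fiber s).presheaf.stalk z) = 0 := by
    intro z hz hzs
    obtain ⟨x, hx, hzx⟩ := Finset.mem_biUnion.mp hz
    rw [Set.Finite.mem_toFinset, specialPoints, Set.mem_ofPred_eq, not_or, not_not] at hzs
    exact localInvariants_of_isNormalDomain _ hzs.1 (hmin x hx z hzx)
  have hsub : hfin.toFinset ⊆ G := fun z hz => hspec (hfin.mem_toFinset.mp hz)
  have hdisj : (E : Set (f.fiber s)).PairwiseDisjoint F := by
    intro x _ y _ hxy
    rw [Function.onFun, Finset.disjoint_left]
    intro z hzx hzy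
    exact hxy ((f.fiberι s).isEmbedding.injective (((hF x z).mp hzx).symm.trans ((hF y z).mp hzy)))
  have hd : delta (h ≫ f) s = ∑ x ∈ E, ∑ z ∈ F x,
      localDelta ((Spec (CommRingCat.of A)).residueField s)
        (((h ≫ f).fiber s).presheaf.stalk z) := by
    rw [delta, finsum_mem_eq_finite_toFinset_sum _ hfin,
      Finset.sum_subset hsub fun z hz hzs => (hnorm z hz hzs).2, Finset.sum_biUnion hdisj]
  have he : epsilon (h ≫ f) s = ∑ x ∈ E, ∑ z ∈ F x,
      localEpsilon ((Spec (CommRingCat.of A)).residueField s)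
        (((h ≫ f).fiber s).presheaf.stalk z) := by
    rw [epsilon, finsum_mem_eq_finite_toFinset_sum _ hfin,
      Finset.sum_subset hsub fun z hz hzs => (hnorm z hz hzs).1, Finset.sum_biUnion hdisj]
  refine ⟨⟨hfin, fun z hz => ?_⟩, ?_, fun hsurj hnil => ?_⟩
  · obtain ⟨x, hx, hzx⟩ := Finset.mem_biUnion.mp (hspec hz)
    exact (hpt x hx).1 z hzx
  · rw [hd]
    exact Finset.sum_congr rfl fun x hx => (hpt x hx).2.1
  · rw [hd, he, ← Finset.sum_add_distrib]
    exact Finset.sum_congr rfl fun x hx => (hpt x hx).2.2 (hsurj _) (hnil _)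

/-- The sum of the delta invariants of the local rings of a fibre at the points which are not
normal or lie on the extended conductor scheme, computed from lengths. -/
def baseDelta (f : X ⟶ Spec (CommRingCat.of A)) (s : Spec (CommRingCat.of A)) : ℤ :=
  ∑ᶠ x ∈ badPoints f s, (fibreDegree f s x : ℤ) * (normLength f s x - nilLength f s x)

/-- The same sum without the contribution of the nilradicals. -/
def baseNorm (f : X ⟶ Spec (CommRingCat.of A)) (s : Spec (CommRingCat.of A)) : ℤ :=
  ∑ᶠ x ∈ badPoints f s, (fibreDegree f s x : ℤ) * normLength f s x

/-- The contribution of a modification along the generic fibre. -/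
def genericDefect (f : X ⟶ Spec (CommRingCat.of A)) (h : Z ⟶ X)
    (η : Spec (CommRingCat.of A)) : ℤ :=
  ∑ᶠ z ∈ {z : f.fiber η | f.fiberι η z ∈ (extConductorIdealSheaf X).support},
    (fibreDegree f η z : ℤ) * defect h (f.fiberι η z)

/-- The delta invariant of a fibre of a modification differs from an invariant of the fibre of the
base by an invariant of the generic fibre. -/
theorem delta_modification [IsDomain A] [IsPrincipalIdealRing A] [IsNoetherian X]
    [IsFinite ((extConductorIdealSheaf X).subschemeι ≫ f)] (hN : IsNagata X) (hf : TorsionFree f)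
    (hm : IsModification f h) {η : Spec (CommRingCat.of A)} (hη : η.asIdeal = ⊥)
    {s : Spec (CommRingCat.of A)}
    (hiso : ∀ x : f.fiber s, ¬ IsIsolatedPoint (f.fiber s) x)
    (hfib : FibreHasFinitelyManyINNS f s) :
    FiniteInvariants (h ≫ f) s ∧
    delta (h ≫ f) s = baseDelta f s - genericDefect f h η ∧
    ((∀ x, Function.Surjective (pushMap h x)) →
      (∀ x o, pushMap h x o = 0 → IsNilpotent o) →
      epsilon (h ≫ f) s + delta (h ≫ f) s = baseNorm f s) := by
  classical
  have hE := finite_badPoints hfib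
  have hD := finite_conductor_fiber (f := f) η
  obtain ⟨π, hs⟩ : ∃ π, s.asIdeal = Ideal.span {π} := (IsPrincipalIdealRing.principal s.asIdeal).1
  rw [baseDelta, baseNorm, genericDefect, finsum_mem_eq_finite_toFinset_sum _ hE,
    finsum_mem_eq_finite_toFinset_sum _ hE, finsum_mem_eq_finite_toFinset_sum _ hD]
  by_cases hπ0 : π = 0
  -- On the generic fibre no degree formula is needed: bad points off the conductor have defect
  -- zero, and the two sums match term by term.
  · have hsη : s = η := PrimeSpectrum.ext (by rw [hs, hη, Ideal.span_singleton_eq_bot, hπ0])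
    subst hsη
    have hgen : ∀ t : Spec (CommRingCat.of A), t ⤳ s → t = s := fun t ht =>
      PrimeSpectrum.ext (le_antisymm ((PrimeSpectrum.le_iff_specializes _ _).mpr ht)
        (hη.le.trans bot_le))
    have key : ∀ x : f.fiber s, _ := fun x =>
      reduction_generic hm hgen (apply_fiberι f s x) hπ0
    obtain ⟨k1, k2, k3⟩ := fibre_invariants hN hm hiso hfib hs
      (fun x _ => ⟨(key x).1, (key x).2.1⟩) hE.toFinset fun x => hE.mem_toFinset
    refine ⟨k1, ?_, k3⟩
    rw [k2]
    have hsub : hD.toFinset ⊆ hE.toFinset := fun x hx =>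
      hE.mem_toFinset.mpr (.inr (hD.mem_toFinset.mp hx))
    rw [Finset.sum_subset hsub fun x _ hx => ?_, ← Finset.sum_sub_distrib]
    · refine Finset.sum_congr rfl fun x _ => ?_
      rw [reductionDefect, (key x).2.2]
      ring
    · rw [defect_eq_zero hm fun hV => hx (hD.mem_toFinset.mpr hV), mul_zero]
  · have hπ : Prime π := (Ideal.span_singleton_prime hπ0).mp (hs ▸ s.isPrime)
    have key : ∀ x : f.fiber s, _ := fun x =>
      reduction_special hm hf hη hπ (x := f.fiberι s x) (by rw [apply_fiberι, hs]) hD.toFinset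
        fun z => hD.mem_toFinset
    obtain ⟨k1, k2, k3⟩ := fibre_invariants hN hm hiso hfib hs
      (fun x _ => ⟨(key x).1, (key x).2.1⟩) hE.toFinset fun x => hE.mem_toFinset
    refine ⟨k1, ?_, k3⟩
    -- The degree of a conductor point of the generic fibre is spread over its specializations in
    -- X_s; these lie on the closed conductor scheme, hence among the bad points.
    have hdeg : ∀ z ∈ hD.toFinset, (fibreDegree f η z : ℤ) =
        ∑ x ∈ hE.toFinset, ((fibreLength f π (f.fiberι η z) (f.fiberι s x)).toNat : ℤ) *
          (fibreDegree f s x : ℤ) := by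
      intro z hz
      have hzV := hD.mem_toFinset.mp hz
      have hzV' := hzV
      rw [Set.mem_ofPred_eq, ← SetLike.mem_coe, ← Scheme.IdealSheafData.range_subschemeι] at hzV
      obtain ⟨w, hw⟩ := hzV
      have h1 := sum_fibreLength_eq_finrank (extConductorIdealSheaf X).subschemeι f hη z w hw hπ s
        hs hE.toFinset fun x hx => hE.mem_toFinset.mpr (.inr
          (hx.mem_closed (extConductorIdealSheaf X).support.isClosed hzV'))
      have h2 := congrArg ENat.toNat h1
      rw [ENat.toNat_sum, ENat.toNat_natCast] at h2
      · rw [fibreDegree, ← h2]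
        push_cast
        exact Finset.sum_congr rfl fun x _ => by rw [ENat.toNat_mul, ENat.toNat_natCast]; rfl
      · intro x hx hT
        exact ENat.natCast_ne_top _ (h1.symm.trans (WithTop.sum_eq_top.mpr ⟨x, hx, hT⟩))
    -- Exchanging the two summations turns the sum over points of the generic fibre into the sum of
    -- the local defects found in X_s.
    have hsum : ∑ z ∈ hD.toFinset, (fibreDegree f η z : ℤ) * defect h (f.fiberι η z) =
        ∑ x ∈ hE.toFinset, ∑ z ∈ hD.toFinset,
          ((fibreLength f π (f.fiberι η z) (f.fiberι s x)).toNat : ℤ) * (fibreDegree f s x : ℤ) *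
            defect h (f.fiberι η z) := by
      rw [Finset.sum_comm]
      exact Finset.sum_congr rfl fun z hz => by rw [hdeg z hz, Finset.sum_mul]
    rw [k2, hsum, ← Finset.sum_sub_distrib]
    refine Finset.sum_congr rfl fun x _ => ?_
    rw [reductionDefect, (key x).2.2, mul_sub, Finset.mul_sum]
    congr 1
    exact Finset.sum_congr rfl fun z _ => by ring

end FibreInvariants

end DeltaFamily
end

/-! ### Sections of the normalization over an affine open set. -/

noncomputable section
namespace DeltaFamily

open IsLocalRing

section GenericSections

lemma exists_eq_primeIdealOf {X : Scheme.{u}} {U : X.Opens} (hU : IsAffineOpen U)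
    (P : PrimeSpectrum Γ(X, U)) : ∃ (y : X) (hy : y ∈ U), hU.primeIdealOf ⟨y, hy⟩ = P := by
  have hy : hU.fromSpec P ∈ U := by
    rw [← SetLike.mem_coe, ← hU.range_fromSpec]
    exact ⟨P, rfl⟩
  exact ⟨_, hy, hU.fromSpec.isOpenEmbedding.injective (hU.fromSpec_primeIdealOf ⟨_, hy⟩)⟩

lemma primeIdealOf_le_primeIdealOf_iff {X : Scheme.{u}} {U : X.Opens} (hU : IsAffineOpen U)
    {y w : X} (hy : y ∈ U) (hw : w ∈ U) :
    (hU.primeIdealOf ⟨w, hw⟩).asIdeal ≤ (hU.primeIdealOf ⟨y, hy⟩).asIdeal ↔ w ⤳ y := by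
  have h1 := PrimeSpectrum.le_iff_specializes (hU.primeIdealOf ⟨w, hw⟩) (hU.primeIdealOf ⟨y, hy⟩)
  refine h1.trans (hU.fromSpec.isOpenEmbedding.isInducing.specializes_iff.symm.trans ?_)
  exact Iff.of_eq (congrArg₂ (fun a b => a ⤳ b) (hU.fromSpec_primeIdealOf ⟨w, hw⟩)
    (hU.fromSpec_primeIdealOf ⟨y, hy⟩))

variable {X W : Scheme.{u}} {g : W ⟶ X} {U : X.Opens} (hU : IsAffineOpen U)
  (hmin : ∀ w x, x ⤳ g w → x = g w) (hgen : ∀ x : X, ∃ w, g w ⤳ x)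

lemma primeIdealOf_mem_minimalPrimes_iff {x : X} (hx : x ∈ U) :
    (hU.primeIdealOf ⟨x, hx⟩).asIdeal ∈ minimalPrimes Γ(X, U) ↔ ∀ y, y ⤳ x → y = x := by
  constructor
  · intro h y hy
    have hyU := hy.mem_open U.isOpen hx
    have h1 := (primeIdealOf_le_primeIdealOf_iff hU hx hyU).mpr hy
    have h2 := (primeIdealOf_le_primeIdealOf_iff hU hyU hx).mp
      (h.2 ⟨(hU.primeIdealOf ⟨y, hyU⟩).isPrime, bot_le⟩ h1)
    exact (hy.antisymm h2).eq
  · intro h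
    refine ⟨⟨(hU.primeIdealOf ⟨x, hx⟩).isPrime, bot_le⟩, fun q hq hle => ?_⟩
    obtain ⟨y, hy, hyq⟩ := exists_eq_primeIdealOf hU ⟨q, hq.1⟩
    have hyq' : (hU.primeIdealOf ⟨y, hy⟩).asIdeal = q := congrArg PrimeSpectrum.asIdeal hyq
    have h1 : y ⤳ x := (primeIdealOf_le_primeIdealOf_iff hU hx hy).mp (hyq'.le.trans hle)
    rw [← hyq']
    exact (primeIdealOf_le_primeIdealOf_iff hU hy hx).mpr (h y h1 ▸ specializes_rfl)

include hU hmin hgen in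
-- By `hmin` and `hgen` the image of g is the set of generic points, whose primes in `U` are the
-- minimal ones; in the reduction, a nonzerodivisor is an element outside all of these.
lemma mk_mem_nonZeroDivisors_iff (b : Γ(X, U)) :
    Ideal.Quotient.mk (nilradical Γ(X, U)) b ∈ nonZeroDivisors (Γ(X, U) ⧸ nilradical Γ(X, U)) ↔
      ∀ w (hw : g w ∈ U), IsUnit (X.presheaf.germ U (g w) hw b) := by
  constructor
  · intro hb w hw
    rw [← mem_primeCompl_primeIdealOf_iff hU hw]
    exact forall_notMem_of_mk_mem_nonZeroDivisors hb _
      ((primeIdealOf_mem_minimalPrimes_iff hU hw).mpr (hmin w))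
  · intro h
    refine mk_mem_nonZeroDivisors_of_forall_notMem fun P hP => ?_
    obtain ⟨y, hy, hyP⟩ := exists_eq_primeIdealOf hU ⟨P, hP.1.1⟩
    have hyP' : (hU.primeIdealOf ⟨y, hy⟩).asIdeal = P := congrArg PrimeSpectrum.asIdeal hyP
    obtain ⟨w, hw⟩ := hgen y
    rw [← hyP'] at hP
    have hwy := (primeIdealOf_mem_minimalPrimes_iff hU hy).mp hP _ hw
    subst hwy
    rw [← hyP']
    exact (mem_primeCompl_primeIdealOf_iff hU hy b).mpr (h w hy)

include hmin in
-- The local ring at a generic point has a single prime, so a nonunit is nilpotent and dies on the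
-- reduced scheme `W`.
lemma germ_app_eq_zero [IsReduced W] (w : W) (hw : g w ∈ U) (hw' : w ∈ g ⁻¹ᵁ U) (c : Γ(X, U))
    (hc : ¬ IsUnit (X.presheaf.germ U (g w) hw c)) :
    W.presheaf.germ (g ⁻¹ᵁ U) w hw' (g.app U c) = 0 := by
  have h1 : IsNilpotent (X.presheaf.germ U (g w) hw c) := by
    rw [← mem_nilradical, nilradical_eq_sInf, Ideal.mem_sInf]
    intro q hq
    have hq' : q.IsPrime := hq
    obtain ⟨y, hy, rfl⟩ := exists_eq_genIdeal (g w) q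
    rw [(genIdeal_eq_maximalIdeal_iff hy).mpr (hmin w y hy)]
    exact hc
  have h2 := (h1.map (g.stalkMap w).hom).eq_zero
  rw [← h2]
  exact (Scheme.Hom.germ_stalkMap_apply g U w hw c).symm

include hU in
lemma exists_germ_eq_fraction (hs : ∀ w, Function.Surjective (g.stalkMap w))
    (l : Γ(W, g ⁻¹ᵁ U)) (w : W) (hw : g w ∈ U) (hw' : w ∈ g ⁻¹ᵁ U) :
    ∃ a b : Γ(X, U), IsUnit (X.presheaf.germ U (g w) hw b) ∧
      W.presheaf.germ (g ⁻¹ᵁ U) w hw' (g.app U b) * W.presheaf.germ (g ⁻¹ᵁ U) w hw' l =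
        W.presheaf.germ (g ⁻¹ᵁ U) w hw' (g.app U a) := by
  obtain ⟨r, hr⟩ := hs w (W.presheaf.germ (g ⁻¹ᵁ U) w hw' l)
  let _ := (X.presheaf.germ U (g w) hw).hom.toAlgebra
  have l1 : IsLocalization.AtPrime (X.presheaf.stalk (g w)) (hU.primeIdealOf ⟨g w, hw⟩).asIdeal :=
    hU.isLocalization_stalk ⟨g w, hw⟩
  obtain ⟨⟨a, b⟩, hab⟩ := IsLocalization.surj (hU.primeIdealOf ⟨g w, hw⟩).asIdeal.primeCompl r
  have hab' : r * X.presheaf.germ U (g w) hw b.1 = X.presheaf.germ U (g w) hw a := hab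
  refine ⟨a, b, (mem_primeCompl_primeIdealOf_iff hU hw b.1).mp b.2, ?_⟩
  have h1 := Scheme.Hom.germ_stalkMap_apply g U w hw a
  have h2 := Scheme.Hom.germ_stalkMap_apply g U w hw b.1
  rw [← hab', map_mul, hr, h2] at h1
  rw [mul_comm]
  exact h1

include hU hmin in
-- At each point i of `W` over `U` the section is a fraction a_i/b_i. Sections E_i that are units at
-- i and vanish on `W` at the other points patch these into one fraction ΣE_i a_i / ΣE_i b_i.
lemma exists_app_mul_eq_app [IsReduced W] [Finite W] (hinj : Function.Injective g)
    (hs : ∀ w, Function.Surjective (g.stalkMap w)) (l : Γ(W, g ⁻¹ᵁ U)) :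
    ∃ a b : Γ(X, U), (∀ w (hw : g w ∈ U), IsUnit (X.presheaf.germ U (g w) hw b)) ∧
      g.app U b * l = g.app U a := by
  classical
  let I := {w : W // g w ∈ U}
  let _ : Fintype I := Fintype.ofFinite _
  -- By minimality distinct generic points do not specialize to each other, so a basic open set
  -- contains g i but not g j. The products of these `c` over j are the patching sections.
  have hc : ∀ i j : I, ∃ c : Γ(X, U), IsUnit (X.presheaf.germ U (g i.1) i.2 c) ∧
      (i ≠ j → ¬ IsUnit (X.presheaf.germ U (g j.1) j.2 c)) := by
    intro i j
    by_cases hij : i = j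
    · exact ⟨1, by rw [map_one]; exact isUnit_one, fun h => absurd hij h⟩
    · have hn : ¬ g j.1 ⤳ g i.1 := fun h =>
        hij (Subtype.ext (hinj (hmin i.1 _ h)).symm)
      rw [specializes_iff_forall_open] at hn
      push Not at hn
      obtain ⟨V, hV, hiV, hjV⟩ := hn
      obtain ⟨c, hcV, hic⟩ := hU.exists_basicOpen_le (V := ⟨V, hV⟩) ⟨g i.1, hiV⟩ i.2
      refine ⟨c, (X.mem_basicOpen c _ i.2).mp hic, fun _ hu => hjV ?_⟩
      exact hcV ((X.mem_basicOpen c _ j.2).mpr hu)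
  choose c hc1 hc2 using hc
  have hab : ∀ i : I, _ := fun i => exists_germ_eq_fraction hU hs l i.1 i.2 i.2
  choose a b hb hab using hab
  let E : I → Γ(X, U) := fun i => ∏ j, c i j
  have hE : ∀ i, IsUnit (X.presheaf.germ U (g i.1) i.2 (E i)) := fun i => by
    rw [map_prod]
    exact IsUnit.prod_univ_iff.mpr fun j => hc1 i j
  have hE0 : ∀ i k : I, k ≠ i → W.presheaf.germ (g ⁻¹ᵁ U) i.1 i.2 (g.app U (E k)) = 0 := by
    intro i k hik
    rw [map_prod, map_prod]
    exact Finset.prod_eq_zero (Finset.mem_univ i)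
      (germ_app_eq_zero hmin i.1 i.2 i.2 _ (hc2 k i hik))
  have hsum : ∀ (i : I) (d : I → Γ(X, U)),
      W.presheaf.germ (g ⁻¹ᵁ U) i.1 i.2 (g.app U (∑ k, E k * d k)) =
      W.presheaf.germ (g ⁻¹ᵁ U) i.1 i.2 (g.app U (E i)) *
        W.presheaf.germ (g ⁻¹ᵁ U) i.1 i.2 (g.app U (d i)) := by
    intro i d
    rw [map_sum, map_sum, Finset.sum_eq_single i]
    · rw [map_mul, map_mul]
    · intro k _ hk
      rw [map_mul, map_mul, hE0 i k hk, zero_mul]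
    · exact fun h => absurd (Finset.mem_univ i) h
  refine ⟨∑ k, E k * a k, ∑ k, E k * b k, fun w hw => ?_, ?_⟩
  · have h1 := hsum ⟨w, hw⟩ b
    have h2 := Scheme.Hom.germ_stalkMap_apply g U w hw (∑ k, E k * b k)
    rw [← isUnit_map_iff (g.stalkMap w).hom]
    refine h2.symm ▸ h1.symm ▸ ?_
    rw [← map_mul, ← map_mul]
    have h3 := Scheme.Hom.germ_stalkMap_apply g U w hw (E ⟨w, hw⟩ * b ⟨w, hw⟩)
    refine h3 ▸ ?_
    refine IsUnit.map (g.stalkMap w).hom ?_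
    rw [map_mul]
    exact (hE ⟨w, hw⟩).mul (hb ⟨w, hw⟩)
  · refine TopCat.Presheaf.section_ext W.sheaf _ _ _ fun w hw => ?_
    change W.presheaf.germ (g ⁻¹ᵁ U) w hw _ = W.presheaf.germ (g ⁻¹ᵁ U) w hw _
    rw [map_mul, hsum ⟨w, hw⟩, hsum ⟨w, hw⟩, mul_assoc, hab ⟨w, hw⟩]

include hU hmin hgen in
/-- The integral closure of the sections of a scheme in the sections of the disjoint union of its
generic points is the normalization. -/
lemma nonempty_integralClosure_sections_equiv [IsReduced W] [Finite W]
    (hinj : Function.Injective g) (hs : ∀ w, Function.Surjective (g.stalkMap w)) :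
    letI := (g.app U).hom.toAlgebra
    Nonempty (integralClosure Γ(X, U) Γ(W, g ⁻¹ᵁ U) ≃ₐ[Γ(X, U)] NormRing Γ(X, U)) := by
  let _ := (g.app U).hom.toAlgebra
  refine nonempty_integralClosure_equiv_normRing (fun a ha => ?_) (fun a ha => ?_) (fun b hb => ?_)
    (fun l => ?_)
  · rw [Scheme.isNilpotent_iff_basicOpen_eq_bot_of_isCompact hU.isCompact, eq_bot_iff]
    intro x hx
    obtain ⟨w, hw⟩ := hgen x
    have h1 : w ∈ g ⁻¹ᵁ X.basicOpen a := hw.mem_open (X.basicOpen a).isOpen hx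
    rw [Scheme.preimage_basicOpen, show g.app U a = 0 from ha, Scheme.basicOpen_zero] at h1
    exact h1.elim
  · exact (ha.map (g.app U).hom).eq_zero
  · refine W.toRingedSpace.isUnit_of_isUnit_germ _ _ fun w hw => ?_
    have h1 := (mk_mem_nonZeroDivisors_iff hU hmin hgen b).mp hb w hw
    exact (Scheme.Hom.germ_stalkMap_apply g U w hw b) ▸ h1.map (g.stalkMap w).hom
  · obtain ⟨a, b, hb, hab⟩ := exists_app_mul_eq_app hU hmin hinj hs l
    exact ⟨a, b, (mk_mem_nonZeroDivisors_iff hU hmin hgen b).mpr hb, hab⟩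

end GenericSections

end DeltaFamily
end

/-! ### Generic points of a Noetherian scheme and the sections of its normalization. -/

noncomputable section
namespace DeltaFamily

open IsLocalRing

section GenericPoints

variable (X : Scheme.{u})

lemma exists_eq_sigmaι (w : (∐ fun x : genericPoints X => Spec (X.residueField x.1) :)) :
    ∃ (x : genericPoints X) (p : Spec (X.residueField x.1)),
      Sigma.ι (fun x : genericPoints X => Spec (X.residueField x.1)) x p = w := by
  obtain ⟨⟨x, p⟩, h⟩ := (sigmaMk fun x : genericPoints X =>
    Spec (X.residueField x.1)).surjective w
  exact ⟨x, p, (sigmaMk_mk (fun x : genericPoints X => Spec (X.residueField x.1)) x p).symm.trans h⟩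

lemma genericPointsMap_sigmaι (x : genericPoints X) (p : Spec (X.residueField x.1)) :
    genericPointsMap X (Sigma.ι (fun x : genericPoints X => Spec (X.residueField x.1)) x p) =
      x.1 := by
  rw [← Scheme.Hom.comp_apply, genericPointsMap, Sigma.ι_desc]
  exact Scheme.fromSpecResidueField_apply x.1 p

lemma eq_of_specializes_genericPoint {X : Scheme.{u}} {x y : X} (hx : x ∈ genericPoints X)
    (h : y ⤳ x) : y = x := by
  have h1 : closure {y} ≤ closure {x} :=
    hx.2 isIrreducible_singleton.closure h.closure_subset
  exact (h.antisymm (specializes_iff_closure_subset.mpr h1)).eq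

lemma genericPointsMap_minimal (w x) (h : x ⤳ genericPointsMap X w) :
    x = genericPointsMap X w := by
  obtain ⟨y, p, rfl⟩ := exists_eq_sigmaι X w
  rw [genericPointsMap_sigmaι] at h ⊢
  exact eq_of_specializes_genericPoint y.2 h

lemma exists_genericPointsMap_specializes (x : X) : ∃ w, genericPointsMap X w ⤳ x := by
  obtain ⟨y, hy⟩ := genericPoints.component_surjective
    (⟨irreducibleComponent x, irreducibleComponent_mem_irreducibleComponents x⟩ :
      irreducibleComponents X)
  let p : Spec (X.residueField y.1) := Classical.arbitrary _
  refine ⟨Sigma.ι (fun x : genericPoints X => Spec (X.residueField x.1)) y p, ?_⟩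
  rw [genericPointsMap_sigmaι, specializes_iff_mem_closure]
  have : closure {y.1} = irreducibleComponent x := congrArg Subtype.val hy
  rw [this]
  exact mem_irreducibleComponent

lemma injective_genericPointsMap : Function.Injective (genericPointsMap X) := by
  intro w w' h
  obtain ⟨y, p, rfl⟩ := exists_eq_sigmaι X w
  obtain ⟨y', p', rfl⟩ := exists_eq_sigmaι X w'
  rw [genericPointsMap_sigmaι, genericPointsMap_sigmaι] at h
  obtain rfl := Subtype.ext h
  rw [Subsingleton.elim p p']

lemma surjective_stalkMap_genericPointsMap (w) :
    Function.Surjective ((genericPointsMap X).stalkMap w) := by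
  obtain ⟨y, p, rfl⟩ := exists_eq_sigmaι X w
  let i := Sigma.ι (fun x : genericPoints X => Spec (X.residueField x.1)) y
  have h1 : i ≫ genericPointsMap X = X.fromSpecResidueField y.1 := Sigma.ι_desc _ _
  have h2 : Function.Surjective ((i ≫ genericPointsMap X).stalkMap p) := by
    rw [h1]
    exact (X.fromSpecResidueField y.1).stalkMap_surjective p
  rw [Scheme.Hom.stalkMap_comp] at h2
  have h3 : Function.Bijective (i.stalkMap p) := ConcreteCategory.bijective_of_isIso _
  intro t
  obtain ⟨r, hr⟩ := h2 (i.stalkMap p t)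
  exact ⟨r, h3.1 hr⟩

instance : IsReduced (∐ fun x : genericPoints X => Spec (X.residueField x.1)) :=
  have : ∀ i, IsReduced ((sigmaOpenCover fun x : genericPoints X =>
    Spec (X.residueField x.1)).X i) := fun i =>
      inferInstanceAs (IsReduced (Spec (X.residueField i.1)))
  .of_openCover _ (sigmaOpenCover _)

instance [IsNoetherian X] :
    Finite (∐ fun x : genericPoints X => Spec (X.residueField x.1) :) :=
  Finite.of_equiv _ (sigmaMk fun x : genericPoints X => Spec (X.residueField x.1)).toEquiv

variable [IsNoetherian X]

instance : IsIntegralHom (normalizationMap X) :=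
  inferInstanceAs (IsIntegralHom (genericPointsMap X).fromNormalization)

instance : IsReduced (normalization X) :=
  inferInstanceAs (IsReduced (genericPointsMap X).normalization)

/-- The sections of the normalization over an affine open subset. -/
lemma nonempty_sections_normalization_equiv {U : X.Opens} (hU : IsAffineOpen U) :
    letI := ((normalizationMap X).app U).hom.toAlgebra
    Nonempty (Γ(normalization X, normalizationMap X ⁻¹ᵁ U) ≃ₐ[Γ(X, U)] NormRing Γ(X, U)) := by
  let _ := ((normalizationMap X).app U).hom.toAlgebra
  let _ := ((genericPointsMap X).app U).hom.toAlgebra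
  obtain ⟨e⟩ := nonempty_integralClosure_sections_equiv hU (genericPointsMap_minimal X)
    (exists_genericPointsMap_specializes X) (injective_genericPointsMap X)
    (surjective_stalkMap_genericPointsMap X)
  let e' : Γ(normalization X, normalizationMap X ⁻¹ᵁ U) ≃+*
      integralClosure Γ(X, U) Γ(∐ fun x : genericPoints X => Spec (X.residueField x.1), genericPointsMap X ⁻¹ᵁ U) :=
    ((genericPointsMap X).normalizationObjIso hU).commRingCatIsoToRingEquiv
  refine ⟨(AlgEquiv.ofRingEquiv (f := e') fun r => ?_).trans e⟩
  have h1 := ConcreteCategory.congr_hom ((genericPointsMap X).fromNormalization_app hU) r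
  change ((genericPointsMap X).normalizationObjIso hU).hom
    ((genericPointsMap X).fromNormalization.app U r) = _
  rw [h1]
  exact ConcreteCategory.congr_hom ((genericPointsMap X).normalizationObjIso hU).inv_hom_id _

end GenericPoints

end DeltaFamily
end

/-! ### Torsion-freeness and flatness over the base. -/

noncomputable section
namespace DeltaFamily

open IsLocalRing

section TorsionFree

variable {A : Type u} [CommRing A] {X Z : Scheme.{u}} (f : X ⟶ Spec (CommRingCat.of A))
  (h : Z ⟶ X)

lemma torsionFree_of_flat [IsDomain A] [Flat f] : TorsionFree f := by
  intro U hU a ha g hg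
  let _ := (sectionsHom f U).toAlgebra
  have h1 : (f.appLE ⊤ U le_top).hom.Flat :=
    HasRingHomProperty.appLE @Flat f inferInstance ⟨⊤, isAffineOpen_top _⟩ ⟨U, hU⟩ le_top
  have h2 : (sectionsHom f U).Flat := by
    have h3 : (Scheme.ΓSpecIso (CommRingCat.of A)).inv.hom.Flat :=
      RingHom.Flat.of_bijective (ConcreteCategory.bijective_of_isIso _)
    exact RingHom.Flat.comp h3 h1
  have h4 : Module.Flat A Γ(X, U) := h2
  have h5 : Module.IsTorsionFree A Γ(X, U) := inferInstance
  have h6 : a • g = 0 := by rw [Algebra.smul_def]; exact hg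
  exact (smul_eq_zero.mp h6).resolve_left ha

/-- Over a principal ideal domain a torsion-free module is flat, and flatness over an affine base is
tested on affine open sets. -/
lemma flat_of_torsionFree [IsDomain A] [IsPrincipalIdealRing A] (hf : TorsionFree f) : Flat f := by
  rw [HasRingHomProperty.iff_of_iSup_eq_top (P := @Flat) (fun U : X.affineOpens => U)
    (iSup_affineOpens_eq_top X)]
  intro U
  let _ := (sectionsHom f U.1).toAlgebra
  have h5 : Module.IsTorsionFree A Γ(X, U.1) := by
    refine .of_smul_eq_zero fun a g hag => ?_
    by_contra! hn
    rw [Algebra.smul_def] at hag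
    exact hn.2 (hf U.1 U.2 a hn.1 g hag)
  have h2 : (sectionsHom f U.1).Flat := by
    have : Module.Flat A Γ(X, U.1) :=
      Module.Flat.flat_iff_torsion_eq_bot_of_isBezout.mpr
        (Submodule.isTorsionFree_iff_torsion_eq_bot.mp h5)
    exact this
  have h3 : (Scheme.ΓSpecIso (CommRingCat.of A)).hom.hom.Flat :=
    RingHom.Flat.of_bijective (ConcreteCategory.bijective_of_isIso _)
  have h4 : f.appLE ⊤ U.1 le_top = (Scheme.ΓSpecIso (CommRingCat.of A)).hom ≫
      CommRingCat.ofHom (sectionsHom f U.1) := by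
    ext x
    change _ = X.presheaf.map _ (f.appTop ((Scheme.ΓSpecIso (CommRingCat.of A)).inv
      ((Scheme.ΓSpecIso (CommRingCat.of A)).hom x)))
    rw [Iso.hom_inv_id_apply]
    rfl
  rw [h4]
  exact RingHom.Flat.comp h3 h2

variable {f}

/-- Every local ring of `Z` is a localization of sections over the preimage of an affine open set of
`X`, so torsion can be excluded there, and sections are determined by their germs. -/
lemma torsionFree_of_preimage [IsAffineHom h] (H : ∀ U : X.Opens, IsAffineOpen U → ∀ a : A, a ≠ 0 →
    ∀ g : Γ(Z, h ⁻¹ᵁ U), h.app U (sectionsHom f U a) * g = 0 → g = 0) : TorsionFree (h ≫ f) := by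
  intro W _ a ha g hg
  refine TopCat.Presheaf.section_ext Z.sheaf _ _ _ fun z hz => ?_
  change Z.presheaf.germ W z hz g = Z.presheaf.germ W z hz 0
  rw [map_zero]
  obtain ⟨U, hU, hx⟩ := exists_isAffineOpen_mem (h z)
  have hx' : z ∈ h ⁻¹ᵁ U := hx
  have hU' := hU.preimage h
  let _ := (Z.presheaf.germ (h ⁻¹ᵁ U) z hx').hom.toAlgebra
  have l1 : IsLocalization.AtPrime (Z.presheaf.stalk z) (hU'.primeIdealOf ⟨z, hx'⟩).asIdeal :=
    hU'.isLocalization_stalk ⟨z, hx'⟩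
  obtain ⟨⟨b, c⟩, hbc⟩ := IsLocalization.surj (hU'.primeIdealOf ⟨z, hx'⟩).asIdeal.primeCompl
    (Z.presheaf.germ W z hz g)
  have h0 : stalkHom (h ≫ f) z a * Z.presheaf.germ W z hz g = 0 := by
    rw [← germ_sectionsHom (h ≫ f) W z hz, ← map_mul, hg, map_zero]
  have h1 : algebraMap Γ(Z, h ⁻¹ᵁ U) (Z.presheaf.stalk z)
      (sectionsHom (h ≫ f) (h ⁻¹ᵁ U) a * b) = 0 := by
    rw [map_mul, ← hbc, ← mul_assoc]
    have : algebraMap Γ(Z, h ⁻¹ᵁ U) (Z.presheaf.stalk z) (sectionsHom (h ≫ f) (h ⁻¹ᵁ U) a) =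
      stalkHom (h ≫ f) z a := germ_sectionsHom (h ≫ f) _ z hx' a
    rw [this, h0, zero_mul]
  obtain ⟨d, hd⟩ := (IsLocalization.map_eq_zero_iff
    (hU'.primeIdealOf ⟨z, hx'⟩).asIdeal.primeCompl _ _).mp h1
  have h2 := H U hU a ha (d * b) (by rw [app_sectionsHom, mul_left_comm, hd])
  have h3 : algebraMap Γ(Z, h ⁻¹ᵁ U) (Z.presheaf.stalk z) (d * b) = 0 := by rw [h2, map_zero]
  rw [map_mul] at h3
  have h4 := ((IsLocalization.map_units (Z.presheaf.stalk z) d).mul_right_eq_zero).mp h3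
  rw [← hbc] at h4
  exact ((IsLocalization.map_units (Z.presheaf.stalk z) c).mul_left_eq_zero).mp h4

lemma TorsionFree.mem_nilradical (hf : TorsionFree f) {U : X.Opens} (hU : IsAffineOpen U) {a : A}
    (ha : a ≠ 0) (g : Γ(X, U)) (hg : sectionsHom f U a * g ∈ nilradical Γ(X, U)) :
    g ∈ nilradical Γ(X, U) := by
  obtain ⟨n, hn⟩ := hg
  refine ⟨n, ?_⟩
  rw [mul_pow] at hn
  induction n generalizing g with
  | zero => simpa using hn
  | succ n ih =>
    have : ∀ m : ℕ, ∀ r : Γ(X, U), sectionsHom f U a ^ m * r = 0 → r = 0 := by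
      intro m
      induction m with
      | zero => intro r hr; simpa using hr
      | succ m ihm =>
        intro r hr
        rw [pow_succ, mul_assoc] at hr
        exact hf U hU a ha r (ihm _ hr)
    exact this _ _ hn

end TorsionFree

section NormRingTorsion

lemma eq_zero_of_algebraMap_mul_normRing {G : Type u} [CommRing G] (b : G)
    (hb : ∀ g, b * g ∈ nilradical G → g ∈ nilradical G) (y : NormRing G)
    (hy : algebraMap G (NormRing G) b * y = 0) : y = 0 := by
  have h1 : Ideal.Quotient.mk (nilradical G) b ∈ nonZeroDivisors (G ⧸ nilradical G) := by
    rw [mem_nonZeroDivisors_iff_right]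
    intro c hc
    obtain ⟨c, rfl⟩ := Ideal.Quotient.mk_surjective c
    rw [← map_mul, Ideal.Quotient.eq_zero_iff_mem, mul_comm] at hc
    exact Ideal.Quotient.eq_zero_iff_mem.mpr (hb c hc)
  have h2 := IsLocalization.map_units (FractionRing (G ⧸ nilradical G)) ⟨_, h1⟩
  exact Subtype.ext (h2.mul_right_eq_zero.mp (congrArg Subtype.val hy))

end NormRingTorsion

/-! ### The identity, the reduction and the normalization as modifications. -/

section Modifications

variable {A : Type u} [CommRing A] {X : Scheme.{u}} {f : X ⟶ Spec (CommRingCat.of A)}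

lemma ideal_extConductorIdealSheaf_le (U : X.affineOpens) :
    (extConductorIdealSheaf X).ideal U ≤ extConductor Γ(X, U.1) :=
  Scheme.IdealSheafData.ideal_ofIdeals_le _ U

lemma isModification_id (hf : TorsionFree f)
    (hiso : ∀ s (x : f.fiber s), ¬ IsIsolatedPoint (f.fiber s) x) : IsModification f (𝟙 X) where
  isFinite := inferInstance
  exists_app_eq U j _ c := by
    rw [Scheme.Hom.id_app]
    exact ⟨j * (show Γ(X, U.1) from c), rfl⟩
  mul_eq_zero U j _ g hg := by
    rw [Scheme.Hom.id_app] at hg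
    have : g = 0 := hg
    rw [this, mul_zero]
  torsionFree := by rwa [Category.id_comp]
  not_isIsolatedPoint := by rwa [Category.id_comp]

lemma ker_redMap_app (U : X.affineOpens) (g : Γ(X, U.1)) :
    (redMap X).app U.1 g = 0 ↔ g ∈ nilradical Γ(X, U.1) := by
  have h1 := X.nilradical.ker_subschemeι_app U
  have h2 : X.nilradical.ideal U = nilradical Γ(X, U.1) := rfl
  rw [← h2, ← h1]
  rfl

/-- There is no cokernel, and the kernel is the nilradical, which is killed by the second ideal in
the definition of the extended conductor. For the normalization below, the first ideal handles the
cokernel in addition. -/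
lemma isModification_red (hf : TorsionFree f)
    (hiso : ∀ s (x : (redMap X ≫ f).fiber s), ¬ IsIsolatedPoint ((redMap X ≫ f).fiber s) x) :
    IsModification f (redMap X) where
  isFinite := inferInstance
  exists_app_eq U j _ c := by
    obtain ⟨c, rfl⟩ := X.nilradical.subschemeι_app_surjective U c
    exact ⟨j * c, map_mul _ _ _⟩
  mul_eq_zero U j hj g hg := by
    have h1 := (ideal_extConductorIdealSheaf_le U hj).2
    exact congrArg Subtype.val (Module.mem_annihilator.mp h1 ⟨g, (ker_redMap_app U g).mp hg⟩)
  torsionFree := by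
    refine torsionFree_of_preimage _ fun U hU a ha g hg => ?_
    obtain ⟨g, rfl⟩ := X.nilradical.subschemeι_app_surjective ⟨U, hU⟩ g
    rw [← map_mul] at hg
    exact (ker_redMap_app ⟨U, hU⟩ g).mpr
      (hf.mem_nilradical hU ha g ((ker_redMap_app ⟨U, hU⟩ _).mp hg))
  not_isIsolatedPoint := hiso

variable [IsNoetherian X]

/-- Finiteness is local on `X`; on a Nagata chart the sections of the normalization are the
normalization of the ring, which is finite. -/
lemma isFinite_normalizationMap (hN : IsNagata X) : IsFinite (normalizationMap X) := by
  choose U hxU hU hNU using hN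
  have inst := @IsFinite.instHasAffinePropertyAndIsAffineFiniteCarrierObjOppositeOpensCarrierCarrierCommRingCatPresheafOpOpensTopHomAppTop
  refine @HasAffineProperty.of_iSup_eq_top _ _ inst _ _ _ _ (fun x => ⟨U x, hU x⟩)
    (top_le_iff.mp fun x _ => Opens.mem_iSup.mpr ⟨x, hxU x⟩) fun x => ?_
  have hpre : IsAffine (normalizationMap X ⁻¹ᵁ U x).toScheme := (hU x).preimage (normalizationMap X)
  refine ⟨hpre, ?_⟩
  let _ := ((normalizationMap X).app (U x)).hom.toAlgebra
  obtain ⟨e⟩ := nonempty_sections_normalization_equiv X (hU x)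
  have h1 := (hNU x).finite_normRing
  have h2 : Module.Finite Γ(X, U x) Γ(normalization X, normalizationMap X ⁻¹ᵁ U x) :=
    Module.Finite.equiv e.symm.toLinearEquiv
  have h3 : ((normalizationMap X).app (U x)).hom.Finite := h2
  have h4 : (U x).ι ''ᵁ ⊤ = U x := (U x).ι_image_top
  have h5 : ∀ V : X.Opens, V = U x → ((normalizationMap X).app V).hom.Finite := by
    rintro V rfl
    exact h3
  rw [morphismRestrict_appTop]
  exact (RingHom.Finite.of_surjective _ (ConcreteCategory.bijective_of_isIso
    ((normalization X).presheaf.map _)).2).comp (h5 _ h4)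

lemma normalAt_normalization (z : normalization X) : NormalAt (normalization X) z := by
  obtain ⟨U, hU, hx⟩ := exists_isAffineOpen_mem (normalizationMap X z)
  have hx' : z ∈ normalizationMap X ⁻¹ᵁ U := hx
  have hU' := hU.preimage (normalizationMap X)
  let _ := ((normalizationMap X).app U).hom.toAlgebra
  let _ := ((normalization X).presheaf.germ (normalizationMap X ⁻¹ᵁ U) z hx').hom.toAlgebra
  have l1 : IsLocalization.AtPrime ((normalization X).presheaf.stalk z)
    (hU'.primeIdealOf ⟨z, hx'⟩).asIdeal := hU'.isLocalization_stalk ⟨z, hx'⟩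
  have : IsNoetherianRing Γ(X, U) := IsLocallyNoetherian.component_noetherian ⟨U, hU⟩
  exact isNormalDomain_of_isLocalization_normRing (nonempty_sections_normalization_equiv X hU)
    (hU'.primeIdealOf ⟨z, hx'⟩).asIdeal

lemma torsionFree_normalization (hf : TorsionFree f) : TorsionFree (normalizationMap X ≫ f) := by
  refine torsionFree_of_preimage _ fun U hU a ha g hg => ?_
  let _ := ((normalizationMap X).app U).hom.toAlgebra
  obtain ⟨e⟩ := nonempty_sections_normalization_equiv X hU
  refine e.injective ?_
  rw [map_zero]
  refine eq_zero_of_algebraMap_mul_normRing (sectionsHom f U a)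
    (fun g hg => hf.mem_nilradical hU ha g hg) _ ?_
  rw [← e.commutes, ← map_mul]
  exact (congrArg e hg).trans (map_zero e)

lemma isModification_normalization (hN : IsNagata X) (hf : TorsionFree f)
    (hiso : ∀ s (x : (normalizationMap X ≫ f).fiber s),
      ¬ IsIsolatedPoint ((normalizationMap X ≫ f).fiber s) x) :
    IsModification f (normalizationMap X) where
  isFinite := isFinite_normalizationMap hN
  exists_app_eq U j hj c := by
    let _ := ((normalizationMap X).app U.1).hom.toAlgebra
    obtain ⟨e⟩ := nonempty_sections_normalization_equiv X U.2
    have h1 := Module.mem_annihilator.mp (ideal_extConductorIdealSheaf_le U hj).1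
      (Submodule.Quotient.mk (e c))
    rw [← Submodule.Quotient.mk_smul, Submodule.Quotient.mk_eq_zero] at h1
    obtain ⟨g, hg⟩ := h1
    refine ⟨g, e.injective ?_⟩
    rw [map_mul]
    refine (e.commutes g).trans (Eq.trans hg ?_)
    rw [Algebra.smul_def, ← e.commutes]
    rfl
  mul_eq_zero U j hj g hg := by
    let _ := ((normalizationMap X).app U.1).hom.toAlgebra
    obtain ⟨e⟩ := nonempty_sections_normalization_equiv X U.2
    have h1 : g ∈ nilradical Γ(X, U.1) := by
      rw [← ker_linearMap_normRing, LinearMap.mem_ker, Algebra.linearMap_apply, ← e.commutes]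
      exact (congrArg e hg).trans (map_zero e)
    exact congrArg Subtype.val
      (Module.mem_annihilator.mp (ideal_extConductorIdealSheaf_le U hj).2 ⟨g, h1⟩)
  torsionFree := torsionFree_normalization hf
  not_isIsolatedPoint := hiso

end Modifications

end DeltaFamily
end

/-! ### Isolated points of fibres under finite surjective morphisms. -/

noncomputable section
namespace DeltaFamily

open IsLocalRing

section IsolatedPoints

variable {A : Type u} [CommRing A] {X Z : Scheme.{u}} {f : X ⟶ Spec (CommRingCat.of A)}
  {h : Z ⟶ X}

lemma IsIsolatedPoint.specializes {Y : Scheme.{u}} {x : Y} (hx : IsIsolatedPoint Y x) :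
    (∀ w, x ⤳ w → w = x) ∧ ∀ w, w ⤳ x → w = x := by
  constructor
  · intro w hw
    exact hw.mem_closed (isClosed_of_mem_irreducibleComponents _ hx) rfl
  · intro w hw
    have h1 : ({x} : Set Y) ≤ closure {w} := Set.singleton_subset_iff.mpr
      (specializes_iff_mem_closure.mp hw)
    exact hx.2 isIrreducible_singleton.closure h1 (subset_closure rfl)

lemma exists_fiberι_eq_of_apply (s : Spec (CommRingCat.of A)) (z : (h ≫ f).fiber s) :
    ∃ x : f.fiber s, f.fiberι s x = h ((h ≫ f).fiberι s z) := by
  have h2 : h ((h ≫ f).fiberι s z) ∈ Set.range (f.fiberι s) := by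
    rw [f.range_fiberι]
    exact apply_fiberι (h ≫ f) s z
  exact h2

lemma exists_fiberι_over (s : Spec (CommRingCat.of A)) (x : f.fiber s) (z : Z)
    (hz : h z = f.fiberι s x) : ∃ z' : (h ≫ f).fiber s, (h ≫ f).fiberι s z' = z := by
  have h2 : z ∈ Set.range ((h ≫ f).fiberι s) := by
    rw [(h ≫ f).range_fiberι]
    change f (h z) = s
    rw [hz, apply_fiberι]
  exact h2

lemma specializes_over {s : Spec (CommRingCat.of A)} {x y : f.fiber s} {z w : (h ≫ f).fiber s}
    (hx : f.fiberι s x = h ((h ≫ f).fiberι s z)) (hy : f.fiberι s y = h ((h ≫ f).fiberι s w))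
    (hzw : z ⤳ w) : x ⤳ y := by
  refine (f.fiberι s).isEmbedding.isInducing.specializes_iff.mp ?_
  rw [hx, hy]
  exact (hzw.map ((h ≫ f).fiberι s).continuous).map h.continuous

lemma eq_of_specializes_over' [IsFinite h] {s : Spec (CommRingCat.of A)} {x : f.fiber s}
    {z w : (h ≫ f).fiber s} (hz : f.fiberι s x = h ((h ≫ f).fiberι s z))
    (hw : f.fiberι s x = h ((h ≫ f).fiberι s w)) (hzw : z ⤳ w) : z = w :=
  ((h ≫ f).fiberι s).isEmbedding.injective (eq_of_specializes_of_isFinite h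
    (hzw.map ((h ≫ f).fiberι s).continuous) (hz.symm.trans hw))

/-- Isolated points of fibres lift along finite surjective morphisms. -/
lemma not_isIsolatedPoint_of_surjective [IsFinite h] (hs : Function.Surjective h)
    (hiso : ∀ s (z : (h ≫ f).fiber s), ¬ IsIsolatedPoint ((h ≫ f).fiber s) z) (s)
    (x : f.fiber s) : ¬ IsIsolatedPoint (f.fiber s) x := by
  intro hx
  obtain ⟨h1, h2⟩ := hx.specializes
  obtain ⟨z, hz⟩ := hs (f.fiberι s x)
  obtain ⟨z, rfl⟩ := exists_fiberι_over s x z hz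
  refine hiso s z (isIsolatedPoint_of_specializes (fun w hw => ?_) fun w hw => ?_)
  · obtain ⟨y, hy⟩ := exists_fiberι_eq_of_apply s w
    rw [h1 y (specializes_over hz.symm hy hw)] at hy
    exact (eq_of_specializes_over' hz.symm hy hw).symm
  · obtain ⟨y, hy⟩ := exists_fiberι_eq_of_apply s w
    rw [h2 y (specializes_over hy hz.symm hw)] at hy
    exact eq_of_specializes_over' hy hz.symm hw

/-- Isolated points of fibres are preserved by surjective closed immersions. -/
lemma not_isIsolatedPoint_of_isClosedImmersion [IsClosedImmersion h] (hs : Function.Surjective h)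
    (hiso : ∀ s (x : f.fiber s), ¬ IsIsolatedPoint (f.fiber s) x) (s)
    (z : (h ≫ f).fiber s) : ¬ IsIsolatedPoint ((h ≫ f).fiber s) z := by
  intro hz
  obtain ⟨h1, h2⟩ := hz.specializes
  obtain ⟨x, hx⟩ := exists_fiberι_eq_of_apply s z
  have key : ∀ y : f.fiber s, ∃ w : (h ≫ f).fiber s, f.fiberι s y = h ((h ≫ f).fiberι s w) := by
    intro y
    obtain ⟨w, hw⟩ := hs (f.fiberι s y)
    obtain ⟨w, rfl⟩ := exists_fiberι_over s y w hw
    exact ⟨w, hw.symm⟩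
  have lift : ∀ (y y' : f.fiber s) (w w' : (h ≫ f).fiber s),
      f.fiberι s y = h ((h ≫ f).fiberι s w) → f.fiberι s y' = h ((h ≫ f).fiberι s w') →
      y ⤳ y' → w ⤳ w' := by
    intro y y' w w' hy hy' hyy
    refine ((h ≫ f).fiberι s).isEmbedding.isInducing.specializes_iff.mp
      (h.isEmbedding.isInducing.specializes_iff.mp ?_)
    rw [← hy, ← hy']
    exact hyy.map (f.fiberι s).continuous
  refine hiso s x (isIsolatedPoint_of_specializes (fun y hy => ?_) fun y hy => ?_)
  · obtain ⟨w, hw⟩ := key y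
    rw [h1 w (lift x y z w hx hw hy), ← hx] at hw
    exact (f.fiberι s).isEmbedding.injective hw
  · obtain ⟨w, hw⟩ := key y
    rw [h2 w (lift y x w z hw hx hy), ← hx] at hw
    exact (f.fiberι s).isEmbedding.injective hw

end IsolatedPoints

/-! ### Vanishing and positivity of the invariants; reduced fibres. -/

section SpecialPoints

variable {A : Type u} [CommRing A] {X Z : Scheme.{u}} {f : X ⟶ Spec (CommRingCat.of A)}
  {h : Z ⟶ X}

/-- The local rings of the fibres of a modification at points which are not normal. -/
lemma specialPoints_spec [IsFinite ((extConductorIdealSheaf X).subschemeι ≫ f)]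
    (hm : IsModification f h) {s : Spec (CommRingCat.of A)}
    (hfib : FibreHasFinitelyManyINNS f s) {z : (h ≫ f).fiber s}
    (hz : ¬ NormalAt ((h ≫ f).fiber s) z) :
    PuncturedNormal (((h ≫ f).fiber s).presheaf.stalk z) ∧
    maximalIdeal (((h ≫ f).fiber s).presheaf.stalk z) ∉
      minimalPrimes (((h ≫ f).fiber s).presheaf.stalk z) := by
  have := hm.isFinite
  have hnorm : ∀ (w : (h ≫ f).fiber s) (y : f.fiber s),
      f.fiberι s y = h ((h ≫ f).fiberι s w) → y ∉ badPoints f s →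
      NormalAt ((h ≫ f).fiber s) w := by
    intro w y hy hb
    rw [badPoints, Set.mem_ofPred_eq, not_or, not_not] at hb
    exact normalAt_of_bijective_pushMap s h y w hy.symm (hm.bijective_pushMap hb.2) hb.1
  obtain ⟨x, hx⟩ := exists_fiberι_eq_of_apply s z
  have hxb : x ∈ badPoints f s := by
    by_contra hb
    exact hz (hnorm z x hx hb)
  obtain ⟨h1, -, h3⟩ := badPoints_spec hfib hxb
  refine ⟨puncturedNormal_stalk fun w hw hne => ?_,
    notMem_minimalPrimes_of_finite_residueField (h ≫ f) s (hm.not_isIsolatedPoint s z)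
      fun w hw => eq_of_specializes_over h3 hx.symm hw⟩
  obtain ⟨y, hy⟩ := exists_fiberι_eq_of_apply s w
  refine hnorm w y hy fun hyb => hne ?_
  have hyx := specializes_over hy hx hw
  have := (badPoints_spec hfib hyb).2.2 x hyx
  rw [← this] at hy
  exact eq_of_specializes_over' hy hx hw

lemma epsilon_nonneg (g : X ⟶ Spec (CommRingCat.of A)) (s : Spec (CommRingCat.of A)) :
    0 ≤ epsilon g s :=
  finsum_nonneg fun _ => finsum_nonneg fun _ => Int.natCast_nonneg _

lemma H0m_eq_bot_of_isReduced {R : Type u} [CommRing R] [IsLocalRing R] [IsNoetherianRing R]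
    [_root_.IsReduced R] (h1 : PuncturedNormal R) (h2 : maximalIdeal R ∉ minimalPrimes R) :
    H0m R = ⊥ := by
  rw [H0m_eq_nilradical h1 h2, nilradical_eq_zero]
  rfl

lemma finrank_H0m_eq_zero (k : Type u) {R : Type u} [Field k] [CommRing R] [IsLocalRing R]
    [Algebra k R] (h : H0m R = ⊥) : localEpsilon k R = 0 := by
  have h3 : Subsingleton (H0m R) := by rw [h]; infer_instance
  simp [localEpsilon, Module.finrank_zero_of_subsingleton]

lemma epsilon_eq_zero_of_isReduced [IsNoetherian X]
    [IsFinite ((extConductorIdealSheaf X).subschemeι ≫ f)] (hm : IsModification f h)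
    {s : Spec (CommRingCat.of A)} (hfib : FibreHasFinitelyManyINNS f s)
    [IsReduced ((h ≫ f).fiber s)] : epsilon (h ≫ f) s = 0 := by
  have := hm.isFinite
  have hZ : IsLocallyNoetherian Z := LocallyOfFiniteType.isLocallyNoetherian h
  refine finsum_mem_of_eqOn_zero fun z hz => ?_
  obtain ⟨h1, h2⟩ := specialPoints_spec hm hfib (hz.resolve_right (hm.not_isIsolatedPoint s z))
  exact finrank_H0m_eq_zero _ (H0m_eq_bot_of_isReduced h1 h2)

lemma delta_eq_zero_of_isNormal (hm : IsModification f h) {s : Spec (CommRingCat.of A)}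
    (hn : IsNormal ((h ≫ f).fiber s)) : delta (h ≫ f) s = 0 :=
  finsum_mem_of_eqOn_zero fun z hz =>
    absurd (hn z) (hz.resolve_right (hm.not_isIsolatedPoint s z))

variable [IsNoetherian X] [IsFinite ((extConductorIdealSheaf X).subschemeι ≫ f)]
  [IsPrincipalIdealRing A]

/-- The local ring of the fibre is the quotient of a normal local domain by the generator of s, and
has positive dimension since the point is not isolated; so its depth is positive. -/
lemma H0m_eq_bot_of_normalAt (hm : IsModification f h) (hn : ∀ z, NormalAt Z z)
    {s : Spec (CommRingCat.of A)} (hfib : FibreHasFinitelyManyINNS f s) {z : (h ≫ f).fiber s}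
    (hz : ¬ NormalAt ((h ≫ f).fiber s) z) : H0m (((h ≫ f).fiber s).presheaf.stalk z) = ⊥ := by
  have := hm.isFinite
  have hZ : IsLocallyNoetherian Z := LocallyOfFiniteType.isLocallyNoetherian h
  obtain ⟨π, hs⟩ : ∃ π, s.asIdeal = Ideal.span {π} := (IsPrincipalIdealRing.principal s.asIdeal).1
  exact H0m_eq_bot_of_isNormalDomain (hn ((h ≫ f).fiberι s z)) (((h ≫ f).fiberι s).stalkMap z).hom
    (surjective_stalkMap_fiberι _ s z) _ (span_stalkHom_eq_ker s z hs)
    (specialPoints_spec hm hfib hz).2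

lemma delta_nonneg (hm : IsModification f h) (hn : ∀ z, NormalAt Z z)
    {s : Spec (CommRingCat.of A)} (hfib : FibreHasFinitelyManyINNS f s) :
    0 ≤ delta (h ≫ f) s :=
  finsum_nonneg fun z => finsum_nonneg fun hz => by
    rw [localDelta, finrank_H0m_eq_zero _ (H0m_eq_bot_of_normalAt hm hn hfib
      (hz.resolve_right (hm.not_isIsolatedPoint s z))), sub_zero]
    exact Int.natCast_nonneg _

/-- At a non-normal point the nilradical equals H⁰_m, which vanishes by positive depth; at a normal
point the local ring is a domain. -/
lemma isReduced_fiber (hm : IsModification f h) (hn : ∀ z, NormalAt Z z)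
    {s : Spec (CommRingCat.of A)} (hfib : FibreHasFinitelyManyINNS f s) :
    IsReduced ((h ≫ f).fiber s) := by
  have := hm.isFinite
  have hZ : IsLocallyNoetherian Z := LocallyOfFiniteType.isLocallyNoetherian h
  have : ∀ z, _root_.IsReduced (((h ≫ f).fiber s).presheaf.stalk z) := by
    intro z
    by_cases hz : NormalAt ((h ≫ f).fiber s) z
    · have := hz.1
      infer_instance
    · obtain ⟨h1, h2⟩ := specialPoints_spec hm hfib hz
      have h3 := H0m_eq_bot_of_normalAt hm hn hfib hz
      rw [H0m_eq_nilradical h1 h2] at h3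
      exact nilradical_eq_bot_iff.mp h3
  exact isReduced_of_isReduced_stalk _

end SpecialPoints

section GenericFibre

variable {A : Type u} [CommRing A] {X : Scheme.{u}} {f : X ⟶ Spec (CommRingCat.of A)}

lemma isNormal_generic_fiber (hn : ∀ x, NormalAt X x) {η : Spec (CommRingCat.of A)}
    (hη : η.asIdeal = ⊥) : IsNormal (f.fiber η) := by
  intro x
  refine isNormalDomain_of_ker_eq (RingHom.id _) ((f.fiberι η).stalkMap x).hom
    Function.surjective_id (surjective_stalkMap_fiberι f η x) ?_ (hn (f.fiberι η x))
  rw [span_stalkHom_eq_ker η x (π := 0) (by rw [hη]; exact (Ideal.span_singleton_eq_bot.mpr rfl).symm),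
    map_zero, Ideal.span_singleton_eq_bot.mpr rfl]
  exact (RingHom.injective_iff_ker_eq_bot _).mp Function.injective_id

/-- A generic point of `X` maps to η: a nonzero element of `A` vanishing there would be nilpotent in
the local ring, yet torsion-freeness makes it a nonzerodivisor. -/
lemma mem_range_of_asIdeal_eq_bot (hf : TorsionFree f) {η : Spec (CommRingCat.of A)}
    (hη : η.asIdeal = ⊥) (x : X) : η ∈ Set.range f := by
  obtain ⟨w, hw⟩ := exists_genericPointsMap_specializes X x
  set y := genericPointsMap X w with hy
  refine ⟨y, PrimeSpectrum.ext ?_⟩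
  rw [hη, eq_bot_iff]
  intro a ha
  by_contra ha0
  have h1 : stalkHom f y a ∈ maximalIdeal (X.presheaf.stalk y) :=
    (comap_stalkHom_maximalIdeal f y).ge ha
  have h2 : IsNilpotent (stalkHom f y a) := by
    rw [← mem_nilradical, nilradical_eq_sInf, Ideal.mem_sInf]
    intro q hq
    have hq' : q.IsPrime := hq
    obtain ⟨v, hv, rfl⟩ := exists_eq_genIdeal y q
    rw [(genIdeal_eq_maximalIdeal_iff hv).mpr (genericPointsMap_minimal X w v hv)]
    exact h1
  obtain ⟨n, hn⟩ := h2
  have h3 : ∀ n : ℕ, stalkHom f y a ^ n ≠ 0 := by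
    intro n
    induction n with
    | zero => simp
    | succ n ih =>
      intro h0
      rw [pow_succ', ← map_pow] at h0
      exact ih ((map_pow _ _ _).symm.trans (hf.stalk y ha0 _ h0))
  exact h3 n hn

end GenericFibre

/-- An integral morphism is closed, and the image contains the generic points. -/
lemma surjective_normalizationMap (X : Scheme.{u}) [IsNoetherian X] :
    Function.Surjective (normalizationMap X) := by
  intro x
  obtain ⟨w, hw⟩ := exists_genericPointsMap_specializes X x
  have h1 : IsClosed (Set.range (normalizationMap X)) := (normalizationMap X).isClosedMap.isClosed_range
  refine hw.mem_closed h1 ⟨(genericPointsMap X).toNormalization w, ?_⟩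
  exact congrArg (fun k : _ ⟶ X => k w) (genericPointsMap X).toNormalization_fromNormalization

lemma surjective_redMap (X : Scheme.{u}) : Function.Surjective (redMap X) := by
  rw [← Set.range_eq_univ, Scheme.IdealSheafData.range_subschemeι, Scheme.support_nilradical]
  rfl

end DeltaFamily
end

/-! ### Reducedness of a fibre as radicality of the ideal generated by π. -/

noncomputable section
namespace DeltaFamily

open IsLocalRing

section Radical

variable {A : Type u} [CommRing A] {Y : Scheme.{u}} (g : Y ⟶ Spec (CommRingCat.of A))
  (U : Y.Opens) (π : A)

/-- The element `π` of the base generates a radical ideal in the sections over `U`. -/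
def RadicalAt : Prop :=
  ∀ (r : Γ(Y, U)) (n : ℕ), sectionsHom g U π ∣ r ^ n → sectionsHom g U π ∣ r

variable {g U π}

/-- If the fibre is reduced, the ideal generated by `π` is radical. -/
lemma radicalAt_of_isReduced {s : Spec (CommRingCat.of A)} (hs : s.asIdeal = Ideal.span {π})
    (hmax : s.asIdeal.IsMaximal) [IsReduced (g.fiber s)] (hU : IsAffineOpen U) :
    RadicalAt g U π := by
  intro r n hr
  -- `I` is the ideal of elements multiplying r into (π). If proper, it lies in a maximal ideal `P`,
  -- whose point is over s because π ∈ I. There the reduced local ring of the fibre puts r into (π),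
  -- which yields an element of `I` outside `P`.
  let I : Ideal Γ(Y, U) :=
    Submodule.comap (LinearMap.mulRight Γ(Y, U) r) (Ideal.span {sectionsHom g U π})
  by_contra hn
  have hI : I ≠ ⊤ := by
    intro h
    have h1 : (1 : Γ(Y, U)) ∈ I := h ▸ Submodule.mem_top
    have h2 : (1 : Γ(Y, U)) * r ∈ Ideal.span {sectionsHom g U π} := h1
    rw [one_mul, Ideal.mem_span_singleton] at h2
    exact hn h2
  obtain ⟨P, hP, hIP⟩ := Ideal.exists_le_maximal I hI
  obtain ⟨y, hy, hyP⟩ := exists_eq_primeIdealOf hU ⟨P, hP.isPrime⟩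
  have hyP' : (hU.primeIdealOf ⟨y, hy⟩).asIdeal = P := congrArg PrimeSpectrum.asIdeal hyP
  let _ := (Y.presheaf.germ U y hy).hom.toAlgebra
  have l1 : IsLocalization.AtPrime (Y.presheaf.stalk y) (hU.primeIdealOf ⟨y, hy⟩).asIdeal :=
    hU.isLocalization_stalk ⟨y, hy⟩
  have hπI : sectionsHom g U π ∈ I := by
    change sectionsHom g U π * r ∈ Ideal.span {sectionsHom g U π}
    exact Ideal.mul_mem_right _ _ (Ideal.mem_span_singleton_self _)
  have hgy : g y = s := by
    have h1 : π ∈ (g y).asIdeal := by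
      rw [← comap_stalkHom_maximalIdeal g y, Ideal.mem_comap, ← germ_sectionsHom g U y hy]
      by_contra hu
      refine (mem_primeCompl_primeIdealOf_iff hU hy _).mpr (not_not.mp hu) ?_
      rw [hyP']
      exact hIP hπI
    have h2 : s.asIdeal ≤ (g y).asIdeal := by
      rw [hs]
      exact (Ideal.span_singleton_le_iff_mem _).mpr h1
    exact PrimeSpectrum.ext (hmax.eq_of_le (g y).isPrime.ne_top h2).symm
  obtain ⟨y, rfl⟩ : y ∈ Set.range (g.fiberι s) := by
    rw [g.range_fiberι]
    exact hgy
  have h3 : (g.fiberι s).stalkMap y (Y.presheaf.germ U _ hy r) = 0 := by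
    refine IsNilpotent.eq_zero ⟨n, ?_⟩
    obtain ⟨c, hc⟩ := hr
    rw [← map_pow, ← map_pow, hc, map_mul, map_mul, germ_sectionsHom]
    have h4 : stalkHom g (g.fiberι s y) π ∈ RingHom.ker ((g.fiberι s).stalkMap y).hom := by
      rw [span_stalkHom_eq_ker s y hs]
      exact Ideal.mem_span_singleton_self _
    exact (congrArg (· * _) (RingHom.mem_ker.mp h4)).trans (zero_mul _)
  have h4 : Y.presheaf.germ U _ hy r ∈ Ideal.span {stalkHom g (g.fiberι s y) π} := by
    rw [← span_stalkHom_eq_ker s y hs]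
    exact h3
  obtain ⟨o, ho⟩ := Ideal.mem_span_singleton'.mp h4
  obtain ⟨⟨b, c⟩, hbc⟩ := IsLocalization.surj (hU.primeIdealOf ⟨_, hy⟩).asIdeal.primeCompl o
  have h5 : algebraMap Γ(Y, U) (Y.presheaf.stalk (g.fiberι s y)) (c.1 * r) =
      algebraMap Γ(Y, U) _ (b * sectionsHom g U π) := by
    rw [map_mul, map_mul, ← hbc]
    change _ * Y.presheaf.germ U _ hy r = _ * _ * Y.presheaf.germ U _ hy (sectionsHom g U π)
    rw [germ_sectionsHom, ← ho]
    ring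
  obtain ⟨d, hd⟩ := (IsLocalization.eq_iff_exists
    (hU.primeIdealOf ⟨_, hy⟩).asIdeal.primeCompl _).mp h5
  refine (d * c).2 (hyP'.ge (hIP ?_))
  change (d.1 * c.1) * r ∈ Ideal.span {sectionsHom g U π}
  rw [mul_assoc, hd, ← mul_assoc]
  exact Ideal.mul_mem_left _ _ (Ideal.mem_span_singleton_self _)

/-- If the ideals generated by `π` are radical on an affine cover, the fibre is reduced. -/
lemma isReduced_fiber_of_radicalAt {s : Spec (CommRingCat.of A)} (hs : s.asIdeal = Ideal.span {π})
    (H : ∀ y, ∃ U : Y.Opens, y ∈ U ∧ IsAffineOpen U ∧ RadicalAt g U π) :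
    IsReduced (g.fiber s) := by
  have : ∀ y, _root_.IsReduced ((g.fiber s).presheaf.stalk y) := by
    refine fun y => ⟨fun r ⟨n, hr⟩ => ?_⟩
    obtain ⟨U, hy, hU, hrad⟩ := H (g.fiberι s y)
    let _ := (Y.presheaf.germ U _ hy).hom.toAlgebra
    have l1 : IsLocalization.AtPrime (Y.presheaf.stalk (g.fiberι s y))
      (hU.primeIdealOf ⟨_, hy⟩).asIdeal := hU.isLocalization_stalk ⟨_, hy⟩
    obtain ⟨o, rfl⟩ := surjective_stalkMap_fiberι g s y r
    have h1 : o ^ (n + 1) ∈ Ideal.span {stalkHom g (g.fiberι s y) π} := by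
      rw [← span_stalkHom_eq_ker s y hs]
      refine RingHom.mem_ker.mpr ((map_pow _ _ _).trans ?_)
      rw [pow_succ]
      exact (congrArg (· * _) hr).trans (zero_mul _)
    obtain ⟨o', ho'⟩ := Ideal.mem_span_singleton'.mp h1
    obtain ⟨⟨b, c⟩, hbc⟩ := IsLocalization.surj (hU.primeIdealOf ⟨_, hy⟩).asIdeal.primeCompl o
    obtain ⟨⟨b', c'⟩, hbc'⟩ := IsLocalization.surj (hU.primeIdealOf ⟨_, hy⟩).asIdeal.primeCompl o'
    have e : algebraMap Γ(Y, U) (Y.presheaf.stalk (g.fiberι s y)) (sectionsHom g U π) =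
      stalkHom g (g.fiberι s y) π := germ_sectionsHom g U _ hy π
    have h5 : algebraMap Γ(Y, U) (Y.presheaf.stalk (g.fiberι s y)) (c'.1 * b ^ (n + 1)) =
        algebraMap Γ(Y, U) _ (sectionsHom g U π * (b' * c.1 ^ (n + 1))) := by
      simp only [map_mul, map_pow]
      simp only [] at hbc hbc'
      rw [← hbc, ← hbc', e, mul_pow, ← ho']
      ring
    obtain ⟨d, hd⟩ := (IsLocalization.eq_iff_exists
      (hU.primeIdealOf ⟨_, hy⟩).asIdeal.primeCompl _).mp h5
    -- Multiplying b by the denominators makes a global power divisible by π. The exponent `n + 1`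
    -- leaves one factor d c' to be absorbed by `hd`, also for `n = 0`.
    have h6 := hrad (d.1 * c'.1 * b) (n + 1) ⟨(d.1 * c'.1) ^ n * d.1 * (b' * c.1 ^ (n + 1)), by
      rw [mul_pow, pow_succ (d.1 * c'.1), mul_assoc, mul_assoc d.1, hd]
      ring⟩
    obtain ⟨k, hk⟩ := h6
    have h7 : o * algebraMap Γ(Y, U) (Y.presheaf.stalk (g.fiberι s y)) (d * c' * c : _).1 ∈
        Ideal.span {stalkHom g (g.fiberι s y) π} := by
      rw [Ideal.mem_span_singleton]
      refine ⟨algebraMap Γ(Y, U) _ k, ?_⟩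
      rw [← e, ← map_mul, ← hk]
      simp only [Submonoid.coe_mul, map_mul]
      simp only [] at hbc
      rw [← hbc]
      ring
    have h8 := (Ideal.mul_unit_mem_iff_mem _ (IsLocalization.map_units
      (Y.presheaf.stalk (g.fiberι s y)) (d * c' * c))).mp h7
    rw [← span_stalkHom_eq_ker s y hs] at h8
    exact h8
  exact isReduced_of_isReduced_stalk _

end Radical

/-! ### Descent of reducedness from the normalization. -/

section GoodPoints

variable {A : Type u} [CommRing A] {X : Scheme.{u}} {f : X ⟶ Spec (CommRingCat.of A)}
  [IsNoetherian X]

/-- Reducedness of the fibres of the normalization descends where `π` is not a zero divisor on the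
cokernel of the normalization. -/
lemma exists_sub_mem_nilradical {U : X.Opens} (hU : IsAffineOpen U) {π : A}
    (hrad : RadicalAt (normalizationMap X ≫ f) (normalizationMap X ⁻¹ᵁ U) π)
    (htors : ∀ y : NormCoker Γ(X, U), sectionsHom f U π • y = 0 → y = 0) (r q : Γ(X, U)) (n : ℕ)
    (h : r ^ n - sectionsHom f U π * q ∈ nilradical Γ(X, U)) :
    ∃ c, r - sectionsHom f U π * c ∈ nilradical Γ(X, U) := by
  let _ := ((normalizationMap X).app U).hom.toAlgebra
  obtain ⟨e⟩ := nonempty_sections_normalization_equiv X hU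
  have hker : ∀ a : Γ(X, U), a ∈ nilradical Γ(X, U) ↔ (normalizationMap X).app U a = 0 := by
    intro a
    rw [← ker_linearMap_normRing, LinearMap.mem_ker, Algebra.linearMap_apply, ← e.commutes,
      EmbeddingLike.map_eq_zero_iff]
    rfl
  have hπ := app_sectionsHom f (normalizationMap X) U π
  obtain ⟨c, hc⟩ := hrad ((normalizationMap X).app U r) n
    ⟨(normalizationMap X).app U q, by
      rw [← hπ, ← map_mul, ← map_pow, ← sub_eq_zero, ← map_sub]
      exact (hker _).mp h⟩
  have h1 : sectionsHom f U π • (Submodule.Quotient.mk (e c) : NormCoker Γ(X, U)) = 0 := by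
    rw [← Submodule.Quotient.mk_smul, Submodule.Quotient.mk_eq_zero]
    refine ⟨r, ?_⟩
    rw [Algebra.linearMap_apply, ← e.commutes, ← map_smul, Algebra.smul_def]
    refine congrArg e ?_
    change (normalizationMap X).app U r = (normalizationMap X).app U (sectionsHom f U π) * c
    rw [hc, hπ]
  have h2 := htors _ h1
  rw [Submodule.Quotient.mk_eq_zero] at h2
  obtain ⟨b, hb⟩ := h2
  refine ⟨b, (hker _).mpr ?_⟩
  rw [Algebra.linearMap_apply, ← e.commutes] at hb
  have hb' : (normalizationMap X).app U b = c := e.injective hb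
  rw [map_sub, map_mul, hb', hc, hπ, sub_self]

/-- For all but finitely many closed points of the base, the reduction has no torsion in the
cokernel of the normalization. -/
lemma exists_finite_torsion [IsDomain A] [IsPrincipalIdealRing A] (hN : IsNagata X) :
    ∃ B : Set (Spec (CommRingCat.of A)), B.Finite ∧ (∀ t ∈ B, IsClosed {t}) ∧
      ∀ t ∉ B, ∀ π, t.asIdeal = Ideal.span {π} → π ≠ 0 → ∀ x : X, ∃ U : X.Opens, x ∈ U ∧
        IsAffineOpen U ∧ ∀ y : NormCoker Γ(X, U), sectionsHom f U π • y = 0 → y = 0 := by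
  choose U hxU hU hNU using hN
  obtain ⟨T, -, hT⟩ := isCompact_univ.elim_nhds_subcover (fun x => (U x : Set X))
    fun x _ => (U x).isOpen.mem_nhds (hxU x)
  -- The exceptional points are the contractions of associated primes of the cokernel of the
  -- normalization, finitely many on each chart of a finite cover.
  let C : X → Set (Spec (CommRingCat.of A)) := fun x =>
    (fun P : Ideal Γ(X, U x) => P.comap (sectionsHom f (U x))) ''
      associatedPrimes Γ(X, U x) (NormCoker Γ(X, U x)) |>.preimage fun t => t.asIdeal
  have hC : ∀ x, (C x).Finite := by
    intro x
    have := (hNU x).1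
    have := (hNU x).finite_normRing
    have h1 := associatedPrimes.finite Γ(X, U x) (NormCoker Γ(X, U x))
    exact (h1.image _).preimage fun s _ t _ hst => PrimeSpectrum.ext hst
  refine ⟨{t | t.asIdeal ≠ ⊥ ∧ ∃ x ∈ T, t ∈ C x}, ?_, ?_, ?_⟩
  · refine (Set.Finite.biUnion T.finite_toSet fun x _ => hC x).subset ?_
    rintro t ⟨-, x, hx, ht⟩
    exact Set.mem_biUnion hx ht
  · rintro t ⟨ht, -⟩
    exact (PrimeSpectrum.isClosed_singleton_iff_isMaximal t).mpr (IsPrime.to_maximal_ideal ht)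
  · intro t ht π hπ hπ0 x
    obtain ⟨x', hx', hxU'⟩ := Set.mem_iUnion₂.mp (hT (Set.mem_univ x))
    refine ⟨U x', hxU', hU x', fun y hy => ?_⟩
    by_contra hy0
    have := (hNU x').1
    -- A nonzero element killed by π gives an associated prime containing π; its contraction to `A`
    -- contains the maximal ideal of t, hence equals it.
    obtain ⟨P, hP, hyP⟩ := exists_le_isAssociatedPrime_of_isNoetherianRing Γ(X, U x') y hy0
    have ht0 : t.asIdeal ≠ ⊥ := by
      rw [hπ, Ne, Ideal.span_singleton_eq_bot]
      exact hπ0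
    refine ht ⟨ht0, x', hx', P, hP, ?_⟩
    have hmax := IsPrime.to_maximal_ideal ht0
    have hPp := hP.isPrime
    refine (hmax.eq_of_le (Ideal.IsPrime.comap _ : (P.comap (sectionsHom f (U x'))).IsPrime).ne_top
      ?_).symm
    rw [hπ, Ideal.span_singleton_le_iff_mem]
    exact hyP (by simpa using hy)

end GoodPoints

end DeltaFamily
end

/-! ### The normalizations of a scheme and of its reduction. -/

noncomputable section
namespace DeltaFamily

open IsLocalRing

section Normalizations

/-- The relative normalization does not change if the target is replaced by a closed subscheme. -/
lemma exists_normalization_iso {W W' X Y : Scheme.{u}} (p : W' ≅ W) (g : W ⟶ X) (g' : W' ⟶ Y)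
    (i : Y ⟶ X) [QuasiCompact g] [QuasiSeparated g] [QuasiCompact g'] [QuasiSeparated g']
    [IsClosedImmersion i] (hp : p.hom ≫ g = g' ≫ i) (l : g.normalization ⟶ Y)
    (hl : l ≫ i = g.fromNormalization) :
    ∃ e : g'.normalization ≅ g.normalization,
      e.hom ≫ g.fromNormalization = g'.fromNormalization ≫ i := by
  have : IsIntegralHom (l ≫ i) := hl ▸ inferInstance
  have : IsIntegralHom l := .of_comp l i
  have h1 : g = (p.inv ≫ g'.toNormalization) ≫ g'.fromNormalization ≫ i := by
    rw [Category.assoc, g'.toNormalization_fromNormalization_assoc, ← hp, p.inv_hom_id_assoc]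
  have h2 : g' = (p.hom ≫ g.toNormalization) ≫ l := by
    rw [← cancel_mono i, Category.assoc, Category.assoc, hl, g.toNormalization_fromNormalization,
      hp]
  -- The universal property of the relative normalization applies in both directions, because `l` is
  -- integral; uniqueness makes the two morphisms inverse to each other.
  let φ := g.normalizationDesc _ _ h1
  let ψ := g'.normalizationDesc _ _ h2
  have a1 : g.toNormalization ≫ φ = p.inv ≫ g'.toNormalization :=
    g.toNormalization_normalizationDesc _ _ h1
  have a2 : φ ≫ g'.fromNormalization ≫ i = g.fromNormalization := g.normalizationDesc_comp _ _ h1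
  have b1 : g'.toNormalization ≫ ψ = p.hom ≫ g.toNormalization :=
    g'.toNormalization_normalizationDesc _ _ h2
  have b2 : ψ ≫ l = g'.fromNormalization := g'.normalizationDesc_comp _ _ h2
  have b3 : ψ ≫ g.fromNormalization = g'.fromNormalization ≫ i := by
    rw [← hl, ← Category.assoc, b2]
  refine ⟨⟨ψ, φ, ?_, ?_⟩, b3⟩
  · refine Scheme.Hom.normalization.hom_ext g' _ _ g'.fromNormalization ?_ ?_ (Category.id_comp _)
    · rw [← Category.assoc, b1, Category.assoc, a1, p.hom_inv_id_assoc, Category.comp_id]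
    · rw [← cancel_mono i, Category.assoc, Category.assoc, a2, b3]
  · refine Scheme.Hom.normalization.hom_ext g _ _ g.fromNormalization ?_ ?_ (Category.id_comp _)
    · rw [← Category.assoc, a1, Category.assoc, b1, p.inv_hom_id_assoc, Category.comp_id]
    · rw [Category.assoc, b3, a2]

variable {X Y : Scheme.{u}}

lemma mem_genericPoints_iff (x : X) : x ∈ genericPoints X ↔ ∀ y, y ⤳ x → y = x := by
  refine ⟨fun h y => eq_of_specializes_genericPoint h, fun h => ?_⟩
  obtain ⟨w, hw⟩ := exists_genericPointsMap_specializes X x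
  obtain ⟨y, p, rfl⟩ := exists_eq_sigmaι X w
  rw [genericPointsMap_sigmaι] at hw
  exact h _ hw ▸ y.2

lemma exists_genericPoints_equiv (i : Y ⟶ X) [IsClosedImmersion i] (hi : Function.Surjective i) :
    ∃ e : genericPoints Y ≃ genericPoints X, ∀ y, (e y).1 = i y.1 := by
  have hemb := i.isClosedEmbedding.isEmbedding
  have hmem : ∀ y, y ∈ genericPoints Y ↔ i y ∈ genericPoints X := by
    intro y
    rw [mem_genericPoints_iff, mem_genericPoints_iff]
    refine ⟨fun h x hx => ?_, fun h w hw => hemb.injective (h _ (hw.map i.continuous))⟩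
    obtain ⟨w, rfl⟩ := hi x
    exact congrArg i (h w (hemb.isInducing.specializes_iff.mp hx))
  refine ⟨Equiv.ofBijective (fun y => ⟨i y.1, (hmem y.1).mp y.2⟩) ⟨fun y y' h => ?_, fun x => ?_⟩,
    fun y => rfl⟩
  · exact Subtype.ext (hemb.injective (congrArg Subtype.val h))
  · obtain ⟨y, hy⟩ := hi x.1
    exact ⟨⟨y, (hmem y).mpr (hy ▸ x.2)⟩, Subtype.ext hy⟩

lemma isIso_residueFieldMap (i : Y ⟶ X) [IsClosedImmersion i] (y : Y) :
    IsIso (i.residueFieldMap y) := by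
  rw [ConcreteCategory.isIso_iff_bijective]
  refine ⟨(i.residueFieldMap y).hom.injective, fun t => ?_⟩
  obtain ⟨r, rfl⟩ := Y.residue_surjective y t
  obtain ⟨r, rfl⟩ := i.stalkMap_surjective y r
  exact ⟨X.residue (i y) r, ConcreteCategory.congr_hom (Scheme.residue_residueFieldMap i y) r⟩

/-- A surjective closed immersion is a homeomorphism inducing isomorphisms of residue fields, so the
generic points and their residue fields are the same. -/
lemma exists_genericPointsMap_iso (i : Y ⟶ X) [IsClosedImmersion i] (hi : Function.Surjective i) :
    ∃ p : (∐ fun x : genericPoints Y => Spec (Y.residueField x.1)) ≅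
        ∐ fun x : genericPoints X => Spec (X.residueField x.1),
      p.hom ≫ genericPointsMap X = genericPointsMap Y ≫ i := by
  obtain ⟨e, he⟩ := exists_genericPoints_equiv i hi
  have h := fun y => isIso_residueFieldMap i y
  have hw : ∀ y : genericPoints Y, ∃ w : Spec (X.residueField (e y).1) ≅ Spec (Y.residueField y.1),
      w.inv ≫ X.fromSpecResidueField (e y).1 = Y.fromSpecResidueField y.1 ≫ i := by
    intro y
    rw [he]
    exact ⟨(asIso (Spec.map (i.residueFieldMap y.1))).symm,
      i.SpecMap_residueFieldMap_fromSpecResidueField y.1⟩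
  choose w hw using hw
  refine ⟨Sigma.whiskerEquiv e w, ?_⟩
  refine Sigma.hom_ext _ _ fun y => ?_
  rw [Sigma.whiskerEquiv_hom, genericPointsMap, genericPointsMap, ← Category.assoc,
    Sigma.ι_comp_map', Category.assoc, Sigma.ι_desc, Sigma.ι_desc_assoc, hw]

lemma nilradical_le_ker [IsReduced Y] (h : Y ⟶ X) [QuasiCompact h] : X.nilradical ≤ h.ker := by
  intro U g hg
  rw [Scheme.Hom.ker_apply]
  obtain ⟨n, hn⟩ : g ∈ nilradical Γ(X, U.1) := hg
  exact RingHom.mem_ker.mpr (IsNilpotent.eq_zero ⟨n, by rw [← map_pow, hn, map_zero]⟩)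

/-- The normalization is reduced, so its morphism to `X` factors through the reduction. The ideal
`I` is kept variable because `idealGT X 1` is only proved equal to the nilradical. -/
lemma exists_normalization_iso_of_eq_nilradical [IsNoetherian X] {I : X.IdealSheafData}
    (hI : I = X.nilradical) : ∃ e : normalization I.subscheme ≅ normalization X,
      e.hom ≫ normalizationMap X = normalizationMap I.subscheme ≫ I.subschemeι := by
  have hs : Function.Surjective I.subschemeι := by
    subst hI
    exact surjective_redMap X
  obtain ⟨p, hp⟩ := exists_genericPointsMap_iso I.subschemeι hs
  have h1 : I.subschemeι.ker ≤ (normalizationMap X).ker := by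
    rw [Scheme.IdealSheafData.ker_subschemeι, hI]
    exact nilradical_le_ker _
  exact exists_normalization_iso p (genericPointsMap X) (genericPointsMap I.subscheme) I.subschemeι
    hp (IsClosedImmersion.lift I.subschemeι (normalizationMap X) h1)
    (IsClosedImmersion.lift_fac _ _ _)

end Normalizations

/-! ### Components of dimension at least two. -/

section Dimension

/-- Irreducible closed sets of a sober space are closures of unique points, so a chain of length two
is a pair of consecutive proper specializations, a form that lifts along closed maps. -/
lemma two_le_topologicalKrullDim_iff_exists {T : Type*} [TopologicalSpace T] [QuasiSober T]
    [T0Space T] : 2 ≤ topologicalKrullDim T ↔ ∃ a b c : T, a ⤳ b ∧ b ⤳ c ∧ a ≠ b ∧ b ≠ c := by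
  let _ := specializationOrder T
  have h1 : topologicalKrullDim T = Order.krullDim T :=
    Order.krullDim_eq_of_orderIso irreducibleSetEquivPoints
  have hlt : ∀ x y : T, x < y ↔ y ⤳ x ∧ y ≠ x := by
    intro x y
    rw [lt_iff_le_and_ne, ne_comm]
    rfl
  rw [h1]
  refine (Order.le_krullDim_iff (n := 2)).trans ⟨?_, ?_⟩
  · rintro ⟨l, hl⟩
    have h2 := (hlt _ _).mp (l.strictMono
      (Fin.mk_lt_mk.mpr zero_lt_one : (⟨0, by omega⟩ : Fin (l.length + 1)) < ⟨1, by omega⟩))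
    have h3 := (hlt _ _).mp (l.strictMono
      (Fin.mk_lt_mk.mpr one_lt_two : (⟨1, by omega⟩ : Fin (l.length + 1)) < ⟨2, by omega⟩))
    exact ⟨_, _, _, h3.1, h2.1, h3.2, h2.2⟩
  · rintro ⟨a, b, c, hab, hbc, h, h'⟩
    let l : LTSeries T := (RelSeries.singleton _ a).cons b ((hlt _ _).mpr ⟨hab, h⟩)
    exact ⟨l.cons c ((hlt _ _).mpr ⟨hbc, h'⟩), rfl⟩

lemma two_le_topologicalKrullDim_iff {X : Scheme.{u}} {Z : Set X} (hZ : IsClosed Z) :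
    2 ≤ topologicalKrullDim Z ↔ ∃ a b c : X, a ∈ Z ∧ a ⤳ b ∧ b ⤳ c ∧ a ≠ b ∧ b ≠ c := by
  have := hZ.isClosedEmbedding_subtypeVal.quasiSober
  rw [two_le_topologicalKrullDim_iff_exists]
  constructor
  · rintro ⟨a, b, c, hab, hbc, h, h'⟩
    exact ⟨a, b, c, a.2, hab.map continuous_subtype_val, hbc.map continuous_subtype_val,
      fun e => h (Subtype.ext e), fun e => h' (Subtype.ext e)⟩
  · rintro ⟨a, b, c, ha, hab, hbc, h, h'⟩
    have hb := hab.mem_closed hZ ha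
    exact ⟨⟨a, ha⟩, ⟨b, hb⟩, ⟨c, hbc.mem_closed hZ hb⟩,
      Topology.IsInducing.subtypeVal.specializes_iff.mp hab,
      Topology.IsInducing.subtypeVal.specializes_iff.mp hbc,
      fun e => h (congrArg Subtype.val e), fun e => h' (congrArg Subtype.val e)⟩

/-- Integral morphisms mapping generic points to generic points lift chains of specializations. -/
lemma two_le_topologicalKrullDim_of_isClosedMap {X Z : Scheme.{u}} (h : Z ⟶ X)
    (hc : IsClosedMap h) (hgen : ∀ z ∈ genericPoints Z, h z ∈ genericPoints X)
    (hdim : ∀ T ∈ irreducibleComponents X, 2 ≤ topologicalKrullDim T) :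
    ∀ T ∈ irreducibleComponents Z, 2 ≤ topologicalKrullDim T := by
  intro T hT
  have hTc := isClosed_of_mem_irreducibleComponents T hT
  have hg := hT.1.isGenericPoint_genericPoint hTc
  have hz : hT.1.genericPoint ∈ genericPoints Z := by
    change closure {hT.1.genericPoint} ∈ irreducibleComponents Z
    rw [hg.def]
    exact hT
  obtain ⟨a, b, c, ha, hab, hbc, h1, h2⟩ :=
    (two_le_topologicalKrullDim_iff isClosed_closure).mp (hdim _ (hgen _ hz))
  obtain ⟨a, ha', rfl⟩ := hc.specializingMap (specializes_iff_mem_closure.mpr ha)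
  obtain ⟨b, hb', rfl⟩ := hc.specializingMap hab
  obtain ⟨c, hc', rfl⟩ := hc.specializingMap hbc
  exact (two_le_topologicalKrullDim_iff hTc).mpr ⟨a, b, c, hg.specializes_iff_mem.mp ha', hb', hc',
    fun e => h1 (congrArg h e), fun e => h2 (congrArg h e)⟩

lemma idealGT_one_eq_nilradical {X : Scheme.{u}}
    (hdim : ∀ T ∈ irreducibleComponents X, 2 ≤ topologicalKrullDim T) :
    idealGT X 1 = X.nilradical := by
  rw [← Scheme.IdealSheafData.vanishingIdeal_top, idealGT]
  congr 1
  refine Closeds.ext (Set.eq_univ_of_forall fun x => subset_closure ?_)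
  have hx := irreducibleComponent_mem_irreducibleComponents x
  refine Set.mem_biUnion (x := irreducibleComponent x) ⟨hx, ?_⟩ mem_irreducibleComponent
  exact lt_of_lt_of_le (by norm_cast) (hdim _ hx)

lemma two_le_topologicalKrullDim_normalization {X : Scheme.{u}} [IsNoetherian X]
    (hdim : ∀ T ∈ irreducibleComponents X, 2 ≤ topologicalKrullDim T) :
    ∀ T ∈ irreducibleComponents (normalization X), 2 ≤ topologicalKrullDim T := by
  refine two_le_topologicalKrullDim_of_isClosedMap (normalizationMap X)
    (normalizationMap X).isClosedMap (fun z hz => ?_) hdim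
  let t := (genericPointsMap X).toNormalization
  -- The finitely many generic points of `X` have dense image in the normalization, so z specializes
  -- from one of them; being generic, z is that point and lies over a generic point of `X`.
  have h1 : z ∈ closure (Set.range t) := t.denseRange z
  have h2 := (Set.toFinite (Set.range t)).closure_biUnion (fun w => {w})
  rw [Set.biUnion_of_singleton] at h2
  rw [h2] at h1
  obtain ⟨_, ⟨w, rfl⟩, hw⟩ := Set.mem_iUnion₂.mp h1
  obtain rfl : t w = z := eq_of_specializes_genericPoint hz (specializes_iff_mem_closure.mpr hw)
  have h3 : normalizationMap X (t w) = genericPointsMap X w :=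
    congrArg (fun k : _ ⟶ X => k w) (genericPointsMap X).toNormalization_fromNormalization
  rw [h3]
  exact (mem_genericPoints_iff _).mpr fun y hy => genericPointsMap_minimal X w y hy

end Dimension

end DeltaFamily
end

/-! ### Direct images under morphisms surjective on sections or with nilpotent kernel. -/

noncomputable section
namespace DeltaFamily

section PushMap

variable {X Z : Scheme.{u}} (h : Z ⟶ X)

lemma surjective_pushMap (hs : ∀ U : X.Opens, IsAffineOpen U → Function.Surjective (h.app U))
    (x : X) : Function.Surjective (pushMap h x) := by
  intro y
  obtain ⟨W, -, hxW, c, rfl⟩ := exists_le_pushGerm_eq h y (Opens.mem_top x)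
  obtain ⟨_, ⟨U, hU, rfl⟩, hx, hUW⟩ :=
    X.isBasis_affineOpens.exists_subset_of_mem_open hxW W.isOpen
  have hUW' : U ≤ W := hUW
  obtain ⟨g, hg⟩ := hs U hU (Z.presheaf.map (homOfLE (h.preimage_mono hUW')).op c)
  refine ⟨X.presheaf.germ U x hx g, ?_⟩
  rw [pushMap_germ, hg]
  exact pushGerm_res h hUW' x hx c

lemma isNilpotent_of_pushMap_eq_zero
    (hk : ∀ U : X.Opens, IsAffineOpen U → ∀ g, h.app U g = 0 → IsNilpotent g) (x : X)
    (o : X.presheaf.stalk x) (ho : pushMap h x o = 0) : IsNilpotent o := by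
  obtain ⟨W, hxW, g, rfl⟩ := X.presheaf.exists_germ_eq o
  rw [pushMap_germ] at ho
  obtain ⟨W', i, hxW', e⟩ := exists_res_eq_of_pushGerm_eq h hxW (h.app W g) 0
    (ho.trans (map_zero _).symm)
  obtain ⟨_, ⟨U, hU, rfl⟩, hx, hUW⟩ :=
    X.isBasis_affineOpens.exists_subset_of_mem_open hxW' W'.isOpen
  have hUW' : U ≤ W' := hUW
  have h1 : h.app U (X.presheaf.map (homOfLE (hUW'.trans i)).op g) = 0 := by
    have h2 : h.app U (X.presheaf.map (homOfLE (hUW'.trans i)).op g) =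
        Z.presheaf.map (homOfLE (h.preimage_mono (hUW'.trans i))).op (h.app W g) :=
      ConcreteCategory.congr_hom (h.naturality (homOfLE (hUW'.trans i)).op) g
    have h3 : Z.presheaf.map (homOfLE (h.preimage_mono (hUW'.trans i))).op =
        Z.presheaf.map (homOfLE (h.preimage_mono i)).op ≫
          Z.presheaf.map (homOfLE (h.preimage_mono hUW')).op := by
      rw [← Functor.map_comp]
      rfl
    rw [h2, h3, CommRingCat.comp_apply, e, map_zero, map_zero]
  have h2 := (hk U hU _ h1).map (X.presheaf.germ U x hx).hom
  have h3 : X.presheaf.germ U x hx (X.presheaf.map (homOfLE (hUW'.trans i)).op g) =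
    X.presheaf.germ W x hxW g := X.presheaf.germ_res_apply _ _ _ _
  rw [← h3]
  exact h2

end PushMap

/-! ### Reduced fibres away from finitely many closed points. -/

section GoodReduction

variable {A : Type u} [CommRing A] {X : Scheme.{u}} {f : X ⟶ Spec (CommRingCat.of A)}

lemma radicalAt_red {U : X.Opens} (hU : IsAffineOpen U) {π : A}
    (H : ∀ (r q : Γ(X, U)) (n : ℕ), r ^ n - sectionsHom f U π * q ∈ nilradical Γ(X, U) →
      ∃ c, r - sectionsHom f U π * c ∈ nilradical Γ(X, U)) :
    RadicalAt (redMap X ≫ f) (redMap X ⁻¹ᵁ U) π := by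
  intro r n hr
  obtain ⟨q, hq⟩ := hr
  obtain ⟨r, rfl⟩ := X.nilradical.subschemeι_app_surjective ⟨U, hU⟩ r
  obtain ⟨q, rfl⟩ := X.nilradical.subschemeι_app_surjective ⟨U, hU⟩ q
  have hπ := app_sectionsHom f (redMap X) U π
  obtain ⟨c, hc⟩ := H r q n ((ker_redMap_app ⟨U, hU⟩ _).mp (by
    rw [map_sub, map_mul, map_pow]
    refine sub_eq_zero.mpr (hq.trans ?_)
    rw [← hπ]))
  refine ⟨(redMap X).app U c, ?_⟩
  have h1 := (ker_redMap_app ⟨U, hU⟩ _).mpr hc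
  rw [map_sub, map_mul] at h1
  refine (sub_eq_zero.mp h1).trans ?_
  rw [← hπ]

lemma radicalAt_of_isReduced_scheme [IsReduced X] {U : X.Opens} {π : A}
    (H : ∀ (r q : Γ(X, U)) (n : ℕ), r ^ n - sectionsHom f U π * q ∈ nilradical Γ(X, U) →
      ∃ c, r - sectionsHom f U π * c ∈ nilradical Γ(X, U)) : RadicalAt f U π := by
  rintro r n ⟨q, hq⟩
  obtain ⟨c, hc⟩ := H r q n (by rw [hq, sub_self]; exact zero_mem _)
  exact ⟨c, sub_eq_zero.mp (IsNilpotent.eq_zero hc)⟩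

variable [IsNoetherian X] [IsDomain A] [IsPrincipalIdealRing A]

/-- If the fibres of the normalization are reduced, then so are those of the reduction away from
finitely many closed points. -/
lemma exists_finite_isReduced_fiber (hN : IsNagata X) : ∃ B : Set (Spec (CommRingCat.of A)),
    B.Finite ∧ (∀ t ∈ B, IsClosed {t}) ∧ ∀ t ∉ B,
      IsReduced ((normalizationMap X ≫ f).fiber t) → IsReduced ((redMap X ≫ f).fiber t) ∧
        (IsReduced X → IsReduced (f.fiber t)) := by
  obtain ⟨B, hB, hBc, H⟩ := exists_finite_torsion (f := f) hN
  refine ⟨B, hB, hBc, fun t ht hred => ?_⟩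
  obtain ⟨π, hπ⟩ : ∃ π, t.asIdeal = Ideal.span {π} := (IsPrincipalIdealRing.principal t.asIdeal).1
  have key : ∀ x, ∃ U : X.Opens, x ∈ U ∧ IsAffineOpen U ∧ ∀ (r q : Γ(X, U)) (n : ℕ),
      r ^ n - sectionsHom f U π * q ∈ nilradical Γ(X, U) →
      ∃ c, r - sectionsHom f U π * c ∈ nilradical Γ(X, U) := by
    intro x
    -- Over the generic point nothing about torsion is needed: modulo π = 0 the condition only says
    -- that the nilradical is a radical ideal.
    by_cases hπ0 : π = 0
    · obtain ⟨U, hU, hx⟩ := exists_isAffineOpen_mem x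
      refine ⟨U, hx, hU, fun r q n h => ⟨0, ?_⟩⟩
      rw [hπ0, map_zero, zero_mul, sub_zero] at h
      obtain ⟨m, hm⟩ := h
      rw [mul_zero, sub_zero]
      exact ⟨n * m, by rw [pow_mul]; exact hm⟩
    · have hmax : t.asIdeal.IsMaximal := IsPrime.to_maximal_ideal (by
        rw [hπ, Ne, Ideal.span_singleton_eq_bot]
        exact hπ0)
      obtain ⟨U, hx, hU, htors⟩ := H t ht π hπ hπ0 x
      exact ⟨U, hx, hU, exists_sub_mem_nilradical hU
        (radicalAt_of_isReduced hπ hmax (hU.preimage (normalizationMap X))) htors⟩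
  constructor
  · refine isReduced_fiber_of_radicalAt hπ fun y => ?_
    obtain ⟨U, hx, hU, h1⟩ := key (redMap X y)
    exact ⟨redMap X ⁻¹ᵁ U, hx, hU.preimage (redMap X), radicalAt_red hU h1⟩
  · intro _
    refine isReduced_fiber_of_radicalAt hπ fun x => ?_
    obtain ⟨U, hx, hU, h1⟩ := key x
    exact ⟨U, hx, hU, radicalAt_of_isReduced_scheme h1⟩

end GoodReduction

end DeltaFamily
end

/-! ### Comparison of a family with its reduction. -/

noncomputable section
namespace DeltaFamily

section Comparison

variable {A : Type u} [CommRing A] {X Z Z' : Scheme.{u}} {f : X ⟶ Spec (CommRingCat.of A)}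
  {h : Z ⟶ X}

lemma IsModification.comp_isIso (hm : IsModification f h) (i : Z' ⟶ Z) [IsIso i] :
    IsModification f (i ≫ h) := by
  have := hm.isFinite
  have hi : ∀ U : Z.Opens, Function.Bijective (i.app U) := fun U =>
    ConcreteCategory.bijective_of_isIso _
  refine ⟨inferInstance, fun U j hj c => ?_, fun U j hj g hg => ?_, ?_, ?_⟩
  · obtain ⟨c, rfl⟩ := (hi (h ⁻¹ᵁ U.1)).2 c
    obtain ⟨g, hg⟩ := hm.exists_app_eq U j hj c
    exact ⟨g, (congrArg (i.app (h ⁻¹ᵁ U.1)) hg).trans (map_mul _ _ _)⟩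
  · exact hm.mul_eq_zero U j hj g ((hi (h ⁻¹ᵁ U.1)).1 (Eq.trans hg (map_zero _).symm))
  · rw [Category.assoc]
    refine torsionFree_of_preimage i fun U hU a ha g hg => ?_
    obtain ⟨g, rfl⟩ := (hi U).2 g
    rw [← map_mul] at hg
    rw [hm.torsionFree U hU a ha g ((hi U).1 (hg.trans (map_zero _).symm)), map_zero]
  · rw [Category.assoc]
    exact not_isIsolatedPoint_of_isClosedImmersion i.homeomorph.surjective hm.not_isIsolatedPoint

lemma invariants_subschemeι_eq {I : X.IdealSheafData} (hI : I = X.nilradical)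
    (s : Spec (CommRingCat.of A)) :
    (FiniteInvariants (redMap X ≫ f) s → FiniteInvariants (I.subschemeι ≫ f) s) ∧
      delta (I.subschemeι ≫ f) s = delta (redMap X ≫ f) s ∧
      epsilon (I.subschemeι ≫ f) s = epsilon (redMap X ≫ f) s := by
  subst hI
  exact ⟨id, rfl, rfl⟩

variable [IsDomain A] [IsPrincipalIdealRing A] [IsNoetherian X]
  [IsFinite ((extConductorIdealSheaf X).subschemeι ≫ f)]

/-- The invariants of the fibres of a family and of its reduction. -/
lemma exists_forall_invariants_eq (hN : IsNagata X) (hf : TorsionFree f)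
    (hiso : ∀ s (x : f.fiber s), ¬ IsIsolatedPoint (f.fiber s) x)
    (hm : IsModification f (redMap X)) :
    ∃ a b : ℤ, ∀ s, FibreHasFinitelyManyINNS f s →
      FiniteInvariants f s ∧ FiniteInvariants (redMap X ≫ f) s ∧
      delta f s = baseDelta f s - a ∧ delta (redMap X ≫ f) s = baseDelta f s - b ∧
      epsilon f s + delta f s = epsilon (redMap X ≫ f) s + delta (redMap X ≫ f) s := by
  obtain ⟨η, hη⟩ : ∃ η : Spec (CommRingCat.of A), η.asIdeal = ⊥ := ⟨⟨⊥, Ideal.isPrime_bot⟩, rfl⟩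
  refine ⟨genericDefect f (𝟙 X) η, genericDefect f (redMap X) η, fun s hs => ?_⟩
  have h1 := delta_modification hN hf (isModification_id hf hiso) hη (hiso s) hs
  have h2 := delta_modification hN hf hm hη (hiso s) hs
  rw [Category.id_comp] at h1
  refine ⟨h1.1, h2.1, h1.2.1, h2.2.1, (h1.2.2 ?_ ?_).trans (h2.2.2 ?_ ?_).symm⟩
  · refine surjective_pushMap _ fun U _ c => ⟨c, ?_⟩
    rw [Scheme.Hom.id_app]
    rfl
  · refine isNilpotent_of_pushMap_eq_zero _ fun U _ g hg => ?_
    rw [Scheme.Hom.id_app] at hg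
    exact ⟨1, (pow_one g).trans hg⟩
  · exact surjective_pushMap _ fun U hU => X.nilradical.subschemeι_app_surjective ⟨U, hU⟩
  · exact isNilpotent_of_pushMap_eq_zero _ fun U hU g hg => (ker_redMap_app ⟨U, hU⟩ g).mp hg

end Comparison

end DeltaFamily
end

/-! ### The main theorem. -/

open DeltaFamily in
theorem corollary2p9 (A : Type u) [CommRing A] [IsDomain A] [IsPrincipalIdealRing A]
    (X : Scheme.{u}) [IsNoetherian X] (hNagata : IsNagata X)
    (hdim : ∀ Z ∈ irreducibleComponents X, 2 ≤ topologicalKrullDim Z)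
    (f : X ⟶ Spec (CommRingCat.of A)) [Flat f]
    (hisol : ∀ (s : Spec (CommRingCat.of A)) (x : (normalizationMap X ≫ f).fiber s),
      ¬ IsIsolatedPoint ((normalizationMap X ≫ f).fiber s) x)
    (hfib : ∀ s ∈ Set.range f, FibreHasFinitelyManyINNS f s)
    (hcond : IsFinite ((extConductorIdealSheaf X).subschemeι ≫ f)) :
    -- identifications: `X^{>1} = X^red`, and the three normalizations agree
    idealGT X 1 = X.nilradical ∧
    IsIso (partGTMap (normalization X) 1) ∧
    (∃ e : normalization (partGT X 1) ≅ normalization X,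
      e.hom ≫ normalizationMap X = normalizationMap (partGT X 1) ≫ partGTMap X 1) ∧
    (IsReduced X → IsIso (partGTMap X 1)) ∧
    -- flatness and finiteness
    Flat (normalizationMap X ≫ f) ∧
    (∀ s ∈ Set.range f,
      FiniteInvariants f s ∧
      FiniteInvariants (redMap X ≫ f) s ∧
      FiniteInvariants (partGTMap X 1 ≫ f) s ∧
      FiniteInvariants (normalizationMap X ≫ f) s ∧
      FiniteInvariants (partGTMap (normalization X) 1 ≫ normalizationMap X ≫ f) s) ∧
    -- local behaviour of delta and epsilon
    ∀ s ∈ Set.range f, ∃ V : (Spec (CommRingCat.of A)).Opens, s ∈ V ∧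
      -- (1)
      (∀ t ∈ (V : Set (Spec (CommRingCat.of A))) ∩ Set.range f,
        delta f s - delta f t = delta (redMap X ≫ f) s - delta (redMap X ≫ f) t ∧
        delta f s - delta f t = delta (partGTMap X 1 ≫ f) s - delta (partGTMap X 1 ≫ f) t ∧
        delta f s - delta f t =
          delta (normalizationMap X ≫ f) s - delta (normalizationMap X ≫ f) t ∧
        delta f s - delta f t =
          delta (partGTMap (normalization X) 1 ≫ normalizationMap X ≫ f) s -
            delta (partGTMap (normalization X) 1 ≫ normalizationMap X ≫ f) t) ∧
      -- (2)
      (∀ t ∈ (V : Set (Spec (CommRingCat.of A))) ∩ Set.range f, t ≠ s →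
        IsNormal ((normalizationMap X ≫ f).fiber t) →
        delta f s - delta f t = delta (normalizationMap X ≫ f) s ∧
        0 ≤ delta (normalizationMap X ≫ f) s) ∧
      -- (3)
      (delta f s - delta f (genericPoint (Spec (CommRingCat.of A))) =
          delta (normalizationMap X ≫ f) s ∧
        0 ≤ delta (normalizationMap X ≫ f) s) ∧
      -- (4)
      (∀ t ∈ (V : Set (Spec (CommRingCat.of A))) ∩ Set.range f, t ≠ s →
        epsilon f s - epsilon f t = epsilon (partGTMap X 1 ≫ f) s ∧
        0 ≤ epsilon (partGTMap X 1 ≫ f) s) ∧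
      -- (5)
      (∀ t ∈ (V : Set (Spec (CommRingCat.of A))) ∩ Set.range f,
        IsReduced ((normalizationMap X ≫ f).fiber t) ∧
        (IsReduced X → t ≠ s → IsReduced (f.fiber t))) := by
  have hf : TorsionFree f := torsionFree_of_flat f
  have hfin := isFinite_normalizationMap hNagata
  have hmn := isModification_normalization hNagata hf hisol
  have hiso := not_isIsolatedPoint_of_surjective (surjective_normalizationMap X) hisol
  have hmr := isModification_red hf
    (not_isIsolatedPoint_of_isClosedImmersion (surjective_redMap X) hiso)
  have hI := idealGT_one_eq_nilradical hdim
  have hJ : IsIso (partGTMap (normalization X) 1) := by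
    rw [Scheme.isIso_subschemeι_iff_eq_bot,
      idealGT_one_eq_nilradical (two_le_topologicalKrullDim_normalization hdim), Scheme.nilradical_eq_bot]
  have hmp := hmn.comp_isIso (partGTMap (normalization X) 1)
  -- `a` and `b` are the generic defects of the identity and of the reduction; they do not depend on
  -- s, which is what makes differences of δ comparable.
  obtain ⟨a, b, hab⟩ := exists_forall_invariants_eq hNagata hf hiso hmr
  have hη : (genericPoint (Spec (CommRingCat.of A))).asIdeal = ⊥ :=
    congrArg PrimeSpectrum.asIdeal (genericPoint_eq_bot_of_affine (CommRingCat.of A))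
  have hn := fun s hs => delta_modification hNagata hf hmn hη (hiso s) (hfib s hs)
  have hp := fun s hs => delta_modification hNagata hf hmp hη (hiso s) (hfib s hs)
  simp only [Category.assoc] at hp
  have hg := fun s => invariants_subschemeι_eq (f := f) hI s
  refine ⟨hI, hJ, exists_normalization_iso_of_eq_nilradical hI, fun _ => ?_,
    flat_of_torsionFree _ hmn.torsionFree, fun s hs => ?_, fun s hs => ?_⟩
  · rw [Scheme.isIso_subschemeι_iff_eq_bot, hI, Scheme.nilradical_eq_bot]
  · obtain ⟨h1, h2, -⟩ := hab s (hfib s hs)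
    exact ⟨h1, h2, (hg s).1 h2, (hn s hs).1, (hp s hs).1⟩
  obtain ⟨B, hB, hBc, hred⟩ := exists_finite_isReduced_fiber (f := f) hNagata
  have hn0 := delta_nonneg hmn normalAt_normalization (hfib s hs)
  -- Neither nearness of t to s nor t ≠ s plays a role here, so this serves (2) and, with t the
  -- generic point, (3).
  have hzero : ∀ t ∈ Set.range f, IsNormal ((normalizationMap X ≫ f).fiber t) →
      delta f s - delta f t = delta (normalizationMap X ≫ f) s := by
    intro t ht hnt
    obtain ⟨-, -, h1, -⟩ := hab s (hfib s hs)
    obtain ⟨-, -, h2, -⟩ := hab t (hfib t ht)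
    have h3 := (hn s hs).2.1
    have h4 := (hn t ht).2.1
    have h5 := delta_eq_zero_of_isNormal hmn hnt
    omega
  -- The exceptional points are closed and finite in number, so removing them leaves an open set; s
  -- itself is kept even if it is exceptional.
  have hV : IsOpen (B \ {s})ᶜ := by
    rw [isOpen_compl_iff, ← Set.biUnion_of_singleton (B \ {s})]
    exact (hB.subset Set.sdiff_subset).isClosed_biUnion fun t ht => hBc t ht.1
  have hVB : ∀ t ∈ (B \ {s})ᶜ, t ≠ s → t ∉ B := fun t ht hts htB => ht ⟨htB, hts⟩
  have hrf := fun t ht => isReduced_fiber hmn normalAt_normalization (hfib t ht)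
  refine ⟨⟨(B \ {s})ᶜ, hV⟩, fun h => h.2 rfl, ?_, ?_, ⟨hzero _ ?_ ?_, hn0⟩, ?_, ?_⟩
  · rintro t ⟨-, ht⟩
    -- Every δ is `baseDelta` minus a constant depending only on the modification, so each
    -- difference equals the difference of `baseDelta` at s and t.
    obtain ⟨-, -, h1, h2, -⟩ := hab s (hfib s hs)
    obtain ⟨-, -, h3, h4, -⟩ := hab t (hfib t ht)
    rw [(hg s).2.1, (hg t).2.1, (hn s hs).2.1, (hn t ht).2.1, (hp s hs).2.1, (hp t ht).2.1, h1, h2,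
      h3, h4]
    refine ⟨?_, ?_, ?_, ?_⟩ <;> ring
  · exact fun t ht _ hnt => ⟨hzero t ht.2 hnt, hn0⟩
  · obtain ⟨x, -⟩ := hs
    exact mem_range_of_asIdeal_eq_bot hf hη x
  · exact isNormal_generic_fiber normalAt_normalization hη
  · rintro t ⟨htV, ht⟩ hts
    obtain ⟨-, -, h1, h2, h3⟩ := hab s (hfib s hs)
    obtain ⟨-, -, h4, h5, h6⟩ := hab t (hfib t ht)
    have := (hred t (hVB t htV hts) (hrf t ht)).1
    -- By `h3` and `h6` the ε of `X` and of its reduction differ by the constant a − b on both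
    -- fibres. The ε of the reduction vanishes at t, so the difference of the ε of `X` is that of
    -- the reduction at s.
    have h7 := epsilon_eq_zero_of_isReduced hmr (hfib t ht)
    rw [(hg s).2.2]
    exact ⟨by omega, epsilon_nonneg _ s⟩
  · rintro t ⟨htV, ht⟩
    exact ⟨hrf t ht, fun hX hts => (hred t (hVB t htV hts) (hrf t ht)).2 hX⟩
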